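/- Let $n\ge 1$, $N,N^*\ge 0$ and let $0=p_0<p_1<\dots<p_{N^*}$ be integers. For functions on $\mathbf R^n$ write $H^m=W^{m,2}$ and $\mathring H^m=\{\phi:\nabla\phi\in H^{m-1}\}$, and for a vector $\boldsymbol\varphi=(\varphi_0,\dots,\varphi_K)$ write $\boldsymbol\varphi'=(\varphi_1,\dots,\varphi_K)$. For exponents $0=q_0<\dots<q_K$, a depth $H$, a bottom $b$ and $h,\delta>0$, put (with the convention $0/0=0$) \[ \begin{aligned} L_{ij}\varphi={}&-\nabla\cdot\Bigl(\tfrac{1}{q_i+q_j+1}H^{q_i+q_j+1}\nabla\varphi-\tfrac{q_j}{q_i+q_j}H^{q_i+q_j}\varphi\,h^{-1}\nabla b\Bigr)-\tfrac{q_i}{q_i+q_j}H^{q_i+q_j}h^{-1}\nabla b\cdot\nabla\varphi\\ &+\tfrac{q_iq_j}{q_i+q_j-1}H^{q_i+q_j-1}\bigl((h\delta)^{-2}+h^{-2}|\nabla b|^2\bigr)\varphi, \end{aligned} \] $\mathcal L_0\boldsymbol\varphi=\sum_j L_{0j}\varphi_j$, $\mathcal L_i\boldsymbol\varphi=\sum_j(L_{ij}\varphi_j-H^{q_i}L_{0j}\varphi_j)$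 for $i\ge1$, and $\boldsymbol l(H)=(H^{q_0},\dots,H^{q_K})$. The operators $\mathcal L_{1,i}$ and the vector $\boldsymbol l_1$ are those obtained for $K=N$, $q_i=2i$, $H=H_1$, $h=\underline h_1$ and zero bottom; $\mathcal L_{2,i}$ and $\boldsymbol l_2$ are those for $K=N^*$, $q_i=p_i$, $H=H_2$, $h=\underline h_2$ and bottom $b$. Let $c_0,M_0>0$ and let $m$ be an integer with $m>\frac n2+1$. There is a constant $C>0$ (depending only on $n,N,N^*,(p_i),m,c_0,M_0$) such that the following holds for all positive $\underline\rho_1,\underline\rho_2,\underline h_1,\underline h_2,\delta$ with $\underline\rho_1+\underline\rho_2=1$, $\frac{\underline\rho_1}{\underline h_1}+\frac{\underline\rho_2}{\underline h_2}=1$ and $\underline h_1\delta,\underline h_2\delta\le1$. If $(\zeta_{(0)},\phi_{(0)})\in H^m\times\mathring H^m$ and $b\in W^{m,\infty}$, with $H_1:=1-\underline h_1^{-1}\zeta_{(0)}$ and $H_2:=1+\underline h_2^{-1}\zeta_{(0)}-\underline h_2^{-1}b$, satisfy \[ \underline h_1^{-1}\|\zeta_{(0)}\|_{H^m}+\underline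 h_2^{-1}\|\zeta_{(0)}\|_{H^m}+\underline h_2^{-1}\|b\|_{W^{m,\infty}}\le M_0,\qquad H_1\ge c_0,\quad H_2\ge c_0\ \text{ on }\mathbf R^n, \] then there exist $\boldsymbol\phi_{1(0)}\in\mathring H^m\times(H^m)^N$ and $\boldsymbol\phi_{2(0)}\in\mathring H^m\times(H^m)^{N^*}$ satisfying the compatibility conditions \[ \mathcal L_{1,i}\boldsymbol\phi_{1(0)}=0\ (1\le i\le N),\qquad \mathcal L_{2,i}\boldsymbol\phi_{2(0)}=0\ (1\le i\le N^*),\qquad \underline h_1\mathcal L_{1,0}\boldsymbol\phi_{1(0)}+\underline h_2\mathcal L_{2,0}\boldsymbol\phi_{2(0)}=0 \] together with \[ \phi_{(0)}=\underline\rho_2\,\boldsymbol l_2(H_2)\cdot\boldsymbol\phi_{2(0)}-\underline\rho_1\,\boldsymbol l_1(H_1)\cdot\boldsymbol\phi_{1(0)}, \] and such that \[ \sum_{\ell=1,2}\underline\rho_\ell\underline h_\ell\Bigl(\|\nabla\boldsymbol\phi_{\ell(0)}\|_{H^{m-1}}^2+(\underline h_\ell\delta)^{-2}\|\boldsymbol\phi_{\ell(0)}'\|_{H^{m-1}}^2\Bigr)\le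 C\|\nabla\phi_{(0)}\|_{H^{m-1}}^2 . \] Moreover these data are unique, even in the larger class $\mathring H^1\times(H^1)^N$, $\mathring H^1\times(H^1)^{N^*}$, up to an additive constant of the form $(\mathcal C\underline\rho_2,\mathcal C\underline\rho_1)$, $\mathcal C\in\mathbf R$, added to $(\phi_{1,0(0)},\phi_{2,0(0)})$; and every such addition gives data with the same properties (compatibility conditions and expression of $\phi_{(0)}$). -/

import Mathlib

open MeasureTheory
open scoped ENNReal ContDiff

noncomputable section

namespace Kakinuma

/-- Horizontal space `ℝⁿ`. -/
abbrev Sp (n : ℕ) : Type := EuclideanSpace ℝ (Fin n)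

/-! ### Sobolev spaces on `ℝⁿ` through weak derivatives -/

/-- Test functions: smooth with compact support. -/
def IsTest {n : ℕ} (ψ : Sp n → ℝ) : Prop :=
  ContDiff ℝ ∞ ψ ∧ HasCompactSupport ψ

/-- The classical derivative `∂_{w 0} ⋯ ∂_{w (k-1)} ψ` of a test function. -/
def testDeriv {n k : ℕ} (w : Fin k → Fin n) (ψ : Sp n → ℝ) (x : Sp n) : ℝ :=
  iteratedFDeriv ℝ k ψ x (fun j => EuclideanSpace.single (w j) (1 : ℝ))

/-- The locally integrable function `g` is the weak derivative `∂_{w 0} ⋯ ∂_{w (k-1)} f` of the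
locally integrable function `f`. -/
def HasWeakDeriv {n k : ℕ} (w : Fin k → Fin n) (f g : Sp n → ℝ) : Prop :=
  LocallyIntegrable f volume ∧ LocallyIntegrable g volume ∧
    ∀ ψ : Sp n → ℝ, IsTest ψ →
      ∫ x, f x * testDeriv w ψ x = (-1) ^ k * ∫ x, g x * ψ x

/-- Weak derivatives are unique almost everywhere. -/
theorem HasWeakDeriv.ae_eq {n k : ℕ} {w : Fin k → Fin n} {f g g' : Sp n → ℝ}
    (h : HasWeakDeriv w f g) (h' : HasWeakDeriv w f g') : g =ᵐ[volume] g' := by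
  refine ae_eq_of_integral_contDiff_smul_eq h.2.1 h'.2.1 fun ψ hψ hc => ?_
  have e := (h.2.2 ψ ⟨hψ, hc⟩).symm.trans (h'.2.2 ψ ⟨hψ, hc⟩)
  have e' := mul_left_cancel₀ (pow_ne_zero k (by norm_num : (-1 : ℝ) ≠ 0)) e
  simpa [smul_eq_mul, mul_comm] using e'

open Classical in
/-- A representative of the weak derivative (and `0` if there is none). -/
def weakDeriv {n k : ℕ} (w : Fin k → Fin n) (f : Sp n → ℝ) : Sp n → ℝ :=
  if h : ∃ g, HasWeakDeriv w f g then h.choose else 0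

/-- The weak partial derivative `∂_i f`. -/
def wpd {n : ℕ} (i : Fin n) (f : Sp n → ℝ) : Sp n → ℝ :=
  weakDeriv (fun _ : Fin 1 => i) f

/-- `f ∈ W^{m,p}`: all weak derivatives of order at most `m` exist and belong to `L^p`. -/
def MemW {n : ℕ} (m : ℕ) (p : ℝ≥0∞) (f : Sp n → ℝ) : Prop :=
  ∀ k ≤ m, ∀ w : Fin k → Fin n, ∃ g, HasWeakDeriv w f g ∧ MemLp g p volume

/-- The norm of `W^{m,p}`: the sum of the `L^p` norms of all derivatives of order at most `m`. -/
def wNorm {n : ℕ} (m : ℕ) (p : ℝ≥0∞) (f : Sp n → ℝ) : ℝ :=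
  ∑ k ∈ Finset.range (m + 1), ∑ w : Fin k → Fin n, (eLpNorm (weakDeriv w f) p volume).toReal

/-- `∇f ∈ H^k = W^{k,2}`, that is, `f` belongs to the homogeneous space of order `k + 1`. -/
def GradMemH {n : ℕ} (k : ℕ) (f : Sp n → ℝ) : Prop :=
  ∀ i : Fin n, ∃ g, HasWeakDeriv (fun _ : Fin 1 => i) f g ∧ MemW k 2 g

/-- `‖∇f‖²` in `H^k`. -/
def gradNormSq {n : ℕ} (k : ℕ) (f : Sp n → ℝ) : ℝ :=
  ∑ i : Fin n, wNorm k 2 (wpd i f) ^ 2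

/-! ### The operators of the model -/

/-- The value at `χ` of the distribution
`L_{ij} φ = - ∇·( H^{pᵢ+pⱼ+1}/(pᵢ+pⱼ+1) ∇φ - pⱼ/(pᵢ+pⱼ) H^{pᵢ+pⱼ} φ h⁻¹∇b )
  - pᵢ/(pᵢ+pⱼ) H^{pᵢ+pⱼ} h⁻¹∇b·∇φ
  + pᵢpⱼ/(pᵢ+pⱼ-1) H^{pᵢ+pⱼ-1} ((hδ)⁻² + h⁻²|∇b|²) φ`,
the divergence being transferred to `χ`; `χ` may be any compactly supported Lipschitz function.
The convention `0/0 = 0` is that of Lean's division; whenever the exponent `pᵢ+pⱼ-1` is negative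
its coefficient vanishes. -/
def Lpair {n K : ℕ} (p : Fin K → ℕ) (H b : Sp n → ℝ) (h δ : ℝ) (i j : Fin K)
    (φ χ : Sp n → ℝ) : ℝ :=
  ∫ x,
    ((∑ a : Fin n,
        (1 / ((p i : ℝ) + p j + 1) * H x ^ (p i + p j + 1) * wpd a φ x
          - (p j : ℝ) / ((p i : ℝ) + p j) * H x ^ (p i + p j) * φ x * (h⁻¹ * wpd a b x))
        * wpd a χ x)
      - (p i : ℝ) / ((p i : ℝ) + p j) * H x ^ (p i + p j)
          * (∑ a : Fin n, h⁻¹ * wpd a b x * wpd a φ x) * χ x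
      + (p i : ℝ) * p j / ((p i : ℝ) + p j - 1) * H x ^ (p i + p j - 1)
          * (((h * δ) ^ 2)⁻¹ + (h ^ 2)⁻¹ * ∑ a : Fin n, wpd a b x ^ 2) * φ x * χ x)

/-- The value at the test function `ψ` of the distribution `𝓛₀ φ = ∑ⱼ L_{0j} φⱼ`. -/
def calL0 {n K : ℕ} (p : Fin (K + 1) → ℕ) (H b : Sp n → ℝ) (h δ : ℝ)
    (φ : Fin (K + 1) → Sp n → ℝ) (ψ : Sp n → ℝ) : ℝ :=
  ∑ j, Lpair p H b h δ 0 j (φ j) ψ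

/-- The value at the test function `ψ` of the distribution
`𝓛ᵢ φ = ∑ⱼ (L_{ij} φⱼ - H^{pᵢ} L_{0j} φⱼ)`. -/
def calL {n K : ℕ} (p : Fin (K + 1) → ℕ) (H b : Sp n → ℝ) (h δ : ℝ) (i : Fin (K + 1))
    (φ : Fin (K + 1) → Sp n → ℝ) (ψ : Sp n → ℝ) : ℝ :=
  ∑ j, (Lpair p H b h δ i j (φ j) ψ
    - Lpair p H b h δ 0 j (φ j) (fun x => H x ^ p i * ψ x))

/-- Exponents in the upper layer: `0, 2, 4, …, 2N`. -/
def evenExp (N : ℕ) : Fin (N + 1) → ℕ := fun i => 2 * (i : ℕ)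

/-- Depth of the upper layer. -/
def H₁ {n : ℕ} (h₁ : ℝ) (ζ : Sp n → ℝ) : Sp n → ℝ := fun x => 1 - h₁⁻¹ * ζ x

/-- Depth of the lower layer. -/
def H₂ {n : ℕ} (h₂ : ℝ) (ζ b : Sp n → ℝ) : Sp n → ℝ := fun x => 1 + h₂⁻¹ * ζ x - h₂⁻¹ * b x

/-- The compatibility conditions, in the sense of distributions. The operators of the upper layer
are those with exponents `2i` and with a flat bottom. -/
def Compatible {n N Ns : ℕ} (p : Fin (Ns + 1) → ℕ) (h₁ h₂ δ : ℝ) (ζ b : Sp n → ℝ)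
    (φ₁ : Fin (N + 1) → Sp n → ℝ) (φ₂ : Fin (Ns + 1) → Sp n → ℝ) : Prop :=
  ∀ ψ : Sp n → ℝ, IsTest ψ →
    (∀ i : Fin N, calL (evenExp N) (H₁ h₁ ζ) 0 h₁ δ i.succ φ₁ ψ = 0) ∧
    (∀ i : Fin Ns, calL p (H₂ h₂ ζ b) b h₂ δ i.succ φ₂ ψ = 0) ∧
    h₁ * calL0 (evenExp N) (H₁ h₁ ζ) 0 h₁ δ φ₁ ψ
      + h₂ * calL0 p (H₂ h₂ ζ b) b h₂ δ φ₂ ψ = 0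

/-- `φ = ρ₂ l₂(H₂)·φ₂ - ρ₁ l₁(H₁)·φ₁`, where `l(H) = (H^{p₀}, …, H^{p_K})`. -/
def Canonical {n N Ns : ℕ} (p : Fin (Ns + 1) → ℕ) (ρ₁ ρ₂ h₁ h₂ : ℝ) (ζ b φ : Sp n → ℝ)
    (φ₁ : Fin (N + 1) → Sp n → ℝ) (φ₂ : Fin (Ns + 1) → Sp n → ℝ) : Prop :=
  ∀ᵐ x ∂(volume : Measure (Sp n)),
    φ x = ρ₂ * ∑ i, H₂ h₂ ζ b x ^ p i * φ₂ i x
      - ρ₁ * ∑ i, H₁ h₁ ζ x ^ evenExp N i * φ₁ i x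

/-- `(φ₀, φ')` has `∇φ₀ ∈ H^k` and `φ' ∈ (H^{k+1})^K`. -/
def InClass {n K : ℕ} (k : ℕ) (φ : Fin (K + 1) → Sp n → ℝ) : Prop :=
  GradMemH k (φ 0) ∧ ∀ i : Fin K, MemW (k + 1) 2 (φ i.succ)

/-- `‖∇φ‖²_{H^k} + (hδ)⁻² ‖φ'‖²_{H^k}`. -/
def layerNormSq {n K : ℕ} (k : ℕ) (h δ : ℝ) (φ : Fin (K + 1) → Sp n → ℝ) : ℝ :=
  (∑ i, gradNormSq k (φ i)) + ((h * δ) ^ 2)⁻¹ * ∑ i : Fin K, wNorm k 2 (φ i.succ) ^ 2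

end Kakinuma

end

/-! Elimination of the constraint. Put s_ℓ = √(ρ_ℓ/h_ℓ) and κ_ℓ = h_ℓ s_ℓ, so that s₁² + s₂² = 1,
κ_ℓ s_ℓ = ρ_ℓ and κ_ℓ² = ρ_ℓ h_ℓ, and let T_ℓ = l_ℓ(H_ℓ)·φ_ℓ be the traces on the interface. Then φ
= ρ₂T₂ − ρ₁T₁ holds exactly if κ₁T₁ = s₂u − s₁φ and κ₂T₂ = s₁u + s₂φ for some u: the pair (κ₁T₁,
κ₂T₂) is an orthogonal image of (u, φ). The unknowns are u and the functions κ_ℓ φ_{ℓ,j} with j ≥ 1,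
and φ_{ℓ,0} is recovered from the trace. Variations of the unknowns preserve the constraint, and the
compatibility conditions are the Euler–Lagrange equations of the sum of the two layer energies under
such variations (`Params.Rel.weakSys_iff`).

Coercivity. The quadratic form of the operators L_{ij} is the integral over 0 < z < H of |∇Φ − h⁻¹∇b
∂_zΦ|² + (hδ)⁻²(∂_zΦ)², where Φ = Σ φ_i z^{p_i} (`layerForm_self`). Since H ≥ c₀ and the exponents
are distinct, linear independence of the monomials on (0, c₀) bounds it from below
(`exists_gram_bound`, `exists_layer_bound`). The two layers control s₂∇u and s₁∇u, hence together
∇u, with a constant that does not depend on the densities, the depths or δ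
(`Params.exists_coercive`).

Existence and uniqueness. The Lax–Milgram theorem is applied in the space of jets (∇U_i, λ_i U_i),
where λ = 0 for u and λ = (h_ℓδ)⁻¹ ≥ 1 for the others (`exists_energy_solution`). As u only has a
square integrable gradient, completeness of this space rests on a weighted Poincaré inequality
(`exists_potential`), and testing with its elements on the weak density of test functions
(`exists_test_weak_approx`). By coercivity two solutions have the same jet, so they differ by a
constant in u, which becomes a multiple of (ρ₂, ρ₁) in (φ_{1,0}, φ_{2,0}).

Regularity. With m = s + 1 and s > n/2, the depths and their first derivatives are multipliers of
H^j for j ≤ s (`exists_mult_of_sobolev`, from a product estimate proved by Fourier transform). The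
matrix of the system is a principal part, polynomial in the depths and hence differentiable with
multiplier derivatives, plus a part containing ∇H and ∇b, which always meets at least one
undifferentiated unknown. Difference quotients and induction on the order handle the first
(`regularity_principal`); the second is moved to the data (`exists_regularity`). After division by
the weights all coefficients are bounded uniformly in the parameters, which makes the final constant
uniform. -/

namespace Kakinuma
open Filter Topology

/-! ### Test functions and weak first derivatives -/

variable {n : ℕ}

/-- The partial derivative in the direction of the `a`-th basis vector. -/
noncomputable def pd (a : Fin n) (ψ : Sp n → ℝ) (x : Sp n) : ℝ :=
  fderiv ℝ ψ x (EuclideanSpace.single a 1)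

/-- `g` is the weak derivative `∂ₐ f`. -/
def WD (a : Fin n) (f g : Sp n → ℝ) : Prop :=
  LocallyIntegrable f volume ∧ LocallyIntegrable g volume ∧
    ∀ ψ : Sp n → ℝ, IsTest ψ → ∫ x, f x * pd a ψ x = - ∫ x, g x * ψ x

theorem testDeriv_one (w : Fin 1 → Fin n) (ψ : Sp n → ℝ) : testDeriv w ψ = pd (w 0) ψ := by
  funext x
  simp [testDeriv, pd]

theorem hasWeakDeriv_one {a : Fin n} {f g : Sp n → ℝ} :
    HasWeakDeriv (fun _ : Fin 1 => a) f g ↔ WD a f g := by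
  simp [HasWeakDeriv, WD, testDeriv_one]

namespace IsTest

variable {ψ χ : Sp n → ℝ}

theorem continuous (h : IsTest ψ) : Continuous ψ := h.1.continuous

theorem differentiable (h : IsTest ψ) : Differentiable ℝ ψ := h.1.differentiable (by simp)

theorem integrable (h : IsTest ψ) : Integrable ψ volume :=
  h.continuous.integrable_of_hasCompactSupport h.2

theorem memLp (h : IsTest ψ) (p : ℝ≥0∞) : MemLp ψ p volume :=
  h.continuous.memLp_of_hasCompactSupport h.2

theorem pd (h : IsTest ψ) (a : Fin n) : IsTest (pd a ψ) := by
  refine ⟨?_, ?_⟩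
  · exact (h.1.fderiv_right (m := ∞) (by simp)).clm_apply contDiff_const
  · exact h.2.fderiv_apply (𝕜 := ℝ) _

theorem smooth_mul (h : IsTest ψ) {η : Sp n → ℝ} (hη : ContDiff ℝ ∞ η) :
    IsTest (fun x => η x * ψ x) :=
  ⟨hη.mul h.1, h.2.mul_left⟩

theorem translate (h : IsTest ψ) (z : Sp n) : IsTest (fun x => ψ (x + z)) :=
  ⟨h.1.comp (contDiff_id.add contDiff_const),
    h.2.comp_homeomorph (Homeomorph.addRight z)⟩

theorem comp_sub (h : IsTest ψ) (z : Sp n) : IsTest (fun x => ψ (z - x)) :=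
  ⟨h.1.comp (contDiff_const.sub contDiff_id), h.2.comp_homeomorph (Homeomorph.subLeft z)⟩

theorem comp_smul (h : IsTest ψ) {c : ℝ} (hc : c ≠ 0) : IsTest (fun x => ψ (c • x)) :=
  ⟨h.1.comp (contDiff_const_smul c), h.2.comp_homeomorph (Homeomorph.smulOfNeZero c hc)⟩

theorem integrable_mul (h : IsTest ψ) {f : Sp n → ℝ} (hf : LocallyIntegrable f volume) :
    Integrable (fun x => f x * ψ x) volume := by
  simpa [smul_eq_mul, mul_comm] using
    hf.integrable_smul_left_of_hasCompactSupport h.continuous h.2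

end IsTest

theorem pd_mul {f g : Sp n → ℝ} (hf : Differentiable ℝ f) (hg : Differentiable ℝ g) (a : Fin n)
    (x : Sp n) : pd a (fun x => f x * g x) x = pd a f x * g x + f x * pd a g x := by
  simp only [pd]
  rw [fderiv_fun_mul (hf x) (hg x)]
  simp [smul_eq_mul]; ring

theorem pd_translate (f : Sp n → ℝ) (a : Fin n) (z x : Sp n) :
    pd a (fun x => f (x + z)) x = pd a f (x + z) := by
  simp only [pd, fderiv_comp_add_right]

theorem pd_comp_sub {f : Sp n → ℝ} (hf : Differentiable ℝ f) (a : Fin n) (z x : Sp n) :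
    pd a (fun x => f (z - x)) x = - pd a f (z - x) := by
  have h := (hf (z - x)).hasFDerivAt.comp x ((hasFDerivAt_id x).const_sub z)
  simp only [pd]
  rw [show (fun x => f (z - x)) = f ∘ HSub.hSub z from rfl, h.fderiv]
  simp

theorem pd_comp_smul {f : Sp n → ℝ} (hf : Differentiable ℝ f) (a : Fin n) (c : ℝ) (x : Sp n) :
    pd a (fun x => f (c • x)) x = c * pd a f (c • x) := by
  have h := (hf (c • x)).hasFDerivAt.comp x ((hasFDerivAt_id x).const_smul c)
  simp only [pd]
  rw [show (fun x => f (c • x)) = f ∘ HSMul.hSMul c from rfl, h.fderiv]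
  simp

theorem continuous_pd {f : Sp n → ℝ} (hf : ContDiff ℝ 1 f) (a : Fin n) : Continuous (pd a f) :=
  (hf.continuous_fderiv (by simp)).clm_apply continuous_const

theorem contDiff_pd {f : Sp n → ℝ} (hf : ContDiff ℝ ∞ f) (a : Fin n) : ContDiff ℝ ∞ (pd a f) :=
  (hf.fderiv_right (m := ∞) (by simp)).clm_apply contDiff_const

/-- The first derivatives of a function combine to the directional derivative. -/
theorem fderiv_eq_sum_pd (f : Sp n → ℝ) (x z : Sp n) :
    fderiv ℝ f x z = ∑ a, z a * pd a f x := by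
  have : z = ∑ a, z a • EuclideanSpace.single a (1 : ℝ) := by
    ext i; simp [Pi.single_apply]
  conv_lhs => rw [this]
  simp [pd]

/-- A function that is integrable against nothing but test functions: pairing with a compactly
supported bounded function. -/
theorem locallyIntegrable_mul_continuous {f g : Sp n → ℝ} (hf : LocallyIntegrable f volume)
    (hg : Continuous g) : LocallyIntegrable (fun x => g x * f x) volume := by
  rw [locallyIntegrable_iff] at hf ⊢
  intro K hK
  exact (hf K hK).continuousOn_mul hg.continuousOn hK

namespace WD

variable {a : Fin n} {f g f' g' : Sp n → ℝ}

theorem ae_eq (h : WD a f g) (h' : WD a f g') : g =ᵐ[volume] g' :=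
  HasWeakDeriv.ae_eq (hasWeakDeriv_one.2 h) (hasWeakDeriv_one.2 h')

theorem congr (h : WD a f g) (hf : f =ᵐ[volume] f') (hg : g =ᵐ[volume] g') : WD a f' g' := by
  refine ⟨h.1.congr hf, h.2.1.congr hg, fun ψ hψ => ?_⟩
  rw [← integral_congr_ae (f := fun x => f x * pd a ψ x), h.2.2 ψ hψ,
    integral_congr_ae (f := fun x => g x * ψ x)]
  · filter_upwards [hg] with x hx; rw [hx]
  · filter_upwards [hf] with x hx; rw [hx]

theorem add (h : WD a f g) (h' : WD a f' g') :
    WD a (fun x => f x + f' x) (fun x => g x + g' x) := by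
  refine ⟨h.1.add h'.1, h.2.1.add h'.2.1, fun ψ hψ => ?_⟩
  simp only [add_mul]
  rw [integral_add ((hψ.pd a).integrable_mul h.1) ((hψ.pd a).integrable_mul h'.1),
    integral_add (hψ.integrable_mul h.2.1) (hψ.integrable_mul h'.2.1), h.2.2 ψ hψ, h'.2.2 ψ hψ]
  ring

theorem const_mul (h : WD a f g) (c : ℝ) : WD a (fun x => c * f x) (fun x => c * g x) := by
  refine ⟨h.1.smul c, h.2.1.smul c, fun ψ hψ => ?_⟩
  simp only [mul_assoc, integral_const_mul, h.2.2 ψ hψ]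
  ring

theorem neg (h : WD a f g) : WD a (fun x => - f x) (fun x => - g x) := by
  simpa using h.const_mul (-1)

theorem sub (h : WD a f g) (h' : WD a f' g') :
    WD a (fun x => f x - f' x) (fun x => g x - g' x) := by
  simpa [sub_eq_add_neg] using h.add h'.neg

theorem of_contDiff (hf : ContDiff ℝ 1 f) (a : Fin n) : WD a f (pd a f) := by
  have c1 := hf.continuous
  have c2 := continuous_pd hf a
  refine ⟨c1.locallyIntegrable, c2.locallyIntegrable, fun ψ hψ => ?_⟩
  exact integral_mul_fderiv_eq_neg_fderiv_mul_of_integrable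
    (hψ.integrable_mul c2.locallyIntegrable) ((hψ.pd a).integrable_mul c1.locallyIntegrable)
    (hψ.integrable_mul c1.locallyIntegrable) (fun x _ => hf.differentiable (by simp) x)
    (fun x _ => hψ.differentiable x)

theorem const (a : Fin n) (c : ℝ) : WD a (fun _ => c) (fun _ => 0) := by
  have := of_contDiff (f := fun _ : Sp n => c) contDiff_const a
  simpa [Kakinuma.pd, funext_iff] using this.congr (EventuallyEq.rfl) (by
    filter_upwards with x; simp [Kakinuma.pd])

theorem sum {ι : Type*} (s : Finset ι) {f g : ι → Sp n → ℝ} (h : ∀ i ∈ s, WD a (f i) (g i)) :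
    WD a (fun x => ∑ i ∈ s, f i x) (fun x => ∑ i ∈ s, g i x) := by
  classical
  induction s using Finset.induction_on with
  | empty => simpa using const a 0
  | insert i s hi ih =>
    simp only [Finset.sum_insert hi]
    exact (h i (by simp)).add (ih fun j hj => h j (by simp [hj]))

/-- The product ηψ is again a test function, so the Leibniz rule for ηψ can be fed into the
definition of the weak derivative of f. -/
theorem smooth_mul (h : WD a f g) {η : Sp n → ℝ} (hη : ContDiff ℝ ∞ η) :
    WD a (fun x => η x * f x) (fun x => pd a η x * f x + η x * g x) := by
  have c1 := hη.continuous
  have c2 := (contDiff_pd hη a).continuous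
  have l1 := locallyIntegrable_mul_continuous h.1 c2
  have l2 := locallyIntegrable_mul_continuous h.2.1 c1
  refine ⟨locallyIntegrable_mul_continuous h.1 c1, l1.add l2, fun ψ hψ => ?_⟩
  have e := h.2.2 _ (hψ.smooth_mul hη)
  have e1 : ∀ x, f x * pd a (fun x => η x * ψ x) x
      = pd a η x * f x * ψ x + η x * f x * pd a ψ x := fun x => by
    rw [pd_mul (hη.differentiable (by simp)) hψ.differentiable]; ring
  simp only [e1] at e
  rw [integral_add (hψ.integrable_mul l1)
    ((hψ.pd a).integrable_mul (locallyIntegrable_mul_continuous h.1 c1))] at e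
  simp only [add_mul]
  rw [integral_add (hψ.integrable_mul l1) (hψ.integrable_mul l2)]
  have e2 : ∫ x, g x * (η x * ψ x) = ∫ x, η x * g x * ψ x := by
    congr 1; ext x; ring
  rw [e2] at e
  linarith

theorem translate (h : WD a f g) (z : Sp n) :
    WD a (fun x => f (x + z)) (fun x => g (x + z)) := by
  have key : ∀ {f : Sp n → ℝ}, LocallyIntegrable f volume →
      LocallyIntegrable (fun x => f (x + z)) volume := fun {f} hf => by
    rw [locallyIntegrable_iff] at hf ⊢
    intro K hK
    have := (measurePreserving_add_right (volume : Measure (Sp n)) z).integrableOn_image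
      (MeasurableEquiv.addRight z).measurableEmbedding (f := f) (s := K)
    exact this.1 (hf _ (hK.image (continuous_add_const z)))
  refine ⟨key h.1, key h.2.1, fun ψ hψ => ?_⟩
  have e := h.2.2 _ (hψ.translate (-z))
  simp only [pd_translate] at e
  rw [← integral_add_right_eq_self (fun x => f x * pd a ψ (x + -z)) z,
    ← integral_add_right_eq_self (fun x => g x * ψ (x + -z)) z] at e
  simpa using e

theorem wpd_eq (h : WD a f g) : wpd a f =ᵐ[volume] g := by
  have hex : ∃ g, HasWeakDeriv (fun _ : Fin 1 => a) f g := ⟨g, hasWeakDeriv_one.2 h⟩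
  have : HasWeakDeriv (fun _ : Fin 1 => a) f (wpd a f) := by
    rw [wpd, weakDeriv, dif_pos hex]; exact hex.choose_spec
  exact (hasWeakDeriv_one.1 this).ae_eq h

theorem wpd (h : WD a f g) : WD a f (wpd a f) := h.congr EventuallyEq.rfl h.wpd_eq.symm

end WD

end Kakinuma

namespace Kakinuma
open Filter Topology

variable {n : ℕ}

/-! ### Mollification -/

theorem eLpNorm_two_sq {α : Type*} [MeasurableSpace α] {μ : Measure α} {E : Type*}
    [NormedAddCommGroup E] (f : α → E) :
    eLpNorm f 2 μ ^ 2 = ∫⁻ x, ‖f x‖ₑ ^ 2 ∂μ := by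
  have := eLpNorm_nnreal_pow_eq_lintegral (μ := μ) (f := f) (p := 2) (by norm_num)
  simpa using this

theorem eLpNorm_two_le_iff {α : Type*} [MeasurableSpace α] {μ : Measure α} {E : Type*}
    [NormedAddCommGroup E] {f : α → E} {C : ℝ≥0∞} :
    eLpNorm f 2 μ ≤ C ↔ ∫⁻ x, ‖f x‖ₑ ^ 2 ∂μ ≤ C ^ 2 := by
  rw [← eLpNorm_two_sq]
  exact (ENNReal.pow_le_pow_left_iff (by norm_num)).symm

/-- The Cauchy–Schwarz inequality for lower Lebesgue integrals. -/
theorem lintegral_mul_sq_le {α : Type*} [MeasurableSpace α] {μ : Measure α} {f g : α → ℝ≥0∞}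
    (hf : AEMeasurable f μ) (hg : AEMeasurable g μ) :
    (∫⁻ x, f x * g x ∂μ) ^ 2 ≤ (∫⁻ x, f x ^ 2 ∂μ) * ∫⁻ x, g x ^ 2 ∂μ := by
  have h := ENNReal.lintegral_mul_le_Lp_mul_Lq μ (p := 2) (q := 2)
    (by constructor <;> norm_num) hf hg
  have h2 := pow_le_pow_left' h 2
  refine (le_trans ?_ h2).trans_eq ?_
  · simp
  · rw [mul_pow, ← ENNReal.rpow_natCast, ← ENNReal.rpow_natCast, ← ENNReal.rpow_mul,
      ← ENNReal.rpow_mul]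
    norm_num

/-- The weighted Cauchy–Schwarz inequality for lower Lebesgue integrals. -/
theorem lintegral_mul_sq_le' {α : Type*} [MeasurableSpace α] {μ : Measure α} {w f : α → ℝ≥0∞}
    (hw : AEMeasurable w μ) (hf : AEMeasurable f μ) :
    (∫⁻ x, w x * f x ∂μ) ^ 2 ≤ (∫⁻ x, w x ∂μ) * ∫⁻ x, w x * f x ^ 2 ∂μ := by
  have e : ∀ x, w x ^ (1 / 2 : ℝ) * w x ^ (1 / 2 : ℝ) = w x := fun x => by
    rw [← ENNReal.rpow_add_of_nonneg _ _ (by norm_num) (by norm_num)]; norm_num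
  have hr : AEMeasurable (fun x => w x ^ (1 / 2 : ℝ)) μ := hw.pow_const _
  have h := lintegral_mul_sq_le hr (hr.mul hf)
  simp only [Pi.mul_apply, ← mul_assoc, e, mul_pow, sq (w _ ^ (1 / 2 : ℝ))] at h
  exact h

/-- Young's inequality `‖G * F‖₂ ≤ ‖G‖₁ ‖F‖₂`. -/
theorem lintegral_conv_sq_le {G F : Sp n → ℝ≥0∞} (hG : Measurable G) (hF : Measurable F) :
    ∫⁻ x, (∫⁻ t, G (x - t) * F t) ^ 2 ≤ (∫⁻ t, G t) ^ 2 * ∫⁻ t, F t ^ 2 := by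
  have hm : Measurable fun q : Sp n × Sp n => G (q.1 - q.2) * F q.2 ^ 2 :=
    (hG.comp (measurable_fst.sub measurable_snd)).mul ((hF.comp measurable_snd).pow_const 2)
  calc ∫⁻ x, (∫⁻ t, G (x - t) * F t) ^ 2
      ≤ ∫⁻ x, (∫⁻ t, G t) * ∫⁻ t, G (x - t) * F t ^ 2 := by
        -- Weighted Cauchy–Schwarz with G(x − ·) as the weight; Tonelli then separates the two
        -- factors.
        refine lintegral_mono fun x => ?_
        have hw : Measurable fun t => G (x - t) := hG.comp (measurable_const.sub measurable_id)
        refine (lintegral_mul_sq_le' hw.aemeasurable hF.aemeasurable).trans_eq ?_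
        rw [lintegral_sub_left_eq_self G x]
    _ = (∫⁻ t, G t) * ∫⁻ t, ∫⁻ x, G (x - t) * F t ^ 2 := by
        rw [lintegral_const_mul _ hm.lintegral_prod_right', lintegral_lintegral_swap hm.aemeasurable]
    _ = (∫⁻ t, G t) * ∫⁻ t, (∫⁻ x, G x) * F t ^ 2 := by
        congr 1
        refine lintegral_congr fun t => ?_
        rw [lintegral_mul_const _ (by fun_prop), lintegral_sub_right_eq_self]
    _ = _ := by
        rw [lintegral_const_mul _ (hF.pow_const 2), sq, mul_assoc]

/-- The bump functions of the mollification. -/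
noncomputable def molBump (n k : ℕ) : ContDiffBump (0 : Sp n) :=
  ⟨1 / (2 * ((k : ℝ) + 1)), 1 / ((k : ℝ) + 1), by positivity, by
    rw [div_lt_div_iff_of_pos_left (by norm_num) (by positivity) (by positivity)]
    nlinarith [k.cast_nonneg (α := ℝ)]⟩

/-- The mollifier of index `k`. -/
noncomputable def mol (k : ℕ) : Sp n → ℝ := (molBump n k).normed volume

theorem isTest_mol (k : ℕ) : IsTest (mol (n := n) k) :=
  ⟨(molBump n k).contDiff_normed, (molBump n k).hasCompactSupport_normed⟩

theorem mol_nonneg (k : ℕ) (x : Sp n) : 0 ≤ mol k x := (molBump n k).nonneg_normed x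

theorem integral_mol (k : ℕ) : ∫ x, mol (n := n) k x = 1 := (molBump n k).integral_normed

/-- Mollification at the scale of index `k`. -/
noncomputable def moll (k : ℕ) (f : Sp n → ℝ) (x : Sp n) : ℝ := ∫ t, mol k (x - t) * f t

theorem moll_eq_convolution (k : ℕ) (f : Sp n → ℝ) :
    moll k f = MeasureTheory.convolution (mol k) f (ContinuousLinearMap.lsmul ℝ ℝ) volume := by
  funext x
  rw [convolution_lsmul_swap]; rfl

theorem contDiff_moll (k : ℕ) {f : Sp n → ℝ} (hf : LocallyIntegrable f volume) :
    ContDiff ℝ ∞ (moll k f) := by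
  rw [moll_eq_convolution]
  exact (isTest_mol k).2.contDiff_convolution_left _ (isTest_mol k).1 hf

theorem moll_congr (k : ℕ) {f g : Sp n → ℝ} (h : f =ᵐ[volume] g) : moll k f = moll k g := by
  funext x
  exact integral_congr_ae (by filter_upwards [h] with t ht; rw [ht])

/-- The derivative of the convolution falls on the smooth kernel; as t ↦ mol(x − t) is a test
function, the definition of the weak derivative moves it over to f. -/
theorem pd_moll (k : ℕ) {a : Fin n} {f g : Sp n → ℝ} (h : WD a f g) :
    pd a (moll k f) = moll k g := by
  funext x
  have hd := (isTest_mol (n := n) k).2.hasFDerivAt_convolution_left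
    (ContinuousLinearMap.lsmul ℝ ℝ) ((isTest_mol k).1.of_le (by simp)) h.1 x
  rw [← moll_eq_convolution] at hd
  rw [pd, hd.fderiv, convolution_eq_swap]
  have hex := ((isTest_mol (n := n) k).2.fderiv (𝕜 := ℝ)).convolutionExists_left
    ((ContinuousLinearMap.lsmul ℝ ℝ).precompL (Sp n))
    ((isTest_mol k).1.continuous_fderiv (by simp)) h.1 x
  rw [ContinuousLinearMap.integral_apply (convolutionExistsAt_iff_integrable_swap.1 hex)]
  have e := h.2.2 _ ((isTest_mol k).comp_sub x)
  simp only [pd_comp_sub (isTest_mol k).differentiable] at e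
  simp only [moll, ContinuousLinearMap.precompL_apply, ContinuousLinearMap.lsmul_apply, smul_eq_mul]
  simp only [mul_neg, integral_neg, neg_inj] at e
  simp only [mul_comm (mol k _)]
  rw [← e]
  refine integral_congr_ae (ae_of_all _ fun t => ?_)
  simp [pd, mul_comm]

theorem tendsto_moll {f : Sp n → ℝ} (hf : LocallyIntegrable f volume) :
    ∀ᵐ x, Tendsto (fun k => moll k f x) atTop (𝓝 (f x)) := by
  -- This is Lebesgue differentiation; it needs a bound K for the ratio of the outer to the inner
  -- radius of the bumps, which is exactly 2 here.
  have h := ContDiffBump.ae_convolution_tendsto_right_of_locallyIntegrable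
    (μ := (volume : Measure (Sp n))) (φ := fun k => molBump n k) (l := atTop) (K := 2) (g := f) ?_ ?_ hf
  · filter_upwards [h] with x hx
    simpa only [moll_eq_convolution, mol] using hx
  · exact tendsto_one_div_add_atTop_nhds_zero_nat
  · refine Eventually.of_forall fun k => ?_
    simp only [molBump]
    have : (0 : ℝ) < (k : ℝ) + 1 := by positivity
    apply le_of_eq
    field_simp

theorem lintegral_mol (k : ℕ) : ∫⁻ x, ‖mol (n := n) k x‖ₑ = 1 := by
  have := ofReal_integral_eq_lintegral_ofReal (isTest_mol (n := n) k).integrable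
    (ae_of_all _ (mol_nonneg k))
  rw [integral_mol] at this
  simp only [Real.enorm_of_nonneg (mol_nonneg k _)]
  simpa using this.symm

theorem enorm_moll_le (k : ℕ) (f : Sp n → ℝ) (x : Sp n) :
    ‖moll k f x‖ₑ ≤ ∫⁻ t, ‖mol k (x - t)‖ₑ * ‖f t‖ₑ := by
  refine (enorm_integral_le_lintegral_enorm _).trans_eq ?_
  simp only [enorm_mul]

theorem eLpNorm_moll_two_le (k : ℕ) {f : Sp n → ℝ} (hf : AEStronglyMeasurable f volume) :
    eLpNorm (moll k f) 2 volume ≤ eLpNorm f 2 volume := by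
  -- Young's inequality above is stated for measurable functions, so f is replaced by a measurable
  -- representative.
  rw [moll_congr k hf.ae_eq_mk, eLpNorm_congr_ae hf.ae_eq_mk]
  have hm := hf.stronglyMeasurable_mk.measurable
  generalize hf.mk f = g at hm
  rw [eLpNorm_two_le_iff, eLpNorm_two_sq]
  calc ∫⁻ x, ‖moll k g x‖ₑ ^ 2 ≤ ∫⁻ x, (∫⁻ t, ‖mol k (x - t)‖ₑ * ‖g t‖ₑ) ^ 2 :=
        lintegral_mono fun x => pow_le_pow_left' (enorm_moll_le k g x) 2
    _ ≤ (∫⁻ t, ‖mol (n := n) k t‖ₑ) ^ 2 * ∫⁻ t, ‖g t‖ₑ ^ 2 :=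
        lintegral_conv_sq_le (G := fun x => ‖mol (n := n) k x‖ₑ) (F := fun x => ‖g x‖ₑ)
          (isTest_mol k).continuous.measurable.enorm hm.enorm
    _ = _ := by rw [lintegral_mol]; simp

theorem enorm_moll_le_essSup (k : ℕ) (f : Sp n → ℝ) (x : Sp n) :
    ‖moll k f x‖ₑ ≤ eLpNorm f ⊤ volume := by
  rw [eLpNorm_exponent_top]
  calc ‖moll k f x‖ₑ ≤ ∫⁻ t, ‖mol k (x - t)‖ₑ * ‖f t‖ₑ := enorm_moll_le k f x
    _ ≤ ∫⁻ t, ‖mol k (x - t)‖ₑ * eLpNormEssSup f volume := by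
        refine lintegral_mono_ae ?_
        filter_upwards [enorm_ae_le_eLpNormEssSup f volume] with t ht
        gcongr
    _ = eLpNormEssSup f volume := by
        rw [lintegral_mul_const _ (by
          exact ((isTest_mol k).comp_sub x).continuous.measurable.enorm),
          lintegral_sub_left_eq_self (fun t => ‖mol k t‖ₑ) x, lintegral_mol, one_mul]

theorem eLpNorm_moll_top_le (k : ℕ) (f : Sp n → ℝ) :
    eLpNorm (moll k f) ⊤ volume ≤ eLpNorm f ⊤ volume := by
  conv_lhs => rw [eLpNorm_exponent_top]
  exact essSup_le_of_ae_le _ (ae_of_all _ (enorm_moll_le_essSup k f))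

theorem memLp_moll_two (k : ℕ) {f : Sp n → ℝ} (hf : MemLp f 2 volume) :
    MemLp (moll k f) 2 volume :=
  ⟨(contDiff_moll k (hf.locallyIntegrable (by norm_num))).continuous.aestronglyMeasurable,
    (eLpNorm_moll_two_le k hf.1).trans_lt hf.2⟩

/-- Fatou's lemma for `L²` norms. -/
theorem eLpNorm_two_le_of_ae_tendsto {α : Type*} [MeasurableSpace α] {μ : Measure α}
    {f : ℕ → α → ℝ} {g : α → ℝ} {C : ℝ≥0∞} (hf : ∀ k, AEStronglyMeasurable (f k) μ)
    (hC : ∀ k, eLpNorm (f k) 2 μ ≤ C) (h : ∀ᵐ x ∂μ, Tendsto (fun k => f k x) atTop (𝓝 (g x))) :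
    eLpNorm g 2 μ ≤ C := by
  refine (Lp.eLpNorm_lim_le_liminf_eLpNorm hf g h).trans ?_
  exact liminf_le_of_le (by isBoundedDefault) fun b hb => by
    obtain ⟨k, hk⟩ := hb.exists
    exact hk.trans (hC k)

theorem eLpNorm_top_le_of_ae_tendsto {α : Type*} [MeasurableSpace α] {μ : Measure α}
    {f : ℕ → α → ℝ} {g : α → ℝ} {C : ℝ≥0∞} (hf : ∀ k, AEStronglyMeasurable (f k) μ)
    (hC : ∀ k, eLpNorm (f k) ⊤ μ ≤ C) (h : ∀ᵐ x ∂μ, Tendsto (fun k => f k x) atTop (𝓝 (g x))) :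
    eLpNorm g ⊤ μ ≤ C := by
  refine (Lp.eLpNorm_lim_le_liminf_eLpNorm hf g h).trans ?_
  exact liminf_le_of_le (by isBoundedDefault) fun b hb => by
    obtain ⟨k, hk⟩ := hb.exists
    exact hk.trans (hC k)

/-- Almost everywhere convergence without excess of norm implies convergence in `L²`. -/
theorem tendsto_eLpNorm_two_of_ae {α : Type*} [MeasurableSpace α] {μ : Measure α}
    {f : ℕ → α → ℝ} {g : α → ℝ} (hf : ∀ k, AEStronglyMeasurable (f k) μ) (hg : MemLp g 2 μ)
    (hC : ∀ k, eLpNorm (f k) 2 μ ≤ eLpNorm g 2 μ)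
    (h : ∀ᵐ x ∂μ, Tendsto (fun k => f k x) atTop (𝓝 (g x))) :
    Tendsto (fun k => eLpNorm (fun x => f k x - g x) 2 μ) atTop (𝓝 0) := by
  set F := ∫⁻ x, ‖g x‖ₑ ^ 2 ∂μ with hF
  have hFtop : F ≠ ⊤ := by
    rw [hF, ← eLpNorm_two_sq]; exact ENNReal.pow_ne_top hg.2.ne
  -- Parallelogram identity |f − g|² + |f + g|² = 2|f|² + 2|g|². By Fatou the integral of |f + g|²
  -- is asymptotically at least 4F, which leaves nothing for |f − g|².
  have hS : ∀ k, ∫⁻ x, ‖f k x - g x‖ₑ ^ 2 ∂μ + ∫⁻ x, ‖f k x + g x‖ₑ ^ 2 ∂μ ≤ 4 * F := fun k => by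
    have hfk : ∫⁻ x, ‖f k x‖ₑ ^ 2 ∂μ ≤ F := by
      rw [hF, ← eLpNorm_two_sq, ← eLpNorm_two_sq]; exact pow_le_pow_left' (hC k) 2
    have e : ∀ x, ‖f k x - g x‖ₑ ^ 2 + ‖f k x + g x‖ₑ ^ 2 = 2 * ‖f k x‖ₑ ^ 2 + 2 * ‖g x‖ₑ ^ 2 := by
      intro x
      simp only [Real.enorm_eq_ofReal_abs, ← ENNReal.ofReal_pow (abs_nonneg _), sq_abs]
      rw [← ENNReal.ofReal_add (by positivity) (by positivity),
        show (2 : ℝ≥0∞) = ENNReal.ofReal 2 by simp, ← ENNReal.ofReal_mul (by norm_num),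
        ← ENNReal.ofReal_mul (by norm_num), ← ENNReal.ofReal_add (by positivity) (by positivity)]
      congr 1; ring
    have hm : AEMeasurable (fun x => ‖f k x - g x‖ₑ ^ 2) μ := ((hf k).sub hg.1).enorm.pow_const 2
    rw [← lintegral_add_left' hm]
    simp only [e]
    rw [lintegral_add_left' (((hf k).enorm.pow_const 2).const_mul 2),
      lintegral_const_mul'' _ ((hf k).enorm.pow_const 2),
      lintegral_const_mul'' _ (hg.1.enorm.pow_const 2)]
    calc 2 * ∫⁻ x, ‖f k x‖ₑ ^ 2 ∂μ + 2 * F ≤ 2 * F + 2 * F := by gcongr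
      _ = 4 * F := by rw [← add_mul]; norm_num
  have hL : 4 * F ≤ liminf (fun k => ∫⁻ x, ‖f k x + g x‖ₑ ^ 2 ∂μ) atTop := by
    refine le_trans (le_of_eq ?_) (lintegral_liminf_le' fun k =>
      ((hf k).add hg.1).enorm.pow_const 2)
    rw [hF, ← lintegral_const_mul'' _ (hg.1.enorm.pow_const 2)]
    refine lintegral_congr_ae ?_
    filter_upwards [h] with x hx
    have : Tendsto (fun k => ‖f k x + g x‖ₑ ^ 2) atTop (𝓝 (‖g x + g x‖ₑ ^ 2)) :=
      (ENNReal.continuous_pow 2).continuousAt.tendsto.comp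
        ((continuous_enorm.tendsto _).comp (hx.add_const _))
    rw [this.liminf_eq, ← two_mul,
      enorm_mul, mul_pow]
    congr 1
    simp [Real.enorm_eq_ofReal_abs]; norm_num
  have hA : Tendsto (fun k => ∫⁻ x, ‖f k x - g x‖ₑ ^ 2 ∂μ) atTop (𝓝 0) := by
    rw [ENNReal.tendsto_nhds_zero]
    intro ε hε
    -- The strict inequality 4F − ε < 4F used below fails for F = 0.
    by_cases h0 : 4 * F = 0
    · refine Eventually.of_forall fun k => ?_
      have := hS k
      rw [h0] at this
      exact (le_self_add.trans this).trans zero_le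
    have h4 : 4 * F ≠ ⊤ := ENNReal.mul_ne_top (by norm_num) hFtop
    have hlt : 4 * F - ε < liminf (fun k => ∫⁻ x, ‖f k x + g x‖ₑ ^ 2 ∂μ) atTop :=
      (ENNReal.sub_lt_self h4 h0 hε.ne').trans_le hL
    filter_upwards [eventually_lt_of_lt_liminf hlt] with k hk
    have hs : ∫⁻ x, ‖f k x + g x‖ₑ ^ 2 ∂μ ≠ ⊤ :=
      ne_top_of_le_ne_top h4 (le_add_self.trans (hS k))
    calc _ ≤ 4 * F - ∫⁻ x, ‖f k x + g x‖ₑ ^ 2 ∂μ := ENNReal.le_sub_of_add_le_right hs (hS k)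
      _ ≤ 4 * F - (4 * F - ε) := tsub_le_tsub_left hk.le _
      _ ≤ ε := tsub_tsub_le
  have hB := (ENNReal.continuous_rpow_const (y := 1 / 2)).continuousAt.tendsto.comp hA
  refine (hB.congr fun k => ?_).trans (by simp)
  rw [Function.comp_apply, ← eLpNorm_two_sq, ← ENNReal.rpow_natCast, ← ENNReal.rpow_mul]
  norm_num

theorem tendsto_moll_two {f : Sp n → ℝ} (hf : MemLp f 2 volume) :
    Tendsto (fun k => eLpNorm (fun x => moll k f x - f x) 2 volume) atTop (𝓝 0) :=
  tendsto_eLpNorm_two_of_ae (fun k => (memLp_moll_two k hf).1) hf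
    (fun k => eLpNorm_moll_two_le k hf.1) (tendsto_moll (hf.locallyIntegrable (by norm_num)))

end Kakinuma

namespace Kakinuma
open Filter Topology

variable {n : ℕ}

/-! ### Pairings of square integrable functions -/

theorem integrable_mul_two {f g : Sp n → ℝ} (hf : MemLp f 2 volume) (hg : MemLp g 2 volume) :
    Integrable (fun x => f x * g x) volume :=
  hf.integrable_mul hg

theorem inner_toLp {f g : Sp n → ℝ} (hf : MemLp f 2 volume) (hg : MemLp g 2 volume) :
    inner ℝ (hf.toLp f) (hg.toLp g) = ∫ x, f x * g x := by
  rw [L2.inner_def]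
  refine integral_congr_ae ?_
  filter_upwards [hf.coeFn_toLp, hg.coeFn_toLp] with x h1 h2
  rw [h1, h2]; simp [mul_comm]

theorem abs_integral_mul_le {f g : Sp n → ℝ} (hf : MemLp f 2 volume) (hg : MemLp g 2 volume) :
    |∫ x, f x * g x| ≤ (eLpNorm f 2 volume).toReal * (eLpNorm g 2 volume).toReal := by
  rw [← inner_toLp hf hg, ← Lp.norm_toLp f hf, ← Lp.norm_toLp g hg]
  exact abs_real_inner_le_norm _ _

theorem tendsto_integral_mul {f : ℕ → Sp n → ℝ} {g ψ : Sp n → ℝ} (hf : ∀ k, MemLp (f k) 2 volume)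
    (hg : MemLp g 2 volume) (hψ : MemLp ψ 2 volume)
    (h : Tendsto (fun k => eLpNorm (fun x => f k x - g x) 2 volume) atTop (𝓝 0)) :
    Tendsto (fun k => ∫ x, f k x * ψ x) atTop (𝓝 (∫ x, g x * ψ x)) := by
  rw [tendsto_iff_norm_sub_tendsto_zero]
  have h1 : Tendsto (fun k => (eLpNorm (fun x => f k x - g x) 2 volume).toReal
      * (eLpNorm ψ 2 volume).toReal) atTop (𝓝 0) := by
    simpa using ((ENNReal.tendsto_toReal ENNReal.zero_ne_top).comp h).mul_const
      (eLpNorm ψ 2 volume).toReal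
  refine squeeze_zero (fun _ => norm_nonneg _) (fun k => ?_) h1
  rw [← integral_sub (integrable_mul_two (hf k) hψ) (integrable_mul_two hg hψ), Real.norm_eq_abs]
  simp only [← sub_mul]
  exact abs_integral_mul_le ((hf k).sub hg) hψ

/-- Weak sequential compactness of balls of `L²`, in a form without subsequences. -/
theorem exists_weak_limit {f : ℕ → Sp n → ℝ} {B : ℝ} (hB : 0 ≤ B)
    (hf : ∀ k, MemLp (f k) 2 volume) (hfB : ∀ k, eLpNorm (f k) 2 volume ≤ ENNReal.ofReal B) :
    ∃ g, MemLp g 2 volume ∧ eLpNorm g 2 volume ≤ ENNReal.ofReal B ∧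
      ∀ ψ : Sp n → ℝ, MemLp ψ 2 volume → ∀ l, Tendsto (fun k => ∫ x, f k x * ψ x) atTop (𝓝 l) →
        ∫ x, g x * ψ x = l := by
  -- Banach–Alaoglu in the dual of L², along an ultrafilter finer than `atTop`, replaces the
  -- extraction of a subsequence: a pairing that converges along `atTop` has the same limit along
  -- the ultrafilter.
  let T : ℕ → WeakDual ℝ (Lp ℝ 2 (volume : Measure (Sp n))) := fun k =>
    StrongDual.toWeakDual (innerSL ℝ ((hf k).toLp (f k)))
  have hK := WeakDual.isCompact_closedBall (𝕜 := ℝ) (0 : StrongDual ℝ (Lp ℝ 2 (volume : Measure (Sp n)))) B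
  have hT : ∀ k, T k ∈ WeakDual.toStrongDual ⁻¹'
      Metric.closedBall (0 : StrongDual ℝ (Lp ℝ 2 (volume : Measure (Sp n)))) B := fun k => by
    simp only [Set.mem_preimage, mem_closedBall_zero_iff]
    change ‖innerSL ℝ ((hf k).toLp (f k))‖ ≤ B
    rw [innerSL_apply_norm, Lp.norm_toLp]
    exact ENNReal.toReal_le_of_le_ofReal hB (hfB k)
  obtain ⟨x, hx, hle⟩ := hK.ultrafilter_le_nhds ((hyperfilter ℕ).map T)
    (by
      rw [le_principal_iff]
      exact (Eventually.of_forall hT : ∀ᶠ k in (hyperfilter ℕ : Filter ℕ), _))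
  let ℓ : StrongDual ℝ (Lp ℝ 2 (volume : Measure (Sp n))) := WeakDual.toStrongDual x
  let G := (InnerProductSpace.toDual ℝ _).symm ℓ
  refine ⟨G, Lp.memLp G, ?_, fun ψ hψ l hl => ?_⟩
  · have h1 : ‖G‖ ≤ B := by
      rw [LinearIsometryEquiv.norm_map]
      simpa using hx
    rw [Lp.norm_def] at h1
    exact (ENNReal.le_ofReal_iff_toReal_le (Lp.eLpNorm_ne_top G) hB).2 h1
  · have e1 : ∫ y, (G : Sp n → ℝ) y * ψ y = x (hψ.toLp ψ) := by
      rw [← inner_toLp (Lp.memLp G) hψ, Lp.toLp_coeFn]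
      exact InnerProductSpace.toDual_symm_apply
    rw [e1]
    have h2 : Tendsto (fun k => T k (hψ.toLp ψ)) (hyperfilter ℕ) (𝓝 (x (hψ.toLp ψ))) :=
      (WeakDual.eval_continuous (hψ.toLp ψ)).continuousAt.tendsto.comp hle
    refine tendsto_nhds_unique h2 ?_
    refine (hl.mono_left ?_).congr fun k => ?_
    · rw [← Nat.cofinite_eq_atTop]; exact hyperfilter_le_cofinite
    · rw [← inner_toLp (hf k) hψ]; rfl

/-! ### Translations -/

theorem memLp_translate {f : Sp n → ℝ} {p : ℝ≥0∞} (hf : MemLp f p volume) (z : Sp n) :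
    MemLp (fun x => f (x + z)) p volume :=
  hf.comp_measurePreserving (measurePreserving_add_right volume z)

theorem eLpNorm_translate {f : Sp n → ℝ} {p : ℝ≥0∞} (hf : AEStronglyMeasurable f volume)
    (z : Sp n) : eLpNorm (fun x => f (x + z)) p volume = eLpNorm f p volume :=
  eLpNorm_comp_measurePreserving hf (measurePreserving_add_right volume z)

theorem ae_translate {P : Sp n → Prop} (h : ∀ᵐ x, P x) (z : Sp n) : ∀ᵐ x : Sp n, P (x + z) :=
  (measurePreserving_add_right volume z).quasiMeasurePreserving.ae h

theorem enorm_translate_sub_le {v : Sp n → ℝ} (hv : ContDiff ℝ 1 v) (z x : Sp n) :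
    ‖v (x + z) - v x‖ₑ ≤ ∫⁻ t in Set.Ioc (0 : ℝ) 1, ‖fderiv ℝ v (x + t • z) z‖ₑ := by
  have hd : ∀ t : ℝ, HasDerivAt (fun t : ℝ => v (x + t • z)) (fderiv ℝ v (x + t • z) z) t := by
    intro t
    have h1 : HasDerivAt (fun t : ℝ => x + t • z) z t := by
      simpa using ((hasDerivAt_id t).smul_const z).const_add x
    exact ((hv.differentiable (by simp) _).hasFDerivAt.comp_hasDerivAt t h1)
  have hc : Continuous fun t : ℝ => fderiv ℝ v (x + t • z) z :=
    ((hv.continuous_fderiv (by simp)).comp (by fun_prop)).clm_apply continuous_const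
  have := intervalIntegral.integral_eq_sub_of_hasDerivAt (a := 0) (b := 1) (fun t _ => hd t)
    (hc.intervalIntegrable _ _)
  simp only [one_smul, zero_smul, add_zero] at this
  rw [← this, intervalIntegral.integral_of_le zero_le_one]
  exact enorm_integral_le_lintegral_enorm _

/-- Fundamental theorem of calculus on the segment from x to x + z, Cauchy–Schwarz in the parameter,
translation invariance in x. -/
theorem lintegral_translate_sub_sq_le {v : Sp n → ℝ} (hv : ContDiff ℝ 1 v) (z : Sp n) :
    ∫⁻ x, ‖v (x + z) - v x‖ₑ ^ 2 ≤ ∫⁻ x, ‖fderiv ℝ v x z‖ₑ ^ 2 := by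
  have hc : Continuous fun x => fderiv ℝ v x z :=
    (hv.continuous_fderiv (by simp)).clm_apply continuous_const
  have hm : Measurable fun q : Sp n × ℝ => ‖fderiv ℝ v (q.1 + q.2 • z) z‖ₑ ^ 2 :=
    (hc.comp (by fun_prop : Continuous fun q : Sp n × ℝ => q.1 + q.2 • z)).measurable.enorm.pow_const 2
  calc ∫⁻ x, ‖v (x + z) - v x‖ₑ ^ 2
      ≤ ∫⁻ x, ∫⁻ t in Set.Ioc (0 : ℝ) 1, ‖fderiv ℝ v (x + t • z) z‖ₑ ^ 2 := by
        refine lintegral_mono fun x => ?_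
        refine (pow_le_pow_left' (enorm_translate_sub_le hv z x) 2).trans ?_
        have h1 : AEMeasurable (fun t : ℝ => ‖fderiv ℝ v (x + t • z) z‖ₑ)
            (volume.restrict (Set.Ioc (0 : ℝ) 1)) :=
          (hc.comp (by fun_prop : Continuous fun t : ℝ => x + t • z)).measurable.enorm.aemeasurable
        simpa using lintegral_mul_sq_le' (μ := volume.restrict (Set.Ioc (0 : ℝ) 1))
          (w := fun _ => 1) aemeasurable_const h1
    _ = ∫⁻ t in Set.Ioc (0 : ℝ) 1, ∫⁻ x, ‖fderiv ℝ v (x + t • z) z‖ₑ ^ 2 :=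
        lintegral_lintegral_swap hm.aemeasurable
    _ = ∫⁻ t in Set.Ioc (0 : ℝ) 1, ∫⁻ x, ‖fderiv ℝ v x z‖ₑ ^ 2 := by
        refine lintegral_congr fun t => ?_
        rw [lintegral_add_right_eq_self (fun x => ‖fderiv ℝ v x z‖ₑ ^ 2)]
    _ = _ := by simp

theorem moll_sum {ι : Type*} (s : Finset ι) (k : ℕ) (c : ι → ℝ) {g : ι → Sp n → ℝ}
    (hg : ∀ i, LocallyIntegrable (g i) volume) (x : Sp n) :
    moll k (fun x => ∑ i ∈ s, c i * g i x) x = ∑ i ∈ s, c i * moll k (g i) x := by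
  simp only [moll, Finset.mul_sum]
  rw [integral_finsetSum]
  · refine Finset.sum_congr rfl fun i _ => ?_
    rw [← integral_const_mul]
    congr 1; ext t; ring
  · intro i _
    have := (((isTest_mol (n := n) k).comp_sub x).integrable_mul (hg i)).const_mul (c i)
    refine this.congr (ae_of_all _ fun t => ?_)
    simp only; ring

/-- Increments are controlled by the weak gradient. -/
theorem eLpNorm_translate_sub_le {p : ℝ≥0∞} (hp : p = 2 ∨ p = ⊤) {u : Sp n → ℝ}
    {g : Fin n → Sp n → ℝ} (h : ∀ a, WD a u (g a)) (z : Sp n) :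
    eLpNorm (fun x => u (x + z) - u x) p volume ≤ eLpNorm (fun x => ∑ a, z a * g a x) p volume := by
  -- Local integrability of u is read off from a weak derivative, and there is none for n = 0; but
  -- then z = 0.
  by_cases hn : n = 0
  · subst hn
    have : z = 0 := Subsingleton.elim _ _
    simp [this]
  have hu : LocallyIntegrable u volume := (h ⟨0, Nat.pos_of_ne_zero hn⟩).1
  -- The smooth estimate applies to the mollifications of u, whose gradients are the mollified g;
  -- Fatou removes the mollification.
  have hc : ∀ k, ContDiff ℝ 1 (moll k u) := fun k => (contDiff_moll k hu).of_le (by simp)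
  have hG : AEStronglyMeasurable (fun x => ∑ a, z a * g a x) volume := by
    simpa using Finset.aestronglyMeasurable_fun_sum Finset.univ fun a _ =>
      (h a).2.1.aestronglyMeasurable.const_mul (z a)
  have hf : ∀ k x, fderiv ℝ (moll k u) x z = moll k (fun x => ∑ a, z a * g a x) x := fun k x => by
    rw [fderiv_eq_sum_pd, moll_sum _ _ _ fun a => (h a).2.1]
    simp only [pd_moll k (h _)]
  have hm : ∀ k, AEStronglyMeasurable (fun x => moll k u (x + z) - moll k u x) volume := fun k =>
    (((hc k).continuous.comp (by fun_prop)).sub (hc k).continuous).aestronglyMeasurable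
  have hlim : ∀ᵐ x, Tendsto (fun k => moll k u (x + z) - moll k u x) atTop
      (𝓝 (u (x + z) - u x)) := by
    filter_upwards [tendsto_moll hu, ae_translate (tendsto_moll hu) z] with x h1 h2
    exact h2.sub h1
  rcases hp with rfl | rfl
  · refine eLpNorm_two_le_of_ae_tendsto hm (fun k => ?_) hlim
    rw [eLpNorm_two_le_iff]
    refine (lintegral_translate_sub_sq_le (hc k) z).trans ?_
    simp only [hf, ← eLpNorm_two_sq]
    exact pow_le_pow_left' (eLpNorm_moll_two_le k hG) 2
  · refine eLpNorm_top_le_of_ae_tendsto hm (fun k => ?_) hlim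
    conv_lhs => rw [eLpNorm_exponent_top]
    refine essSup_le_of_ae_le _ (ae_of_all _ fun x => ?_)
    refine (enorm_translate_sub_le (hc k) z x).trans ?_
    refine (lintegral_mono (g := fun _ => eLpNorm (fun x => ∑ a, z a * g a x) ⊤ volume)
      fun t => ?_).trans (by simp)
    rw [hf]
    exact enorm_moll_le_essSup _ _ _

/-- Difference quotients. -/
noncomputable def dq (a : Fin n) (h : ℝ) (f : Sp n → ℝ) (x : Sp n) : ℝ :=
  h⁻¹ * (f (x + EuclideanSpace.single a h) - f x)

theorem eLpNorm_dq_le {p : ℝ≥0∞} (hp : p = 2 ∨ p = ⊤) {u : Sp n → ℝ}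
    {g : Fin n → Sp n → ℝ} (h : ∀ a, WD a u (g a)) (a : Fin n) {t : ℝ} (ht : t ≠ 0) :
    eLpNorm (dq a t u) p volume ≤ eLpNorm (g a) p volume := by
  have h1 := eLpNorm_translate_sub_le hp h (EuclideanSpace.single a t)
  have e : (fun x => ∑ b, (EuclideanSpace.single a t) b * g b x) = t • g a := by
    ext x; simp
  rw [e, eLpNorm_const_smul] at h1
  have e2 : dq a t u = t⁻¹ • fun x => u (x + EuclideanSpace.single a t) - u x := by
    ext x; simp [dq]
  rw [e2, eLpNorm_const_smul]
  calc _ ≤ ‖t⁻¹‖ₑ * (‖t‖ₑ * eLpNorm (g a) p volume) := by gcongr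
    _ = _ := by
      rw [← mul_assoc, ← enorm_mul, inv_mul_cancel₀ ht]; simp

theorem memLp_dq {f : Sp n → ℝ} {p : ℝ≥0∞} (hf : MemLp f p volume) (a : Fin n) (h : ℝ) :
    MemLp (dq a h f) p volume :=
  ((memLp_translate hf _).sub hf).const_mul _

theorem integral_dq_mul {f g : Sp n → ℝ} (hg : IsTest g) (hf : LocallyIntegrable f volume)
    (a : Fin n) (h : ℝ) : ∫ x, dq a h f x * g x = - ∫ x, f x * dq a (-h) g x := by
  set z : Sp n := EuclideanSpace.single a h with hz
  have hz' : EuclideanSpace.single a (-h) = -z := by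
    rw [hz]; ext i; simp; split_ifs <;> simp
  have i1 : Integrable (fun x => f x * g (x + -z)) volume := (hg.translate (-z)).integrable_mul hf
  have i2 := hg.integrable_mul hf
  have i3 : Integrable (fun x => f (x + z) * g x) volume := by
    simpa using i1.comp_add_right z
  have e1 : ∫ x, f (x + z) * g x = ∫ x, f x * g (x + -z) := by
    rw [← integral_add_right_eq_self (fun x => f x * g (x + -z)) z]; simp
  calc ∫ x, dq a h f x * g x = ∫ x, h⁻¹ * (f (x + z) * g x - f x * g x) := by
        congr 1; ext x; simp only [dq, ← hz]; ring
    _ = h⁻¹ * (∫ x, f x * g (x + -z) - f x * g x) := by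
        rw [integral_const_mul, integral_sub i3 i2, integral_sub i1 i2, e1]
    _ = _ := by
        rw [← integral_const_mul, ← integral_neg]
        congr 1; ext x; simp only [dq, hz', inv_neg]; ring

/-- Dominated convergence: for steps of length at most 1 the difference quotients of ψ are bounded
by its Lipschitz constant and vanish outside the 1-neighbourhood of its support. -/
theorem tendsto_integral_mul_dq {f ψ : Sp n → ℝ} (hf : LocallyIntegrable f volume) (hψ : IsTest ψ)
    (a : Fin n) {h : ℕ → ℝ} (h0 : ∀ k, h k ≠ 0) (h1 : ∀ k, |h k| ≤ 1)
    (hlim : Tendsto h atTop (𝓝 0)) :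
    Tendsto (fun k => ∫ x, f x * dq a (h k) ψ x) atTop (𝓝 (∫ x, f x * pd a ψ x)) := by
  obtain ⟨L, hL⟩ := hψ.1.lipschitzWith_of_hasCompactSupport hψ.2 (by simp)
  set K := Metric.cthickening 1 (tsupport ψ)
  have hK : IsCompact K := hψ.2.isCompact.cthickening
  have hsing : ∀ t : ℝ, ‖(EuclideanSpace.single a t : Sp n)‖ = |t| := fun t => by simp
  have hbd : ∀ k x, ‖dq a (h k) ψ x‖ ≤ K.indicator (fun _ => (L : ℝ)) x := by
    intro k x
    by_cases hx : x ∈ K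
    · rw [Set.indicator_of_mem hx]
      have := hL.dist_le_mul (x + EuclideanSpace.single a (h k)) x
      rw [dist_eq_norm, dist_eq_norm, add_sub_cancel_left, hsing] at this
      rw [dq, norm_mul, norm_inv, Real.norm_eq_abs (h k)]
      rw [inv_mul_le_iff₀ (abs_pos.2 (h0 k)), mul_comm]
      exact this
    · rw [Set.indicator_of_notMem hx]
      have z1 : ψ x = 0 := image_eq_zero_of_notMem_tsupport fun hx' =>
        hx (Metric.self_subset_cthickening _ hx')
      have z2 : ψ (x + EuclideanSpace.single a (h k)) = 0 :=
        image_eq_zero_of_notMem_tsupport fun hx' => hx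
          (Metric.mem_cthickening_of_dist_le _ _ _ _ hx' (by
            rw [dist_eq_norm, sub_add_cancel_left, norm_neg, hsing]; exact h1 k))
      simp [dq, z1, z2]
  refine tendsto_integral_of_dominated_convergence (fun x => K.indicator (fun x => L * ‖f x‖) x)
    (fun k => ?_) ?_ (fun k => ae_of_all _ fun x => ?_) (ae_of_all _ fun x => ?_)
  · refine hf.aestronglyMeasurable.mul (Continuous.aestronglyMeasurable ?_)
    exact continuous_const.mul (((hψ.translate _).continuous).sub hψ.continuous)
  · rw [integrable_indicator_iff hK.measurableSet]
    exact ((hf.integrableOn_isCompact hK).norm).const_mul _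
  · rw [norm_mul]
    refine (mul_le_mul_of_nonneg_left (hbd k x) (norm_nonneg _)).trans_eq ?_
    by_cases hx : x ∈ K <;> simp [hx, mul_comm]
  · refine Tendsto.const_mul _ ?_
    have hd : HasDerivAt (fun t : ℝ => ψ (x + t • EuclideanSpace.single a (1 : ℝ)))
        (pd a ψ x) 0 := by
      have h1 : HasDerivAt (fun t : ℝ => x + t • EuclideanSpace.single a (1 : ℝ))
          (EuclideanSpace.single a (1 : ℝ)) 0 := by
        simpa using ((hasDerivAt_id (0 : ℝ)).smul_const (EuclideanSpace.single a (1 : ℝ))).const_add x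
      have h2 := (hψ.differentiable (x + (0 : ℝ) • EuclideanSpace.single a (1 : ℝ))).hasFDerivAt
      simpa [pd, Function.comp_def] using h2.comp_hasDerivAt (0 : ℝ) h1
    have hs := hd.tendsto_slope_zero
    have hk : Tendsto h atTop (𝓝[≠] 0) :=
      tendsto_nhdsWithin_iff.2 ⟨hlim, Eventually.of_forall h0⟩
    refine (hs.comp hk).congr fun k => ?_
    have : h k • EuclideanSpace.single a (1 : ℝ) = EuclideanSpace.single a (h k) := by
      ext i; simp
    simp [dq, this]

/-- Bounded difference quotients in `L²` provide a weak derivative in `L²`. -/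
theorem exists_wd_of_dq_bounded {f : Sp n → ℝ} (hf : MemLp f 2 volume) (a : Fin n) {B : ℝ}
    (hB : 0 ≤ B) (h : ∀ t : ℝ, t ≠ 0 → eLpNorm (dq a t f) 2 volume ≤ ENNReal.ofReal B) :
    ∃ g, WD a f g ∧ MemLp g 2 volume ∧ eLpNorm g 2 volume ≤ ENNReal.ofReal B := by
  have hpos : ∀ k : ℕ, (0 : ℝ) < 1 / ((k : ℝ) + 1) := fun k => by positivity
  obtain ⟨g, hg, hgB, hlim⟩ := exists_weak_limit hB
    (f := fun k => dq a (1 / ((k : ℝ) + 1)) f) (fun k => memLp_dq hf a _)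
    (fun k => h _ (hpos k).ne')
  have lf := hf.locallyIntegrable (by norm_num)
  refine ⟨g, ⟨lf, hg.locallyIntegrable (by norm_num), fun ψ hψ => ?_⟩, hg, hgB⟩
  rw [hlim ψ (hψ.memLp 2) (-∫ x, f x * pd a ψ x), neg_neg]
  simp only [integral_dq_mul hψ lf]
  refine (tendsto_integral_mul_dq lf hψ a (fun k => neg_ne_zero.2 (hpos k).ne') (fun k => ?_) ?_).neg
  · rw [abs_neg, abs_of_pos (hpos k), div_le_one (by positivity)]
    linarith [k.cast_nonneg (α := ℝ)]
  · simpa using (tendsto_one_div_add_atTop_nhds_zero_nat (𝕜 := ℝ)).neg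

/-! ### The product rule -/

/-- Local square integrability. -/
def L2loc (f : Sp n → ℝ) : Prop := ∀ η : Sp n → ℝ, IsTest η → MemLp (fun x => η x * f x) 2 volume

/-- A cutoff function that equals `1` on a large ball. -/
theorem exists_cutoff (R : ℝ) : ∃ θ : Sp n → ℝ, IsTest θ ∧ (∀ x, 0 ≤ θ x ∧ θ x ≤ 1) ∧
    (∀ x, ‖x‖ ≤ R → θ x = 1) ∧ ∀ a x, ‖x‖ < R → pd a θ x = 0 := by
  let θ : ContDiffBump (0 : Sp n) := ⟨max R 1, max R 1 + 1, by positivity, by simp⟩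
  have h1 : ∀ x : Sp n, ‖x‖ ≤ R → θ x = 1 := fun x hx =>
    θ.one_of_mem_closedBall (by simpa [θ] using Or.inl hx)
  refine ⟨θ, ⟨θ.contDiff, θ.hasCompactSupport⟩, fun x => ⟨θ.nonneg, θ.le_one⟩, h1, ?_⟩
  intro a x hx
  have : (θ : Sp n → ℝ) =ᶠ[𝓝 x] fun _ => 1 := by
    filter_upwards [(isOpen_lt continuous_norm continuous_const).mem_nhds hx] with y hy
    exact h1 y (le_of_lt hy)
  rw [pd, this.fderiv_eq]; simp

theorem IsTest.exists_bound {ψ : Sp n → ℝ} (hψ : IsTest ψ) : ∃ C, ∀ x, |ψ x| ≤ C := by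
  obtain ⟨C, hC⟩ := hψ.2.exists_bound_of_continuous hψ.continuous
  exact ⟨C, hC⟩

theorem IsTest.exists_radius {ψ : Sp n → ℝ} (hψ : IsTest ψ) : ∃ R, ∀ x, R ≤ ‖x‖ → ψ x = 0 := by
  obtain ⟨R, hR⟩ := hψ.2.isCompact.isBounded.subset_ball (0 : Sp n)
  refine ⟨R, fun x hx => image_eq_zero_of_notMem_tsupport fun h => ?_⟩
  have := hR h
  rw [mem_ball_zero_iff] at this
  linarith

theorem L2loc.of_memLp_two {f : Sp n → ℝ} (hf : MemLp f 2 volume) : L2loc f := fun η hη => by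
  obtain ⟨C, hC⟩ := hη.exists_bound
  refine hf.of_le_mul (c := C) (hη.continuous.aestronglyMeasurable.mul hf.1)
    (ae_of_all _ fun x => ?_)
  rw [norm_mul]
  exact mul_le_mul_of_nonneg_right (hC x) (norm_nonneg _)

theorem L2loc.of_memLp_top {f : Sp n → ℝ} (hf : MemLp f ⊤ volume) : L2loc f := fun η hη => by
  have := hf.mul (p := 2) (q := ⊤) (r := 2) (hη.memLp 2)
  exact this

theorem L2loc.memLp_mul {f : Sp n → ℝ} (hf : L2loc f) {η : Sp n → ℝ} (hη : IsTest η) :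
    MemLp (fun x => f x * η x) 2 volume := by
  simpa [mul_comm] using hf η hη

theorem L2loc.locallyIntegrable_mul {f g : Sp n → ℝ} (hf : L2loc f) (hg : L2loc g) :
    LocallyIntegrable (fun x => f x * g x) volume := by
  rw [locallyIntegrable_iff]
  intro K hK
  obtain ⟨R, hR⟩ := hK.isBounded.subset_closedBall (0 : Sp n)
  obtain ⟨θ, hθ, -, h1, -⟩ := exists_cutoff (n := n) R
  refine (integrable_mul_two (hf θ hθ) (hg θ hθ)).integrableOn.congr_fun (fun x hx => ?_)
    hK.measurableSet
  have : θ x = 1 := h1 x (by simpa using hR hx)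
  simp [this]

/-- Local square integrability suffices: near the support of ψ the factor f may be replaced by F =
θf in L². The mollifications of F are smooth, so `WD.smooth_mul` covers them, and they converge in
L² together with their derivatives. -/
theorem WD.mul {a : Fin n} {f f' g g' : Sp n → ℝ} (hf : WD a f f') (hg : WD a g g')
    (lf : L2loc f) (lf' : L2loc f') (lg : L2loc g) (lg' : L2loc g') :
    WD a (fun x => f x * g x) (fun x => f' x * g x + f x * g' x) := by
  refine ⟨lf.locallyIntegrable_mul lg,
    (lf'.locallyIntegrable_mul lg).add (lf.locallyIntegrable_mul lg'), fun ψ hψ => ?_⟩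
  obtain ⟨R, hR⟩ := hψ.exists_radius
  obtain ⟨R', hR'⟩ := (hψ.pd a).exists_radius
  obtain ⟨θ, hθ, -, h1, h2⟩ := exists_cutoff (n := n) (max R R')
  have hF := hf.smooth_mul hθ.1
  set F : Sp n → ℝ := fun x => θ x * f x with hFdef
  set F' : Sp n → ℝ := fun x => Kakinuma.pd a θ x * f x + θ x * f' x with hF'def
  have mF : MemLp F 2 volume := lf θ hθ
  have mF' : MemLp F' 2 volume := (lf _ (hθ.pd a)).add (lf' θ hθ)
  have key : ∀ k, ∫ x, moll k F x * (g x * Kakinuma.pd a ψ x)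
      = - (∫ x, moll k F' x * (g x * ψ x)) - ∫ x, moll k F x * (g' x * ψ x) := by
    intro k
    have e := (hg.smooth_mul (contDiff_moll k hF.1)).2.2 ψ hψ
    rw [pd_moll k hF] at e
    simp only [add_mul] at e
    rw [integral_add] at e
    · simp only [mul_assoc] at e
      linarith
    · simpa only [mul_assoc] using integrable_mul_two (memLp_moll_two k mF') (lg.memLp_mul hψ)
    · simpa only [mul_assoc] using integrable_mul_two (memLp_moll_two k mF) (lg'.memLp_mul hψ)
  have t1 := tendsto_integral_mul (fun k => memLp_moll_two k mF) mF (lg.memLp_mul (hψ.pd a))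
    (tendsto_moll_two mF)
  have t2 := tendsto_integral_mul (fun k => memLp_moll_two k mF') mF' (lg.memLp_mul hψ)
    (tendsto_moll_two mF')
  have t3 := tendsto_integral_mul (fun k => memLp_moll_two k mF) mF (lg'.memLp_mul hψ)
    (tendsto_moll_two mF)
  have e := tendsto_nhds_unique t1 ((t2.neg.sub t3).congr fun k => (key k).symm)
  have zero : ∀ x, max R R' ≤ ‖x‖ → ψ x = 0 ∧ Kakinuma.pd a ψ x = 0 := fun x hx =>
    ⟨hR x ((le_max_left _ _).trans hx), hR' x ((le_max_right _ _).trans hx)⟩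
  have c1 : ∀ x, F x * (g x * Kakinuma.pd a ψ x) = f x * g x * Kakinuma.pd a ψ x := fun x => by
    rcases le_or_gt (max R R') ‖x‖ with hx | hx
    · simp [(zero x hx).2]
    · simp only [hFdef, h1 x hx.le]; ring
  have c2 : ∀ x, F' x * (g x * ψ x) = f' x * g x * ψ x := fun x => by
    rcases le_or_gt (max R R') ‖x‖ with hx | hx
    · simp [(zero x hx).1]
    · simp only [hF'def, h1 x hx.le, h2 a x hx]; ring
  have c3 : ∀ x, F x * (g' x * ψ x) = f x * g' x * ψ x := fun x => by
    rcases le_or_gt (max R R') ‖x‖ with hx | hx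
    · simp [(zero x hx).1]
    · simp only [hFdef, h1 x hx.le]; ring
  simp only [c1, c2, c3] at e
  rw [e]
  simp only [add_mul]
  rw [integral_add (hψ.integrable_mul (lf'.locallyIntegrable_mul lg))
    (hψ.integrable_mul (lf.locallyIntegrable_mul lg'))]
  ring

end Kakinuma

namespace Kakinuma
open Filter Topology

variable {n : ℕ}

/-! ### Quantitative Sobolev classes -/

/-- `f ∈ L^p` with norm at most `B`. -/
def LB (p : ℝ≥0∞) (B : ℝ) (f : Sp n → ℝ) : Prop :=
  MemLp f p volume ∧ 0 ≤ B ∧ eLpNorm f p volume ≤ ENNReal.ofReal B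

/-- `f ∈ W^{k,p}`, with the norms of all derivatives of order at most `k` bounded by `B`. -/
def SB (p : ℝ≥0∞) : ℕ → ℝ → (Sp n → ℝ) → Prop
  | 0, B, f => LB p B f
  | k + 1, B, f => LB p B f ∧ ∀ a, ∃ g, WD a f g ∧ SB p k B g

namespace LB

variable {p : ℝ≥0∞} {B B' : ℝ} {f g : Sp n → ℝ}

theorem mono (h : LB p B f) (hB : B ≤ B') : LB p B' f :=
  ⟨h.1, h.2.1.trans hB, h.2.2.trans (ENNReal.ofReal_le_ofReal hB)⟩

theorem congr (h : LB p B f) (hfg : f =ᵐ[volume] g) : LB p B g :=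
  ⟨(memLp_congr_ae hfg).1 h.1, h.2.1, (eLpNorm_congr_ae hfg) ▸ h.2.2⟩

theorem add (hp : 1 ≤ p) (h : LB p B f) (h' : LB p B' g) : LB p (B + B') (fun x => f x + g x) := by
  refine ⟨h.1.add h'.1, add_nonneg h.2.1 h'.2.1, ?_⟩
  rw [ENNReal.ofReal_add h.2.1 h'.2.1]
  exact (eLpNorm_add_le h.1.1 h'.1.1 hp).trans (add_le_add h.2.2 h'.2.2)

theorem const_mul (h : LB p B f) (c : ℝ) : LB p (|c| * B) (fun x => c * f x) := by
  refine ⟨h.1.const_mul c, mul_nonneg (abs_nonneg c) h.2.1, ?_⟩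
  have e := eLpNorm_const_smul c f p volume
  rw [show (fun x => c * f x) = c • f from rfl, e, ENNReal.ofReal_mul (abs_nonneg c),
    Real.enorm_eq_ofReal_abs]
  gcongr
  exact h.2.2

theorem bounded_mul {M : ℝ} (h : LB p B f) (hg : AEStronglyMeasurable g volume) (hM : 0 ≤ M)
    (hgM : ∀ᵐ x, |g x| ≤ M) : LB p (M * B) (fun x => g x * f x) := by
  have hle : ∀ᵐ x, ‖g x * f x‖ ≤ M * ‖f x‖ := by
    filter_upwards [hgM] with x hx
    rw [norm_mul]; gcongr; exact hx
  refine ⟨h.1.of_le_mul (hg.mul h.1.1) hle, mul_nonneg hM h.2.1, ?_⟩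
  refine (eLpNorm_le_mul_eLpNorm_of_ae_le_mul hle p).trans ?_
  rw [ENNReal.ofReal_mul hM]
  gcongr
  exact h.2.2

theorem ae_abs_le (h : LB ⊤ B f) : ∀ᵐ x, |f x| ≤ B := by
  have h1 := enorm_ae_le_eLpNormEssSup f volume
  rw [← eLpNorm_exponent_top] at h1
  filter_upwards [h1] with x hx
  have := hx.trans h.2.2
  rw [Real.enorm_eq_ofReal_abs] at this
  exact (ENNReal.ofReal_le_ofReal_iff h.2.1).1 this

theorem of_ae_abs_le (hf : AEStronglyMeasurable f volume) (hB : 0 ≤ B) (h : ∀ᵐ x, |f x| ≤ B) :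
    LB ⊤ B f := by
  refine ⟨memLp_top_of_bound hf B h, hB, ?_⟩
  rw [eLpNorm_exponent_top]
  refine essSup_le_of_ae_le _ ?_
  filter_upwards [h] with x hx
  rw [Real.enorm_eq_ofReal_abs]
  exact ENNReal.ofReal_le_ofReal hx

theorem translate (h : LB p B f) (z : Sp n) : LB p B (fun x => f (x + z)) :=
  ⟨memLp_translate h.1 z, h.2.1, (eLpNorm_translate h.1.1 z).trans_le h.2.2⟩

theorem toReal_le (h : LB p B f) : (eLpNorm f p volume).toReal ≤ B :=
  ENNReal.toReal_le_of_le_ofReal h.2.1 h.2.2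

theorem self (h : MemLp f p volume) : LB p (eLpNorm f p volume).toReal f :=
  ⟨h, ENNReal.toReal_nonneg, by rw [ENNReal.ofReal_toReal h.2.ne]⟩

theorem l2loc (hp : p = 2 ∨ p = ⊤) (h : LB p B f) : L2loc f := by
  rcases hp with rfl | rfl
  · exact .of_memLp_two h.1
  · exact .of_memLp_top h.1

end LB

namespace SB

variable {p : ℝ≥0∞} {k j : ℕ} {B B' : ℝ} {f g : Sp n → ℝ}

theorem lb (h : SB p k B f) : LB p B f := by
  cases k with
  | zero => exact h
  | succ k => exact h.1

theorem memLp (h : SB p k B f) : MemLp f p volume := h.lb.1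

theorem nonneg (h : SB p k B f) : 0 ≤ B := h.lb.2.1

theorem congr (h : SB p k B f) (hfg : f =ᵐ[volume] g) : SB p k B g := by
  cases k with
  | zero => exact LB.congr h hfg
  | succ k =>
    refine ⟨h.1.congr hfg, fun a => ?_⟩
    obtain ⟨g', h1, h2⟩ := h.2 a
    exact ⟨g', h1.congr hfg EventuallyEq.rfl, h2⟩

theorem deriv {a : Fin n} (h : SB p (k + 1) B f) (hg : WD a f g) : SB p k B g := by
  obtain ⟨g', h1, h2⟩ := h.2 a
  exact h2.congr (h1.ae_eq hg)

theorem succ (h : LB p B f) {g : Fin n → Sp n → ℝ} (hg : ∀ a, WD a f (g a))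
    (hB : ∀ a, SB p k B (g a)) : SB p (k + 1) B f :=
  ⟨h, fun a => ⟨g a, hg a, hB a⟩⟩

theorem mono (h : SB p k B f) (hB : B ≤ B') : SB p k B' f := by
  induction k generalizing f with
  | zero => exact LB.mono h hB
  | succ k ih =>
    refine ⟨h.1.mono hB, fun a => ?_⟩
    obtain ⟨g', h1, h2⟩ := h.2 a
    exact ⟨g', h1, ih h2⟩

theorem pred (h : SB p (k + 1) B f) : SB p k B f := by
  induction k generalizing f with
  | zero => exact h.1
  | succ k ih =>
    refine ⟨h.1, fun a => ?_⟩
    obtain ⟨g', h1, h2⟩ := h.2 a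
    exact ⟨g', h1, ih h2⟩

theorem of_le (h : SB p k B f) (hj : j ≤ k) : SB p j B f := by
  induction k with
  | zero => rwa [Nat.le_zero.1 hj]
  | succ k ih =>
    rcases Nat.le_succ_iff.1 hj with h' | rfl
    · exact ih h.pred h'
    · exact h

theorem add (hp : 1 ≤ p) (h : SB p k B f) (h' : SB p k B' g) :
    SB p k (B + B') (fun x => f x + g x) := by
  induction k generalizing f g with
  | zero => exact LB.add hp h h'
  | succ k ih =>
    refine ⟨h.1.add hp h'.1, fun a => ?_⟩
    obtain ⟨g1, h1, h2⟩ := h.2 a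
    obtain ⟨g1', h1', h2'⟩ := h'.2 a
    exact ⟨_, h1.add h1', ih h2 h2'⟩

theorem const_mul (h : SB p k B f) (c : ℝ) : SB p k (|c| * B) (fun x => c * f x) := by
  induction k generalizing f with
  | zero => exact LB.const_mul h c
  | succ k ih =>
    refine ⟨h.1.const_mul c, fun a => ?_⟩
    obtain ⟨g1, h1, h2⟩ := h.2 a
    exact ⟨_, h1.const_mul c, ih h2⟩

theorem neg (h : SB p k B f) : SB p k B (fun x => - f x) := by
  simpa using h.const_mul (-1)

theorem sub (hp : 1 ≤ p) (h : SB p k B f) (h' : SB p k B' g) :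
    SB p k (B + B') (fun x => f x - g x) := by
  simpa [sub_eq_add_neg] using h.add hp h'.neg

theorem zero (hB : 0 ≤ B) : SB p k B (fun _ : Sp n => (0 : ℝ)) := by
  have h0 : LB p B (fun _ : Sp n => (0 : ℝ)) :=
    ⟨MemLp.zero, hB, by simp⟩
  induction k with
  | zero => exact h0
  | succ k ih => exact ⟨h0, fun a => ⟨_, WD.const a 0, ih⟩⟩

theorem sum (hp : 1 ≤ p) {ι : Type*} (s : Finset ι) {f : ι → Sp n → ℝ} {B : ι → ℝ}
    (h : ∀ i ∈ s, SB p k (B i) (f i)) : SB p k (∑ i ∈ s, B i) (fun x => ∑ i ∈ s, f i x) := by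
  classical
  induction s using Finset.induction_on with
  | empty => simpa using zero le_rfl
  | insert i s hi ih =>
    simp only [Finset.sum_insert hi]
    exact (h i (by simp)).add hp (ih fun j hj => h j (by simp [hj]))

theorem l2loc (hp : p = 2 ∨ p = ⊤) (h : SB p k B f) : L2loc f := h.lb.l2loc hp

theorem moll (hp : p = 2 ∨ p = ⊤) (h : SB p k B f) (i : ℕ) : SB p k B (moll i f) := by
  have key : ∀ {f : Sp n → ℝ}, LB p B f → LB p B (Kakinuma.moll i f) := by
    intro f h
    have hl : LocallyIntegrable f volume := by
      refine h.1.locallyIntegrable ?_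
      rcases hp with rfl | rfl <;> norm_num
    have hle : eLpNorm (Kakinuma.moll i f) p volume ≤ eLpNorm f p volume := by
      rcases hp with rfl | rfl
      · exact eLpNorm_moll_two_le i h.1.1
      · exact eLpNorm_moll_top_le i f
    exact ⟨⟨(contDiff_moll i hl).continuous.aestronglyMeasurable, hle.trans_lt h.1.2⟩, h.2.1,
      hle.trans h.2.2⟩
  induction k generalizing f with
  | zero => exact key h
  | succ k ih =>
    refine ⟨key h.1, fun a => ?_⟩
    obtain ⟨g1, h1, h2⟩ := h.2 a
    refine ⟨_, ?_, ih h2⟩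
    rw [← pd_moll i h1]
    exact WD.of_contDiff ((contDiff_moll i h1.1).of_le (by simp)) a

/-- Bounded functions with bounded derivatives are multipliers. -/
theorem top_mul (hp : p = 2 ∨ p = ⊤) (hf : SB ⊤ k B f) (hg : SB p k B' g) :
    SB p k (2 ^ k * (B * B')) (fun x => f x * g x) := by
  have hp1 : 1 ≤ p := by rcases hp with rfl | rfl <;> norm_num
  have h0 : ∀ {f g : Sp n → ℝ}, LB ⊤ B f → LB p B' g → LB p (B * B') (fun x => f x * g x) :=
    fun hf hg => hg.bounded_mul hf.1.1 hf.2.1 hf.ae_abs_le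
  have hBB : 0 ≤ B * B' := mul_nonneg hf.nonneg hg.nonneg
  induction k generalizing f g with
  | zero => simpa [SB] using h0 hf hg
  | succ k ih =>
    refine ⟨(h0 hf.1 hg.1).mono (le_mul_of_one_le_left hBB (one_le_pow₀ (by norm_num))),
      fun a => ?_⟩
    obtain ⟨f1, w1, h1⟩ := hf.2 a
    obtain ⟨g1, w2, h2⟩ := hg.2 a
    refine ⟨_, w1.mul w2 (hf.l2loc (.inr rfl)) (h1.l2loc (.inr rfl)) (hg.l2loc hp) (h2.l2loc hp), ?_⟩
    -- The Leibniz rule gives two terms for each derivative, whence the power of 2.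
    exact ((ih h1 hg.pred).add hp1 (ih hf.pred h2)).mono (le_of_eq (by ring))

end SB

/-! ### Comparison with the norms of `W^{k,p}` -/

theorem testDeriv_cons {k : ℕ} (a : Fin n) (w : Fin k → Fin n) {ψ : Sp n → ℝ} (hψ : IsTest ψ) :
    testDeriv (Fin.cons a w) ψ = pd a (testDeriv w ψ) := by
  funext x
  have hd : DifferentiableAt ℝ (iteratedFDeriv ℝ k ψ) x :=
    (hψ.1.differentiable_iteratedFDeriv (by exact_mod_cast WithTop.coe_lt_top k)) x
  simp only [testDeriv, pd]
  rw [iteratedFDeriv_succ_apply_left]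
  have : HasFDerivAt (testDeriv w ψ) _ x :=
    (ContinuousMultilinearMap.apply ℝ (fun _ : Fin k => Sp n) ℝ
      (fun j => EuclideanSpace.single (w j) (1 : ℝ))).hasFDerivAt.comp x hd.hasFDerivAt
  rw [this.fderiv]
  simp [Fin.tail_def]

theorem testDeriv_zero (w : Fin 0 → Fin n) (ψ : Sp n → ℝ) : testDeriv w ψ = ψ := by
  funext x; simp [testDeriv]

theorem isTest_testDeriv {k : ℕ} (w : Fin k → Fin n) {ψ : Sp n → ℝ} (hψ : IsTest ψ) :
    IsTest (testDeriv w ψ) := by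
  induction k with
  | zero => rwa [testDeriv_zero]
  | succ k ih =>
    rw [← Fin.cons_self_tail w, testDeriv_cons _ _ hψ]
    exact (ih _).pd _

theorem hasWeakDeriv_zero {w : Fin 0 → Fin n} {f : Sp n → ℝ} (hf : LocallyIntegrable f volume) :
    HasWeakDeriv w f f :=
  ⟨hf, hf, fun ψ _ => by simp [testDeriv_zero]⟩

/-- One integration by parts moves ∂ₐ from ψ to f and leaves the remaining derivatives on ψ; it
accounts for one of the k + 1 signs. -/
theorem hasWeakDeriv_cons_iff {k : ℕ} {a : Fin n} {w : Fin k → Fin n} {f g g' : Sp n → ℝ}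
    (h : WD a f g) : HasWeakDeriv (Fin.cons a w : Fin (k + 1) → Fin n) f g' ↔ HasWeakDeriv w g g' := by
  have key : ∀ ψ, IsTest ψ → ∫ x, f x * testDeriv (Fin.cons a w : Fin (k + 1) → Fin n) ψ x
      = - ∫ x, g x * testDeriv w ψ x := fun ψ hψ => by
    rw [testDeriv_cons a w hψ]; exact h.2.2 _ (isTest_testDeriv w hψ)
  constructor
  · rintro ⟨h1, h2, h3⟩
    refine ⟨h.2.1, h2, fun ψ hψ => ?_⟩
    have := h3 ψ hψ
    rw [key ψ hψ, pow_succ] at this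
    linarith
  · rintro ⟨h1, h2, h3⟩
    refine ⟨h.1, h2, fun ψ hψ => ?_⟩
    rw [key ψ hψ, h3 ψ hψ, pow_succ]
    ring

/-- The recursive form of `SB` suits inductions that peel off one derivative. This lemma and the
next connect it with derivatives indexed by words, one and the same bound serving all of them. -/
theorem SB.of_hasWeakDeriv {p : ℝ≥0∞} {k : ℕ} {B : ℝ} (hB : 0 ≤ B) {f : Sp n → ℝ}
    (h : ∀ j ≤ k, ∀ w : Fin j → Fin n, ∃ g, HasWeakDeriv w f g ∧ MemLp g p volume ∧
      eLpNorm g p volume ≤ ENNReal.ofReal B) : SB p k B f := by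
  have h0 : LB p B f := by
    obtain ⟨g, h1, h2, h3⟩ := h 0 (Nat.zero_le _) Fin.elim0
    exact LB.congr ⟨h2, hB, h3⟩ (h1.ae_eq (hasWeakDeriv_zero h1.1))
  induction k generalizing f with
  | zero => exact h0
  | succ k ih =>
    refine ⟨h0, fun a => ?_⟩
    obtain ⟨g, h1, h2, h3⟩ := h 1 (by omega) fun _ => a
    have hw := hasWeakDeriv_one.1 h1
    refine ⟨g, hw, ih (fun j hj w => ?_) ⟨h2, hB, h3⟩⟩
    obtain ⟨g', h1', h2'⟩ := h (j + 1) (by omega) (Fin.cons a w)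
    exact ⟨g', (hasWeakDeriv_cons_iff hw).1 h1', h2'⟩

theorem SB.hasWeakDeriv {p : ℝ≥0∞} (hp : 1 ≤ p) {k : ℕ} {B : ℝ} {f : Sp n → ℝ} (h : SB p k B f)
    {j : ℕ} (hj : j ≤ k) (w : Fin j → Fin n) : ∃ g, HasWeakDeriv w f g ∧ LB p B g := by
  induction j generalizing f k with
  | zero => exact ⟨f, hasWeakDeriv_zero (h.memLp.locallyIntegrable hp), h.lb⟩
  | succ j ih =>
    obtain ⟨k, rfl⟩ : ∃ k', k = k' + 1 := ⟨k - 1, by omega⟩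
    obtain ⟨g, h1, h2⟩ := h.2 (w 0)
    obtain ⟨g', h1', h2'⟩ := ih h2 (by omega) (Fin.tail w)
    refine ⟨g', ?_, h2'⟩
    rw [← Fin.cons_self_tail w]
    exact (hasWeakDeriv_cons_iff h1).2 h1'

theorem HasWeakDeriv.weakDeriv_eq {k : ℕ} {w : Fin k → Fin n} {f g : Sp n → ℝ}
    (h : HasWeakDeriv w f g) : weakDeriv w f =ᵐ[volume] g := by
  have hex : ∃ g, HasWeakDeriv w f g := ⟨g, h⟩
  rw [weakDeriv, dif_pos hex]
  exact hex.choose_spec.ae_eq h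

theorem wNorm_nonneg (k : ℕ) (p : ℝ≥0∞) (f : Sp n → ℝ) : 0 ≤ wNorm k p f :=
  Finset.sum_nonneg fun _ _ => Finset.sum_nonneg fun _ _ => ENNReal.toReal_nonneg

theorem MemW.sb {p : ℝ≥0∞} {k : ℕ} {f : Sp n → ℝ} (h : MemW k p f) : SB p k (wNorm k p f) f := by
  refine SB.of_hasWeakDeriv (wNorm_nonneg k p f) fun j hj w => ?_
  obtain ⟨g, h1, h2⟩ := h j hj w
  refine ⟨g, h1, h2, ?_⟩
  rw [← ENNReal.ofReal_toReal h2.2.ne, ← eLpNorm_congr_ae h1.weakDeriv_eq]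
  refine ENNReal.ofReal_le_ofReal ?_
  refine le_trans ?_ (Finset.single_le_sum (f := fun k => ∑ w : Fin k → Fin n,
    (eLpNorm (weakDeriv w f) p volume).toReal)
    (fun _ _ => Finset.sum_nonneg fun _ _ => ENNReal.toReal_nonneg)
    (Finset.mem_range.2 (by omega : j < k + 1)))
  exact Finset.single_le_sum (f := fun w : Fin j → Fin n =>
    (eLpNorm (weakDeriv w f) p volume).toReal)
    (fun _ _ => ENNReal.toReal_nonneg) (Finset.mem_univ w)

theorem SB.memW {p : ℝ≥0∞} (hp : 1 ≤ p) {k : ℕ} {B : ℝ} {f : Sp n → ℝ} (h : SB p k B f) :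
    MemW k p f := fun j hj w => by
  obtain ⟨g, h1, h2⟩ := h.hasWeakDeriv hp hj w
  exact ⟨g, h1, h2.1⟩

/-- The number of derivatives of order at most `k`. -/
def numDeriv (n k : ℕ) : ℕ := ∑ j ∈ Finset.range (k + 1), n ^ j

theorem SB.wNorm_le {p : ℝ≥0∞} (hp : 1 ≤ p) {k : ℕ} {B : ℝ} {f : Sp n → ℝ} (h : SB p k B f) :
    wNorm k p f ≤ numDeriv n k * B := by
  rw [wNorm, numDeriv, Nat.cast_sum, Finset.sum_mul]
  refine Finset.sum_le_sum fun j hj => ?_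
  have : ∀ w ∈ (Finset.univ : Finset (Fin j → Fin n)),
      (eLpNorm (weakDeriv w f) p volume).toReal ≤ B := fun w _ => by
    obtain ⟨g, h1, h2⟩ := h.hasWeakDeriv hp (Nat.lt_succ_iff.1 (Finset.mem_range.1 hj)) w
    rw [eLpNorm_congr_ae h1.weakDeriv_eq]
    exact h2.toReal_le
  refine (Finset.sum_le_card_nsmul _ _ _ this).trans_eq ?_
  simp

/-! ### Approximation by test functions -/

/-- Each derivative of χ(c·) brings out a factor c ≤ 1, so the bound does not depend on the scale.
-/
theorem IsTest.exists_sb (k : ℕ) {χ : Sp n → ℝ} (hχ : IsTest χ) :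
    ∃ B, ∀ c : ℝ, 0 < c → c ≤ 1 → SB ⊤ k B (fun x => χ (c • x)) := by
  induction k generalizing χ with
  | zero =>
    obtain ⟨C, hC⟩ := hχ.exists_bound
    refine ⟨C, fun c hc _ => LB.of_ae_abs_le (hχ.comp_smul hc.ne').continuous.aestronglyMeasurable
      ((abs_nonneg _).trans (hC 0)) (ae_of_all _ fun x => hC _)⟩
  | succ k ih =>
    choose B hB using fun a => ih (hχ.pd a)
    obtain ⟨C, hC⟩ := hχ.exists_bound
    have hC0 : 0 ≤ C := (abs_nonneg _).trans (hC 0)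
    have hB0 : ∀ a, 0 ≤ B a := fun a => (hB a 1 one_pos le_rfl).nonneg
    have hBs : ∀ a, B a ≤ ∑ b, B b := fun a =>
      Finset.single_le_sum (fun b _ => hB0 b) (Finset.mem_univ a)
    refine ⟨C + ∑ a, B a, fun c hc hc1 => SB.succ (g := fun a x => c * Kakinuma.pd a χ (c • x)) ?_
      (fun a => ?_) fun a => ?_⟩
    · refine LB.of_ae_abs_le (hχ.comp_smul hc.ne').continuous.aestronglyMeasurable
        (add_nonneg hC0 (Finset.sum_nonneg fun a _ => hB0 a))
        (ae_of_all _ fun x => (hC _).trans ?_)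
      exact le_add_of_nonneg_right (Finset.sum_nonneg fun a _ => hB0 a)
    · have := WD.of_contDiff ((hχ.comp_smul hc.ne').1.of_le (by simp)) a
      refine this.congr EventuallyEq.rfl (ae_of_all _ fun x => ?_)
      exact pd_comp_smul hχ.differentiable a c x
    · refine ((hB a c hc hc1).const_mul c).mono ?_
      rw [abs_of_pos hc]
      calc c * B a ≤ 1 * B a := by gcongr; exact hB0 a
        _ ≤ _ := by rw [one_mul]; exact (hBs a).trans (le_add_of_nonneg_left hC0)

theorem exists_std_cutoff (n : ℕ) : ∃ χ : Sp n → ℝ, IsTest χ ∧ (∀ x, |χ x| ≤ 1) ∧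
    (∀ x, ‖x‖ ≤ 1 → χ x = 1) ∧ ∀ a x, ‖x‖ < 1 → pd a χ x = 0 := by
  obtain ⟨χ, h1, h2, h3, h4⟩ := exists_cutoff (n := n) 1
  exact ⟨χ, h1, fun x => abs_le.2 ⟨by linarith [(h2 x).1], (h2 x).2⟩, h3, h4⟩

/-- A fixed smooth cutoff function. -/
noncomputable def stdCutoff (n : ℕ) : Sp n → ℝ := (exists_std_cutoff n).choose

theorem isTest_stdCutoff (n : ℕ) : IsTest (stdCutoff n) := (exists_std_cutoff n).choose_spec.1

theorem abs_stdCutoff_le (x : Sp n) : |stdCutoff n x| ≤ 1 := (exists_std_cutoff n).choose_spec.2.1 x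

theorem stdCutoff_eq_one {x : Sp n} (hx : ‖x‖ ≤ 1) : stdCutoff n x = 1 :=
  (exists_std_cutoff n).choose_spec.2.2.1 x hx

theorem pd_stdCutoff_eq_zero (a : Fin n) {x : Sp n} (hx : ‖x‖ < 1) : pd a (stdCutoff n) x = 0 :=
  (exists_std_cutoff n).choose_spec.2.2.2 a x hx

/-- The cutoff function at scale `k + 1`. -/
noncomputable def cut (k : ℕ) (x : Sp n) : ℝ := stdCutoff n ((1 / ((k : ℝ) + 1)) • x)

theorem isTest_cut (k : ℕ) : IsTest (cut (n := n) k) :=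
  (isTest_stdCutoff n).comp_smul (by positivity)

theorem abs_cut_le (k : ℕ) (x : Sp n) : |cut k x| ≤ 1 := abs_stdCutoff_le _

theorem cut_eq_one {k : ℕ} {x : Sp n} (hx : ‖x‖ ≤ (k : ℝ) + 1) : cut k x = 1 := by
  refine stdCutoff_eq_one ?_
  have hk : (0 : ℝ) < (k : ℝ) + 1 := by positivity
  rw [norm_smul, Real.norm_of_nonneg (by positivity), one_div, inv_mul_le_iff₀ hk]
  simpa using hx

theorem pd_cut (k : ℕ) (a : Fin n) (x : Sp n) :
    pd a (cut k) x = 1 / ((k : ℝ) + 1) * pd a (stdCutoff n) ((1 / ((k : ℝ) + 1)) • x) :=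
  pd_comp_smul (isTest_stdCutoff n).differentiable a _ x

theorem pd_cut_eq_zero {k : ℕ} {x : Sp n} (a : Fin n) (hx : ‖x‖ < (k : ℝ) + 1) :
    pd a (cut k) x = 0 := by
  have hk : (0 : ℝ) < (k : ℝ) + 1 := by positivity
  rw [pd_cut, pd_stdCutoff_eq_zero, mul_zero]
  rw [norm_smul, Real.norm_of_nonneg (by positivity), one_div, inv_mul_lt_iff₀ hk]
  simpa using hx

theorem eventually_norm_lt (x : Sp n) : ∀ᶠ k : ℕ in atTop, ‖x‖ < (k : ℝ) + 1 := by
  filter_upwards [(tendsto_natCast_atTop_atTop (R := ℝ)).eventually_ge_atTop ‖x‖] with k hk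
  linarith

/-- Approximation by test functions, with control of the Sobolev norms. -/
theorem exists_test_approx (n k : ℕ) : ∃ C : ℝ, 0 ≤ C ∧ ∀ (f : Sp n → ℝ) (B : ℝ), SB 2 k B f →
    ∃ F : ℕ → Sp n → ℝ, (∀ i, IsTest (F i)) ∧ (∀ i, SB 2 k (C * B) (F i)) ∧
      ∀ᵐ x, Tendsto (fun i => F i x) atTop (𝓝 (f x)) := by
  obtain ⟨C, hC⟩ := (isTest_stdCutoff n).exists_sb k
  have hcut : ∀ i : ℕ, SB ⊤ k C (cut (n := n) i) := fun i =>
    hC _ (by positivity) (by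
      rw [div_le_one (by positivity)]; linarith [i.cast_nonneg (α := ℝ)])
  refine ⟨2 ^ k * C, mul_nonneg (by positivity) (hcut 0).nonneg, fun f B hf => ?_⟩
  have hl := hf.memLp.locallyIntegrable (by norm_num)
  refine ⟨fun i x => cut i x * moll i f x, fun i => ?_, fun i => ?_, ?_⟩
  · simpa only [mul_comm] using (isTest_cut i).smooth_mul (contDiff_moll i hl)
  · have := (hcut i).top_mul (.inl rfl) (hf.moll (.inl rfl) i)
    rwa [← mul_assoc] at this
  · filter_upwards [tendsto_moll hl] with x hx
    refine hx.congr' ?_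
    filter_upwards [eventually_norm_lt x] with i hi
    rw [cut_eq_one hi.le, one_mul]

end Kakinuma

namespace Kakinuma
open Filter Topology FourierTransform
open scoped SchwartzMap LineDeriv

variable {n : ℕ}

/-! ### Products in Sobolev spaces -/

/-- A test function as a complex valued Schwartz function. -/
noncomputable def schw {f : Sp n → ℝ} (hf : IsTest f) : 𝓢(Sp n, ℂ) :=
  HasCompactSupport.toSchwartzMap (f := fun x => (f x : ℂ))
    (hf.2.comp_left (g := fun t : ℝ => (t : ℂ)) (by simp)) (Complex.ofRealCLM.contDiff.comp hf.1)

theorem schw_apply {f : Sp n → ℝ} (hf : IsTest f) (x : Sp n) : schw hf x = (f x : ℂ) := rfl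

/-- The modulus of the inverse Fourier transform of a test function. -/
noncomputable def fmod {f : Sp n → ℝ} (hf : IsTest f) (ξ : Sp n) : ℝ≥0∞ := ‖(𝓕⁻ (schw hf)) ξ‖ₑ

theorem measurable_fmod {f : Sp n → ℝ} (hf : IsTest f) : Measurable (fmod hf) :=
  (𝓕⁻ (schw hf)).continuous.measurable.enorm

theorem lintegral_enorm_sq_eq {E : Type*} [NormedAddCommGroup E] {f : Sp n → E}
    (hi : Integrable (fun x => ‖f x‖ ^ 2) volume) :
    ∫⁻ x, ‖f x‖ₑ ^ 2 = ENNReal.ofReal (∫ x, ‖f x‖ ^ 2) := by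
  rw [ofReal_integral_eq_lintegral_ofReal hi (ae_of_all _ fun x => by positivity)]
  refine lintegral_congr fun x => ?_
  rw [ENNReal.ofReal_pow (norm_nonneg _), ofReal_norm]

theorem lintegral_fmod_sq {f : Sp n → ℝ} (hf : IsTest f) :
    ∫⁻ ξ, fmod hf ξ ^ 2 = ∫⁻ x, ‖f x‖ₑ ^ 2 := by
  have key : ∀ g : 𝓢(Sp n, ℂ), Integrable (fun x => ‖g x‖ ^ 2) volume := fun g =>
    (g.memLp 2 volume).integrable_norm_pow (by norm_num)
  have e := SchwartzMap.integral_norm_sq_fourier (𝓕⁻ (schw hf))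
  rw [FourierTransform.fourier_fourierInv_eq] at e
  have e1 := lintegral_enorm_sq_eq (key (𝓕⁻ (schw hf)))
  have e2 := lintegral_enorm_sq_eq (key (schw hf))
  simp only [fmod]
  rw [e1, ← e, ← e2]
  refine lintegral_congr fun x => ?_
  rw [schw_apply]; simp [enorm_eq_nnnorm]

theorem schw_pd {f : Sp n → ℝ} (hf : IsTest f) (a : Fin n) :
    schw (hf.pd a) = ∂_{(EuclideanSpace.single a (1 : ℝ) : Sp n)} (schw hf) := by
  ext x
  rw [SchwartzMap.lineDerivOp_apply_eq_fderiv, schw_apply]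
  have h := Complex.ofRealCLM.hasFDerivAt.comp x (hf.differentiable x).hasFDerivAt
  have h2 : fderiv ℝ (schw hf) x = _ := h.fderiv
  rw [h2]
  simp [pd]

/-- Under the inverse Fourier transform a derivative becomes multiplication by a factor of modulus
2π|ξₐ|; the constant 2π ≥ 1 is dropped. -/
theorem fmod_pd {f : Sp n → ℝ} (hf : IsTest f) (a : Fin n) (ξ : Sp n) :
    ‖ξ a‖ₑ * fmod hf ξ ≤ fmod (hf.pd a) ξ := by
  simp only [fmod]
  rw [schw_pd, SchwartzMap.fourierInv_lineDerivOp_eq]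
  have ht : (fun x : Sp n => inner ℝ x (EuclideanSpace.single a (1 : ℝ))).HasTemperateGrowth := by
    fun_prop
  rw [smul_apply, SchwartzMap.smulLeftCLM_apply_apply ht, enorm_smul, enorm_smul]
  have e1 : ‖inner ℝ ξ (EuclideanSpace.single a (1 : ℝ) : Sp n)‖ₑ = ‖ξ a‖ₑ := by
    rw [EuclideanSpace.inner_single_right]; simp
  rw [e1]
  refine le_mul_of_one_le_left zero_le ?_
  rw [← ofReal_norm, ENNReal.one_le_ofReal]
  simp only [norm_neg, norm_mul, Complex.norm_I, Complex.norm_real, Complex.norm_ofNat,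
    Real.norm_of_nonneg Real.pi_pos.le]
  linarith [Real.pi_gt_three]

/-- The inverse transform turns products into convolutions, by Fourier inversion from the rule for
transforms of convolutions. -/
theorem fmod_mul_le {f g : Sp n → ℝ} (hf : IsTest f) (hg : IsTest g)
    (hfg : IsTest fun x => f x * g x) (ξ : Sp n) :
    fmod hfg ξ ≤ ∫⁻ t, fmod hf (ξ - t) * fmod hg t := by
  have e : 𝓕⁻ (schw hfg) = SchwartzMap.convolution (ContinuousLinearMap.mul ℂ ℂ)
      (𝓕⁻ (schw hf)) (𝓕⁻ (schw hg)) := by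
    have e0 : 𝓕⁻ (𝓕 (SchwartzMap.convolution (ContinuousLinearMap.mul ℂ ℂ) (𝓕⁻ (schw hf))
        (𝓕⁻ (schw hg)))) = SchwartzMap.convolution (ContinuousLinearMap.mul ℂ ℂ) (𝓕⁻ (schw hf))
        (𝓕⁻ (schw hg)) := by simp
    rw [← e0, SchwartzMap.fourier_convolution, FourierTransform.fourier_fourierInv_eq,
      FourierTransform.fourier_fourierInv_eq]
    congr 1
    ext x
    simp [SchwartzMap.pairing_apply_apply, schw_apply]
  simp only [fmod]
  rw [e, SchwartzMap.convolution_apply, convolution_eq_swap]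
  refine (enorm_integral_le_lintegral_enorm _).trans_eq ?_
  simp only [ContinuousLinearMap.mul_apply', enorm_mul]

theorem enorm_le_lintegral_fmod {f : Sp n → ℝ} (hf : IsTest f) (x : Sp n) :
    ‖f x‖ₑ ≤ ∫⁻ ξ, fmod hf ξ := by
  have e : (f x : ℂ) = 𝓕 (𝓕⁻ (schw hf)) x := by
    rw [FourierTransform.fourier_fourierInv_eq, schw_apply]
  have e2 : ‖f x‖ₑ = ‖(f x : ℂ)‖ₑ := by simp [enorm_eq_nnnorm]
  rw [e2, e, SchwartzMap.fourier_coe, Real.fourier_eq]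
  refine (enorm_integral_le_lintegral_enorm _).trans_eq ?_
  refine lintegral_congr fun ξ => ?_
  simp only [fmod]
  rw [← ofReal_norm, ← ofReal_norm, Circle.norm_smul]

/-- The Fourier weight. -/
noncomputable def fw (ξ : Sp n) : ℝ≥0∞ := 1 + ‖ξ‖ₑ

theorem measurable_fw : Measurable (fw (n := n)) := measurable_const.add measurable_id.enorm

theorem fw_ne_zero (ξ : Sp n) : fw ξ ≠ 0 := by simp [fw]

theorem fw_ne_top (ξ : Sp n) : fw ξ ≠ ⊤ := by simp [fw]

theorem fw_sq_le (ξ : Sp n) : fw ξ ^ 2 ≤ 2 * (1 + ∑ a, ‖ξ a‖ₑ ^ 2) := by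
  have e : ∑ a, ‖ξ a‖ₑ ^ 2 = ENNReal.ofReal (‖ξ‖ ^ 2) := by
    rw [EuclideanSpace.norm_sq_eq, ENNReal.ofReal_sum_of_nonneg fun _ _ => by positivity]
    refine Finset.sum_congr rfl fun a _ => ?_
    rw [ENNReal.ofReal_pow (norm_nonneg _), ofReal_norm]
  rw [e, fw, ← ofReal_norm, ← ENNReal.ofReal_one, ← ENNReal.ofReal_add (by norm_num) (by positivity),
    ← ENNReal.ofReal_add (by norm_num) (by positivity), ← ENNReal.ofReal_pow (by positivity)]
  refine (ENNReal.ofReal_le_ofReal (show _ ≤ 2 * (1 + ‖ξ‖ ^ 2) by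
    nlinarith [sq_nonneg (1 - ‖ξ‖)])).trans_eq ?_
  rw [ENNReal.ofReal_mul (by norm_num), ENNReal.ofReal_ofNat]

/-- Plancherel settles k = 0. Each further weight, squared, is at most 2(1 + Σ ξₐ²), that is, it
costs the function itself and its n derivatives. -/
theorem lintegral_fw_pow_mul_fmod_le (k : ℕ) {f : Sp n → ℝ} (hf : IsTest f) {B : ℝ}
    (h : SB 2 k B f) :
    ∫⁻ ξ, (fw ξ ^ k * fmod hf ξ) ^ 2 ≤ (2 * ((n : ℝ≥0∞) + 1)) ^ k * ENNReal.ofReal B ^ 2 := by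
  induction k generalizing f with
  | zero =>
    simp only [pow_zero, one_mul, lintegral_fmod_sq]
    rw [← eLpNorm_two_sq]
    exact pow_le_pow_left' h.lb.2.2 2
  | succ k ih =>
    have hm : ∀ {g : Sp n → ℝ} (hg : IsTest g),
        Measurable fun ξ => (fw ξ ^ k * fmod hg ξ) ^ 2 := fun hg =>
      ((measurable_fw.pow_const k).mul (measurable_fmod hg)).pow_const 2
    have hp : ∀ ξ, (fw ξ ^ (k + 1) * fmod hf ξ) ^ 2 ≤ 2 * ((fw ξ ^ k * fmod hf ξ) ^ 2
        + ∑ a, (fw ξ ^ k * fmod (hf.pd a) ξ) ^ 2) := fun ξ => by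
      calc (fw ξ ^ (k + 1) * fmod hf ξ) ^ 2 = fw ξ ^ 2 * (fw ξ ^ k * fmod hf ξ) ^ 2 := by ring
        _ ≤ 2 * (1 + ∑ a, ‖ξ a‖ₑ ^ 2) * (fw ξ ^ k * fmod hf ξ) ^ 2 := by gcongr; exact fw_sq_le ξ
        _ = 2 * ((fw ξ ^ k * fmod hf ξ) ^ 2
            + ∑ a, (fw ξ ^ k * (‖ξ a‖ₑ * fmod hf ξ)) ^ 2) := by
          rw [mul_assoc, add_mul, one_mul, Finset.sum_mul]
          congr 3 with a
          ring
        _ ≤ _ := by gcongr with a; exact fmod_pd hf a ξ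
    refine (lintegral_mono hp).trans ?_
    rw [lintegral_const_mul _ (by
      exact (hm hf).add (Finset.measurable_fun_sum _ fun a _ => hm (hf.pd a))),
      lintegral_add_left (hm hf), lintegral_finsetSum _ fun a _ => hm (hf.pd a)]
    have h1 := ih hf h.pred
    have h2 : ∀ a, ∫⁻ ξ, (fw ξ ^ k * fmod (hf.pd a) ξ) ^ 2 ≤ _ := fun a =>
      ih (hf.pd a) (h.deriv (WD.of_contDiff (hf.1.of_le (by simp)) a))
    calc _ ≤ 2 * ((2 * ((n : ℝ≥0∞) + 1)) ^ k * ENNReal.ofReal B ^ 2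
          + ∑ a : Fin n, (2 * ((n : ℝ≥0∞) + 1)) ^ k * ENNReal.ofReal B ^ 2) := by
          gcongr with a
          exact h2 a
      _ = _ := by
        rw [Finset.sum_const, Finset.card_univ, Fintype.card_fin, nsmul_eq_mul, pow_succ]
        ring

theorem lintegral_fw_inv_lt_top {s : ℕ} (hs : n < 2 * s) :
    ∫⁻ ξ : Sp n, ((fw ξ ^ s)⁻¹) ^ 2 < ⊤ := by
  have h := finite_integral_one_add_norm (E := Sp n) (μ := volume) (r := ((2 * s : ℕ) : ℝ))
    (by simpa using (by exact_mod_cast hs : (n : ℝ) < ((2 * s : ℕ) : ℝ)))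
  refine lt_of_le_of_lt (le_of_eq (lintegral_congr fun ξ => ?_)) h
  have hpos : 0 < 1 + ‖ξ‖ := by positivity
  rw [Real.rpow_neg hpos.le, Real.rpow_natCast, ENNReal.ofReal_inv_of_pos (by positivity),
    ENNReal.ofReal_pow hpos.le, ENNReal.ofReal_add (by norm_num) (norm_nonneg _), ofReal_norm,
    ENNReal.ofReal_one, fw, ENNReal.inv_pow, ← pow_mul, mul_comm s 2, ENNReal.inv_pow]

/-- If |x| ≤ |y|, all a + b weights may be taken at x, and conversely. In a convolution this places
the inverse weight on the smaller frequency, where it is square integrable as soon as a + b > n/2.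
-/
theorem fmod_weight_le (a b : ℕ) (x y : Sp n) :
    1 ≤ fw x ^ a * fw y ^ b * ((fw x ^ (a + b))⁻¹ + (fw y ^ (a + b))⁻¹) := by
  have key : ∀ {u v : ℝ≥0∞}, u ≠ 0 → u ≠ ⊤ → u ≤ v → ∀ i j : ℕ,
      1 ≤ u ^ i * v ^ j * (u ^ (i + j))⁻¹ := fun {u v} h0 ht huv i j => by
    have h1 : u ^ (i + j) ≤ u ^ i * v ^ j := by rw [pow_add]; gcongr
    calc (1 : ℝ≥0∞) = u ^ (i + j) * (u ^ (i + j))⁻¹ :=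
          (ENNReal.mul_inv_cancel (pow_ne_zero _ h0) (ENNReal.pow_ne_top ht)).symm
      _ ≤ _ := by gcongr
  rcases le_total (fw x) (fw y) with h | h
  · refine (key (fw_ne_zero x) (fw_ne_top x) h a b).trans ?_
    gcongr; exact le_self_add
  · refine (key (fw_ne_zero y) (fw_ne_top y) h b a).trans ?_
    rw [mul_comm (fw y ^ b), add_comm b a]
    gcongr; exact le_add_self

theorem ofReal_sqrt_mul_sq {D : ℝ≥0∞} (hD : D ≠ ⊤) (B : ℝ) :
    ENNReal.ofReal (Real.sqrt D.toReal * B) ^ 2 = D * ENNReal.ofReal B ^ 2 := by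
  rw [ENNReal.ofReal_mul (Real.sqrt_nonneg _), mul_pow,
    ← ENNReal.ofReal_pow (Real.sqrt_nonneg _), Real.sq_sqrt ENNReal.toReal_nonneg,
    ENNReal.ofReal_toReal hD]

/-- On the Fourier side the product is a convolution. With weighted transforms U, V and the square
integrable inverse weight m, it is dominated by (Um) ∗ V + U ∗ (Vm); Cauchy–Schwarz puts Um and Vm
into L¹, and Young's inequality concludes. -/
theorem test_mul_bound (a b : ℕ) (hab : n < 2 * (a + b)) : ∃ C : ℝ, 0 ≤ C ∧
    ∀ (f g : Sp n → ℝ) (B B' : ℝ), IsTest f → IsTest g → SB 2 a B f → SB 2 b B' g →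
      eLpNorm (fun x => f x * g x) 2 volume ≤ ENNReal.ofReal (C * (B * B')) := by
  set M := ∫⁻ ξ : Sp n, ((fw ξ ^ (a + b))⁻¹) ^ 2 with hM
  have hMt : M ≠ ⊤ := (lintegral_fw_inv_lt_top hab).ne
  set D : ℝ≥0∞ := 4 * M * ((2 * ((n : ℝ≥0∞) + 1)) ^ a * (2 * ((n : ℝ≥0∞) + 1)) ^ b) with hD
  have hDt : D ≠ ⊤ := by
    refine ENNReal.mul_ne_top (ENNReal.mul_ne_top (by norm_num) hMt) (ENNReal.mul_ne_top ?_ ?_) <;>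
    exact ENNReal.pow_ne_top (ENNReal.mul_ne_top (by norm_num) (by simp))
  refine ⟨Real.sqrt D.toReal, Real.sqrt_nonneg _, fun f g B B' hf hg hfB hgB => ?_⟩
  have hfg : IsTest fun x => f x * g x := hg.smooth_mul hf.1
  rw [eLpNorm_two_le_iff, ← lintegral_fmod_sq hfg]
  set U : Sp n → ℝ≥0∞ := fun ξ => fw ξ ^ a * fmod hf ξ with hU
  set V : Sp n → ℝ≥0∞ := fun ξ => fw ξ ^ b * fmod hg ξ with hV
  set m : Sp n → ℝ≥0∞ := fun ξ => (fw ξ ^ (a + b))⁻¹ with hm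
  have mU : Measurable U := (measurable_fw.pow_const a).mul (measurable_fmod hf)
  have mV : Measurable V := (measurable_fw.pow_const b).mul (measurable_fmod hg)
  have mm : Measurable m := (measurable_fw.pow_const _).inv
  have hbound : ∀ {W : Sp n → ℝ≥0∞}, Measurable W →
      (∫⁻ t, W t * m t) ^ 2 ≤ (∫⁻ t, W t ^ 2) * M := fun hW =>
    lintegral_mul_sq_le hW.aemeasurable mm.aemeasurable
  have hpt : ∀ ξ, fmod hfg ξ ≤ (∫⁻ t, (U (ξ - t) * m (ξ - t)) * V t)
      + ∫⁻ t, U (ξ - t) * (V t * m t) := fun ξ => by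
    rw [← lintegral_add_left (by fun_prop)]
    refine (fmod_mul_le hf hg hfg ξ).trans (lintegral_mono fun t => ?_)
    calc fmod hf (ξ - t) * fmod hg t
        ≤ fmod hf (ξ - t) * fmod hg t * (fw (ξ - t) ^ a * fw t ^ b *
          ((fw (ξ - t) ^ (a + b))⁻¹ + (fw t ^ (a + b))⁻¹)) :=
          le_mul_of_one_le_right zero_le (fmod_weight_le a b _ _)
      _ = _ := by simp only [hU, hV, hm]; ring
  -- Subtraction is avoided in `ℝ≥0∞`: the larger number is the smaller one plus d, and d² is the
  -- term to be added.
  have hsq : ∀ x y : ℝ≥0∞, (x + y) ^ 2 ≤ 2 * (x ^ 2 + y ^ 2) := fun x y => by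
    rcases le_total x y with h | h
    · obtain ⟨d, rfl⟩ := exists_add_of_le h
      calc (x + (x + d)) ^ 2 ≤ (x + (x + d)) ^ 2 + d ^ 2 := le_self_add
        _ = _ := by ring
    · obtain ⟨d, rfl⟩ := exists_add_of_le h
      calc (y + d + y) ^ 2 ≤ (y + d + y) ^ 2 + d ^ 2 := le_self_add
        _ = _ := by ring
  have y1 := lintegral_conv_sq_le (G := fun t => U t * m t) (F := V) (mU.mul mm) mV
  have y2 : ∫⁻ ξ, (∫⁻ t, U (ξ - t) * (V t * m t)) ^ 2 ≤ (∫⁻ t, V t * m t) ^ 2 * ∫⁻ t, U t ^ 2 := by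
    refine le_trans (le_of_eq (lintegral_congr fun ξ => ?_))
      (lintegral_conv_sq_le (G := fun t => V t * m t) (F := U) (mV.mul mm) mU)
    congr 1
    rw [← lintegral_sub_left_eq_self _ ξ]
    refine lintegral_congr fun t => ?_
    simp only [sub_sub_cancel]
    ring
  have mc1 : Measurable fun ξ => (∫⁻ t, (U (ξ - t) * m (ξ - t)) * V t) ^ 2 := by
    refine Measurable.pow_const (Measurable.lintegral_prod_right' (f := fun q : Sp n × Sp n =>
      (U (q.1 - q.2) * m (q.1 - q.2)) * V q.2) ?_) 2
    fun_prop
  calc ∫⁻ ξ, fmod hfg ξ ^ 2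
      ≤ ∫⁻ ξ, 2 * ((∫⁻ t, (U (ξ - t) * m (ξ - t)) * V t) ^ 2
        + (∫⁻ t, U (ξ - t) * (V t * m t)) ^ 2) :=
        lintegral_mono fun ξ => (pow_le_pow_left' (hpt ξ) 2).trans (hsq _ _)
    _ = 2 * ((∫⁻ ξ, (∫⁻ t, (U (ξ - t) * m (ξ - t)) * V t) ^ 2)
        + ∫⁻ ξ, (∫⁻ t, U (ξ - t) * (V t * m t)) ^ 2) := by
        rw [lintegral_const_mul' _ _ (by norm_num), lintegral_add_left mc1]
    _ ≤ 2 * ((∫⁻ t, U t ^ 2) * M * (∫⁻ t, V t ^ 2) + (∫⁻ t, V t ^ 2) * M * ∫⁻ t, U t ^ 2) := by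
        gcongr
        · exact y1.trans (by gcongr; exact hbound mU)
        · exact y2.trans (by gcongr; exact hbound mV)
    _ = 4 * M * ((∫⁻ t, U t ^ 2) * ∫⁻ t, V t ^ 2) := by ring
    _ ≤ 4 * M * (((2 * ((n : ℝ≥0∞) + 1)) ^ a * ENNReal.ofReal B ^ 2)
          * ((2 * ((n : ℝ≥0∞) + 1)) ^ b * ENNReal.ofReal B' ^ 2)) := by
        gcongr
        · exact lintegral_fw_pow_mul_fmod_le a hf hfB
        · exact lintegral_fw_pow_mul_fmod_le b hg hgB
    _ = D * (ENNReal.ofReal B * ENNReal.ofReal B') ^ 2 := by rw [hD]; ring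
    _ = _ := by
        rw [ofReal_sqrt_mul_sq hDt, ENNReal.ofReal_mul hfB.nonneg]

/-- Fourier inversion bounds |f| by the L¹ norm of the transform; Cauchy–Schwarz against the square
integrable inverse weight bounds that by the H^s norm. -/
theorem test_sup_bound (s : ℕ) (hs : n < 2 * s) : ∃ C : ℝ, 0 ≤ C ∧
    ∀ (f : Sp n → ℝ) (B : ℝ), IsTest f → SB 2 s B f → ∀ x, |f x| ≤ C * B := by
  set M := ∫⁻ ξ : Sp n, ((fw ξ ^ s)⁻¹) ^ 2 with hM
  have hMt : M ≠ ⊤ := (lintegral_fw_inv_lt_top hs).ne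
  set D : ℝ≥0∞ := M * (2 * ((n : ℝ≥0∞) + 1)) ^ s with hD
  have hDt : D ≠ ⊤ :=
    ENNReal.mul_ne_top hMt (ENNReal.pow_ne_top (ENNReal.mul_ne_top (by norm_num) (by simp)))
  refine ⟨Real.sqrt D.toReal, Real.sqrt_nonneg _, fun f B hf hfB x => ?_⟩
  have h1 : ‖f x‖ₑ ^ 2 ≤ ENNReal.ofReal (Real.sqrt D.toReal * B) ^ 2 := by
    calc ‖f x‖ₑ ^ 2 ≤ (∫⁻ ξ, fmod hf ξ) ^ 2 := pow_le_pow_left' (enorm_le_lintegral_fmod hf x) 2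
      _ = (∫⁻ ξ, (fw ξ ^ s)⁻¹ * (fw ξ ^ s * fmod hf ξ)) ^ 2 := by
          congr 1
          refine lintegral_congr fun ξ => ?_
          rw [← mul_assoc, ENNReal.inv_mul_cancel (pow_ne_zero _ (fw_ne_zero ξ))
            (ENNReal.pow_ne_top (fw_ne_top ξ)), one_mul]
      _ ≤ M * ∫⁻ ξ, (fw ξ ^ s * fmod hf ξ) ^ 2 :=
          lintegral_mul_sq_le (measurable_fw.pow_const _).inv.aemeasurable
            ((measurable_fw.pow_const _).mul (measurable_fmod hf)).aemeasurable
      _ ≤ M * ((2 * ((n : ℝ≥0∞) + 1)) ^ s * ENNReal.ofReal B ^ 2) := by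
          gcongr; exact lintegral_fw_pow_mul_fmod_le s hf hfB
      _ = _ := by
          rw [ofReal_sqrt_mul_sq hDt, hD, mul_assoc]
  have h2 := (ENNReal.pow_le_pow_left_iff (by norm_num)).1 h1
  rw [Real.enorm_eq_ofReal_abs] at h2
  exact (ENNReal.ofReal_le_ofReal_iff (mul_nonneg (Real.sqrt_nonneg _) hfB.nonneg)).1 h2

/-- Sobolev's embedding into bounded functions. -/
theorem sup_bound (s : ℕ) (hs : n < 2 * s) : ∃ C : ℝ, 0 ≤ C ∧
    ∀ (f : Sp n → ℝ) (B : ℝ), SB 2 s B f → ∀ᵐ x, |f x| ≤ C * B := by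
  obtain ⟨C, hC, h⟩ := test_sup_bound (n := n) s hs
  obtain ⟨C', hC', h'⟩ := exists_test_approx n s
  refine ⟨C * C', mul_nonneg hC hC', fun f B hf => ?_⟩
  obtain ⟨F, hF, hFB, hlim⟩ := h' f B hf
  filter_upwards [hlim] with x hx
  rw [mul_assoc]
  exact le_of_tendsto hx.abs (Eventually.of_forall fun i => h _ _ (hF i) (hFB i) x)

/-- `‖f g‖_{L²} ≤ C ‖f‖_{H^a} ‖g‖_{H^b}` if `a + b > n / 2`. -/
theorem mul_bound (a b : ℕ) (hab : n < 2 * (a + b)) : ∃ C : ℝ, 0 ≤ C ∧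
    ∀ (f g : Sp n → ℝ) (B B' : ℝ), SB 2 a B f → SB 2 b B' g →
      LB 2 (C * (B * B')) (fun x => f x * g x) := by
  obtain ⟨C, hC, h⟩ := test_mul_bound (n := n) a b hab
  obtain ⟨C1, hC1, h1⟩ := exists_test_approx n a
  obtain ⟨C2, hC2, h2⟩ := exists_test_approx n b
  refine ⟨C * (C1 * C2), by positivity, fun f g B B' hf hg => ?_⟩
  obtain ⟨F, hF, hFB, hlim⟩ := h1 f B hf
  obtain ⟨G, hG, hGB, hlim'⟩ := h2 g B' hg
  have hle : eLpNorm (fun x => f x * g x) 2 volume ≤ ENNReal.ofReal (C * (C1 * C2) * (B * B')) := by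
    refine eLpNorm_two_le_of_ae_tendsto (f := fun i x => F i x * G i x)
      (fun i => ((hF i).continuous.mul (hG i).continuous).aestronglyMeasurable) (fun i => ?_) ?_
    · refine (h _ _ _ _ (hF i) (hG i) (hFB i) (hGB i)).trans_eq ?_
      congr 1; ring
    · filter_upwards [hlim, hlim'] with x hx hx' using hx.mul hx'
  have := hf.nonneg
  have := hg.nonneg
  exact ⟨⟨hf.memLp.1.mul hg.memLp.1, hle.trans_lt ENNReal.ofReal_lt_top⟩, by positivity, hle⟩

/-- Products of Sobolev functions. -/
theorem sobolev_mul (k : ℕ) : ∀ a b : ℕ, k ≤ a → k ≤ b → n < 2 * (a + b - k) → ∃ C : ℝ, 0 ≤ C ∧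
    ∀ (f g : Sp n → ℝ) (B B' : ℝ), SB 2 a B f → SB 2 b B' g →
      SB 2 k (C * (B * B')) (fun x => f x * g x) := by
  induction k with
  | zero =>
    intro a b _ _ h
    exact mul_bound a b (by omega)
  | succ k ih =>
    intro a b ha hb h
    obtain ⟨a, rfl⟩ : ∃ a', a = a' + 1 := ⟨a - 1, by omega⟩
    obtain ⟨b, rfl⟩ : ∃ b', b = b' + 1 := ⟨b - 1, by omega⟩
    obtain ⟨C0, hC0, h0⟩ := mul_bound (n := n) (a + 1) (b + 1) (by omega)
    -- Differentiating one factor lowers its order and the target order by one each, so a + b − k is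
    -- preserved.
    obtain ⟨C1, hC1, h1⟩ := ih a (b + 1) (by omega) (by omega) (by omega)
    obtain ⟨C2, hC2, h2⟩ := ih (a + 1) b (by omega) (by omega) (by omega)
    refine ⟨C0 + (C1 + C2), by positivity, fun f g B B' hf hg => ?_⟩
    have hB := mul_nonneg hf.nonneg hg.nonneg
    refine ⟨(h0 f g B B' hf hg).mono (by nlinarith [mul_nonneg hC1 hB, mul_nonneg hC2 hB]),
      fun i => ?_⟩
    obtain ⟨f1, w1, s1⟩ := hf.2 i
    obtain ⟨g1, w2, s2⟩ := hg.2 i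
    refine ⟨_, w1.mul w2 (hf.l2loc (.inl rfl)) (s1.l2loc (.inl rfl)) (hg.l2loc (.inl rfl))
      (s2.l2loc (.inl rfl)), ?_⟩
    refine ((h1 _ _ _ _ s1 hg).add (by norm_num) (h2 _ _ _ _ hf s2)).mono ?_
    nlinarith [mul_nonneg hC0 hB]

/-! ### Multipliers -/

/-- `f` is bounded by `C` and multiplication with `f` maps `H^j` to itself with norm at most `C`,
for all `j ≤ s`. -/
def Mult (s : ℕ) (C : ℝ) (f : Sp n → ℝ) : Prop :=
  AEStronglyMeasurable f volume ∧ 0 ≤ C ∧ (∀ᵐ x, |f x| ≤ C) ∧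
    ∀ j ≤ s, ∀ (B : ℝ) (g : Sp n → ℝ), SB 2 j B g → SB 2 j (C * B) (fun x => f x * g x)

/-- `f` and its first derivatives are multipliers. -/
def Mult1 (s : ℕ) (C : ℝ) (f : Sp n → ℝ) : Prop :=
  Mult s C f ∧ ∀ a, ∃ g, WD a f g ∧ Mult s C g

namespace Mult

variable {s : ℕ} {C C' : ℝ} {f g : Sp n → ℝ}

theorem nonneg (h : Mult s C f) : 0 ≤ C := h.2.1

theorem lb (h : Mult s C f) : LB ⊤ C f := LB.of_ae_abs_le h.1 h.2.1 h.2.2.1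

theorem l2loc (h : Mult s C f) : L2loc f := h.lb.l2loc (.inr rfl)

theorem mono (h : Mult s C f) (hC : C ≤ C') : Mult s C' f :=
  ⟨h.1, h.2.1.trans hC, h.2.2.1.mono fun _ hx => hx.trans hC, fun j hj B g hg =>
    (h.2.2.2 j hj B g hg).mono (mul_le_mul_of_nonneg_right hC hg.nonneg)⟩

theorem congr (h : Mult s C f) (hfg : f =ᵐ[volume] g) : Mult s C g := by
  refine ⟨h.1.congr hfg, h.2.1, ?_, fun j hj B u hu => (h.2.2.2 j hj B u hu).congr ?_⟩
  · filter_upwards [h.2.2.1, hfg] with x hx hx'; rwa [← hx']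
  · filter_upwards [hfg] with x hx; rw [hx]

theorem add (h : Mult s C f) (h' : Mult s C' g) : Mult s (C + C') (fun x => f x + g x) := by
  refine ⟨h.1.add h'.1, add_nonneg h.2.1 h'.2.1, ?_, fun j hj B u hu => ?_⟩
  · filter_upwards [h.2.2.1, h'.2.2.1] with x hx hx'
    exact (abs_add_le _ _).trans (add_le_add hx hx')
  · simp only [add_mul]
    exact (h.2.2.2 j hj B u hu).add (by norm_num) (h'.2.2.2 j hj B u hu)

theorem mul (h : Mult s C f) (h' : Mult s C' g) : Mult s (C * C') (fun x => f x * g x) := by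
  refine ⟨h.1.mul h'.1, mul_nonneg h.2.1 h'.2.1, ?_, fun j hj B u hu => ?_⟩
  · filter_upwards [h.2.2.1, h'.2.2.1] with x hx hx'
    rw [abs_mul]; exact mul_le_mul hx hx' (abs_nonneg _) h.2.1
  · simp only [mul_assoc]
    exact h.2.2.2 j hj _ _ (h'.2.2.2 j hj B u hu)

theorem const (s : ℕ) (c : ℝ) : Mult s |c| (fun _ : Sp n => c) :=
  ⟨aestronglyMeasurable_const, abs_nonneg c, by simp, fun _ _ _ _ hg => hg.const_mul c⟩

theorem zero (s : ℕ) : Mult s 0 (fun _ : Sp n => (0 : ℝ)) := by simpa using const (n := n) s 0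

theorem of_top (h : SB ⊤ s C f) : Mult s (2 ^ s * C) f := by
  have h2 : (1 : ℝ) ≤ 2 ^ s := one_le_pow₀ (by norm_num)
  refine ⟨h.memLp.1, mul_nonneg (by positivity) h.nonneg, ?_, fun j hj B u hu => ?_⟩
  · filter_upwards [h.lb.ae_abs_le] with x hx
    exact hx.trans (le_mul_of_one_le_left h.nonneg h2)
  · refine ((h.of_le hj).top_mul (.inl rfl) hu).mono ?_
    rw [mul_assoc]
    have := mul_nonneg h.nonneg hu.nonneg
    gcongr
    norm_num

end Mult

/-- Functions in `H^s`, `s > n / 2`, are multipliers. -/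
theorem exists_mult_of_sobolev {s : ℕ} (hs : n < 2 * s) : ∃ K : ℝ, 0 ≤ K ∧
    ∀ (f : Sp n → ℝ) (B : ℝ), SB 2 s B f → Mult s (K * B) f := by
  obtain ⟨C0, hC0, h0⟩ := sup_bound (n := n) s hs
  -- The product of H^j and H^s lies in H^j because j + s − j = s > n/2.
  choose C hC h using fun j : Fin (s + 1) => sobolev_mul (n := n) j s j (by omega) le_rfl (by omega)
  refine ⟨C0 + ∑ j, C j, add_nonneg hC0 (Finset.sum_nonneg fun j _ => hC j), fun f B hf => ?_⟩
  have hB := hf.nonneg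
  have hS : 0 ≤ ∑ j, C j := Finset.sum_nonneg fun j _ => hC j
  refine ⟨hf.memLp.1, by positivity, ?_, fun j hj B' u hu => ?_⟩
  · filter_upwards [h0 f B hf] with x hx
    refine hx.trans ?_
    gcongr
    exact le_add_of_nonneg_right hS
  · refine (h ⟨j, by omega⟩ f u B B' hf hu).mono ?_
    have h1 : C ⟨j, by omega⟩ ≤ ∑ j, C j :=
      Finset.single_le_sum (fun i _ => hC i) (Finset.mem_univ _)
    rw [mul_assoc]
    have := mul_nonneg hB hu.nonneg
    gcongr
    linarith

namespace Mult1

variable {s : ℕ} {C C' : ℝ} {f g : Sp n → ℝ}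

theorem mono (h : Mult1 s C f) (hC : C ≤ C') : Mult1 s C' f :=
  ⟨h.1.mono hC, fun a => by
    obtain ⟨g, h1, h2⟩ := h.2 a
    exact ⟨g, h1, h2.mono hC⟩⟩

theorem add (h : Mult1 s C f) (h' : Mult1 s C' g) : Mult1 s (C + C') (fun x => f x + g x) :=
  ⟨h.1.add h'.1, fun a => by
    obtain ⟨f1, h1, h2⟩ := h.2 a
    obtain ⟨g1, h1', h2'⟩ := h'.2 a
    exact ⟨_, h1.add h1', h2.add h2'⟩⟩

theorem mul (h : Mult1 s C f) (h' : Mult1 s C' g) :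
    Mult1 s (2 * (C * C')) (fun x => f x * g x) := by
  have hC := mul_nonneg h.1.nonneg h'.1.nonneg
  refine ⟨(h.1.mul h'.1).mono (by linarith), fun a => ?_⟩
  obtain ⟨f1, h1, h2⟩ := h.2 a
  obtain ⟨g1, h1', h2'⟩ := h'.2 a
  exact ⟨_, h1.mul h1' h.1.l2loc h2.l2loc h'.1.l2loc h2'.l2loc,
    ((h2.mul h'.1).add (h.1.mul h2')).mono (by linarith)⟩

theorem const (s : ℕ) (c : ℝ) : Mult1 s |c| (fun _ : Sp n => c) :=
  ⟨Mult.const s c, fun a => ⟨_, WD.const a c, (Mult.zero s).mono (abs_nonneg c)⟩⟩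

end Mult1

end Kakinuma

namespace Kakinuma
open Filter Topology

variable {n : ℕ}

/-! ### Weighted Poincaré inequality, potentials, density of test functions -/

theorem eLpNorm_translate_sub_le_norm {u : Sp n → ℝ} {g : Fin n → Sp n → ℝ}
    (h : ∀ a, WD a u (g a)) (hg : ∀ a, MemLp (g a) 2 volume) (z : Sp n) :
    eLpNorm (fun x => u (x + z) - u x) 2 volume ≤ ‖z‖ₑ * ∑ a, eLpNorm (g a) 2 volume := by
  refine (eLpNorm_translate_sub_le (.inl rfl) h z).trans ?_
  have e : (fun x => ∑ a, z a * g a x) = ∑ a, z a • g a := by ext x; simp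
  rw [e, Finset.mul_sum]
  refine (eLpNorm_sum_le (fun a _ => (hg a).1.const_smul (z a)) (by norm_num)).trans ?_
  refine Finset.sum_le_sum fun a _ => ?_
  rw [eLpNorm_const_smul]
  gcongr
  rw [← ofReal_norm, ← ofReal_norm]
  exact ENNReal.ofReal_le_ofReal (PiLp.norm_apply_le z a)

/-- A Poincaré inequality for general weights. -/
theorem exists_weighted_poincare {u : Sp n → ℝ} {g : Fin n → Sp n → ℝ}
    (hul : AEStronglyMeasurable u volume)
    (h : ∀ a, WD a u (g a)) (hg : ∀ a, MemLp (g a) 2 volume) {τ σ : Sp n → ℝ≥0∞}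
    (hτ : Measurable τ) (hσ : Measurable σ) (hτσ : ∀ y z, τ y * τ (y + z) ≤ σ z)
    (hT : ∫⁻ x, τ x ≠ 0) (hT' : ∫⁻ x, τ x ≠ ⊤) (hI : ∫⁻ z, σ z * ‖z‖ₑ ^ 2 ≠ ⊤) :
    ∃ c : ℝ, (∫⁻ x, τ x) * ∫⁻ x, τ x * ‖u x - c‖ₑ ^ 2
      ≤ (∫⁻ z, σ z * ‖z‖ₑ ^ 2) * (∑ a, eLpNorm (g a) 2 volume) ^ 2 + 1 := by
  set Γ := ∑ a, eLpNorm (g a) 2 volume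
  set I := ∫⁻ z, σ z * ‖z‖ₑ ^ 2
  set T := ∫⁻ x, τ x
  have hΓ : Γ ≠ ⊤ := ENNReal.sum_ne_top.2 fun a _ => (hg a).2.ne
  have hIΓ : I * Γ ^ 2 ≠ ⊤ := ENNReal.mul_ne_top hI (ENNReal.pow_ne_top hΓ)
  set v := hul.mk u
  have hv : Measurable v := hul.stronglyMeasurable_mk.measurable
  have hvu : u =ᵐ[volume] v := hul.ae_eq_mk
  have hW : ∀ a, WD a v (g a) := fun a => (h a).congr hvu EventuallyEq.rfl
  have hm : Measurable fun q : Sp n × Sp n => τ q.1 * (τ q.2 * ‖v q.2 - v q.1‖ₑ ^ 2) :=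
    (hτ.comp measurable_fst).mul ((hτ.comp measurable_snd).mul
      (((hv.comp measurable_snd).sub (hv.comp measurable_fst)).enorm.pow_const 2))
  have hm2 : Measurable fun q : Sp n × Sp n => τ q.1 * (τ (q.1 + q.2) * ‖v (q.1 + q.2) - v q.1‖ₑ ^ 2) :=
    hm.comp (measurable_fst.prodMk (measurable_fst.add measurable_snd))
  have key : ∫⁻ y, τ y * ∫⁻ x, τ x * ‖v x - v y‖ₑ ^ 2 ≤ I * Γ ^ 2 := by
    calc ∫⁻ y, τ y * ∫⁻ x, τ x * ‖v x - v y‖ₑ ^ 2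
        = ∫⁻ y, ∫⁻ z, τ y * (τ (y + z) * ‖v (y + z) - v y‖ₑ ^ 2) := by
          refine lintegral_congr fun y => ?_
          have hmy : Measurable fun x => τ x * ‖v x - v y‖ₑ ^ 2 :=
            hτ.mul ((hv.sub measurable_const).enorm.pow_const 2)
          rw [← lintegral_const_mul _ hmy]
          rw [lintegral_add_left_eq_self (fun x => τ y * (τ x * ‖v x - v y‖ₑ ^ 2)) y]
      _ = ∫⁻ z, ∫⁻ y, τ y * (τ (y + z) * ‖v (y + z) - v y‖ₑ ^ 2) :=
          lintegral_lintegral_swap hm2.aemeasurable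
      _ ≤ ∫⁻ z, σ z * ‖z‖ₑ ^ 2 * Γ ^ 2 := by
          refine lintegral_mono fun z => ?_
          calc ∫⁻ y, τ y * (τ (y + z) * ‖v (y + z) - v y‖ₑ ^ 2)
              ≤ ∫⁻ y, σ z * ‖v (y + z) - v y‖ₑ ^ 2 := by
                refine lintegral_mono fun y => ?_
                rw [← mul_assoc]; gcongr; exact hτσ y z
            _ = σ z * ∫⁻ y, ‖v (y + z) - v y‖ₑ ^ 2 := by
                refine lintegral_const_mul _ ?_
                exact ((hv.comp (measurable_id.add_const z)).sub hv).enorm.pow_const 2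
            _ ≤ σ z * (‖z‖ₑ * Γ) ^ 2 := by
                gcongr
                rw [← eLpNorm_two_sq (fun y => v (y + z) - v y)]
                exact pow_le_pow_left' (eLpNorm_translate_sub_le_norm hW hg z) 2
            _ = _ := by ring
      _ = _ := lintegral_mul_const _ (hσ.mul (measurable_id.enorm.pow_const 2))
  -- If no value c = v(y) served, integration in y against τ would contradict `key`. The summand 1
  -- in the bound makes the contradiction strict.
  by_contra hcon
  push Not at hcon
  have h1 : ∀ y, (I * Γ ^ 2 + 1) / T ≤ ∫⁻ x, τ x * ‖v x - v y‖ₑ ^ 2 := fun y => by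
    refine ENNReal.div_le_of_le_mul' ((hcon (v y)).le.trans_eq ?_)
    congr 1
    refine lintegral_congr_ae ?_
    filter_upwards [hvu] with x hx
    rw [hx]
  have h2 : I * Γ ^ 2 + 1 ≤ I * Γ ^ 2 := by
    calc I * Γ ^ 2 + 1 = T * ((I * Γ ^ 2 + 1) / T) := (ENNReal.mul_div_cancel hT hT').symm
      _ = ∫⁻ y, τ y * ((I * Γ ^ 2 + 1) / T) := (lintegral_mul_const _ hτ).symm
      _ ≤ ∫⁻ y, τ y * ∫⁻ x, τ x * ‖v x - v y‖ₑ ^ 2 := by gcongr with y; exact h1 y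
      _ ≤ _ := key
  exact absurd h2 (not_le.2 (ENNReal.lt_add_right hIΓ one_ne_zero))

/-- The square root of the weight used for the construction of potentials. -/
noncomputable def pw (x : Sp n) : ℝ := ((1 + ‖x‖) ^ (n + 2))⁻¹

theorem pw_pos (x : Sp n) : 0 < pw x := by unfold pw; positivity

theorem continuous_pw : Continuous (pw (n := n)) := by
  unfold pw
  exact Continuous.inv₀ (by fun_prop) fun x => by positivity

theorem enorm_pw (x : Sp n) : ‖pw x‖ₑ = (fw x ^ (n + 2))⁻¹ := by
  have hpos : 0 < 1 + ‖x‖ := by positivity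
  rw [Real.enorm_of_nonneg (pw_pos x).le, pw, ENNReal.ofReal_inv_of_pos (by positivity),
    ENNReal.ofReal_pow hpos.le, ENNReal.ofReal_add (by norm_num) (norm_nonneg _), ofReal_norm,
    ENNReal.ofReal_one, fw]

/-- The weight τ = (1 + |x|)^(−2(n+2)) can serve as its own σ, because 1 + |z| ≤ (1 + |y|)(1 + |y +
z|), and it has finite mass and finite second moment. -/
theorem exists_const_pw_bound (n : ℕ) : ∃ K : ℝ≥0∞, K ≠ ⊤ ∧ ∀ (u : Sp n → ℝ) (g : Fin n → Sp n → ℝ),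
    AEStronglyMeasurable u volume → (∀ a, WD a u (g a)) → (∀ a, MemLp (g a) 2 volume) →
    ∃ c : ℝ, eLpNorm (fun x => pw x * (u x - c)) 2 volume ^ 2
      ≤ K * ((∑ a, eLpNorm (g a) 2 volume) ^ 2 + 1) := by
  set τ : Sp n → ℝ≥0∞ := fun x => ((fw x ^ (n + 2))⁻¹) ^ 2
  have hτ : Measurable τ := (measurable_fw.pow_const _).inv.pow_const 2
  have hmul : ∀ y z : Sp n, fw z ≤ fw y * fw (y + z) := fun y z => by
    have h1 : ‖z‖ₑ ≤ ‖y‖ₑ + ‖y + z‖ₑ := by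
      calc ‖z‖ₑ = ‖-y + (y + z)‖ₑ := by congr 1; abel
        _ ≤ ‖-y‖ₑ + ‖y + z‖ₑ := enorm_add_le _ _
        _ = _ := by rw [enorm_neg]
    calc fw z ≤ 1 + (‖y‖ₑ + ‖y + z‖ₑ) := by unfold fw; gcongr
      _ ≤ 1 + (‖y‖ₑ + ‖y + z‖ₑ) + ‖y‖ₑ * ‖y + z‖ₑ := le_self_add
      _ = _ := by unfold fw; ring
  have hτσ : ∀ y z, τ y * τ (y + z) ≤ τ z := fun y z => by
    simp only [τ]
    rw [← mul_pow, ← ENNReal.mul_inv (.inr (ENNReal.pow_ne_top (fw_ne_top _)))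
      (.inl (ENNReal.pow_ne_top (fw_ne_top _))), ← mul_pow]
    gcongr
    exact hmul y z
  have hT : ∫⁻ x, τ x ≠ ⊤ := (lintegral_fw_inv_lt_top (n := n) (s := n + 2) (by omega)).ne
  have hI : ∫⁻ z, τ z * ‖z‖ₑ ^ 2 ≠ ⊤ := by
    refine ne_top_of_le_ne_top (lintegral_fw_inv_lt_top (n := n) (s := n + 1) (by omega)).ne
      (lintegral_mono fun z => ?_)
    simp only [τ]
    rw [← mul_pow]
    refine pow_le_pow_left' ?_ 2
    rw [pow_succ, ENNReal.mul_inv (.inl (pow_ne_zero _ (fw_ne_zero _))) (.inr (fw_ne_zero _)),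
      mul_assoc]
    refine mul_le_of_le_one_right zero_le ?_
    rw [mul_comm, ← div_eq_mul_inv]
    refine ENNReal.div_le_of_le_mul ?_
    rw [one_mul]
    exact le_add_self
  have hT0 : ∫⁻ x, τ x ≠ 0 := by
    rw [Ne, lintegral_eq_zero_iff hτ]
    intro h0
    have h1 : ∀ᵐ x : Sp n, False := by
      filter_upwards [h0] with x hx
      simp only [τ, Pi.zero_apply] at hx
      exact ENNReal.inv_ne_zero.2 (ENNReal.pow_ne_top (fw_ne_top _)) (pow_eq_zero_iff (by norm_num) |>.1 hx)
    have h2 : (volume : Measure (Sp n)) = 0 := by simpa [ae_eq_bot] using h1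
    exact NeZero.ne _ h2
  set T := ∫⁻ x, τ x
  set I := ∫⁻ z, τ z * ‖z‖ₑ ^ 2
  refine ⟨T⁻¹ * (I + 1), ENNReal.mul_ne_top (ENNReal.inv_ne_top.2 hT0)
    (ENNReal.add_ne_top.2 ⟨hI, ENNReal.one_ne_top⟩), fun u g hu h hg => ?_⟩
  obtain ⟨c, hc⟩ := exists_weighted_poincare hu h hg hτ hτ hτσ hT0 hT hI
  refine ⟨c, ?_⟩
  rw [eLpNorm_two_sq]
  have e : ∀ x, ‖pw x * (u x - c)‖ₑ ^ 2 = τ x * ‖u x - c‖ₑ ^ 2 := fun x => by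
    rw [enorm_mul, mul_pow, enorm_pw]
  simp only [e]
  calc ∫⁻ x, τ x * ‖u x - c‖ₑ ^ 2 = T⁻¹ * (T * ∫⁻ x, τ x * ‖u x - c‖ₑ ^ 2) := by
        rw [← mul_assoc, ENNReal.inv_mul_cancel hT0 hT, one_mul]
    _ ≤ T⁻¹ * (I * (∑ a, eLpNorm (g a) 2 volume) ^ 2 + 1) := by gcongr
    _ ≤ T⁻¹ * ((I + 1) * ((∑ a, eLpNorm (g a) 2 volume) ^ 2 + 1)) := by
        gcongr
        calc I * (∑ a, eLpNorm (g a) 2 volume) ^ 2 + 1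
            ≤ I * (∑ a, eLpNorm (g a) 2 volume) ^ 2 + 1
              + (I + (∑ a, eLpNorm (g a) 2 volume) ^ 2) := le_self_add
          _ = _ := by ring
    _ = _ := by rw [mul_assoc]

/-- Limits of gradients in `L²` are gradients. -/
theorem exists_potential {u : ℕ → Sp n → ℝ} {g : ℕ → Fin n → Sp n → ℝ} {G : Fin n → Sp n → ℝ}
    (hu : ∀ k, AEStronglyMeasurable (u k) volume)
    (h : ∀ k a, WD a (u k) (g k a)) (hg : ∀ k a, MemLp (g k a) 2 volume)
    (hG : ∀ a, MemLp (G a) 2 volume)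
    (hlim : ∀ a, Tendsto (fun k => eLpNorm (fun x => g k a x - G a x) 2 volume) atTop (𝓝 0)) :
    ∃ v : Sp n → ℝ, LocallyIntegrable v volume ∧ ∀ a, WD a v (G a) := by
  obtain ⟨K, hK, hKb⟩ := exists_const_pw_bound n
  -- After subtraction of suitable constants the functions, multiplied by `pw`, are bounded in L²
  -- and have a weak limit w. The potential is w divided by `pw`.
  choose c hc using fun k => hKb (u k) (g k) (hu k) (h k) (hg k)
  set S := ∑ a, (eLpNorm (G a) 2 volume + 1)
  have hS : S ≠ ⊤ := ENNReal.sum_ne_top.2 fun a _ =>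
    ENNReal.add_ne_top.2 ⟨(hG a).2.ne, ENNReal.one_ne_top⟩
  have hev : ∀ᶠ k in atTop, ∑ a, eLpNorm (g k a) 2 volume ≤ S := by
    have : ∀ a, ∀ᶠ k in atTop, eLpNorm (g k a) 2 volume ≤ eLpNorm (G a) 2 volume + 1 := fun a => by
      filter_upwards [(ENNReal.tendsto_nhds_zero.1 (hlim a)) 1 one_pos] with k hk
      have e : g k a = (fun x => g k a x - G a x) + G a := by ext x; simp
      rw [e, add_comm (eLpNorm (G a) 2 volume)]
      exact (eLpNorm_add_le ((hg k a).sub (hG a)).1 (hG a).1 (by norm_num)).trans (by gcongr; exact hk)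
    filter_upwards [eventually_all.2 this] with k hk
    exact Finset.sum_le_sum fun a _ => hk a
  obtain ⟨k₀, hk₀⟩ := eventually_atTop.1 hev
  set B := Real.sqrt (K * (S ^ 2 + 1)).toReal
  have hfin : K * (S ^ 2 + 1) ≠ ⊤ :=
    ENNReal.mul_ne_top hK (ENNReal.add_ne_top.2 ⟨ENNReal.pow_ne_top hS, ENNReal.one_ne_top⟩)
  have hb : ∀ k, eLpNorm (fun x => pw x * (u (k + k₀) x - c (k + k₀))) 2 volume
      ≤ ENNReal.ofReal B := fun k => by
    refine (ENNReal.pow_le_pow_left_iff (n := 2) (by norm_num)).1 ?_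
    have e := ofReal_sqrt_mul_sq hfin 1
    simp only [mul_one, ENNReal.ofReal_one, one_pow] at e
    rw [e]
    refine (hc (k + k₀)).trans ?_
    gcongr
    exact hk₀ _ (by omega)
  have hmem : ∀ k, MemLp (fun x => pw x * (u (k + k₀) x - c (k + k₀))) 2 volume := fun k =>
    ⟨continuous_pw.aestronglyMeasurable.mul ((hu _).sub aestronglyMeasurable_const),
      (hb k).trans_lt ENNReal.ofReal_lt_top⟩
  obtain ⟨w, hw, -, hwlim⟩ := exists_weak_limit (Real.sqrt_nonneg _) hmem hb
  have hcinv : Continuous fun x : Sp n => (pw x)⁻¹ :=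
    continuous_pw.inv₀ fun x => (pw_pos x).ne'
  have hloc : LocallyIntegrable (fun x => (pw x)⁻¹ * w x) volume :=
    locallyIntegrable_mul_continuous (hw.locallyIntegrable (by norm_num)) hcinv
  refine ⟨fun x => (pw x)⁻¹ * w x, hloc, fun a => ⟨hloc,
    (hG a).locallyIntegrable (by norm_num), fun ψ hψ => ?_⟩⟩
  have hψm : MemLp (fun x => (pw x)⁻¹ * pd a ψ x) 2 volume :=
    (hcinv.mul (hψ.pd a).continuous).memLp_of_hasCompactSupport (hψ.pd a).2.mul_left
  -- A derivative of a test function has mean zero, so the subtracted constants are not seen in the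
  -- limit.
  have hψ0 : ∫ x, pd a ψ x = 0 := by
    have := (WD.const a 1 : WD a (fun _ : Sp n => (1 : ℝ)) _).2.2 ψ hψ
    simpa using this
  have hval : ∀ k, ∫ x, pw x * (u (k + k₀) x - c (k + k₀)) * ((pw x)⁻¹ * pd a ψ x)
      = - ∫ x, g (k + k₀) a x * ψ x := fun k => by
    have e : ∀ x, pw x * (u (k + k₀) x - c (k + k₀)) * ((pw x)⁻¹ * pd a ψ x)
        = u (k + k₀) x * pd a ψ x - c (k + k₀) * pd a ψ x := fun x => by
      have := (pw_pos x).ne'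
      field_simp
    simp only [e]
    rw [integral_sub ((hψ.pd a).integrable_mul (h (k + k₀) a).1) ((hψ.pd a).integrable.const_mul _),
      integral_const_mul, hψ0, mul_zero, sub_zero]
    exact (h (k + k₀) a).2.2 ψ hψ
  have hconv : Tendsto (fun k => ∫ x, pw x * (u (k + k₀) x - c (k + k₀)) * ((pw x)⁻¹ * pd a ψ x))
      atTop (𝓝 (- ∫ x, G a x * ψ x)) := by
    simp only [hval]
    exact ((tendsto_integral_mul (fun k => hg k a) (hG a) (hψ.memLp 2) (hlim a)).comp
      (tendsto_add_atTop_nat k₀)).neg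
  rw [← hwlim _ hψm _ hconv]
  congr 1; ext x; ring

theorem tendsto_cut_mul_moll {f : Sp n → ℝ} (hf : MemLp f 2 volume) :
    Tendsto (fun k => eLpNorm (fun x => cut k x * moll k f x - f x) 2 volume) atTop (𝓝 0) := by
  have hc : ∀ k, Continuous fun x => cut k x * moll k f x := fun k =>
    (isTest_cut k).continuous.mul (contDiff_moll k (hf.locallyIntegrable (by norm_num))).continuous
  refine tendsto_eLpNorm_two_of_ae (fun k => (hc k).aestronglyMeasurable) hf (fun k => ?_) ?_
  · refine (eLpNorm_mono (g := moll k f) fun x => ?_).trans (eLpNorm_moll_two_le k hf.1)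
    rw [norm_mul]
    exact mul_le_of_le_one_left (norm_nonneg _) (abs_cut_le k x)
  · filter_upwards [tendsto_moll (hf.locallyIntegrable (by norm_num))] with x hx
    refine hx.congr' ?_
    filter_upwards [eventually_norm_lt x] with i hi
    rw [cut_eq_one hi.le, one_mul]

theorem memLp_cut_mul_moll {f : Sp n → ℝ} (hf : MemLp f 2 volume) (k : ℕ) :
    MemLp (fun x => cut k x * moll k f x) 2 volume := by
  refine (memLp_moll_two k hf).of_le ?_ (ae_of_all _ fun x => ?_)
  · exact ((isTest_cut k).continuous.mul
      (contDiff_moll k (hf.locallyIntegrable (by norm_num))).continuous).aestronglyMeasurable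
  · rw [norm_mul]
    exact mul_le_of_le_one_left (norm_nonneg _) (abs_cut_le k x)

/-- Functions bounded in `L²` and supported away from growing balls converge weakly to zero. -/
theorem tendsto_integral_mul_of_vanish {r : ℕ → Sp n → ℝ} {B : ℝ} (hr : ∀ k, MemLp (r k) 2 volume)
    (hB : ∀ k, (eLpNorm (r k) 2 volume).toReal ≤ B) (h0 : ∀ (k : ℕ) x, ‖x‖ < (k : ℝ) + 1 → r k x = 0)
    {φ : Sp n → ℝ} (hφ : MemLp φ 2 volume) :
    Tendsto (fun k => ∫ x, r k x * φ x) atTop (𝓝 0) := by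
  set s : ℕ → Set (Sp n) := fun k => Metric.ball 0 ((k : ℝ) + 1)
  have hs : ∀ k, MeasurableSet (s k) := fun k => Metric.isOpen_ball.measurableSet
  set χ : ℕ → Sp n → ℝ := fun k => (s k).indicator φ
  have hχ : ∀ k, MemLp (χ k) 2 volume := fun k => hφ.indicator (hs k)
  have ht : Tendsto (fun k => eLpNorm (fun x => χ k x - φ x) 2 volume) atTop (𝓝 0) := by
    refine tendsto_eLpNorm_two_of_ae (fun k => (hχ k).1) hφ (fun k => eLpNorm_indicator_le _) ?_
    refine ae_of_all _ fun x => tendsto_const_nhds.congr' ?_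
    filter_upwards [eventually_norm_lt x] with k hk
    simp [χ, s, hk]
  have ht2 : Tendsto (fun k => B * (eLpNorm (fun x => χ k x - φ x) 2 volume).toReal) atTop
      (𝓝 0) := by
    simpa using ((ENNReal.tendsto_toReal ENNReal.zero_ne_top).comp ht).const_mul B
  refine squeeze_zero_norm (fun k => ?_) ht2
  have e : ∫ x, r k x * φ x = - ∫ x, r k x * (χ k x - φ x) := by
    rw [← integral_neg]
    congr 1; ext x
    by_cases hx : x ∈ s k
    · rw [h0 k x (by simpa [s] using hx)]; simp
    · simp [χ, hx]
  rw [e, norm_neg, Real.norm_eq_abs]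
  refine (abs_integral_mul_le (hr k) ((hχ k).sub hφ)).trans ?_
  exact mul_le_mul_of_nonneg_right (hB k) ENNReal.toReal_nonneg

theorem pd_cut_mul {v : Sp n → ℝ} (hv : Differentiable ℝ v) (k : ℕ) (a : Fin n) (x : Sp n) :
    pd a (fun x => cut k x * v x) x = pd a (cut k) x * v x + cut k x * pd a v x :=
  pd_mul (isTest_cut k).differentiable hv a x

theorem exists_pd_cut_bound (n : ℕ) : ∃ D : ℝ, 0 ≤ D ∧ ∀ (k : ℕ) (a : Fin n) (x : Sp n),
    |pd a (cut k) x| ≤ D / ((k : ℝ) + 1) := by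
  choose D hD using fun a => ((isTest_stdCutoff n).pd a).exists_bound
  have h0 : ∀ a, 0 ≤ D a := fun a => (abs_nonneg _).trans (hD a 0)
  refine ⟨∑ a, D a, Finset.sum_nonneg fun a _ => h0 a, fun k a x => ?_⟩
  have hk : (0 : ℝ) < (k : ℝ) + 1 := by positivity
  rw [pd_cut, abs_mul, abs_of_pos (by positivity), div_mul_eq_mul_div, one_mul]
  gcongr
  exact (hD a _).trans (Finset.single_le_sum (fun a _ => h0 a) (Finset.mem_univ a))

/-- Weak density of test functions in `H¹`. -/
theorem exists_test_weak_approx_H1 {u : Sp n → ℝ} {g : Fin n → Sp n → ℝ}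
    (hu : MemLp u 2 volume) (h : ∀ a, WD a u (g a)) (hg : ∀ a, MemLp (g a) 2 volume) :
    ∃ V : ℕ → Sp n → ℝ, (∀ k, IsTest (V k)) ∧
      (∀ φ, MemLp φ 2 volume → Tendsto (fun k => ∫ x, V k x * φ x) atTop (𝓝 (∫ x, u x * φ x))) ∧
      ∀ a φ, MemLp φ 2 volume →
        Tendsto (fun k => ∫ x, pd a (V k) x * φ x) atTop (𝓝 (∫ x, g a x * φ x)) := by
  have hl := hu.locallyIntegrable (by norm_num)
  obtain ⟨D, hD0, hD⟩ := exists_pd_cut_bound n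
  refine ⟨fun k x => cut k x * moll k u x, fun k => ?_, fun φ hφ => ?_, fun a φ hφ => ?_⟩
  · simpa only [mul_comm] using (isTest_cut k).smooth_mul (contDiff_moll k hl)
  · exact tendsto_integral_mul (memLp_cut_mul_moll hu) hu hφ (tendsto_cut_mul_moll hu)
  -- The term in which the cutoff is differentiated is bounded in L² and vanishes on growing balls,
  -- hence tends weakly to zero. Strong convergence is not needed.
  · have hr : ∀ k, LB 2 (D * (eLpNorm u 2 volume).toReal) (fun x => pd a (cut k) x * moll k u x) :=
      fun k => by
        have h1 : LB 2 (eLpNorm u 2 volume).toReal (moll k u) :=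
          SB.moll (k := 0) (.inl rfl) (LB.self hu) k
        refine h1.bounded_mul ((isTest_cut k).pd a).continuous.aestronglyMeasurable hD0
          (ae_of_all _ fun x => (hD k a x).trans (div_le_self hD0 ?_))
        linarith [k.cast_nonneg (α := ℝ)]
    have t1 := tendsto_integral_mul_of_vanish (fun k => (hr k).1) (fun k => (hr k).toReal_le)
      (fun k x hx => by simp only [pd_cut_eq_zero a hx, zero_mul]) hφ
    have t2 := tendsto_integral_mul (memLp_cut_mul_moll (hg a)) (hg a) hφ (tendsto_cut_mul_moll (hg a))
    refine ((t1.add t2).congr fun k => ?_).trans (by rw [zero_add])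
    rw [← integral_add (integrable_mul_two (hr k).1 hφ)
      (integrable_mul_two (memLp_cut_mul_moll (hg a) k) hφ)]
    congr 1; ext x
    rw [pd_cut_mul ((contDiff_moll k hl).differentiable (by simp)), pd_moll k (h a)]
    ring

/-- Weak density of test functions in the homogeneous space. -/
theorem exists_test_weak_approx {u : Sp n → ℝ} {g : Fin n → Sp n → ℝ}
    (hu : LocallyIntegrable u volume) (h : ∀ a, WD a u (g a)) (hg : ∀ a, MemLp (g a) 2 volume) :
    ∃ V : ℕ → Sp n → ℝ, (∀ k, IsTest (V k)) ∧
      ∀ a φ, MemLp φ 2 volume →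
        Tendsto (fun k => ∫ x, pd a (V k) x * φ x) atTop (𝓝 (∫ x, g a x * φ x)) := by
  obtain ⟨D, hD0, hD⟩ := exists_pd_cut_bound n
  obtain ⟨R', hR'⟩ := (isTest_stdCutoff n).exists_radius
  set R : ℝ := max R' 1
  have hR1 : 1 ≤ R := le_max_right _ _
  have hsupp : ∀ (a : Fin n) (k : ℕ) (x : Sp n), R * ((k : ℝ) + 1) < ‖x‖ → pd a (cut k) x = 0 := by
    intro a k x hx
    have hk : (0 : ℝ) < (k : ℝ) + 1 := by positivity
    have hev : (cut k : Sp n → ℝ) =ᶠ[𝓝 x] fun _ => 0 := by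
      filter_upwards [(isOpen_lt continuous_const continuous_norm).mem_nhds hx] with y hy
      refine hR' _ ((le_max_left _ _).trans (b := R) ?_)
      rw [norm_smul, Real.norm_of_nonneg (by positivity), one_div, inv_mul_eq_div, le_div_iff₀ hk]
      exact (le_of_lt hy : R * ((k : ℝ) + 1) ≤ ‖y‖)
    rw [pd, hev.fderiv_eq]; simp
  set Γ := ∑ a, eLpNorm (g a) 2 volume
  have hΓ : Γ ≠ ⊤ := ENNReal.sum_ne_top.2 fun a _ => (hg a).2.ne
  set v1 := volume (Metric.closedBall (0 : Sp n) 1)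
  have hv1 : v1 ≠ ⊤ := measure_closedBall_lt_top.ne
  have hv0 : v1 ≠ 0 := (Metric.measure_closedBall_pos volume _ one_pos).ne'
  have hvol : ∀ r : ℝ, 0 ≤ r → volume (Metric.closedBall (0 : Sp n) r) = ENNReal.ofReal (r ^ n) * v1 :=
    fun r hr => by
      have := Measure.addHaar_closedBall_mul (volume : Measure (Sp n)) 0 hr zero_le_one
      simpa using this
  -- The summand `v1⁻¹` absorbs the additive 1 of the Poincaré inequality.
  set K : ℝ≥0∞ := ENNReal.ofReal ((2 * R) ^ 2) * ENNReal.ofReal (2 ^ n) * Γ ^ 2 + v1⁻¹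
  have hK : K ≠ ⊤ := ENNReal.add_ne_top.2 ⟨ENNReal.mul_ne_top (ENNReal.mul_ne_top
    ENNReal.ofReal_ne_top ENNReal.ofReal_ne_top) (ENNReal.pow_ne_top hΓ), ENNReal.inv_ne_top.2 hv0⟩
  -- The derivative of the cutoff has size 1/(k + 1) and lives in the ball of radius R(k + 1). On
  -- that ball u, less a constant, grows at most like k + 1 in L², so their product stays bounded.
  have hc : ∀ k : ℕ, ∃ c : ℝ, ∫⁻ x in Metric.closedBall (0 : Sp n) (R * ((k : ℝ) + 1)),
      ‖moll k u x - c‖ₑ ^ 2 ≤ ENNReal.ofReal (((k : ℝ) + 1) ^ 2) * K := by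
    intro k
    set ρ : ℝ := R * ((k : ℝ) + 1)
    have hk1 : (1 : ℝ) ≤ (k : ℝ) + 1 := by linarith [k.cast_nonneg (α := ℝ)]
    have hρ1 : 1 ≤ ρ := one_le_mul_of_one_le_of_one_le hR1 hk1
    have hρ : 0 ≤ ρ := by linarith
    -- Two points of the ball of radius ρ differ by at most 2ρ, which dictates σ.
    set τ : Sp n → ℝ≥0∞ := (Metric.closedBall (0 : Sp n) ρ).indicator fun _ => 1
    set σ : Sp n → ℝ≥0∞ := (Metric.closedBall (0 : Sp n) (2 * ρ)).indicator fun _ => 1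
    have hmτ : Measurable τ := measurable_const.indicator Metric.isClosed_closedBall.measurableSet
    have hmσ : Measurable σ := measurable_const.indicator Metric.isClosed_closedBall.measurableSet
    have hτσ : ∀ y z, τ y * τ (y + z) ≤ σ z := fun y z => by
      by_cases hy : ‖y‖ ≤ ρ
      · by_cases hz : ‖y + z‖ ≤ ρ
        · have : ‖z‖ ≤ 2 * ρ := by
            calc ‖z‖ = ‖(y + z) - y‖ := by congr 1; abel
              _ ≤ ‖y + z‖ + ‖y‖ := norm_sub_le _ _
              _ ≤ _ := by linarith
          simp [τ, σ, hy, hz, this]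
        · simp [τ, hz]
      · simp [τ, hy]
    have eT : ∫⁻ x, τ x = ENNReal.ofReal (ρ ^ n) * v1 := by
      rw [← hvol ρ hρ, lintegral_indicator Metric.isClosed_closedBall.measurableSet]; simp
    have eI : ∫⁻ z, σ z * ‖z‖ₑ ^ 2
        ≤ ENNReal.ofReal ((2 * ρ) ^ 2) * (ENNReal.ofReal ((2 * ρ) ^ n) * v1) := by
      rw [← hvol (2 * ρ) (by linarith)]
      calc ∫⁻ z, σ z * ‖z‖ₑ ^ 2
          ≤ ∫⁻ z, ENNReal.ofReal ((2 * ρ) ^ 2) * σ z := by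
            refine lintegral_mono fun z => ?_
            by_cases hz : ‖z‖ ≤ 2 * ρ
            · have : ‖z‖ₑ ^ 2 ≤ ENNReal.ofReal ((2 * ρ) ^ 2) := by
                rw [← ofReal_norm, ← ENNReal.ofReal_pow (norm_nonneg _)]
                exact ENNReal.ofReal_le_ofReal (by gcongr)
              simpa [σ, hz] using this
            · simp [σ, hz]
        _ = _ := by
            rw [lintegral_const_mul _ hmσ,
              lintegral_indicator Metric.isClosed_closedBall.measurableSet]
            simp
    have hT0 : ENNReal.ofReal (ρ ^ n) * v1 ≠ 0 :=
      mul_ne_zero (by rw [Ne, ENNReal.ofReal_eq_zero, not_le]; positivity) hv0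
    have hTt : ENNReal.ofReal (ρ ^ n) * v1 ≠ ⊤ := ENNReal.mul_ne_top ENNReal.ofReal_ne_top hv1
    obtain ⟨c, hc⟩ := exists_weighted_poincare (u := moll k u) (g := fun a => moll k (g a))
      (contDiff_moll k hu).continuous.aestronglyMeasurable
      (fun a => by
        rw [← pd_moll k (h a)]
        exact WD.of_contDiff ((contDiff_moll k hu).of_le (by simp)) a)
      (fun a => memLp_moll_two k (hg a)) hmτ hmσ hτσ (by rwa [eT]) (by rwa [eT])
      (ne_top_of_le_ne_top (ENNReal.mul_ne_top ENNReal.ofReal_ne_top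
        (ENNReal.mul_ne_top ENNReal.ofReal_ne_top hv1)) eI)
    refine ⟨c, ?_⟩
    have eL : ∫⁻ x, τ x * ‖moll k u x - c‖ₑ ^ 2
        = ∫⁻ x in Metric.closedBall (0 : Sp n) ρ, ‖moll k u x - c‖ₑ ^ 2 := by
      rw [← lintegral_indicator Metric.isClosed_closedBall.measurableSet]
      refine lintegral_congr fun x => ?_
      by_cases hx : x ∈ Metric.closedBall (0 : Sp n) ρ <;> simp [τ, hx]
    rw [eL, eT] at hc
    set X := ∫⁻ x in Metric.closedBall (0 : Sp n) ρ, ‖moll k u x - c‖ₑ ^ 2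
    have hG : ∑ a, eLpNorm (moll k (g a)) 2 volume ≤ Γ :=
      Finset.sum_le_sum fun a _ => eLpNorm_moll_two_le k (hg a).1
    have hρn : 1 ≤ ENNReal.ofReal (ρ ^ n) := by
      rw [ENNReal.one_le_ofReal]; exact one_le_pow₀ hρ1
    have hkk : 1 ≤ ENNReal.ofReal (((k : ℝ) + 1) ^ 2) := by
      rw [ENNReal.one_le_ofReal]; exact one_le_pow₀ hk1
    -- Both sides carry the volume of the ball of radius ρ, which is cancelled at the end.
    have hle : ENNReal.ofReal (ρ ^ n) * v1 * X
        ≤ ENNReal.ofReal (ρ ^ n) * v1 * (ENNReal.ofReal (((k : ℝ) + 1) ^ 2) * K) := by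
      refine hc.trans ?_
      calc _ ≤ ENNReal.ofReal ((2 * ρ) ^ 2) * (ENNReal.ofReal ((2 * ρ) ^ n) * v1) * Γ ^ 2
            + 1 * (v1 * v1⁻¹) * 1 := by
            rw [ENNReal.mul_inv_cancel hv0 hv1, one_mul, one_mul]
            gcongr
        _ ≤ ENNReal.ofReal ((2 * ρ) ^ 2) * (ENNReal.ofReal ((2 * ρ) ^ n) * v1) * Γ ^ 2
            + ENNReal.ofReal (ρ ^ n) * (v1 * v1⁻¹) * ENNReal.ofReal (((k : ℝ) + 1) ^ 2) := by
            gcongr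
        _ = _ := by
            have e1 : ENNReal.ofReal ((2 * ρ) ^ 2)
                = ENNReal.ofReal ((2 * R) ^ 2) * ENNReal.ofReal (((k : ℝ) + 1) ^ 2) := by
              rw [← ENNReal.ofReal_mul (by positivity)]
              congr 1; simp only [ρ]; ring
            have e2 : ENNReal.ofReal ((2 * ρ) ^ n) = ENNReal.ofReal (2 ^ n) * ENNReal.ofReal (ρ ^ n) := by
              rw [← ENNReal.ofReal_mul (by positivity), mul_pow]
            rw [e1, e2]
            ring
    exact (ENNReal.mul_le_mul_iff_right hT0 hTt).1 hle
  choose c hc using hc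
  set B := Real.sqrt K.toReal * D
  have hB : 0 ≤ B := mul_nonneg (Real.sqrt_nonneg _) hD0
  have hcm : ∀ k, ContDiff ℝ ∞ (fun x => moll k u x - c k) := fun k =>
    (contDiff_moll k hu).sub contDiff_const
  have hr : ∀ k a, MemLp (fun x => pd a (cut k) x * (moll k u x - c k)) 2 volume := fun k a =>
    (((isTest_cut k).pd a).continuous.mul (hcm k).continuous).memLp_of_hasCompactSupport
      ((isTest_cut k).pd a).2.mul_right
  have hrB : ∀ k a, (eLpNorm (fun x => pd a (cut k) x * (moll k u x - c k)) 2 volume).toReal ≤ B := by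
    intro k a
    refine ENNReal.toReal_le_of_le_ofReal hB ?_
    rw [eLpNorm_two_le_iff]
    have hk : (0 : ℝ) < (k : ℝ) + 1 := by positivity
    calc ∫⁻ x, ‖pd a (cut k) x * (moll k u x - c k)‖ₑ ^ 2
        ≤ ∫⁻ x, (Metric.closedBall (0 : Sp n) (R * ((k : ℝ) + 1))).indicator
            (fun x => ENNReal.ofReal (D / ((k : ℝ) + 1)) ^ 2 * ‖moll k u x - c k‖ₑ ^ 2) x := by
          refine lintegral_mono fun x => ?_
          by_cases hx : ‖x‖ ≤ R * ((k : ℝ) + 1)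
          · rw [Set.indicator_of_mem (by simpa using hx), enorm_mul, mul_pow]
            gcongr
            rw [Real.enorm_eq_ofReal_abs]
            exact ENNReal.ofReal_le_ofReal (hD k a x)
          · rw [hsupp a k x (not_le.1 hx)]; simp
      _ = ENNReal.ofReal (D / ((k : ℝ) + 1)) ^ 2
            * ∫⁻ x in Metric.closedBall (0 : Sp n) (R * ((k : ℝ) + 1)), ‖moll k u x - c k‖ₑ ^ 2 := by
          rw [lintegral_indicator Metric.isClosed_closedBall.measurableSet, lintegral_const_mul]
          exact (hcm k).continuous.measurable.enorm.pow_const 2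
      _ ≤ ENNReal.ofReal (D / ((k : ℝ) + 1)) ^ 2 * (ENNReal.ofReal (((k : ℝ) + 1) ^ 2) * K) := by
          gcongr; exact hc k
      _ = _ := by
          rw [ofReal_sqrt_mul_sq hK, ← mul_assoc, ← ENNReal.ofReal_pow (by positivity),
            ← ENNReal.ofReal_mul (by positivity), ← ENNReal.ofReal_pow hD0, mul_comm]
          congr 2
          field_simp
  refine ⟨fun k x => cut k x * (moll k u x - c k), fun k => ?_, fun a φ hφ => ?_⟩
  · simpa only [mul_comm] using (isTest_cut k).smooth_mul (hcm k)
  · have t1 := tendsto_integral_mul_of_vanish (fun k => hr k a) (fun k => hrB k a)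
      (fun k x hx => by simp only [pd_cut_eq_zero a hx, zero_mul]) hφ
    have t2 := tendsto_integral_mul (memLp_cut_mul_moll (hg a)) (hg a) hφ (tendsto_cut_mul_moll (hg a))
    refine ((t1.add t2).congr fun k => ?_).trans (by rw [zero_add])
    rw [← integral_add (integrable_mul_two (hr k a) hφ)
      (integrable_mul_two (memLp_cut_mul_moll (hg a) k) hφ)]
    congr 1; ext x
    rw [pd_cut_mul ((hcm k).differentiable (by simp))]
    have : pd a (fun x => moll k u x - c k) x = moll k (g a) x := by
      rw [← pd_moll k (h a)]; simp only [pd]; rw [fderiv_sub_const]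
    rw [this]
    ring

end Kakinuma

/-! ### Weak divergence identities -/

namespace Kakinuma
open Filter Topology
variable {n : ℕ}

/-- `∇·Φ = Ψ` in the sense of distributions. -/
def DivEq (Φ : Fin n → Sp n → ℝ) (Ψ : Sp n → ℝ) : Prop :=
  ∀ ψ : Sp n → ℝ, IsTest ψ → (∑ a, ∫ x, Φ a x * pd a ψ x) + ∫ x, Ψ x * ψ x = 0

/-- A weak divergence identity may be tested with functions of the energy class. -/
theorem DivEq.extend {Φ : Fin n → Sp n → ℝ} {Ψ : Sp n → ℝ} (h : DivEq Φ Ψ)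
    (hΦ : ∀ a, MemLp (Φ a) 2 volume) (hΨ : MemLp Ψ 2 volume) {u : Sp n → ℝ}
    {g : Fin n → Sp n → ℝ} (hu : LocallyIntegrable u volume) (hw : ∀ a, WD a u (g a))
    (hg : ∀ a, MemLp (g a) 2 volume) (hor : Ψ = 0 ∨ MemLp u 2 volume) :
    (∑ a, ∫ x, Φ a x * g a x) + ∫ x, Ψ x * u x = 0 := by
  -- For Ψ = 0 only the gradient of the test function occurs, so approximation of gradients
  -- suffices; otherwise u itself has to be approximated as well.
  rcases hor with h0 | hu2
  · obtain ⟨V, hV, hV1⟩ := exists_test_weak_approx hu hw hg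
    have t : Tendsto (fun k => ∑ a, ∫ x, pd a (V k) x * Φ a x) atTop
        (𝓝 (∑ a, ∫ x, g a x * Φ a x)) := tendsto_finsetSum _ fun a _ => hV1 a _ (hΦ a)
    have e : ∀ k, ∑ a, ∫ x, pd a (V k) x * Φ a x = 0 := fun k => by
      simpa [h0, mul_comm] using h (V k) (hV k)
    simp only [e] at t
    have := tendsto_nhds_unique t tendsto_const_nhds
    simpa [h0, mul_comm] using this
  · obtain ⟨V, hV, hV0, hV1⟩ := exists_test_weak_approx_H1 hu2 hw hg
    have t : Tendsto (fun k => (∑ a, ∫ x, pd a (V k) x * Φ a x) + ∫ x, V k x * Ψ x) atTop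
        (𝓝 ((∑ a, ∫ x, g a x * Φ a x) + ∫ x, u x * Ψ x)) :=
      (tendsto_finsetSum _ fun a _ => hV1 a _ (hΦ a)).add (hV0 _ hΨ)
    have e : ∀ k, (∑ a, ∫ x, pd a (V k) x * Φ a x) + ∫ x, V k x * Ψ x = 0 := fun k => by
      simpa [mul_comm] using h (V k) (hV k)
    simp only [e] at t
    have := tendsto_nhds_unique t tendsto_const_nhds
    simpa [mul_comm] using this

theorem pd_comm {ψ : Sp n → ℝ} (hψ : IsTest ψ) (a e : Fin n) :
    pd a (pd e ψ) = pd e (pd a ψ) := by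
  have hd : Differentiable ℝ (fderiv ℝ ψ) :=
    (hψ.1.fderiv_right (m := 1) (by norm_cast)).differentiable (by simp)
  have h : ∀ (v w x : Sp n), fderiv ℝ (fun y => fderiv ℝ ψ y w) x v
      = fderiv ℝ (fderiv ℝ ψ) x v w := fun v w x => by
    rw [fderiv_clm_apply (hd x) (differentiableAt_const w)]
    simp
  ext x
  change fderiv ℝ (fun y => fderiv ℝ ψ y _) x _ = fderiv ℝ (fun y => fderiv ℝ ψ y _) x _
  rw [h, h]
  exact (hψ.1.contDiffAt.isSymmSndFDerivAt (by simp; norm_cast)).eq _ _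

/-- Differentiating a weak divergence identity; the part `Ψ₂` of the right-hand side that need not
be differentiable moves into the flux. -/
theorem DivEq.deriv {Φ Φ' : Fin n → Sp n → ℝ} {Ψ₁ Ψ₁' Ψ₂ : Sp n → ℝ}
    (h : DivEq Φ (fun x => Ψ₁ x + Ψ₂ x)) (e : Fin n) (hΦ : ∀ a, WD e (Φ a) (Φ' a))
    (hΨ : WD e Ψ₁ Ψ₁') (hΨ₂ : LocallyIntegrable Ψ₂ volume) :
    DivEq (fun a x => Φ' a x - if a = e then Ψ₂ x else 0) Ψ₁' := by
  intro ψ hψ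
  have hp := hψ.pd e
  have h1 := h _ hp
  have e1 : ∀ a, ∫ x, Φ a x * pd a (pd e ψ) x = - ∫ x, Φ' a x * pd a ψ x := fun a => by
    rw [← (hΦ a).2.2 _ (hψ.pd a)]
    congr 1; ext x
    rw [pd_comm hψ a e]
  have e2 : ∫ x, (Ψ₁ x + Ψ₂ x) * pd e ψ x = -(∫ x, Ψ₁' x * ψ x) + ∫ x, Ψ₂ x * pd e ψ x := by
    rw [← hΨ.2.2 _ hψ, ← integral_add (hp.integrable_mul hΨ.1) (hp.integrable_mul hΨ₂)]
    congr 1; ext x; ring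
  have e3 : ∑ a, ∫ x, (Φ' a x - if a = e then Ψ₂ x else 0) * pd a ψ x
      = (∑ a, ∫ x, Φ' a x * pd a ψ x) - ∫ x, Ψ₂ x * pd e ψ x := by
    have : ∀ a, ∫ x, (Φ' a x - if a = e then Ψ₂ x else 0) * pd a ψ x
        = (∫ x, Φ' a x * pd a ψ x) - if a = e then ∫ x, Ψ₂ x * pd e ψ x else 0 := fun a => by
      by_cases ha : a = e
      · subst ha
        simp only [if_true, sub_mul]
        exact integral_sub ((hψ.pd a).integrable_mul (hΦ a).2.1)
          ((hψ.pd a).integrable_mul hΨ₂)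
      · simp [ha]
    rw [Finset.sum_congr rfl fun a _ => this a, Finset.sum_sub_distrib]
    simp
  simp only [e1, Finset.sum_neg_distrib] at h1
  rw [e2] at h1
  refine (congrArg (· + ∫ x, Ψ₁' x * ψ x) e3).trans ?_
  linarith

/-! ### The energy space of jets and the Lax–Milgram theorem -/

variable {ι : Type*}

/-- Tuples of locally integrable functions with square integrable gradients, the components of
positive weight being square integrable themselves. -/
structure Energy (lam : ι → ℝ) (U : ι → Sp n → ℝ) (D : ι → Fin n → Sp n → ℝ) : Prop where
  loc : ∀ i, LocallyIntegrable (U i) volume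
  wd : ∀ i a, WD a (U i) (D i a)
  memLp : ∀ i a, MemLp (D i a) 2 volume
  memLp_self : ∀ i, lam i ≠ 0 → MemLp (U i) 2 volume

/-- The gradients and the weighted components. -/
def jet (lam : ι → ℝ) (U : ι → Sp n → ℝ) (D : ι → Fin n → Sp n → ℝ) :
    ι × Fin n ⊕ ι → Sp n → ℝ
  | .inl q => D q.1 q.2
  | .inr i => fun x => lam i * U i x

namespace Energy
variable {lam : ι → ℝ} {U V : ι → Sp n → ℝ} {D E : ι → Fin n → Sp n → ℝ}

theorem memLp_jet (h : Energy lam U D) (q : ι × Fin n ⊕ ι) : MemLp (jet lam U D q) 2 volume := by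
  rcases q with q | i
  · exact h.memLp _ _
  · by_cases hi : lam i = 0
    · simp [jet, hi]
    · exact (h.memLp_self i hi).const_mul _

theorem zero (lam : ι → ℝ) : Energy (n := n) lam 0 0 where
  loc _ := locallyIntegrable_zero
  wd _ a := WD.const a 0
  memLp _ _ := MemLp.zero
  memLp_self _ _ := MemLp.zero

theorem add (h : Energy lam U D) (h' : Energy lam V E) : Energy lam (U + V) (D + E) where
  loc i := (h.loc i).add (h'.loc i)
  wd i a := (h.wd i a).add (h'.wd i a)
  memLp i a := (h.memLp i a).add (h'.memLp i a)
  memLp_self i hi := (h.memLp_self i hi).add (h'.memLp_self i hi)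

theorem smul (h : Energy lam U D) (c : ℝ) : Energy lam (c • U) (c • D) where
  loc i := (h.loc i).smul c
  wd i a := (h.wd i a).const_mul c
  memLp i a := (h.memLp i a).const_mul c
  memLp_self i hi := (h.memLp_self i hi).const_mul c

end Energy

theorem jet_add (lam : ι → ℝ) (U V : ι → Sp n → ℝ) (D E : ι → Fin n → Sp n → ℝ)
    (q : ι × Fin n ⊕ ι) : jet lam (U + V) (D + E) q = jet lam U D q + jet lam V E q := by
  rcases q with q | i
  · rfl
  · ext x; simp [jet, mul_add]

theorem jet_smul (lam : ι → ℝ) (U : ι → Sp n → ℝ) (D : ι → Fin n → Sp n → ℝ) (c : ℝ)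
    (q : ι × Fin n ⊕ ι) : jet lam (c • U) (c • D) q = c • jet lam U D q := by
  rcases q with q | i
  · rfl
  · ext x; simp [jet]; ring

variable [Fintype ι]

/-- The Hilbert space containing the jets. -/
abbrev JetSpace (ι : Type*) [Fintype ι] (n : ℕ) : Type _ :=
  PiLp 2 fun _ : ι × Fin n ⊕ ι => Lp ℝ 2 (volume : Measure (Sp n))

/-- The space of jets of tuples of finite energy. -/
def jetSubmodule (n : ℕ) (lam : ι → ℝ) : Submodule ℝ (JetSpace ι n) where
  carrier := {g | ∃ U D, Energy lam U D ∧ ∀ q, g q =ᵐ[volume] jet lam U D q}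
  zero_mem' := ⟨0, 0, Energy.zero lam, fun q => by
    refine (Lp.coeFn_zero ℝ 2 volume).trans (ae_of_all _ fun x => ?_)
    rcases q with q | i <;> simp [jet]⟩
  add_mem' := by
    rintro g g' ⟨U, D, h, hg⟩ ⟨V, E, h', hg'⟩
    refine ⟨_, _, h.add h', fun q => ?_⟩
    rw [jet_add]
    exact (Lp.coeFn_add _ _).trans ((hg q).add (hg' q))
  smul_mem' := by
    rintro c g ⟨U, D, h, hg⟩
    refine ⟨_, _, h.smul c, fun q => ?_⟩
    rw [jet_smul]
    exact (Lp.coeFn_smul c _).trans ((hg q).const_smul c)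

/-- For λᵢ ≠ 0 the limit function is λᵢ⁻¹ times the limit of the weighted entries. For λᵢ = 0 only
gradients converge, and the limit function comes from `exists_potential`. -/
theorem isClosed_jetSubmodule (lam : ι → ℝ) :
    IsClosed (jetSubmodule n lam : Set (JetSpace ι n)) := by
  refine IsSeqClosed.isClosed fun g G hg hG => ?_
  choose U D h hgU using hg
  have hq : ∀ q, Tendsto (fun k => eLpNorm (fun x => jet lam (U k) (D k) q x - G q x) 2 volume)
      atTop (𝓝 0) := fun q => by
    have h1 : Tendsto (fun k => g k q) atTop (𝓝 (G q)) :=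
      ((PiLp.continuous_apply 2 _ q).tendsto G).comp hG
    rw [Lp.tendsto_Lp_iff_tendsto_eLpNorm'] at h1
    refine h1.congr fun k => eLpNorm_congr_ae ?_
    filter_upwards [hgU k q] with x hx
    simp [hx]
  have hpot : ∀ i, ∃ v : Sp n → ℝ, LocallyIntegrable v volume ∧
      (∀ a, WD a v (G (.inl (i, a)))) ∧ (lam i ≠ 0 → MemLp v 2 volume) ∧
      G (.inr i) =ᵐ[volume] fun x => lam i * v x := fun i => by
    by_cases hi : lam i = 0
    · obtain ⟨v, hv, hw⟩ := exists_potential (u := fun k => U k i)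
        (fun k => ((h k).loc i).aestronglyMeasurable) (fun k a => (h k).wd i a)
        (fun k a => (h k).memLp i a) (fun a => Lp.memLp (G (.inl (i, a))))
        (fun a => hq (.inl (i, a)))
      refine ⟨v, hv, hw, fun h => absurd hi h, ?_⟩
      have := hq (.inr i)
      simp only [jet, hi, zero_mul, zero_sub] at this
      have h0 := (tendsto_nhds_unique this tendsto_const_nhds).symm
      rw [show (fun x => - G (.inr i) x) = - (G (.inr i) : Sp n → ℝ) from rfl, eLpNorm_neg,
        eLpNorm_eq_zero_iff (Lp.aestronglyMeasurable _) (by norm_num)] at h0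
      simp only [hi, zero_mul]
      exact h0
    · have hm := Lp.memLp (G (.inr i))
      set v : Sp n → ℝ := fun x => (lam i)⁻¹ * G (.inr i) x
      have hv : MemLp v 2 volume := hm.const_mul _
      have hvl := hv.locallyIntegrable (by norm_num)
      refine ⟨v, hvl, fun a => ⟨hvl, (Lp.memLp _).locallyIntegrable (by norm_num),
        fun ψ hψ => ?_⟩, fun _ => hv, ae_of_all _ fun x => by simp [v, hi]⟩
      have t1 := tendsto_integral_mul (fun k => (h k).memLp_jet (.inr i)) hm ((hψ.pd a).memLp 2)
        (hq (.inr i))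
      have t2 := tendsto_integral_mul (fun k => (h k).memLp i a) (Lp.memLp (G (.inl (i, a))))
        (hψ.memLp 2) (hq (.inl (i, a)))
      have t3 := t1.const_mul (lam i)⁻¹
      have e : ∀ k, (lam i)⁻¹ * ∫ x, jet lam (U k) (D k) (.inr i) x * pd a ψ x
          = - ∫ x, D k i a x * ψ x := fun k => by
        rw [← ((h k).wd i a).2.2 ψ hψ, ← integral_const_mul]
        congr 1; ext x; simp only [jet]; field_simp
      simp only [e] at t3
      have := tendsto_nhds_unique t3 t2.neg
      rw [← this, ← integral_const_mul]
      congr 1; ext x; simp only [v]; ring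
  choose v hv hw hv2 hvG using hpot
  exact ⟨v, fun i a => G (.inl (i, a)), ⟨hv, hw, fun i a => Lp.memLp _, hv2⟩, fun q => by
    rcases q with q | i
    · exact ae_of_all _ fun x => rfl
    · exact hvG i⟩

/-- Multiplication by a bounded function as a bilinear form on `L²`. -/
noncomputable def mulForm (f : Sp n → ℝ) (hf : MemLp f ⊤ volume) :
    Lp ℝ 2 (volume : Measure (Sp n)) →L[ℝ] Lp ℝ 2 (volume : Measure (Sp n)) →L[ℝ] ℝ :=
  (innerSL ℝ).comp ((ContinuousLinearMap.mul ℝ ℝ).holderL volume ⊤ 2 2 (hf.toLp f))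

theorem mulForm_apply {f : Sp n → ℝ} (hf : MemLp f ⊤ volume)
    (u v : Lp ℝ 2 (volume : Measure (Sp n))) : mulForm f hf u v = ∫ x, f x * u x * v x := by
  simp only [mulForm, ContinuousLinearMap.comp_apply, innerSL_apply_apply,
    ContinuousLinearMap.holderL_apply_apply]
  rw [L2.inner_def]
  refine integral_congr_ae ?_
  filter_upwards [(ContinuousLinearMap.mul ℝ ℝ).coeFn_holder (r := 2) (hf.toLp f) u,
    hf.coeFn_toLp] with x h1 h2
  rw [h1, h2]
  simp [mul_comm]

/-- A matrix of bounded functions as a bilinear form on the space of jets. -/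
noncomputable def matForm (Q : ι × Fin n ⊕ ι → ι × Fin n ⊕ ι → Sp n → ℝ)
    (hQ : ∀ q r, MemLp (Q q r) ⊤ volume) : JetSpace ι n →L[ℝ] JetSpace ι n →L[ℝ] ℝ :=
  ∑ q, ∑ r, (mulForm (Q q r) (hQ q r)).bilinearComp (PiLp.proj 2 _ r) (PiLp.proj 2 _ q)

theorem matForm_apply (Q : ι × Fin n ⊕ ι → ι × Fin n ⊕ ι → Sp n → ℝ)
    (hQ : ∀ q r, MemLp (Q q r) ⊤ volume) (u v : JetSpace ι n) :
    matForm Q hQ u v = ∑ q, ∑ r, ∫ x, Q q r x * u r x * v q x := by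
  simp [matForm, mulForm_apply]

theorem integrable_mul_mul {f g h : Sp n → ℝ} (hf : MemLp f ⊤ volume) (hg : MemLp g 2 volume)
    (hh : MemLp h 2 volume) : Integrable (fun x => f x * g x * h x) volume :=
  integrable_mul_two (hg.mul (p := ⊤) (q := 2) (r := 2) hf) hh

theorem norm_sq_jetSpace (u : JetSpace ι n) : ‖u‖ ^ 2 = ∑ q, ∫ x, u q x ^ 2 := by
  rw [PiLp.norm_sq_eq_of_L2]
  refine Finset.sum_congr rfl fun q _ => ?_
  rw [← real_inner_self_eq_norm_sq, L2.inner_def]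
  congr 1; ext x; simp [sq]

/-- Pointwise coercivity integrates. -/
theorem coercive_integral {lam : ι → ℝ} {Q : ι × Fin n ⊕ ι → ι × Fin n ⊕ ι → Sp n → ℝ}
    (hQ : ∀ q r, MemLp (Q q r) ⊤ volume) {c : ℝ}
    (hc : ∀ᵐ x, ∀ z : ι × Fin n ⊕ ι → ℝ, (∀ i, lam i = 0 → z (.inr i) = 0) →
      c * ∑ q, z q ^ 2 ≤ ∑ q, ∑ r, Q q r x * z r * z q)
    {u : ι × Fin n ⊕ ι → Sp n → ℝ} (hu : ∀ q, MemLp (u q) 2 volume)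
    (h0 : ∀ i, lam i = 0 → u (.inr i) =ᵐ[volume] 0) :
    c * ∑ q, ∫ x, u q x ^ 2 ≤ ∑ q, ∑ r, ∫ x, Q q r x * u r x * u q x := by
  have e1 : c * ∑ q, ∫ x, u q x ^ 2 = ∫ x, c * ∑ q, u q x ^ 2 := by
    rw [integral_const_mul, integral_finsetSum _ fun q _ => (hu q).integrable_sq]
  have hi : ∀ q r, Integrable (fun x => Q q r x * u r x * u q x) volume := fun q r =>
    integrable_mul_mul (hQ q r) (hu r) (hu q)
  have e2 : ∑ q, ∑ r, ∫ x, Q q r x * u r x * u q x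
      = ∫ x, ∑ q, ∑ r, Q q r x * u r x * u q x := by
    rw [integral_finsetSum _ fun q _ => integrable_finsetSum _ fun r _ => hi q r]
    exact Finset.sum_congr rfl fun q _ => (integral_finsetSum _ fun r _ => hi q r).symm
  rw [e1, e2]
  have h0' : ∀ᵐ x, ∀ i, lam i = 0 → u (.inr i) x = 0 := by
    rw [ae_all_iff]
    intro i
    by_cases hi : lam i = 0
    · filter_upwards [h0 i hi] with x hx _ using hx
    · exact ae_of_all _ fun x h => absurd h hi
  refine integral_mono_ae ((integrable_finsetSum _ fun q _ => (hu q).integrable_sq).const_mul c)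
    (integrable_finsetSum _ fun q _ => integrable_finsetSum _ fun r _ => hi q r) ?_
  filter_upwards [hc, h0'] with x hx h0x
  exact hx (fun q => u q x) h0x

/-- Lax–Milgram on the closed subspace of jets, where the form inherits coercivity from the
pointwise one. The right-hand side is represented by the orthogonal projection of F to the subspace.
-/
theorem exists_energy_solution {lam : ι → ℝ}
    {Q : ι × Fin n ⊕ ι → ι × Fin n ⊕ ι → Sp n → ℝ}
    (hQ : ∀ q r, MemLp (Q q r) ⊤ volume) {c : ℝ} (hc0 : 0 < c)
    (hc : ∀ᵐ x, ∀ z : ι × Fin n ⊕ ι → ℝ, (∀ i, lam i = 0 → z (.inr i) = 0) →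
      c * ∑ q, z q ^ 2 ≤ ∑ q, ∑ r, Q q r x * z r * z q)
    {F : ι × Fin n ⊕ ι → Sp n → ℝ} (hF : ∀ q, MemLp (F q) 2 volume) :
    ∃ U D, Energy lam U D ∧ ∀ V E, Energy lam V E →
      ∑ q, ∑ r, ∫ x, Q q r x * jet lam U D r x * jet lam V E q x
        = ∑ q, ∫ x, F q x * jet lam V E q x := by
  set M := jetSubmodule n lam
  have : CompleteSpace M := (isClosed_jetSubmodule lam).completeSpace_coe
  let B : M →L[ℝ] M →L[ℝ] ℝ := (matForm Q hQ).bilinearComp M.subtypeL M.subtypeL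
  have hB : IsCoercive B := by
    refine ⟨c, hc0, fun v => ?_⟩
    obtain ⟨U, D, hU, hv⟩ := v.2
    have e : c * ‖v‖ * ‖v‖ = c * ∑ q, ∫ x, (v : JetSpace ι n) q x ^ 2 := by
      rw [← norm_sq_jetSpace, Submodule.coe_norm]; ring
    rw [e]
    refine (coercive_integral hQ hc (fun q => Lp.memLp _) fun i hi => ?_).trans
      (matForm_apply Q hQ v v).ge
    filter_upwards [hv (.inr i)] with x hx
    simp [hx, jet, hi]
  let f : JetSpace ι n := WithLp.toLp 2 fun q => (hF q).toLp (F q)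
  obtain ⟨w, hw⟩ := hB.continuousLinearEquivOfBilin.surjective (M.orthogonalProjectionOnto f)
  obtain ⟨U, D, hU, hwU⟩ := w.2
  refine ⟨U, D, hU, fun V E hV => ?_⟩
  let v : JetSpace ι n := WithLp.toLp 2 fun q => (hV.memLp_jet q).toLp _
  have hvq : ∀ q, v q =ᵐ[volume] jet lam V E q := fun q => (hV.memLp_jet q).coeFn_toLp
  have hv : v ∈ M := ⟨V, E, hV, hvq⟩
  have h1 := hB.continuousLinearEquivOfBilin_apply w ⟨v, hv⟩
  rw [hw] at h1
  have h2 : inner ℝ (M.orthogonalProjectionOnto f) (⟨v, hv⟩ : M) = inner ℝ f v :=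
    Submodule.inner_orthogonalProjectionOnto_eq_of_mem_right (⟨v, hv⟩ : M) f
  rw [h2] at h1
  have h3 : B w ⟨v, hv⟩ = ∑ q, ∑ r, ∫ x, Q q r x * jet lam U D r x * jet lam V E q x := by
    refine (matForm_apply Q hQ w v).trans ?_
    refine Finset.sum_congr rfl fun q _ => Finset.sum_congr rfl fun r _ => integral_congr_ae ?_
    filter_upwards [hwU r, hvq q] with x h1 h2
    rw [h1, h2]
  rw [← h3, ← h1, PiLp.inner_apply]
  exact Finset.sum_congr rfl fun q _ => inner_toLp (hF q) (hV.memLp_jet q)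

/-- The energy estimate. -/
theorem energy_estimate {lam : ι → ℝ}
    {Q : ι × Fin n ⊕ ι → ι × Fin n ⊕ ι → Sp n → ℝ}
    (hQ : ∀ q r, MemLp (Q q r) ⊤ volume) {c : ℝ} (hc0 : 0 < c)
    (hc : ∀ᵐ x, ∀ z : ι × Fin n ⊕ ι → ℝ, (∀ i, lam i = 0 → z (.inr i) = 0) →
      c * ∑ q, z q ^ 2 ≤ ∑ q, ∑ r, Q q r x * z r * z q)
    {U : ι → Sp n → ℝ} {D : ι → Fin n → Sp n → ℝ} (hU : Energy lam U D) {B : ℝ} (hB : 0 ≤ B)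
    (h : ∑ q, ∑ r, ∫ x, Q q r x * jet lam U D r x * jet lam U D q x
        ≤ B * ∑ q, (eLpNorm (jet lam U D q) 2 volume).toReal) (q : ι × Fin n ⊕ ι) :
    LB 2 (c⁻¹ * Fintype.card (ι × Fin n ⊕ ι) * B) (jet lam U D q) := by
  set K := ((Fintype.card (ι × Fin n ⊕ ι) : ℕ) : ℝ) with hKdef
  set t : ι × Fin n ⊕ ι → ℝ := fun q => (eLpNorm (jet lam U D q) 2 volume).toReal with ht
  have ht0 : ∀ q, 0 ≤ t q := fun q => ENNReal.toReal_nonneg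
  have hsq : ∀ q, ∫ x, jet lam U D q x ^ 2 = t q ^ 2 := fun q => by
    rw [ht]
    simp only
    rw [← Lp.norm_toLp _ (hU.memLp_jet q), ← real_inner_self_eq_norm_sq, inner_toLp]
    simp [sq]
  have h1 := coercive_integral hQ hc hU.memLp_jet (fun i hi => by simp [jet, hi]; rfl)
  simp only [hsq] at h1
  have h2 : (∑ q, t q) ^ 2 ≤ K * ∑ q, t q ^ 2 := by
    simpa [K] using sq_sum_le_card_mul_sum_sq (s := Finset.univ) (f := t)
  -- Coercivity and Cauchy–Schwarz give c(Σt)² ≤ KB Σt; arguing by contradiction makes Σt positive,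
  -- so that it can be cancelled.
  have h3 : ∑ q, t q ≤ c⁻¹ * K * B := by
    by_contra! hlt
    have hK : 0 ≤ K := by positivity
    have hS : 0 < ∑ q, t q := lt_of_le_of_lt (by positivity) hlt
    have h4 : c * (∑ q, t q) ^ 2 ≤ K * B * ∑ q, t q := by
      calc c * (∑ q, t q) ^ 2 ≤ c * (K * ∑ q, t q ^ 2) := by gcongr
        _ = K * (c * ∑ q, t q ^ 2) := by ring
        _ ≤ K * (B * ∑ q, t q) := mul_le_mul_of_nonneg_left (h1.trans h) hK
        _ = _ := by ring
    have h5 : c * ∑ q, t q ≤ K * B := by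
      refine le_of_mul_le_mul_right ?_ hS
      linarith [h4, sq (∑ q, t q)]
    rw [mul_assoc, inv_mul_lt_iff₀ hc0] at hlt
    linarith
  refine ⟨hU.memLp_jet q, by positivity, ?_⟩
  rw [← ENNReal.ofReal_toReal (hU.memLp_jet q).2.ne]
  exact ENNReal.ofReal_le_ofReal
    ((Finset.single_le_sum (fun q _ => ht0 q) (Finset.mem_univ q)).trans h3)

end Kakinuma

/-! ### Difference quotients of solutions -/

namespace Kakinuma
open Filter Topology
variable {n : ℕ} {ι : Type*}

theorem integral_dq_mul_two {f g : Sp n → ℝ} (hf : MemLp f 2 volume) (hg : MemLp g 2 volume)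
    (a : Fin n) (h : ℝ) : ∫ x, dq a h f x * g x = - ∫ x, f x * dq a (-h) g x := by
  set z : Sp n := EuclideanSpace.single a h with hz
  have hz' : EuclideanSpace.single a (-h) = -z := by
    rw [hz]; ext i; simp; split_ifs <;> simp
  have i1 := integrable_mul_two hf (memLp_translate hg (-z))
  have i2 := integrable_mul_two hf hg
  have i3 := integrable_mul_two (memLp_translate hf z) hg
  have e1 : ∫ x, f (x + z) * g x = ∫ x, f x * g (x + -z) := by
    rw [← integral_add_right_eq_self (fun x => f x * g (x + -z)) z]
    simp
  have e2 : ∫ x, dq a h f x * g x = h⁻¹ * ((∫ x, f (x + z) * g x) - ∫ x, f x * g x) := by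
    rw [← integral_sub i3 i2, ← integral_const_mul]
    congr 1; ext x; simp only [dq, ← hz]; ring
  have e3 : ∫ x, f x * dq a (-h) g x
      = (-h)⁻¹ * ((∫ x, f x * g (x + -z)) - ∫ x, f x * g x) := by
    rw [← integral_sub i1 i2, ← integral_const_mul]
    congr 1; ext x; simp only [dq, hz']; ring
  rw [e2, e3, e1, inv_neg]
  ring

theorem WD.dq {a : Fin n} {f g : Sp n → ℝ} (h : WD a f g) (e : Fin n) (t : ℝ) :
    WD a (dq e t f) (dq e t g) :=
  ((h.translate _).sub h).const_mul _

/-- Weak derivatives commute. -/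
theorem WD.comm {a e : Fin n} {f fa fe g : Sp n → ℝ} (ha : WD a f fa) (he : WD e f fe)
    (h : WD e fa g) : WD a fe g := by
  refine ⟨he.2.1, h.2.1, fun ψ hψ => ?_⟩
  have h1 := he.2.2 _ (hψ.pd a)
  have h2 := ha.2.2 _ (hψ.pd e)
  have h3 := h.2.2 _ hψ
  rw [pd_comm hψ] at h2
  linarith

theorem Energy.dq {lam : ι → ℝ} {U : ι → Sp n → ℝ} {D : ι → Fin n → Sp n → ℝ}
    (h : Energy lam U D) (e : Fin n) (t : ℝ) :
    Energy lam (fun i => dq e t (U i)) (fun i a => dq e t (D i a)) where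
  loc i := ((h.wd i e).dq e t).1
  wd i a := (h.wd i a).dq e t
  memLp i a := memLp_dq (h.memLp i a) e t
  memLp_self i hi := memLp_dq (h.memLp_self i hi) e t

theorem jet_dq (lam : ι → ℝ) (U : ι → Sp n → ℝ) (D : ι → Fin n → Sp n → ℝ) (e : Fin n) (t : ℝ)
    (q : ι × Fin n ⊕ ι) :
    jet lam (fun i => dq e t (U i)) (fun i a => dq e t (D i a)) q = dq e t (jet lam U D q) := by
  rcases q with q | i
  · rfl
  · ext x; simp only [jet, dq]; ring

variable [Fintype ι]

/-- The weak form of the system with matrix `P` and data `F`, `R`. -/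
def WeakSys (lam : ι → ℝ) (P : ι × Fin n ⊕ ι → ι × Fin n ⊕ ι → Sp n → ℝ)
    (U : ι → Sp n → ℝ) (D : ι → Fin n → Sp n → ℝ) (F : ι × Fin n ⊕ ι → Sp n → ℝ)
    (R : ι → Sp n → ℝ) : Prop :=
  ∀ i, DivEq (fun a x => ∑ r, P (.inl (i, a)) r x * jet lam U D r x - F (.inl (i, a)) x)
    (fun x => lam i * (∑ r, P (.inr i) r x * jet lam U D r x - F (.inr i) x) - R i x)

/-- Pointwise coercivity of a matrix on jets. -/
def Coercive (lam : ι → ℝ) (c : ℝ) (P : ι × Fin n ⊕ ι → ι × Fin n ⊕ ι → Sp n → ℝ) : Prop :=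
  ∀ᵐ x, ∀ z : ι × Fin n ⊕ ι → ℝ, (∀ i, lam i = 0 → z (.inr i) = 0) →
    c * ∑ q, z q ^ 2 ≤ ∑ q, ∑ r, P q r x * z r * z q

section

variable {lam : ι → ℝ} {P : ι × Fin n ⊕ ι → ι × Fin n ⊕ ι → Sp n → ℝ} {U : ι → Sp n → ℝ}
  {D : ι → Fin n → Sp n → ℝ} {F : ι × Fin n ⊕ ι → Sp n → ℝ} {R : ι → Sp n → ℝ} {s : ℕ}
  {C₀ c B : ℝ}

theorem memLp_sum_mul (hP : ∀ q r, MemLp (P q r) ⊤ volume)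
    {u : ι × Fin n ⊕ ι → Sp n → ℝ} (hu : ∀ r, MemLp (u r) 2 volume) (q : ι × Fin n ⊕ ι) :
    MemLp (fun x => ∑ r, P q r x * u r x) 2 volume :=
  memLp_finsetSum _ fun r _ => (hu r).mul (p := ⊤) (q := 2) (r := 2) (hP q r)

/-- The weak form may be tested with tuples of finite energy. -/
theorem WeakSys.test (h : WeakSys lam P U D F R) (hP : ∀ q r, MemLp (P q r) ⊤ volume)
    (hU : Energy lam U D) (hF : ∀ q, MemLp (F q) 2 volume) (hR : ∀ i, MemLp (R i) 2 volume)
    (hR0 : ∀ i, lam i = 0 → R i = 0) {V : ι → Sp n → ℝ} {E : ι → Fin n → Sp n → ℝ}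
    (hV : Energy lam V E) :
    ∑ q, ∫ x, (∑ r, P q r x * jet lam U D r x - F q x) * jet lam V E q x
      = ∑ i, ∫ x, R i x * V i x := by
  have hG : ∀ q, MemLp (fun x => ∑ r, P q r x * jet lam U D r x - F q x) 2 volume := fun q =>
    (memLp_sum_mul hP hU.memLp_jet q).sub (hF q)
  have key : ∀ i, (∑ a, ∫ x, (∑ r, P (.inl (i, a)) r x * jet lam U D r x - F (.inl (i, a)) x)
      * jet lam V E (.inl (i, a)) x)
      + ∫ x, (∑ r, P (.inr i) r x * jet lam U D r x - F (.inr i) x) * jet lam V E (.inr i) x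
      = ∫ x, R i x * V i x := fun i => by
    have h1 := (h i).extend (fun a => hG _) (((hG (.inr i)).const_mul (lam i)).sub (hR i))
      (hV.loc i) (hV.wd i) (hV.memLp i) (by
        by_cases hi : lam i = 0
        · left; ext x; simp [hi, hR0 i hi]
        · exact .inr (hV.memLp_self i hi))
    by_cases hi : lam i = 0
    · simp only [hi, hR0 i hi, jet] at h1 ⊢
      simpa using h1
    · have i1 := integrable_mul_two (hG (.inr i)) (hV.memLp_jet (.inr i))
      have i2 := integrable_mul_two (hR i) (hV.memLp_self i hi)
      have e : ∫ x, (lam i * (∑ r, P (.inr i) r x * jet lam U D r x - F (.inr i) x) - R i x)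
          * V i x = (∫ x, (∑ r, P (.inr i) r x * jet lam U D r x - F (.inr i) x)
            * jet lam V E (.inr i) x) - ∫ x, R i x * V i x := by
        rw [← integral_sub i1 i2]
        congr 1; ext x; simp only [jet]; ring
      rw [e] at h1
      simp only [jet] at h1 ⊢
      linarith
  rw [Fintype.sum_sum_type, Fintype.sum_prod_type, ← Finset.sum_add_distrib]
  exact Finset.sum_congr rfl fun i _ => key i

/-- Difference quotients of the jet are bounded. -/
theorem jet_dq_bound (hP : ∀ q r, Mult1 s C₀ (P q r)) (hc0 : 0 < c) (hc : Coercive lam c P)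
    (hU : Energy lam U D) (h : WeakSys lam P U D F R) (hJ : ∀ q, LB 2 B (jet lam U D q))
    (hF : ∀ q, SB 2 1 B (F q)) (hR : ∀ i, LB 2 B (R i)) (hR0 : ∀ i, lam i = 0 → R i = 0)
    (e : Fin n) {t : ℝ} (ht : t ≠ 0) (q : ι × Fin n ⊕ ι) :
    LB 2 (c⁻¹ * Fintype.card (ι × Fin n ⊕ ι)
      * ((2 + Fintype.card (ι × Fin n ⊕ ι) * C₀) * B)) (dq e t (jet lam U D q)) := by
  set K := ((Fintype.card (ι × Fin n ⊕ ι) : ℕ) : ℝ) with hK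
  have hB := (hJ q).2.1
  have hC0 := (hP q q).1.nonneg
  have hPm : ∀ q r, MemLp (P q r) ⊤ volume := fun q r => (hP q r).1.lb.1
  have hV := hU.dq e t
  have hWq : ∀ q, MemLp (dq e t (jet lam U D q)) 2 volume := fun q =>
    memLp_dq (hU.memLp_jet q) e t
  set z : Sp n := EuclideanSpace.single e t
  -- In the difference quotient of PJ − F the term P·dq J reproduces the coercive form; T collects
  -- the quotients falling on P and on F.
  set T : ι × Fin n ⊕ ι → Sp n → ℝ := fun q x =>
    (∑ r, dq e t (P q r) x * jet lam U D r (x + z)) - dq e t (F q) x with hT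
  have hTB : ∀ q, LB 2 (K * (C₀ * B) + B) (T q) := fun q => by
    have h1 : ∀ r, LB 2 (C₀ * B) (fun x => dq e t (P q r) x * jet lam U D r (x + z)) :=
      fun r => by
        choose g hg hg' using (hP q r).2
        have h2 : LB ⊤ C₀ (dq e t (P q r)) :=
          ⟨memLp_dq (hPm q r) e t, hC0,
            (eLpNorm_dq_le (.inr rfl) hg e ht).trans (hg' e).lb.2.2⟩
        exact ((hJ r).translate z).bounded_mul h2.1.1 hC0 h2.ae_abs_le
    have h2 : LB 2 B (dq e t (F q)) := by
      choose g hg hg' using (hF q).2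
      exact ⟨memLp_dq (hF q).lb.1 e t, hB, (eLpNorm_dq_le (.inl rfl) hg e ht).trans (hg' e).2.2⟩
    have h3 : SB 2 0 (∑ r : ι × Fin n ⊕ ι, C₀ * B)
        (fun x => ∑ r, dq e t (P q r) x * jet lam U D r (x + z)) :=
      SB.sum (k := 0) (by norm_num) Finset.univ fun r _ => h1 r
    have h4 : SB 2 0 ((∑ r : ι × Fin n ⊕ ι, C₀ * B) + B) (T q) :=
      h3.sub (k := 0) (by norm_num) h2
    simpa [K, SB] using h4
  have hdq : ∀ q x, dq e t (fun x => ∑ r, P q r x * jet lam U D r x - F q x) x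
      = (∑ r, P q r x * dq e t (jet lam U D r) x) + T q x := fun q x => by
    have : ∀ r, t⁻¹ * (P q r (x + z) * jet lam U D r (x + z) - P q r x * jet lam U D r x)
        = P q r x * dq e t (jet lam U D r) x + dq e t (P q r) x * jet lam U D r (x + z) :=
      fun r => by simp only [dq]; ring
    have h2 : dq e t (fun x => ∑ r, P q r x * jet lam U D r x - F q x) x
        = (∑ r, t⁻¹ * (P q r (x + z) * jet lam U D r (x + z) - P q r x * jet lam U D r x))
          - dq e t (F q) x := by
      rw [← Finset.mul_sum, Finset.sum_sub_distrib]
      simp only [dq]; ring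
    rw [h2, Finset.sum_congr rfl fun r _ => this r, Finset.sum_add_distrib, hT]
    ring
  -- The test function is the second difference of U; moving one quotient to the other factor leaves
  -- the form evaluated at dq U.
  have htest := h.test hPm hU (fun q => (hF q).lb.1) (fun i => (hR i).1) hR0 (hV.dq e (-t))
  have hG : ∀ q, MemLp (fun x => ∑ r, P q r x * jet lam U D r x - F q x) 2 volume := fun q =>
    (memLp_sum_mul hPm hU.memLp_jet q).sub (hF q).lb.1
  have hsum : ∀ q, ∫ x, (∑ r, P q r x * jet lam U D r x - F q x)
      * jet lam (fun i => dq e (-t) (dq e t (U i))) (fun i a => dq e (-t) (dq e t (D i a))) q x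
      = - ((∑ r, ∫ x, P q r x * dq e t (jet lam U D r) x * dq e t (jet lam U D q) x)
        + ∫ x, T q x * dq e t (jet lam U D q) x) := fun q => by
    rw [jet_dq lam (fun i => dq e t (U i)) (fun i a => dq e t (D i a)), jet_dq]
    have h1 := integral_dq_mul_two (hG q) (hWq q) e t
    rw [← neg_eq_iff_eq_neg, ← h1]
    simp only [hdq, add_mul]
    have hi : ∀ r, Integrable
        (fun x => P q r x * dq e t (jet lam U D r) x * dq e t (jet lam U D q) x) := fun r =>
      integrable_mul_mul (hPm q r) (hWq r) (hWq q)
    rw [← integral_finsetSum _ fun r _ => hi r, ← integral_add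
      (integrable_finsetSum _ fun r _ => hi r) (integrable_mul_two (hTB q).1 (hWq q))]
    simp only [Finset.sum_mul]
  rw [Finset.sum_congr rfl fun q _ => hsum q, Finset.sum_neg_distrib, Finset.sum_add_distrib]
    at htest
  set w : ι × Fin n ⊕ ι → ℝ := fun q => (eLpNorm (dq e t (jet lam U D q)) 2 volume).toReal with hw
  have hw0 : ∀ q, 0 ≤ w q := fun q => ENNReal.toReal_nonneg
  have b1 : -(∑ q, ∫ x, T q x * dq e t (jet lam U D q) x) ≤ (K * (C₀ * B) + B) * ∑ q, w q := by
    rw [← Finset.sum_neg_distrib, Finset.mul_sum]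
    refine Finset.sum_le_sum fun q _ => (neg_le_abs _).trans
      ((abs_integral_mul_le (hTB q).1 (hWq q)).trans ?_)
    exact mul_le_mul_of_nonneg_right (hTB q).toReal_le (hw0 q)
  -- R need not be differentiable: both quotients stay on U, and the outer one is bounded by the
  -- derivative ∂ₑ of dq U, which is an entry of its jet. This is why R is allowed one derivative
  -- less than F.
  have b2 : -(∑ i, ∫ x, R i x * dq e (-t) (dq e t (U i)) x) ≤ B * ∑ q, w q := by
    have h1 : -(∑ i, ∫ x, R i x * dq e (-t) (dq e t (U i)) x) ≤ ∑ i, B * w (.inl (i, e)) := by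
      rw [← Finset.sum_neg_distrib]
      refine Finset.sum_le_sum fun i _ => ?_
      have hle := eLpNorm_dq_le (.inl rfl) (hV.wd i) e (neg_ne_zero.2 ht)
      have hm : MemLp (dq e (-t) (dq e t (U i))) 2 volume :=
        ⟨(((hV.wd i e).dq e (-t)).1).aestronglyMeasurable,
          hle.trans_lt (hWq (.inl (i, e))).2⟩
      refine (neg_le_abs _).trans ((abs_integral_mul_le (hR i).1 hm).trans ?_)
      exact mul_le_mul (hR i).toReal_le (ENNReal.toReal_mono (hWq (.inl (i, e))).2.ne hle)
        ENNReal.toReal_nonneg hB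
    refine h1.trans ?_
    rw [← Finset.mul_sum]
    refine mul_le_mul_of_nonneg_left ?_ hB
    rw [Fintype.sum_sum_type, Fintype.sum_prod_type]
    refine le_add_of_le_of_nonneg (Finset.sum_le_sum fun i _ => ?_)
      (Finset.sum_nonneg fun _ _ => hw0 _)
    exact Finset.single_le_sum (f := fun a => w (.inl (i, a))) (fun _ _ => hw0 _)
      (Finset.mem_univ e)
  rw [← jet_dq]
  refine energy_estimate hPm hc0 hc hV (by positivity) ?_ q
  simp only [jet_dq]
  calc _ ≤ (K * (C₀ * B) + B) * ∑ q, w q + B * ∑ q, w q := by linarith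
    _ = _ := by ring

/-- The jet is weakly differentiable. -/
theorem exists_wd_jet (hP : ∀ q r, Mult1 s C₀ (P q r)) (hc0 : 0 < c) (hc : Coercive lam c P)
    (hU : Energy lam U D) (h : WeakSys lam P U D F R) (hJ : ∀ q, LB 2 B (jet lam U D q))
    (hF : ∀ q, SB 2 1 B (F q)) (hR : ∀ i, LB 2 B (R i)) (hR0 : ∀ i, lam i = 0 → R i = 0)
    (e : Fin n) (q : ι × Fin n ⊕ ι) :
    ∃ g, WD e (jet lam U D q) g ∧ LB 2 (c⁻¹ * Fintype.card (ι × Fin n ⊕ ι)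
      * ((2 + Fintype.card (ι × Fin n ⊕ ι) * C₀) * B)) g := by
  have hb := fun (t : ℝ) (ht : t ≠ 0) => jet_dq_bound hP hc0 hc hU h hJ hF hR hR0 e ht q
  obtain ⟨g, h1, h2, h3⟩ := exists_wd_of_dq_bounded (hU.memLp_jet q) e (hb 1 one_ne_zero).2.1
    fun t ht => (hb t ht).2.2
  exact ⟨g, h1, h2, (hb 1 one_ne_zero).2.1, h3⟩

end

end Kakinuma

/-! ### Higher regularity of solutions -/

namespace Kakinuma
open Filter Topology
variable {n : ℕ} {ι : Type*} [Fintype ι]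

section

variable {lam : ι → ℝ} {P : ι × Fin n ⊕ ι → ι × Fin n ⊕ ι → Sp n → ℝ} {U : ι → Sp n → ℝ}
  {D : ι → Fin n → Sp n → ℝ} {F : ι × Fin n ⊕ ι → Sp n → ℝ} {R : ι → Sp n → ℝ} {s k : ℕ}
  {C₀ c B : ℝ}

/-- The data of the differentiated system. -/
def derivData (P' : ι × Fin n ⊕ ι → ι × Fin n ⊕ ι → Sp n → ℝ) (J F' : ι × Fin n ⊕ ι → Sp n → ℝ)
    (R : ι → Sp n → ℝ) (e : Fin n) (q : ι × Fin n ⊕ ι) (x : Sp n) : ℝ :=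
  F' q x - (∑ r, P' q r x * J r x)
    - Sum.elim (fun p : ι × Fin n => if p.2 = e then R p.1 x else 0) (fun _ => 0) q

/-- Derivatives of a solution solve the differentiated system. -/
theorem WeakSys.deriv (h : WeakSys lam P U D F R) (hU : Energy lam U D) (e : Fin n)
    {P' : ι × Fin n ⊕ ι → ι × Fin n ⊕ ι → Sp n → ℝ} {F' : ι × Fin n ⊕ ι → Sp n → ℝ}
    {D' : ι → Fin n → Sp n → ℝ} (hP : ∀ q r, LB ⊤ C₀ (P q r)) (hP' : ∀ q r, LB ⊤ C₀ (P' q r))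
    (hPP' : ∀ q r, WD e (P q r) (P' q r)) (hF : ∀ q, WD e (F q) (F' q))
    (hR : ∀ i, LocallyIntegrable (R i) volume)
    (hD : ∀ i a, WD e (D i a) (D' i a)) (hD' : Energy lam (fun i => D i e) D') :
    WeakSys lam P (fun i => D i e) D'
      (derivData P' (jet lam U D) F' R e) 0 := by
  have hJ : ∀ q, WD e (jet lam U D q) (jet lam (fun i => D i e) D' q) := fun q => by
    rcases q with q | i
    · exact hD _ _
    · exact (hU.wd i e).const_mul _
  have hS : ∀ q, WD e (fun x => ∑ r, P q r x * jet lam U D r x)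
      (fun x => ∑ r, (P' q r x * jet lam U D r x + P q r x * jet lam (fun i => D i e) D' r x)) :=
    fun q => WD.sum Finset.univ fun r _ => (hPP' q r).mul (hJ r) ((hP q r).l2loc (.inr rfl))
      ((hP' q r).l2loc (.inr rfl)) (.of_memLp_two (hU.memLp_jet r))
      (.of_memLp_two (hD'.memLp_jet r))
  intro i
  -- The term −R takes the place of the summand that is not differentiated but moved into the flux;
  -- hence the new system has R = 0 and R appears in `derivData`.
  have h1 : DivEq (fun a x => ∑ r, P (.inl (i, a)) r x * jet lam U D r x - F (.inl (i, a)) x)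
    (fun x => lam i * (∑ r, P (.inr i) r x * jet lam U D r x - F (.inr i) x) + - R i x) := h i
  have h2 := h1.deriv e (fun a => (hS _).sub (hF _)) (((hS (.inr i)).sub (hF _)).const_mul (lam i))
    (hR i).neg
  convert h2 using 2 with a
  · ext x
    simp only [derivData, Sum.elim_inl, Finset.sum_add_distrib]
    by_cases ha : a = e <;> simp [ha] <;> ring
  · simp only [derivData, Sum.elim_inr, Finset.sum_add_distrib, Pi.zero_apply]
    ring

end

/-- Regularity for systems with multiplier coefficients, principal part only. -/
theorem regularity_principal (ι : Type*) [Fintype ι] (n s : ℕ) (C₀ c : ℝ) (hC0 : 0 ≤ C₀)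
    (hc0 : 0 < c) :
    ∀ k : ℕ, k ≤ s + 1 → ∃ C : ℝ, 0 ≤ C ∧
      ∀ (lam : ι → ℝ) (P : ι × Fin n ⊕ ι → ι × Fin n ⊕ ι → Sp n → ℝ) (U : ι → Sp n → ℝ)
        (D : ι → Fin n → Sp n → ℝ) (F : ι × Fin n ⊕ ι → Sp n → ℝ) (R : ι → Sp n → ℝ) (B : ℝ),
        (∀ q r, Mult1 s C₀ (P q r)) → Coercive lam c P → Energy lam U D → WeakSys lam P U D F R →
        (∀ q, LB 2 B (jet lam U D q)) → (∀ q, SB 2 k B (F q)) → (∀ i, lam i = 0 → R i = 0) →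
        (∀ i, SB 2 (k - 1) B (R i)) → ∀ q, SB 2 k (C * B) (jet lam U D q) := by
  intro k
  induction k with
  | zero => exact fun _ => ⟨1, zero_le_one, fun lam P U D F R B _ _ _ _ hJ _ _ _ q => by
      rw [one_mul]; exact hJ q⟩
  | succ k ih =>
    intro hk
    obtain ⟨C, hC, hreg⟩ := ih (by omega)
    set K := ((Fintype.card (ι × Fin n ⊕ ι) : ℕ) : ℝ) with hK
    -- `C1` bounds the jet of the derivative, by the difference quotient estimate. `C2` bounds the
    -- new data: one unit each for F' and R, and K products of P' with the jet, which is already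
    -- known to be in H^k.
    set C1 := c⁻¹ * K * (2 + K * C₀)
    set C2 := 2 + K * (C₀ * C)
    have hK0 : 0 ≤ K := by positivity
    have hC1 : 0 ≤ C1 := by positivity
    have hC2 : 0 ≤ C2 := by positivity
    refine ⟨1 + C * (C1 + C2), by positivity, fun lam P U D F R B hP hc hU h hJ hF hR0 hR q => ?_⟩
    -- The index (k + 1) − 1 is k by definition.
    have hR' : ∀ i, SB 2 k B (R i) := hR
    have hB : 0 ≤ B := (hJ q).2.1
    have hJk := hreg lam P U D F R B hP hc hU h hJ (fun q => (hF q).pred) hR0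
      (fun i => (hR' i).of_le (by omega))
    have hex := fun e => exists_wd_jet hP hc0 hc hU h hJ (fun q => (hF q).of_le (by omega))
      (fun i => (hR' i).lb) hR0 e
    refine SB.succ ((hJ q).mono (le_mul_of_one_le_left hB (by nlinarith [mul_nonneg hC (add_nonneg hC1 hC2)])))
      (g := fun e => (hex e q).choose) (fun e => (hex e q).choose_spec.1) fun e => ?_
    choose g hg hgB using hex e
    have hD' : ∀ i a, WD a (D i e) (g (.inl (i, a))) := fun i a =>
      (hU.wd i a).comm (hU.wd i e) (hg (.inl (i, a)))
    have hE : Energy lam (fun i => D i e) (fun i a => g (.inl (i, a))) :=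
      ⟨fun i => (hU.wd i e).2.1, hD', fun i a => (hgB _).1, fun i _ => hU.memLp i e⟩
    choose P' hPP' hP' using fun q r => (hP q r).2 e
    choose F' hFF' hF' using fun q => (hF q).2 e
    have hsys := h.deriv hU e (fun q r => (hP q r).1.lb) (fun q r => (hP' q r).lb) hPP' hFF'
      (fun i => (hR' i).memLp.locallyIntegrable (by norm_num))
      (fun i a => hg (.inl (i, a))) hE
    have hwd : ∀ q, WD e (jet lam U D q)
        (jet lam (fun i => D i e) (fun i a => g (.inl (i, a))) q) := fun q => by
      rcases q with q | i
      · exact hg _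
      · exact (hU.wd i e).const_mul _
    have hB' : 0 ≤ (C1 + C2) * B := by positivity
    have hJ' : ∀ q, LB 2 ((C1 + C2) * B)
        (jet lam (fun i => D i e) (fun i a => g (.inl (i, a))) q) := fun q =>
      ((hgB q).congr ((hg q).ae_eq (hwd q))).mono (by
        have := mul_nonneg hC2 hB
        have e : c⁻¹ * K * ((2 + K * C₀) * B) = C1 * B := by ring
        rw [e]; linarith)
    have hFk : ∀ q, SB 2 k ((C1 + C2) * B) (derivData P' (jet lam U D) F' R e q) := fun q => by
      have h1 : ∀ r, SB 2 k (C₀ * (C * B)) (fun x => P' q r x * jet lam U D r x) := fun r =>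
        (hP' q r).2.2.2 k (by omega) _ _ (hJk r)
      have h2 := SB.sum (by norm_num) Finset.univ fun r _ => h1 r
      have h3 : SB 2 k B (fun x => Sum.elim (fun p : ι × Fin n => if p.2 = e then R p.1 x else 0)
          (fun _ => 0) q) := by
        rcases q with q | i
        · by_cases hq : q.2 = e
          · simpa [hq] using hR' q.1
          · simpa [hq] using SB.zero hB
        · simpa using SB.zero hB
      refine (((hF' q).sub (by norm_num) h2).sub (by norm_num) h3).mono ?_
      have := mul_nonneg hC1 hB
      simp only [Finset.sum_const, Finset.card_univ, nsmul_eq_mul, ← hK, C2]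
      nlinarith
    have hfin := hreg lam P _ _ _ 0 ((C1 + C2) * B) hP hc hE hsys hJ' hFk (fun _ _ => rfl)
      (fun i => SB.zero hB') q
    refine (hfin.congr ((hwd q).ae_eq (hex e q).choose_spec.1)).mono ?_
    nlinarith

/-- The weights of the components of a jet. -/
def jetWeight (n : ℕ) (lam : ι → ℝ) : ι × Fin n ⊕ ι → ℝ := Sum.elim (fun _ => 1) lam

/-- The matrix with principal part `P` and lower order part `S`. -/
noncomputable def fullMat (lam : ι → ℝ) (P S : ι × Fin n ⊕ ι → ι × Fin n ⊕ ι → Sp n → ℝ)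
    (q r : ι × Fin n ⊕ ι) (x : Sp n) : ℝ :=
  P q r x + (jetWeight n lam q)⁻¹ * (jetWeight n lam r)⁻¹ * S q r x

/-- The inverse of a zero weight is 0 by convention. Unknowns without an L² bound thereby drop out
of the lower order terms of `fullMat`. -/
theorem abs_jetWeight_inv_le {lam : ι → ℝ} (hlam : ∀ i, lam i = 0 ∨ 1 ≤ lam i)
    (q : ι × Fin n ⊕ ι) : |(jetWeight n lam q)⁻¹| ≤ 1 := by
  rcases q with q | i
  · simp [jetWeight]
  · rcases hlam i with h | h
    · simp [jetWeight, h]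
    · simp only [jetWeight, Sum.elim_inr, abs_inv]
      exact inv_le_one_of_one_le₀ (h.trans (le_abs_self _))

section

variable {lam : ι → ℝ} {P S : ι × Fin n ⊕ ι → ι × Fin n ⊕ ι → Sp n → ℝ} {U : ι → Sp n → ℝ}
  {D : ι → Fin n → Sp n → ℝ} {F : ι × Fin n ⊕ ι → Sp n → ℝ} {s k : ℕ} {C₀ c B : ℝ}

theorem memLp_fullMat (hP : ∀ q r, Mult1 s C₀ (P q r)) (hS : ∀ q r, Mult s C₀ (S q r))
    (q r : ι × Fin n ⊕ ι) : MemLp (fullMat lam P S q r) ⊤ volume :=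
  (hP q r).1.lb.1.add ((hS q r).lb.1.const_mul _)

/-- The energy estimate for weak solutions. -/
theorem WeakSys.energy {Q : ι × Fin n ⊕ ι → ι × Fin n ⊕ ι → Sp n → ℝ}
    (hQ : ∀ q r, MemLp (Q q r) ⊤ volume) (hc0 : 0 < c) (hc : Coercive lam c Q)
    (hU : Energy lam U D) (hB : 0 ≤ B) (hF : ∀ q, LB 2 B (F q)) (h : WeakSys lam Q U D F 0)
    (q : ι × Fin n ⊕ ι) :
    LB 2 (c⁻¹ * Fintype.card (ι × Fin n ⊕ ι) * B) (jet lam U D q) := by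
  refine energy_estimate hQ hc0 hc hU hB ?_ q
  have h1 := h.test hQ hU (fun q => (hF q).1) (fun i => MemLp.zero) (fun _ _ => rfl) hU
  have hi : ∀ q r, Integrable (fun x => Q q r x * jet lam U D r x * jet lam U D q x) := fun q r =>
    integrable_mul_mul (hQ q r) (hU.memLp_jet r) (hU.memLp_jet q)
  have h2 : ∀ q, ∫ x, (∑ r, Q q r x * jet lam U D r x - F q x) * jet lam U D q x
      = (∑ r, ∫ x, Q q r x * jet lam U D r x * jet lam U D q x)
        - ∫ x, F q x * jet lam U D q x := fun q => by
    rw [← integral_finsetSum _ fun r _ => hi q r, ← integral_sub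
      (integrable_finsetSum _ fun r _ => hi q r) (integrable_mul_two (hF q).1 (hU.memLp_jet q))]
    congr 1; ext x
    rw [sub_mul, Finset.sum_mul]
  rw [Finset.sum_congr rfl fun q _ => h2 q, Finset.sum_sub_distrib] at h1
  simp only [Pi.zero_apply, zero_mul, integral_zero, Finset.sum_const_zero, sub_eq_zero] at h1
  rw [h1, Finset.mul_sum]
  refine Finset.sum_le_sum fun q _ => (le_abs_self _).trans
    ((abs_integral_mul_le (hF q).1 (hU.memLp_jet q)).trans ?_)
  exact mul_le_mul_of_nonneg_right (hF q).toReal_le ENNReal.toReal_nonneg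

/-- Existence of weak solutions. -/
theorem exists_weakSys {Q : ι × Fin n ⊕ ι → ι × Fin n ⊕ ι → Sp n → ℝ}
    (hQ : ∀ q r, MemLp (Q q r) ⊤ volume) (hc0 : 0 < c) (hc : Coercive lam c Q)
    (hF : ∀ q, MemLp (F q) 2 volume) :
    ∃ U D, Energy lam U D ∧ WeakSys lam Q U D F 0 := by
  classical
  obtain ⟨U, D, hU, h⟩ := exists_energy_solution hQ hc0 hc hF
  refine ⟨U, D, hU, fun i ψ hψ => ?_⟩
  set V : ι → Sp n → ℝ := fun j => if j = i then ψ else 0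
  set E : ι → Fin n → Sp n → ℝ := fun j a => if j = i then pd a ψ else 0
  have hV : Energy lam V E := by
    have hl : ∀ {f : Sp n → ℝ}, IsTest f → LocallyIntegrable f volume := fun hf =>
      (hf.memLp 2).locallyIntegrable (by norm_num)
    refine ⟨fun j => ?_, fun j a => ?_, fun j a => ?_, fun j _ => ?_⟩ <;> by_cases hj : j = i <;>
      simp only [V, E, hj, if_true, if_false]
    · exact hl hψ
    · exact locallyIntegrable_zero
    · exact WD.of_contDiff (hψ.1.of_le (by norm_cast)) a
    · exact WD.const a 0
    · exact (hψ.pd a).memLp 2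
    · exact MemLp.zero
    · exact hψ.memLp 2
    · exact MemLp.zero
  have h1 := h V E hV
  have hi : ∀ q r, Integrable (fun x => Q q r x * jet lam U D r x * jet lam V E q x) :=
    fun q r => integrable_mul_mul (hQ q r) (hU.memLp_jet r) (hV.memLp_jet q)
  have h2 : ∑ q, ∫ x, (∑ r, Q q r x * jet lam U D r x - F q x) * jet lam V E q x = 0 := by
    rw [← sub_eq_zero, ← Finset.sum_sub_distrib] at h1
    rw [← h1]
    refine Finset.sum_congr rfl fun q _ => ?_
    rw [← integral_finsetSum _ fun r _ => hi q r, ← integral_sub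
      (integrable_finsetSum _ fun r _ => hi q r) (integrable_mul_two (hF q) (hV.memLp_jet q))]
    congr 1; ext x
    rw [sub_mul, Finset.sum_mul]
  rw [Fintype.sum_sum_type, Fintype.sum_prod_type, ← Finset.sum_add_distrib,
    Finset.sum_eq_single i] at h2
  · refine Eq.trans ?_ h2
    congr 1
    · simp [jet, E]
    · congr 1; ext x
      simp only [jet, V, if_true, Pi.zero_apply]; ring
  · intro j _ hj
    simp [jet, V, E, hj]
  · simp

end

/-- Regularity of solutions of coercive systems with multiplier coefficients. -/
theorem exists_regularity (ι : Type*) [Fintype ι] (n s : ℕ) (C₀ c : ℝ) (hC0 : 0 ≤ C₀)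
    (hc0 : 0 < c) : ∃ C : ℝ, 0 ≤ C ∧
      ∀ (lam : ι → ℝ) (P S : ι × Fin n ⊕ ι → ι × Fin n ⊕ ι → Sp n → ℝ) (U : ι → Sp n → ℝ)
        (D : ι → Fin n → Sp n → ℝ) (F : ι × Fin n ⊕ ι → Sp n → ℝ) (B : ℝ),
        (∀ i, lam i = 0 ∨ 1 ≤ lam i) →
        (∀ q r, Mult1 s C₀ (P q r)) → (∀ q r, Mult s C₀ (S q r)) →
        (∀ q r, S (.inl q) (.inl r) = 0) →
        Coercive lam c P → Coercive lam c (fullMat lam P S) → Energy lam U D →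
        WeakSys lam (fullMat lam P S) U D F 0 →
        (∀ q, SB 2 s B (F q)) → ∀ q, SB 2 s (C * B) (jet lam U D q) := by
  -- Induction on the order. Coercivity of the full matrix is used once, for the energy estimate
  -- that starts it; afterwards the lower order terms count as data and coercivity of P is used.
  suffices H : ∀ k ≤ s, ∃ C : ℝ, 0 ≤ C ∧
      ∀ (lam : ι → ℝ) (P S : ι × Fin n ⊕ ι → ι × Fin n ⊕ ι → Sp n → ℝ) (U : ι → Sp n → ℝ)
        (D : ι → Fin n → Sp n → ℝ) (F : ι × Fin n ⊕ ι → Sp n → ℝ) (B : ℝ),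
        (∀ i, lam i = 0 ∨ 1 ≤ lam i) →
        (∀ q r, Mult1 s C₀ (P q r)) → (∀ q r, Mult s C₀ (S q r)) →
        (∀ q r, S (.inl q) (.inl r) = 0) →
        Coercive lam c P → Coercive lam c (fullMat lam P S) → Energy lam U D →
        WeakSys lam (fullMat lam P S) U D F 0 →
        (∀ q, SB 2 s B (F q)) → ∀ q, SB 2 k (C * B) (jet lam U D q) from H s le_rfl
  intro k
  induction k with
  | zero =>
    intro _
    refine ⟨c⁻¹ * Fintype.card (ι × Fin n ⊕ ι), by positivity,
      fun lam P S U D F B hlam hP hS hS0 hcP hcQ hU h hF q => ?_⟩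
    exact h.energy (memLp_fullMat hP hS) hc0 hcQ hU (hF q).nonneg (fun q => (hF q).lb) q
  | succ k ih =>
    intro hk
    obtain ⟨C, hC, hreg⟩ := ih (by omega)
    obtain ⟨C', hC', hreg'⟩ := regularity_principal ι n s C₀ c hC0 hc0 (k + 1) (by omega)
    set K := ((Fintype.card (ι × Fin n ⊕ ι) : ℕ) : ℝ) with hK
    have hK0 : 0 ≤ K := by positivity
    refine ⟨C' * (1 + C + K * (C₀ * C)), by positivity,
      fun lam P S U D F B hlam hP hS hS0 hcP hcQ hU h hF q => ?_⟩
    have hB := (hF q).nonneg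
    have hJ := hreg lam P S U D F B hlam hP hS hS0 hcP hcQ hU h hF
    have hCB : 0 ≤ C * B := mul_nonneg hC hB
    set I : ι × Fin n ⊕ ι → Sp n → ℝ := fun r x => (jetWeight n lam r)⁻¹ * jet lam U D r x
    have hI : ∀ r, SB 2 k (C * B) (I r) := fun r =>
      ((hJ r).const_mul _).mono (mul_le_of_le_one_left hCB (abs_jetWeight_inv_le hlam r))
    -- This is the gain that drives the induction: ∇Uⱼ is part of the jet, so Uⱼ has one derivative
    -- more than the jet is known to have.
    have hI' : ∀ j, SB 2 (k + 1) (C * B) (I (.inr j)) := fun j => by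
      rcases eq_or_ne (lam j) 0 with hj | hj
      · have : I (.inr j) = fun _ => 0 := by ext x; simp [I, jetWeight, hj]
        rw [this]; exact SB.zero hCB
      · have : I (.inr j) = U j := by ext x; simp [I, jetWeight, jet, hj]
        refine SB.succ (hI _).lb (g := D j) (fun a => ?_) fun a => hJ (.inl (j, a))
        rw [this]; exact hU.wd j a
    -- In a gradient row S meets only undifferentiated unknowns, of order k + 1, so the product may
    -- join F. In the other rows it also meets gradients, only of order k, and has to go into R, for
    -- which order k suffices.
    set F₁ : ι × Fin n ⊕ ι → Sp n → ℝ := fun q x => F q x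
      - ∑ r, Sum.elim (fun _ => S q r x * I r x) (fun _ => 0) q
    set R₁ : ι → Sp n → ℝ := fun i x => - if lam i = 0 then 0 else ∑ r, S (.inr i) r x * I r x
    set B₁ := (1 + C + K * (C₀ * C)) * B
    have hKC : 0 ≤ K * (C₀ * C) * B := by positivity
    have hB₁ : 0 ≤ B₁ := by positivity
    have hF₁ : ∀ q, SB 2 (k + 1) B₁ (F₁ q) := fun q => by
      have h1 : ∀ r, SB 2 (k + 1) (C₀ * (C * B))
          (fun x => Sum.elim (fun _ => S q r x * I r x) (fun _ => 0) q) := fun r => by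
        rcases q with q | i
        · rcases r with r | j
          · simp only [hS0, Sum.elim_inl, Pi.zero_apply, zero_mul]
            exact SB.zero (by positivity)
          · exact (hS _ _).2.2.2 (k + 1) hk _ _ (hI' j)
        · exact SB.zero (by positivity)
      refine (((hF q).of_le hk).sub (by norm_num)
        (SB.sum (by norm_num) Finset.univ fun r _ => h1 r)).mono ?_
      simp only [Finset.sum_const, Finset.card_univ, nsmul_eq_mul, ← hK, B₁]
      nlinarith
    have hR₁ : ∀ i, SB 2 k B₁ (R₁ i) := fun i => by
      by_cases hi : lam i = 0
      · simp only [R₁, hi, if_true]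
        exact (SB.zero hB₁).neg
      · simp only [R₁, hi, if_false]
        refine (SB.sum (by norm_num) Finset.univ fun r _ =>
          (hS (.inr i) r).2.2.2 k (by omega) _ _ (hI r)).neg.mono ?_
        simp only [Finset.sum_const, Finset.card_univ, nsmul_eq_mul, ← hK, B₁]
        nlinarith
    have hsys : WeakSys lam P U D F₁ R₁ := by
      intro i
      convert h i using 2 with a
      · ext x
        simp only [F₁, fullMat, add_mul, Finset.sum_add_distrib, Sum.elim_inl, I, jetWeight, inv_one,
          one_mul]
        have : ∀ r, (Sum.elim (fun _ => 1) lam r)⁻¹ * S (.inl (i, a)) r x * jet lam U D r x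
          = S (.inl (i, a)) r x * ((Sum.elim (fun _ => 1) lam r)⁻¹ * jet lam U D r x) :=
          fun r => by ring
        rw [Finset.sum_congr rfl fun r _ => this r]
        ring
      · rename_i x
        by_cases hi : lam i = 0
        · simp [hi, R₁]
        · simp only [F₁, R₁, hi, if_false, fullMat, add_mul, Finset.sum_add_distrib, Sum.elim_inr, I,
            Finset.sum_const_zero, Pi.zero_apply]
          have : ∀ r, (jetWeight n lam (.inr i))⁻¹ * (jetWeight n lam r)⁻¹ * S (.inr i) r x
              * jet lam U D r x
            = (lam i)⁻¹ * (S (.inr i) r x * ((jetWeight n lam r)⁻¹ * jet lam U D r x)) :=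
            fun r => by simp only [jetWeight, Sum.elim_inr]; ring
          rw [Finset.sum_congr rfl fun r _ => this r, ← Finset.mul_sum]
          field_simp
          ring
    have := hreg' lam P U D F₁ R₁ B₁ hP hcP hU hsys (fun q => (hJ q).lb.mono ?_) hF₁
      (fun i hi => by ext x; simp [R₁, hi]) hR₁ q
    · rwa [mul_assoc]
    · simp only [B₁]; nlinarith

end Kakinuma

namespace Kakinuma
open Filter Topology

/-! ### Gram matrices of monomials -/

/-- A polynomial with infinitely many zeros vanishes, and distinct exponents keep its coefficients
apart. -/
theorem sum_monomial_eq_zero {K : ℕ} {r : Fin K → ℕ} (hr : Function.Injective r) {c : ℝ}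
    (hc : 0 < c) {x : Fin K → ℝ} (h : ∀ z ∈ Set.Ioo 0 c, ∑ i, x i * z ^ r i = 0) : x = 0 := by
  set f : Polynomial ℝ := ∑ i, Polynomial.monomial (r i) (x i)
  have hf : f = 0 := by
    refine Polynomial.eq_zero_of_infinite_isRoot f ((Set.Ioo_infinite hc).mono fun z hz => ?_)
    simp only [Set.mem_ofPred_eq, Polynomial.IsRoot, f, Polynomial.eval_finsetSum,
      Polynomial.eval_monomial]
    exact h z hz
  ext i
  have h1 : f.coeff (r i) = x i := by
    simp only [f, Polynomial.finsetSum_coeff, Polynomial.coeff_monomial]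
    rw [Finset.sum_eq_single i]
    · simp
    · intro j _ hj; simp [hr.ne hj]
    · simp
  rw [← h1, hf]; simp

theorem continuous_sum_monomial {K : ℕ} (r : Fin K → ℕ) (x : Fin K → ℝ) :
    Continuous fun z : ℝ => ∑ i, x i * z ^ r i := by fun_prop

theorem integral_sum_monomial_mul {K : ℕ} (r : Fin K → ℕ) (x y : Fin K → ℝ) (c : ℝ) :
    ∫ z in (0 : ℝ)..c, (∑ i, x i * z ^ r i) * (∑ i, y i * z ^ r i)
      = ∑ i, ∑ j, x i * y j * (c ^ (r i + r j + 1) / (r i + r j + 1)) := by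
  have h : ∀ z : ℝ, (∑ i, x i * z ^ r i) * (∑ i, y i * z ^ r i)
      = ∑ i, ∑ j, x i * y j * z ^ (r i + r j) := fun z => by
    rw [Finset.sum_mul_sum]
    refine Finset.sum_congr rfl fun i _ => Finset.sum_congr rfl fun j _ => ?_
    rw [pow_add]; ring
  simp only [h]
  rw [intervalIntegral.integral_finsetSum fun i _ => Continuous.intervalIntegrable (by fun_prop) _ _]
  refine Finset.sum_congr rfl fun i _ => ?_
  rw [intervalIntegral.integral_finsetSum fun j _ => Continuous.intervalIntegrable (by fun_prop) _ _]
  refine Finset.sum_congr rfl fun j _ => ?_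
  rw [intervalIntegral.integral_const_mul, integral_pow]
  simp

/-- A continuous quadratic form that is positive on the unit sphere has a positive minimum there;
positivity is linear independence of the monomials on (0, c). -/
theorem exists_gram_bound {K : ℕ} {r : Fin K → ℕ} (hr : Function.Injective r) {c : ℝ}
    (hc : 0 < c) : ∃ g : ℝ, 0 < g ∧ ∀ x : Fin K → ℝ,
      g * ∑ i, x i ^ 2 ≤ ∫ z in (0 : ℝ)..c, (∑ i, x i * z ^ r i) ^ 2 := by
  set q : EuclideanSpace ℝ (Fin K) → ℝ := fun x => ∫ z in (0 : ℝ)..c, (∑ i, x i * z ^ r i) ^ 2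
  have hq : ∀ x, q x = ∑ i, ∑ j, x i * x j * (c ^ (r i + r j + 1) / (r i + r j + 1)) := fun x => by
    simp only [q, sq]; exact integral_sum_monomial_mul r _ _ c
  have hqc : Continuous q := by
    have : q = fun x => ∑ i, ∑ j, x i * x j * (c ^ (r i + r j + 1) / ((r i : ℝ) + r j + 1)) :=
      funext hq
    rw [this]; fun_prop
  have hpos : ∀ x, x ≠ 0 → 0 < q x := fun x hx => by
    have h0 : 0 ≤ q x := intervalIntegral.integral_nonneg hc.le fun z _ => sq_nonneg _
    refine lt_of_le_of_ne h0 fun h => hx ?_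
    have hcont : Continuous fun z : ℝ => (∑ i, x i * z ^ r i) ^ 2 :=
      (continuous_sum_monomial r x.ofLp).pow 2
    have h2 : ∀ z ∈ Set.Ioo 0 c, ∑ i, x i * z ^ r i = 0 := by
      intro z hz
      by_contra hne
      refine (intervalIntegral.integral_pos hc hcont.continuousOn (fun z _ => sq_nonneg _)
        ⟨z, ⟨hz.1.le, hz.2.le⟩, by positivity⟩).ne h
    ext i
    exact congrFun (sum_monomial_eq_zero hr hc h2) i
  have hnorm : ∀ x : EuclideanSpace ℝ (Fin K), ‖x‖ ^ 2 = ∑ i, x i ^ 2 := fun x => by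
    rw [EuclideanSpace.norm_sq_eq]; simp
  have hex : ∃ g : ℝ, 0 < g ∧ ∀ x ∈ Metric.sphere (0 : EuclideanSpace ℝ (Fin K)) 1, g ≤ q x := by
    -- The sphere is empty for K = 0.
    rcases (Metric.sphere (0 : EuclideanSpace ℝ (Fin K)) 1).eq_empty_or_nonempty with he | hne
    · exact ⟨1, one_pos, by simp [he]⟩
    · obtain ⟨x, hx, hmin⟩ := (isCompact_sphere (0 : EuclideanSpace ℝ (Fin K)) 1).exists_isMinOn hne
        hqc.continuousOn
      exact ⟨q x, hpos x (fun h => by simp [h] at hx), fun y hy => hmin hy⟩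
  obtain ⟨g, hg, hmin⟩ := hex
  refine ⟨g, hg, fun x => ?_⟩
  set v : EuclideanSpace ℝ (Fin K) := WithLp.toLp 2 x
  change g * ∑ i, v i ^ 2 ≤ q v
  rw [← hnorm]
  rcases eq_or_ne v 0 with h0 | h0
  · rw [h0, hq]; simp
  · have hn : 0 < ‖v‖ := norm_pos_iff.2 h0
    have h1 := hmin (‖v‖⁻¹ • v) (by simp [norm_smul, hn.ne'])
    have h2 : q (‖v‖⁻¹ • v) = (‖v‖⁻¹) ^ 2 * q v := by
      rw [hq, hq, Finset.mul_sum]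
      refine Finset.sum_congr rfl fun i _ => ?_
      rw [Finset.mul_sum]
      refine Finset.sum_congr rfl fun j _ => ?_
      simp only [PiLp.smul_apply, smul_eq_mul]; ring
    rw [h2, inv_pow, ← div_eq_inv_mul, le_div_iff₀ (by positivity)] at h1
    exact h1

/-! ### The pointwise form of a layer -/

variable {n K : ℕ}

/-- The integrand of `Lpair`. -/
noncomputable def pairForm (p : Fin K → ℕ) (H μ : ℝ) (β : Fin n → ℝ) (i j : Fin K)
    (v v' : (Fin n → ℝ) × ℝ) : ℝ :=
  (∑ a, (1 / ((p i : ℝ) + p j + 1) * H ^ (p i + p j + 1) * v.1 a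
      - (p j : ℝ) / ((p i : ℝ) + p j) * H ^ (p i + p j) * v.2 * β a) * v'.1 a)
    - (p i : ℝ) / ((p i : ℝ) + p j) * H ^ (p i + p j) * (∑ a, β a * v.1 a) * v'.2
    + (p i : ℝ) * p j / ((p i : ℝ) + p j - 1) * H ^ (p i + p j - 1)
        * (μ + ∑ a, β a ^ 2) * v.2 * v'.2

/-- `pairForm` as a bilinear map. -/
noncomputable def pairFormL (p : Fin K → ℕ) (H μ : ℝ) (β : Fin n → ℝ) (i j : Fin K) :
    ((Fin n → ℝ) × ℝ) →ₗ[ℝ] ((Fin n → ℝ) × ℝ) →ₗ[ℝ] ℝ :=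
  LinearMap.mk₂ ℝ (pairForm p H μ β i j)
    (fun v₁ v₂ v' => by
      simp only [pairForm, Prod.fst_add, Prod.snd_add, Pi.add_apply, mul_add, add_mul, sub_mul,
        Finset.sum_add_distrib, Finset.sum_sub_distrib]
      ring)
    (fun c v v' => by
      simp only [pairForm, Prod.smul_fst, Prod.smul_snd, Pi.smul_apply, smul_eq_mul, mul_add,
        mul_sub, Finset.mul_sum, Finset.sum_mul]
      congr 1
      · congr 1
        · exact Finset.sum_congr rfl fun a _ => by ring
        · exact Finset.sum_congr rfl fun a _ => by ring
      · ring_nf)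
    (fun v v₁ v₂ => by
      simp only [pairForm, Prod.fst_add, Prod.snd_add, Pi.add_apply, mul_add, Finset.sum_add_distrib]
      ring)
    (fun c v v' => by
      simp only [pairForm, Prod.smul_fst, Prod.smul_snd, Pi.smul_apply, smul_eq_mul, mul_add,
        mul_sub, Finset.mul_sum, Finset.sum_mul]
      congr 1
      · congr 1
        · exact Finset.sum_congr rfl fun a _ => by ring
        · exact Finset.sum_congr rfl fun a _ => by ring
      · ring_nf)

@[simp]
theorem pairFormL_apply (p : Fin K → ℕ) (H μ : ℝ) (β : Fin n → ℝ) (i j : Fin K)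
    (v v' : (Fin n → ℝ) × ℝ) : pairFormL p H μ β i j v v' = pairForm p H μ β i j v v' := rfl

/-- The pointwise form of a layer. -/
noncomputable def layerForm (p : Fin K → ℕ) (H μ : ℝ) (β : Fin n → ℝ) :
    (Fin K → (Fin n → ℝ) × ℝ) →ₗ[ℝ] (Fin K → (Fin n → ℝ) × ℝ) →ₗ[ℝ] ℝ :=
  ∑ i, ∑ j, (pairFormL p H μ β i j).compl₁₂ (LinearMap.proj j) (LinearMap.proj i)

theorem layerForm_apply (p : Fin K → ℕ) (H μ : ℝ) (β : Fin n → ℝ)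
    (v v' : Fin K → (Fin n → ℝ) × ℝ) :
    layerForm p H μ β v v' = ∑ i, ∑ j, pairForm p H μ β i j (v j) (v' i) := by
  simp [layerForm, LinearMap.sum_apply]

/-- This is where the convention 0/0 = 0 is seen to be the right one: for j = 0 the derivative of
z^j vanishes, also if i = 0. -/
theorem integral_pow_mul_deriv (H : ℝ) (i j : ℕ) :
    ∫ z in (0 : ℝ)..H, z ^ i * (j * z ^ (j - 1)) = (j : ℝ) / (i + j) * H ^ (i + j) := by
  rcases j with _ | j
  · simp
  · have : ∀ z : ℝ, z ^ i * (((j + 1 : ℕ) : ℝ) * z ^ (j + 1 - 1)) = ((j + 1 : ℕ) : ℝ) * z ^ (i + j) :=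
      fun z => by rw [Nat.add_sub_cancel, pow_add]; ring
    simp only [this]
    rw [intervalIntegral.integral_const_mul, integral_pow]
    push_cast
    rw [zero_pow (by omega), sub_zero, ← add_assoc, ← add_assoc]
    ring

/-- The truncated exponent i + j − 1 differs from the true one only for i = j = 0, where the
coefficient vanishes. -/
theorem integral_deriv_mul_deriv (H : ℝ) (i j : ℕ) :
    ∫ z in (0 : ℝ)..H, (i * z ^ (i - 1)) * (j * z ^ (j - 1))
      = (i : ℝ) * j / ((i : ℝ) + j - 1) * H ^ (i + j - 1) := by
  rcases i with _ | i
  · simp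
  rcases j with _ | j
  · simp
  have : ∀ z : ℝ, (((i + 1 : ℕ) : ℝ) * z ^ (i + 1 - 1)) * (((j + 1 : ℕ) : ℝ) * z ^ (j + 1 - 1))
      = ((i + 1 : ℕ) : ℝ) * ((j + 1 : ℕ) : ℝ) * z ^ (i + j) :=
    fun z => by rw [Nat.add_sub_cancel, Nat.add_sub_cancel, pow_add]; ring
  simp only [this]
  rw [intervalIntegral.integral_const_mul, integral_pow, show i + 1 + (j + 1) - 1 = i + j + 1 by omega,
    zero_pow (by omega), sub_zero]
  push_cast
  rw [show (i : ℝ) + 1 + (j + 1) - 1 = i + j + 1 by ring]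
  ring

/-- The form of a layer is an integral over the depth. -/
theorem layerForm_self (p : Fin K → ℕ) (H μ : ℝ) (β : Fin n → ℝ) (v : Fin K → (Fin n → ℝ) × ℝ) :
    layerForm p H μ β v v = ∫ z in (0 : ℝ)..H,
      ((∑ a, ((∑ i, (v i).1 a * z ^ p i) - β a * ∑ i, p i * (v i).2 * z ^ (p i - 1)) ^ 2)
        + μ * (∑ i, p i * (v i).2 * z ^ (p i - 1)) ^ 2) := by
  have hz : ∀ z : ℝ, (∑ a, ((∑ i, (v i).1 a * z ^ p i)
        - β a * ∑ i, p i * (v i).2 * z ^ (p i - 1)) ^ 2)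
        + μ * (∑ i, p i * (v i).2 * z ^ (p i - 1)) ^ 2
      = ∑ i, ∑ j, ((∑ a, (v i).1 a * (v j).1 a) * (z ^ p i * z ^ p j)
          - (∑ a, β a * (v i).1 a) * (v j).2 * (z ^ p i * (p j * z ^ (p j - 1)))
          - (∑ a, β a * (v j).1 a) * (v i).2 * (z ^ p j * (p i * z ^ (p i - 1)))
          + (μ + ∑ a, β a ^ 2) * (v i).2 * (v j).2
            * ((p i * z ^ (p i - 1)) * (p j * z ^ (p j - 1)))) := fun z => by
    have h1 : ∀ a, (∑ i, (v i).1 a * z ^ p i) - β a * ∑ i, p i * (v i).2 * z ^ (p i - 1)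
        = ∑ i, ((v i).1 a * z ^ p i - β a * (p i * (v i).2 * z ^ (p i - 1))) := fun a => by
      rw [Finset.mul_sum, Finset.sum_sub_distrib]
    simp only [h1, sq (∑ i, _), Finset.sum_mul_sum]
    rw [Finset.sum_comm, Finset.mul_sum, ← Finset.sum_add_distrib]
    refine Finset.sum_congr rfl fun i _ => ?_
    rw [Finset.sum_comm, Finset.mul_sum, ← Finset.sum_add_distrib]
    refine Finset.sum_congr rfl fun j _ => ?_
    simp only [add_mul, Finset.sum_mul]
    rw [← Finset.sum_sub_distrib, ← Finset.sum_sub_distrib, add_comm (μ * _ * _ * _), ← add_assoc,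
      ← Finset.sum_add_distrib]
    congr 1
    · exact Finset.sum_congr rfl fun a _ => by ring
    · ring
  simp only [hz]
  rw [layerForm_apply,
    intervalIntegral.integral_finsetSum fun i _ => Continuous.intervalIntegrable (by fun_prop) _ _]
  refine Finset.sum_congr rfl fun i _ => ?_
  rw [intervalIntegral.integral_finsetSum fun j _ => Continuous.intervalIntegrable (by fun_prop) _ _]
  refine Finset.sum_congr rfl fun j _ => ?_
  rw [intervalIntegral.integral_add (Continuous.intervalIntegrable (by fun_prop) _ _)
      (Continuous.intervalIntegrable (by fun_prop) _ _),
    intervalIntegral.integral_sub (Continuous.intervalIntegrable (by fun_prop) _ _)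
      (Continuous.intervalIntegrable (by fun_prop) _ _),
    intervalIntegral.integral_sub (Continuous.intervalIntegrable (by fun_prop) _ _)
      (Continuous.intervalIntegrable (by fun_prop) _ _)]
  simp only [intervalIntegral.integral_const_mul _, integral_pow_mul_deriv,
    integral_deriv_mul_deriv]
  have h0 : ∫ z in (0 : ℝ)..H, z ^ p i * z ^ p j = 1 / ((p i : ℝ) + p j + 1) * H ^ (p i + p j + 1) := by
    simp only [← pow_add]
    rw [integral_pow]
    push_cast
    rw [zero_pow (by omega), sub_zero]; ring
  have e1 : ∑ a, (1 / ((p i : ℝ) + p j + 1) * H ^ (p i + p j + 1) * (v j).1 a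
      - (p j : ℝ) / ((p i : ℝ) + p j) * H ^ (p i + p j) * (v j).2 * β a) * (v i).1 a
      = 1 / ((p i : ℝ) + p j + 1) * H ^ (p i + p j + 1) * (∑ a, (v i).1 a * (v j).1 a)
        - (p j : ℝ) / ((p i : ℝ) + p j) * H ^ (p i + p j) * (v j).2 * ∑ a, β a * (v i).1 a := by
    rw [Finset.mul_sum, Finset.mul_sum, ← Finset.sum_sub_distrib]
    exact Finset.sum_congr rfl fun a _ => by ring
  rw [h0, pairForm, e1, add_comm (p j) (p i), add_comm (p j : ℝ) (p i : ℝ)]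
  ring

/-- Coercivity of the form of a layer. -/
theorem exists_layer_bound {p : Fin (K + 1) → ℕ} (hp0 : p 0 = 0) (hp : StrictMono p)
    {c₀ M : ℝ} (hc₀ : 0 < c₀) : ∃ c : ℝ, 0 < c ∧ ∀ (H μ : ℝ) (β : Fin n → ℝ)
      (v : Fin (K + 1) → (Fin n → ℝ) × ℝ), c₀ ≤ H → ∑ a, β a ^ 2 ≤ M → 1 ≤ μ →
      c * ((∑ i, ∑ a, (v i).1 a ^ 2) + μ * ∑ j : Fin K, (v j.succ).2 ^ 2)
        ≤ layerForm p H μ β v v := by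
  have hpos : ∀ j : Fin K, 1 ≤ p j.succ := fun j => by
    have := hp (Fin.succ_pos j); omega
  obtain ⟨g₁, hg₁, h₁⟩ := exists_gram_bound hp.injective hc₀
  -- The vertical derivative involves the exponents pⱼ − 1 with j ≥ 1. They remain distinct because
  -- pⱼ ≥ 1, so that the truncated subtraction is injective.
  obtain ⟨g₂, hg₂, h₂⟩ := exists_gram_bound (r := fun j : Fin K => p j.succ - 1)
    (fun i j hij => by
      have h1 := hpos i
      have h2 := hpos j
      have : p i.succ = p j.succ := by simp only at hij; omega
      exact Fin.succ_injective _ (hp.injective this)) hc₀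
  set M' := max M 0
  have hM' : 0 ≤ M' := le_max_right _ _
  -- For θ ≤ 1 one has (f − βg)² ≥ (θ/2)f² − θβ²g². The choice of θ makes the loss at most g²/2,
  -- which half of μg² absorbs since μ ≥ 1.
  set θ : ℝ := 1 / (2 * (1 + M')) with hθ
  have hθ0 : 0 < θ := by positivity
  have hθM : θ * M' ≤ 1 / 2 := by
    rw [hθ, div_mul_eq_mul_div, div_le_div_iff₀ (by positivity) (by norm_num)]; linarith
  have hθ1 : θ ≤ 1 := by
    rw [hθ, div_le_one (by positivity)]; linarith
  refine ⟨min (θ / 2 * g₁) (g₂ / 2), by positivity, fun H μ β v hH hβ hμ => ?_⟩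
  set f : Fin n → ℝ → ℝ := fun a z => ∑ i, (v i).1 a * z ^ p i
  set g : ℝ → ℝ := fun z => ∑ i, p i * (v i).2 * z ^ (p i - 1)
  have hf : ∀ a, Continuous (f a) := fun a => by fun_prop
  have hg : Continuous g := by fun_prop
  have hH0 : 0 ≤ H := hc₀.le.trans hH
  have hlow : ∀ z, θ / 2 * ∑ a, f a z ^ 2 + μ / 2 * g z ^ 2
      ≤ (∑ a, (f a z - β a * g z) ^ 2) + μ * g z ^ 2 := fun z => by
    have h1 : ∀ a, θ / 2 * f a z ^ 2 - θ * (β a ^ 2 * g z ^ 2) ≤ (f a z - β a * g z) ^ 2 := fun a => by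
      nlinarith [sq_nonneg (f a z - 2 * (β a * g z)), sq_nonneg (f a z - β a * g z)]
    have h2 := Finset.sum_le_sum fun a (_ : a ∈ Finset.univ) => h1 a
    rw [Finset.sum_sub_distrib, ← Finset.mul_sum, ← Finset.mul_sum, ← Finset.sum_mul] at h2
    have h3 : θ * ((∑ a, β a ^ 2) * g z ^ 2) ≤ 1 / 2 * g z ^ 2 := by
      rw [← mul_assoc]
      refine mul_le_mul_of_nonneg_right ?_ (sq_nonneg _)
      exact (mul_le_mul_of_nonneg_left (hβ.trans (le_max_left _ _)) hθ0.le).trans hθM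
    nlinarith [sq_nonneg (g z)]
  have e1 : ∫ z in (0 : ℝ)..H, (θ / 2 * ∑ a, f a z ^ 2 + μ / 2 * g z ^ 2) ≤ layerForm p H μ β v v := by
    rw [layerForm_self]
    exact intervalIntegral.integral_mono_on hH0
      (Continuous.intervalIntegrable (by fun_prop) _ _)
      (Continuous.intervalIntegrable (by fun_prop) _ _) fun z _ => hlow z
  have e2 : ∫ z in (0 : ℝ)..H, (θ / 2 * ∑ a, f a z ^ 2 + μ / 2 * g z ^ 2)
      = θ / 2 * ∑ a, (∫ z in (0 : ℝ)..H, f a z ^ 2) + μ / 2 * ∫ z in (0 : ℝ)..H, g z ^ 2 := by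
    rw [intervalIntegral.integral_add (Continuous.intervalIntegrable (by fun_prop) _ _)
      (Continuous.intervalIntegrable (by fun_prop) _ _), intervalIntegral.integral_const_mul,
      intervalIntegral.integral_const_mul, intervalIntegral.integral_finsetSum fun a _ =>
        Continuous.intervalIntegrable (by fun_prop) _ _]
  -- The integrands are nonnegative, so the depth may be shortened to c₀, where the Gram bounds hold
  -- with fixed constants.
  have hmono : ∀ u : ℝ → ℝ, Continuous u →
      ∫ z in (0 : ℝ)..c₀, u z ^ 2 ≤ ∫ z in (0 : ℝ)..H, u z ^ 2 := fun u hu => by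
    refine intervalIntegral.integral_mono_interval le_rfl hc₀.le hH
      (Eventually.of_forall fun z => sq_nonneg _) (Continuous.intervalIntegrable (by fun_prop) _ _)
  have e3 : ∀ a, g₁ * ∑ i, (v i).1 a ^ 2 ≤ ∫ z in (0 : ℝ)..H, f a z ^ 2 := fun a =>
    (h₁ fun i => (v i).1 a).trans (hmono _ (hf a))
  have hg0 : ∀ z, g z = ∑ j : Fin K, (p j.succ * (v j.succ).2) * z ^ (p j.succ - 1) := fun z =>
    (Fin.sum_univ_succ _).trans (by simp [hp0])
  have e4 : g₂ * ∑ j : Fin K, (v j.succ).2 ^ 2 ≤ ∫ z in (0 : ℝ)..H, g z ^ 2 := by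
    refine le_trans ?_ (hmono g hg)
    simp only [hg0]
    refine le_trans ?_ (h₂ fun j => p j.succ * (v j.succ).2)
    refine mul_le_mul_of_nonneg_left (Finset.sum_le_sum fun j _ => ?_) hg₂.le
    rw [mul_pow]
    refine le_mul_of_one_le_left (sq_nonneg _) (one_le_pow₀ ?_)
    exact_mod_cast hpos j
  have e5 : g₁ * ∑ i, ∑ a, (v i).1 a ^ 2 ≤ ∑ a, ∫ z in (0 : ℝ)..H, f a z ^ 2 := by
    rw [Finset.sum_comm, Finset.mul_sum]
    exact Finset.sum_le_sum fun a _ => e3 a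
  rw [e2] at e1
  refine le_trans ?_ e1
  have hX : 0 ≤ ∑ i, ∑ a, (v i).1 a ^ 2 :=
    Finset.sum_nonneg fun i _ => Finset.sum_nonneg fun a _ => sq_nonneg _
  have hy : 0 ≤ ∑ j : Fin K, (v j.succ).2 ^ 2 := Finset.sum_nonneg fun j _ => sq_nonneg _
  rw [mul_add]
  refine add_le_add ?_ ?_
  · calc _ ≤ θ / 2 * g₁ * ∑ i, ∑ a, (v i).1 a ^ 2 :=
          mul_le_mul_of_nonneg_right (min_le_left _ _) hX
      _ ≤ _ := by rw [mul_assoc]; exact mul_le_mul_of_nonneg_left e5 (by positivity)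
  · have hμ0 : 0 ≤ μ := zero_le_one.trans hμ
    calc _ ≤ g₂ / 2 * (μ * ∑ j : Fin K, (v j.succ).2 ^ 2) :=
          mul_le_mul_of_nonneg_right (min_le_right _ _) (mul_nonneg hμ0 hy)
      _ = μ / 2 * (g₂ * ∑ j : Fin K, (v j.succ).2 ^ 2) := by ring
      _ ≤ _ := mul_le_mul_of_nonneg_left e4 (by positivity)

end Kakinuma

namespace Kakinuma
open Filter Topology

/-! ### Uniform multipliers -/

variable {n K : ℕ} {Θ : Type*}

/-- Families of functions that are multipliers with a common bound. -/
def multAlg (Θ : Type*) (n s : ℕ) : Subalgebra ℝ (Θ → Sp n → ℝ) where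
  carrier := {f | ∃ C, ∀ θ, Mult s C (f θ)}
  mul_mem' := by
    rintro f g ⟨C, hC⟩ ⟨C', hC'⟩
    exact ⟨C * C', fun θ => (hC θ).mul (hC' θ)⟩
  add_mem' := by
    rintro f g ⟨C, hC⟩ ⟨C', hC'⟩
    exact ⟨C + C', fun θ => (hC θ).add (hC' θ)⟩
  algebraMap_mem' c := ⟨|c|, fun _ => Mult.const s c⟩

/-- Families of functions that are multipliers together with their first derivatives, with a common
bound. -/
def multAlg1 (Θ : Type*) (n s : ℕ) : Subalgebra ℝ (Θ → Sp n → ℝ) where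
  carrier := {f | ∃ C, ∀ θ, Mult1 s C (f θ)}
  mul_mem' := by
    rintro f g ⟨C, hC⟩ ⟨C', hC'⟩
    exact ⟨2 * (C * C'), fun θ => (hC θ).mul (hC' θ)⟩
  add_mem' := by
    rintro f g ⟨C, hC⟩ ⟨C', hC'⟩
    exact ⟨C + C', fun θ => (hC θ).add (hC' θ)⟩
  algebraMap_mem' c := ⟨|c|, fun _ => Mult1.const s c⟩

theorem multAlg1_le {s : ℕ} : multAlg1 Θ n s ≤ multAlg Θ n s := by
  rintro f ⟨C, hC⟩
  exact ⟨C, fun θ => (hC θ).1⟩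

theorem const_mem_multAlg1 {s : ℕ} {c : Θ → ℝ} {M : ℝ} (hc : ∀ θ, |c θ| ≤ M) :
    (fun θ _ => c θ) ∈ multAlg1 Θ n s :=
  ⟨M, fun θ => (Mult1.const s (c θ)).mono (hc θ)⟩

section

variable (A : Subalgebra ℝ (Θ → Sp n → ℝ))

theorem mem_const (c : ℝ) : (fun _ _ => c) ∈ A := A.algebraMap_mem c

theorem mem_mul {f g : Θ → Sp n → ℝ} (hf : f ∈ A) (hg : g ∈ A) : (fun θ x => f θ x * g θ x) ∈ A :=
  A.mul_mem hf hg

theorem mem_add {f g : Θ → Sp n → ℝ} (hf : f ∈ A) (hg : g ∈ A) : (fun θ x => f θ x + g θ x) ∈ A :=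
  A.add_mem hf hg

theorem mem_sub {f g : Θ → Sp n → ℝ} (hf : f ∈ A) (hg : g ∈ A) : (fun θ x => f θ x - g θ x) ∈ A :=
  A.sub_mem hf hg

theorem mem_pow {f : Θ → Sp n → ℝ} (hf : f ∈ A) (k : ℕ) : (fun θ x => f θ x ^ k) ∈ A :=
  A.pow_mem hf k

theorem mem_sum {α : Type*} (t : Finset α) {f : α → Θ → Sp n → ℝ} (hf : ∀ i, f i ∈ A) :
    (fun θ x => ∑ i ∈ t, f i θ x) ∈ A := by
  have := A.sum_mem (t := t) fun i _ => hf i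
  convert this using 1
  ext θ x; simp

/-- The form is polynomial in H, β, μ and its arguments, so membership in any subalgebra is
inherited. Uniform multiplier bounds for the matrices thus become pure algebra. -/
theorem mem_pairForm {p : Fin K → ℕ} {H : Θ → Sp n → ℝ} {β : Fin n → Θ → Sp n → ℝ}
    {μ : Θ → Sp n → ℝ} {v v' : Θ → Sp n → (Fin n → ℝ) × ℝ} (hH : H ∈ A) (hβ : ∀ a, β a ∈ A)
    (hμ : μ ∈ A) (h1 : ∀ a, (fun θ x => (v θ x).1 a) ∈ A) (h2 : (fun θ x => (v θ x).2) ∈ A)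
    (h1' : ∀ a, (fun θ x => (v' θ x).1 a) ∈ A) (h2' : (fun θ x => (v' θ x).2) ∈ A) (i j : Fin K) :
    (fun θ x => pairForm p (H θ x) (μ θ x) (fun a => β a θ x) i j (v θ x) (v' θ x)) ∈ A := by
  unfold pairForm
  have c := mem_const A
  refine mem_add A (mem_sub A ?_ ?_) ?_
  · refine mem_sum A _ fun a => mem_mul A (mem_sub A ?_ ?_) (h1' a)
    · exact mem_mul A (mem_mul A (c _) (mem_pow A hH _)) (h1 a)
    · exact mem_mul A (mem_mul A (mem_mul A (c _) (mem_pow A hH _)) h2) (hβ a)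
  · exact mem_mul A (mem_mul A (mem_mul A (c _) (mem_pow A hH _))
      (mem_sum A _ fun a => mem_mul A (hβ a) (h1 a))) h2'
  · exact mem_mul A (mem_mul A (mem_mul A (mem_mul A (c _) (mem_pow A hH _))
      (mem_add A hμ (mem_sum A _ fun a => mem_pow A (hβ a) 2))) h2) h2'

theorem mem_layerForm {p : Fin K → ℕ} {H : Θ → Sp n → ℝ} {β : Fin n → Θ → Sp n → ℝ}
    {μ : Θ → Sp n → ℝ} {v v' : Θ → Sp n → Fin K → (Fin n → ℝ) × ℝ} (hH : H ∈ A)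
    (hβ : ∀ a, β a ∈ A) (hμ : μ ∈ A) (h1 : ∀ i a, (fun θ x => (v θ x i).1 a) ∈ A)
    (h2 : ∀ i, (fun θ x => (v θ x i).2) ∈ A)
    (h1' : ∀ i a, (fun θ x => (v' θ x i).1 a) ∈ A) (h2' : ∀ i, (fun θ x => (v' θ x i).2) ∈ A) :
    (fun θ x => layerForm p (H θ x) (μ θ x) (fun a => β a θ x) (v θ x) (v' θ x)) ∈ A := by
  simp only [layerForm_apply]
  exact mem_sum A _ fun i => mem_sum A _ fun j =>
    mem_pairForm A hH hβ hμ (h1 j) (h2 j) (h1' i) (h2' i) i j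

end

/-! ### The variables of a layer -/

variable {ι : Type*}

/-- Gradients and values of the unknowns of a layer, with first component `σ u - ∑ⱼ H^{pⱼ} vⱼ`, in
terms of gradients and values of `u` and `v`. -/
noncomputable def layerMap (p : Fin (K + 1) → ℕ) (u : ι) (e : Fin K → ι) (σ H : ℝ)
    (H' : Fin n → ℝ) : (ι × Fin n ⊕ ι → ℝ) →ₗ[ℝ] (Fin (K + 1) → (Fin n → ℝ) × ℝ) where
  toFun z := Fin.cons
    (fun a => σ * z (.inl (u, a)) - ∑ j, (H ^ p j.succ * z (.inl (e j, a))
      + p j.succ * H ^ (p j.succ - 1) * H' a * z (.inr (e j))), 0)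
    fun j => (fun a => z (.inl (e j, a)), z (.inr (e j)))
  map_add' z z' := by
    funext i
    refine Fin.cases ?_ (fun j => ?_) i
    · ext a
      · simp only [Pi.add_apply, Fin.cons_zero, Prod.fst_add, mul_add, Finset.sum_add_distrib]
        ring
      · simp
    · simp only [Pi.add_apply, Fin.cons_succ]; rfl
  map_smul' c z := by
    funext i
    refine Fin.cases ?_ (fun j => ?_) i
    · ext a
      · simp only [Pi.smul_apply, Fin.cons_zero, Prod.smul_fst, smul_eq_mul, RingHom.id_apply,
          mul_sub, Finset.mul_sum]
        congr 1
        · ring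
        · exact Finset.sum_congr rfl fun j _ => by ring
      · simp
    · simp only [Pi.smul_apply, Fin.cons_succ]; rfl

theorem layerMap_zero (p : Fin (K + 1) → ℕ) (u : ι) (e : Fin K → ι) (σ H : ℝ)
    (H' : Fin n → ℝ) (z : ι × Fin n ⊕ ι → ℝ) :
    layerMap p u e σ H H' z 0 = (fun a => σ * z (.inl (u, a)) - ∑ j, (H ^ p j.succ * z (.inl (e j, a))
      + p j.succ * H ^ (p j.succ - 1) * H' a * z (.inr (e j))), 0) := rfl

theorem layerMap_succ (p : Fin (K + 1) → ℕ) (u : ι) (e : Fin K → ι) (σ H : ℝ)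
    (H' : Fin n → ℝ) (z : ι × Fin n ⊕ ι → ℝ) (j : Fin K) :
    layerMap p u e σ H H' z j.succ = (fun a => z (.inl (e j, a)), z (.inr (e j))) := rfl

theorem mem_layerMap (A : Subalgebra ℝ (Θ → Sp n → ℝ)) {p : Fin (K + 1) → ℕ} {u : ι}
    {e : Fin K → ι} {σ H : Θ → Sp n → ℝ} {H' : Fin n → Θ → Sp n → ℝ} (hσ : σ ∈ A) (hH : H ∈ A)
    (hH' : ∀ a, H' a ∈ A) (z : ι × Fin n ⊕ ι → ℝ) (i : Fin (K + 1)) :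
    (∀ a, (fun θ x => (layerMap p u e (σ θ x) (H θ x) (fun a => H' a θ x) z i).1 a) ∈ A) ∧
      (fun θ x => (layerMap p u e (σ θ x) (H θ x) (fun a => H' a θ x) z i).2) ∈ A := by
  have c := mem_const A
  refine Fin.cases ?_ (fun j => ?_) i
  · simp only [layerMap_zero]
    refine ⟨fun a => mem_sub A (mem_mul A hσ (c _)) (mem_sum A _ fun j => mem_add A ?_ ?_), c 0⟩
    · exact mem_mul A (mem_pow A hH _) (c _)
    · exact mem_mul A (mem_mul A (mem_mul A (c _) (mem_pow A hH _)) (hH' a)) (c _)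
  · simp only [layerMap_succ]
    exact ⟨fun a => c _, c _⟩

/-- Coercivity of the form of a layer in terms of `u` and `v`. -/
theorem exists_layerMap_bound (ι : Type*) (n : ℕ) {p : Fin (K + 1) → ℕ} (hp0 : p 0 = 0)
    (hp : StrictMono p) {c₀ M : ℝ} (hc₀ : 0 < c₀) (hM : 0 ≤ M) : ∃ c : ℝ, 0 < c ∧
      ∀ (u : ι) (e : Fin K → ι) (σ H μ : ℝ) (β H' : Fin n → ℝ) (z : ι × Fin n ⊕ ι → ℝ),
      c₀ ≤ H → |H| ≤ M → (∀ a, |H' a| ≤ M) → (∀ a, |β a| ≤ M) → 1 ≤ μ →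
      c * ((∑ a, (σ * z (.inl (u, a))) ^ 2) + (∑ j, ∑ a, z (.inl (e j, a)) ^ 2)
          + μ * ∑ j, z (.inr (e j)) ^ 2)
        ≤ layerForm p H μ β (layerMap p u e σ H H' z) (layerMap p u e σ H H' z) := by
  obtain ⟨c, hc, h⟩ := exists_layer_bound (n := n) hp0 hp (M := n * M ^ 2) hc₀
  set A : Fin K → ℝ := fun j => M ^ p j.succ
  set B : Fin K → ℝ := fun j => p j.succ * M ^ (p j.succ - 1) * M
  set a2 := ∑ j, A j ^ 2
  set b2 := ∑ j, B j ^ 2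
  have ha2 : 0 ≤ a2 := Finset.sum_nonneg fun _ _ => sq_nonneg _
  have hb2 : 0 ≤ b2 := Finset.sum_nonneg fun _ _ => sq_nonneg _
  -- The gradient σ∂ₐu is the sum of three terms: the gradient of the first component, the sum with
  -- H^p ∂ₐv, and the sum with p H^(p−1) ∂ₐH v. Hence the factor 3; `a2` and `b2` come from
  -- Cauchy–Schwarz in the last two.
  set E := 3 * (1 + a2 + n * b2) + 1
  have hE : 0 < E := by positivity
  refine ⟨c / E, by positivity, fun u e σ H μ β H' z hH hHM hH'M hβ hμ => ?_⟩
  set v := layerMap p u e σ H H' z with hv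
  have hβ2 : ∑ a, β a ^ 2 ≤ n * M ^ 2 := by
    calc ∑ a, β a ^ 2 ≤ ∑ _a : Fin n, M ^ 2 :=
          Finset.sum_le_sum fun a _ => by
            rw [← sq_abs]; exact pow_le_pow_left₀ (abs_nonneg _) (hβ a) 2
      _ = _ := by simp
  have h1 := h H μ β v hH hβ2 hμ
  set X := ∑ j : Fin K, ∑ a, z (.inl (e j, a)) ^ 2
  set Y := ∑ j, z (.inr (e j)) ^ 2
  have hY : 0 ≤ Y := Finset.sum_nonneg fun _ _ => sq_nonneg _
  have hX : 0 ≤ X := Finset.sum_nonneg fun _ _ => Finset.sum_nonneg fun _ _ => sq_nonneg _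
  have e1 : ∑ i, ∑ a, (v i).1 a ^ 2 = (∑ a, (v 0).1 a ^ 2) + X := Fin.sum_univ_succ _
  have e2 : ∑ j : Fin K, (v j.succ).2 ^ 2 = Y := rfl
  rw [e1, e2] at h1
  have habs : ∀ a, (σ * z (.inl (u, a))) ^ 2 ≤ 3 * ((v 0).1 a ^ 2
      + a2 * (∑ j, z (.inl (e j, a)) ^ 2) + b2 * Y) := fun a => by
    set s1 := ∑ j, H ^ p j.succ * z (.inl (e j, a))
    set s2 := ∑ j, (p j.succ * H ^ (p j.succ - 1) * H' a) * z (.inr (e j))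
    have es : σ * z (.inl (u, a)) = (v 0).1 a + s1 + s2 := by
      rw [hv, layerMap_zero]
      simp only [Finset.sum_add_distrib, s1, s2]; ring
    have hs1 : s1 ^ 2 ≤ a2 * ∑ j, z (.inl (e j, a)) ^ 2 := by
      refine (Finset.sum_mul_sq_le_sq_mul_sq _ _ _).trans ?_
      refine mul_le_mul_of_nonneg_right (Finset.sum_le_sum fun j _ => ?_)
        (Finset.sum_nonneg fun _ _ => sq_nonneg _)
      rw [← sq_abs (H ^ _), abs_pow]
      exact pow_le_pow_left₀ (by positivity) (pow_le_pow_left₀ (abs_nonneg _) hHM _) 2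
    have hs2 : s2 ^ 2 ≤ b2 * Y := by
      refine (Finset.sum_mul_sq_le_sq_mul_sq _ _ _).trans ?_
      refine mul_le_mul_of_nonneg_right (Finset.sum_le_sum fun j _ => ?_) hY
      rw [← sq_abs (_ * _), abs_mul, abs_mul, abs_pow, Nat.abs_cast]
      refine pow_le_pow_left₀ (by positivity) ?_ 2
      have := hH'M a
      simp only [B]
      gcongr
    rw [es]
    nlinarith [sq_nonneg ((v 0).1 a - s1), sq_nonneg ((v 0).1 a - s2), sq_nonneg (s1 - s2)]
  have hsum : ∑ a, (σ * z (.inl (u, a))) ^ 2 ≤ 3 * ((∑ a, (v 0).1 a ^ 2) + a2 * X + n * (b2 * Y)) := by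
    refine (Finset.sum_le_sum fun a _ => habs a).trans ?_
    rw [← Finset.mul_sum, Finset.sum_add_distrib, Finset.sum_add_distrib, ← Finset.mul_sum,
      Finset.sum_comm (f := fun (a : Fin n) j => z (.inl (e j, a)) ^ 2)]
    simp [X]
  set V := ∑ a, (v 0).1 a ^ 2
  have hV : 0 ≤ V := Finset.sum_nonneg fun _ _ => sq_nonneg _
  refine le_trans ?_ h1
  rw [div_mul_eq_mul_div, div_le_iff₀ hE, mul_assoc]
  refine mul_le_mul_of_nonneg_left ?_ hc.le
  -- The values v are estimated without a factor μ, and μ ≥ 1 restores it.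
  have hYμ : Y ≤ μ * Y := le_mul_of_one_le_left hY hμ
  have hn : (0 : ℝ) ≤ n := Nat.cast_nonneg n
  have hnb : 0 ≤ n * b2 := mul_nonneg hn hb2
  have hμY := hY.trans hYμ
  simp only [E]
  nlinarith [mul_nonneg ha2 hV, mul_nonneg ha2 hX, mul_nonneg ha2 hμY, mul_nonneg hnb hV,
    mul_nonneg hnb hX, mul_nonneg hnb hμY, mul_le_mul_of_nonneg_left hYμ hnb]

end Kakinuma

/-! ### Principal and lower order parts of the matrix of a layer -/

namespace Kakinuma
open Filter Topology

variable {n K : ℕ} {Θ : Type*} {ι : Type*}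

/-- The zeroth order principal part of the form of a layer. -/
noncomputable def massForm (p : Fin K → ℕ) (H : ℝ) (v v' : Fin K → (Fin n → ℝ) × ℝ) : ℝ :=
  ∑ i, ∑ j, (p i : ℝ) * p j / ((p i : ℝ) + p j - 1) * H ^ (p i + p j - 1) * (v j).2 * (v' i).2

/-- The mass term is the only place of μ = (hδ)⁻², the one coefficient that is not bounded
uniformly. -/
theorem layerForm_eq_add (p : Fin K → ℕ) (H μ : ℝ) (β : Fin n → ℝ)
    (v v' : Fin K → (Fin n → ℝ) × ℝ) :
    layerForm p H μ β v v' = layerForm p H 0 β v v' + μ * massForm p H v v' := by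
  simp only [layerForm_apply, massForm, Finset.mul_sum, ← Finset.sum_add_distrib]
  refine Finset.sum_congr rfl fun i _ => Finset.sum_congr rfl fun j _ => ?_
  simp only [pairForm]; ring

/-- Every occurrence of β is accompanied by a zeroth order entry. -/
theorem layerForm_of_snd_eq_zero (p : Fin K → ℕ) (H : ℝ) (β : Fin n → ℝ)
    {v v' : Fin K → (Fin n → ℝ) × ℝ} (hv : ∀ i, (v i).2 = 0) (hv' : ∀ i, (v' i).2 = 0) :
    layerForm p H 0 β v v' = layerForm p H 0 0 v v' := by
  simp [layerForm_apply, pairForm, hv, hv']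

theorem layerMap_snd (p : Fin (K + 1) → ℕ) (u : ι) (e : Fin K → ι) (σ H : ℝ) (H' H'' : Fin n → ℝ)
    (z : ι × Fin n ⊕ ι → ℝ) (i : Fin (K + 1)) :
    (layerMap p u e σ H H' z i).2 = (layerMap p u e σ H H'' z i).2 := by
  refine Fin.cases rfl (fun j => rfl) i

section

variable [DecidableEq ι]

/-- The matrix of the form of a layer. -/
noncomputable def layerMat (p : Fin (K + 1) → ℕ) (u : ι) (e : Fin K → ι) (σ μ : ℝ) (H : Sp n → ℝ)
    (H' β : Fin n → Sp n → ℝ) (q r : ι × Fin n ⊕ ι) (x : Sp n) : ℝ :=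
  layerForm p (H x) μ (fun a => β a x)
    (layerMap p u e σ (H x) (fun a => H' a x) (Pi.single r 1))
    (layerMap p u e σ (H x) (fun a => H' a x) (Pi.single q 1))

theorem layerMap_eq_sum [Fintype ι] (p : Fin (K + 1) → ℕ) (u : ι) (e : Fin K → ι) (σ H : ℝ)
    (H' : Fin n → ℝ) (z : ι × Fin n ⊕ ι → ℝ) :
    layerMap p u e σ H H' z = ∑ r, z r • layerMap p u e σ H H' (Pi.single r 1) := by
  conv_lhs => rw [← Finset.univ_sum_single z]
  rw [map_sum]
  refine Finset.sum_congr rfl fun r _ => ?_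
  rw [← map_smul, ← Pi.single_smul, smul_eq_mul, mul_one]

theorem sum_layerMat [Fintype ι] (p : Fin (K + 1) → ℕ) (u : ι) (e : Fin K → ι) (σ μ : ℝ)
    (H : Sp n → ℝ) (H' β : Fin n → Sp n → ℝ) (w z z' : ι × Fin n ⊕ ι → ℝ) (x : Sp n) :
    ∑ q, ∑ r, (w q)⁻¹ * (w r)⁻¹ * layerMat p u e σ μ H H' β q r x * z r * z' q
      = layerForm p (H x) μ (fun a => β a x)
        (layerMap p u e σ (H x) (fun a => H' a x) fun r => (w r)⁻¹ * z r)
        (layerMap p u e σ (H x) (fun a => H' a x) fun r => (w r)⁻¹ * z' r) := by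
  rw [layerMap_eq_sum p u e σ (H x) _ fun r => (w r)⁻¹ * z r,
    layerMap_eq_sum p u e σ (H x) _ fun r => (w r)⁻¹ * z' r]
  simp only [map_sum, LinearMap.sum_apply, map_smul, LinearMap.smul_apply, smul_eq_mul, layerMat,
    Finset.mul_sum]
  refine Finset.sum_congr rfl fun q _ => Finset.sum_congr rfl fun r _ => by ring

/-- The lower order part of `layerMat`. -/
noncomputable def layerLow (p : Fin (K + 1) → ℕ) (u : ι) (e : Fin K → ι) (σ : ℝ) (H : Sp n → ℝ)
    (H' β : Fin n → Sp n → ℝ) (q r : ι × Fin n ⊕ ι) (x : Sp n) : ℝ :=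
  layerMat p u e σ 0 H H' β q r x - layerMat p u e σ 0 H 0 0 q r x

/-- The mass term sees only zeroth order entries, which do not involve H'. It therefore cancels in
the difference, and the lower order part can be defined with μ = 0. -/
theorem layerMat_eq_add_low (p : Fin (K + 1) → ℕ) (u : ι) (e : Fin K → ι) (σ μ : ℝ) (H : Sp n → ℝ)
    (H' β : Fin n → Sp n → ℝ) (q r : ι × Fin n ⊕ ι) (x : Sp n) :
    layerMat p u e σ μ H H' β q r x
      = layerMat p u e σ μ H 0 0 q r x + layerLow p u e σ H H' β q r x := by
  simp only [layerLow, layerMat, Pi.zero_apply]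
  rw [layerForm_eq_add p (H x) μ, layerForm_eq_add p (H x) μ (fun _ => 0)]
  have : ∀ v w : ι × Fin n ⊕ ι → ℝ,
      massForm p (H x) (layerMap p u e σ (H x) (fun a => H' a x) v)
        (layerMap p u e σ (H x) (fun a => H' a x) w)
      = massForm p (H x) (layerMap p u e σ (H x) (fun _ => 0) v)
        (layerMap p u e σ (H x) (fun _ => 0) w) := fun v w => by
    simp only [massForm]
    refine Finset.sum_congr rfl fun i _ => Finset.sum_congr rfl fun j _ => ?_
    rw [layerMap_snd p u e σ (H x) (fun a => H' a x) (fun _ => 0) v,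
      layerMap_snd p u e σ (H x) (fun a => H' a x) (fun _ => 0) w]
  rw [this]; ring

theorem layerMap_single_inl (p : Fin (K + 1) → ℕ) (u : ι) (e : Fin K → ι) (σ H : ℝ)
    (H' : Fin n → ℝ) (q : ι × Fin n) :
    layerMap p u e σ H H' (Pi.single (.inl q) 1) = layerMap p u e σ H 0 (Pi.single (.inl q) 1) := by
  funext i
  refine Fin.cases ?_ (fun j => rfl) i
  simp [layerMap_zero]

/-- A gradient slot produces no zeroth order entry, so neither H' nor β can appear between two of
them. This is the structural hypothesis of `exists_regularity`. -/
theorem layerLow_inl_inl (p : Fin (K + 1) → ℕ) (u : ι) (e : Fin K → ι) (σ : ℝ) (H : Sp n → ℝ)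
    (H' β : Fin n → Sp n → ℝ) (q r : ι × Fin n) :
    layerLow p u e σ H H' β (.inl q) (.inl r) = 0 := by
  ext x
  have h0 : ∀ (q : ι × Fin n) i,
      (layerMap p u e σ (H x) (0 : Fin n → ℝ) (Pi.single (.inl q) 1) i).2 = 0 := fun q i => by
    refine Fin.cases rfl (fun j => ?_) i
    simp [layerMap_succ]
  simp only [layerLow, layerMat, Pi.zero_apply]
  rw [layerMap_single_inl p u e σ (H x) _ q, layerMap_single_inl p u e σ (H x) _ r,
    layerMap_single_inl p u e σ (H x) (fun _ => 0) q, layerMap_single_inl p u e σ (H x) (fun _ => 0) r,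
    layerForm_of_snd_eq_zero p _ (fun a => β a x) (h0 r) (h0 q),
    layerForm_of_snd_eq_zero p _ (fun _ => 0) (h0 r) (h0 q), sub_self]

theorem mem_layerMat (A : Subalgebra ℝ (Θ → Sp n → ℝ)) {p : Fin (K + 1) → ℕ} {u : ι}
    {e : Fin K → ι} {σ μ : Θ → ℝ} {H : Θ → Sp n → ℝ} {H' β : Θ → Fin n → Sp n → ℝ}
    (hσ : (fun θ _ => σ θ) ∈ A) (hμ : (fun θ _ => μ θ) ∈ A) (hH : H ∈ A)
    (hH' : ∀ a, (fun θ => H' θ a) ∈ A) (hβ : ∀ a, (fun θ => β θ a) ∈ A) (q r : ι × Fin n ⊕ ι) :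
    (fun θ => layerMat p u e (σ θ) (μ θ) (H θ) (H' θ) (β θ) q r) ∈ A :=
  mem_layerForm A (μ := fun θ _ => μ θ) (β := fun a θ => β θ a) hH hβ hμ
    (fun i => (mem_layerMap A (σ := fun θ _ => σ θ) (H' := fun a θ => H' θ a) hσ hH hH' _ i).1)
    (fun i => (mem_layerMap A (σ := fun θ _ => σ θ) (H' := fun a θ => H' θ a) hσ hH hH' _ i).2)
    (fun i => (mem_layerMap A (σ := fun θ _ => σ θ) (H' := fun a θ => H' θ a) hσ hH hH' _ i).1)
    (fun i => (mem_layerMap A (σ := fun θ _ => σ θ) (H' := fun a θ => H' θ a) hσ hH hH' _ i).2)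

theorem mem_layerLow {s : ℕ} {p : Fin (K + 1) → ℕ} {u : ι}
    {e : Fin K → ι} {σ : Θ → ℝ} {H : Θ → Sp n → ℝ} {H' β : Θ → Fin n → Sp n → ℝ}
    (hσ : ∀ θ, |σ θ| ≤ 1) (hH : H ∈ multAlg1 Θ n s)
    (hH' : ∀ a, (fun θ => H' θ a) ∈ multAlg Θ n s) (hβ : ∀ a, (fun θ => β θ a) ∈ multAlg Θ n s)
    (q r : ι × Fin n ⊕ ι) :
    (fun θ => layerLow p u e (σ θ) (H θ) (H' θ) (β θ) q r) ∈ multAlg Θ n s := by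
  have h1 := multAlg1_le (const_mem_multAlg1 (n := n) (s := s) hσ)
  have h0 := mem_const (multAlg Θ n s) 0
  exact mem_sub _ (mem_layerMat _ (μ := fun _ => 0) h1 h0 (multAlg1_le hH) hH' hβ q r)
    (mem_layerMat _ (μ := fun _ => 0) (H' := fun _ => 0) (β := fun _ => 0) h1 h0 (multAlg1_le hH)
      (fun _ => h0) (fun _ => h0) q r)

/-- The principal part of the weighted matrix of a layer is uniformly bounded. -/
theorem mem_layerMat_principal [Fintype ι] {s : ℕ} {p : Fin (K + 1) → ℕ} {u : ι}
    {e : Fin K → ι} {σ l : Θ → ℝ} {H : Θ → Sp n → ℝ} {lam : Θ → ι → ℝ}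
    (hσ : ∀ θ, |σ θ| ≤ 1) (hH : H ∈ multAlg1 Θ n s) (hlam : ∀ θ i, lam θ i = 0 ∨ 1 ≤ lam θ i)
    (hle : ∀ θ j, lam θ (e j) = l θ) (hl : ∀ θ, 1 ≤ l θ) (q r : ι × Fin n ⊕ ι) :
    (fun θ x => (jetWeight n (lam θ) q)⁻¹ * (jetWeight n (lam θ) r)⁻¹
      * layerMat p u e (σ θ) (l θ ^ 2) (H θ) 0 0 q r x) ∈ multAlg1 Θ n s := by
  set A := multAlg1 Θ n s
  have c := mem_const A
  have hσA : (fun θ _ => σ θ) ∈ A := const_mem_multAlg1 hσ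
  have hw : ∀ q, (fun θ (_ : Sp n) => (jetWeight n (lam θ) q)⁻¹) ∈ A := fun q =>
    const_mem_multAlg1 fun θ => abs_jetWeight_inv_le (hlam θ) q
  -- A zeroth order entry is nonzero only in a slot of weight l, so inserting weight⁻¹ · l changes
  -- nothing. Applied to both arguments of the mass term, this consumes the factor l².
  have hsnd : ∀ θ (x : Sp n) (q : ι × Fin n ⊕ ι) i, (jetWeight n (lam θ) q)⁻¹ * l θ
      * (layerMap p u e (σ θ) (H θ x) (0 : Fin n → ℝ) (Pi.single q 1) i).2
      = (layerMap p u e (σ θ) (H θ x) (0 : Fin n → ℝ) (Pi.single q 1) i).2 := fun θ x q i => by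
    refine Fin.cases ?_ (fun j => ?_) i
    · simp [layerMap_zero]
    · simp only [layerMap_succ]
      by_cases hq : q = .inr (e j)
      · subst hq
        have : l θ ≠ 0 := (zero_lt_one.trans_le (hl θ)).ne'
        simp [jetWeight, hle, this]
      · rw [Pi.single_apply, if_neg (fun h => hq h.symm), mul_zero]
  have hmass : ∀ θ (x : Sp n), (jetWeight n (lam θ) q)⁻¹ * (jetWeight n (lam θ) r)⁻¹
      * (l θ ^ 2 * massForm p (H θ x)
        (layerMap p u e (σ θ) (H θ x) (0 : Fin n → ℝ) (Pi.single r 1))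
        (layerMap p u e (σ θ) (H θ x) (0 : Fin n → ℝ) (Pi.single q 1)))
      = massForm p (H θ x) (layerMap p u e (σ θ) (H θ x) (0 : Fin n → ℝ) (Pi.single r 1))
        (layerMap p u e (σ θ) (H θ x) (0 : Fin n → ℝ) (Pi.single q 1)) := fun θ x => by
    simp only [massForm, Finset.mul_sum]
    refine Finset.sum_congr rfl fun i _ => Finset.sum_congr rfl fun j _ => ?_
    conv_rhs => rw [← hsnd θ x r j, ← hsnd θ x q i]
    ring
  have hL := fun q i => mem_layerMap A (p := p) (u := u) (e := e) (σ := fun θ _ => σ θ)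
    (H' := fun _ _ _ => 0) hσA hH (fun _ => c 0) (Pi.single q 1) i
  have h0 := mem_layerMat A (p := p) (u := u) (e := e) (μ := fun _ => 0) (H' := fun _ => 0)
    (β := fun _ => 0) hσA (c 0) hH (fun _ => c 0) (fun _ => c 0) q r
  have hm : (fun θ x => massForm p (H θ x)
      (layerMap p u e (σ θ) (H θ x) (0 : Fin n → ℝ) (Pi.single r 1))
      (layerMap p u e (σ θ) (H θ x) (0 : Fin n → ℝ) (Pi.single q 1))) ∈ A :=
    mem_sum A _ fun i => mem_sum A _ fun j => mem_mul A (mem_mul A (mem_mul A (c _)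
      (mem_pow A hH _)) (hL r j).2) (hL q i).2
  have := mem_add A (mem_mul A (mem_mul A (hw q) (hw r)) h0) hm
  convert this using 1
  funext θ x
  rw [← hmass θ x, ← mul_add]
  congr 1
  exact layerForm_eq_add _ _ _ _ _ _

end

end Kakinuma

/-! ### Physical parameters: uniform multipliers and uniform coercivity -/

namespace Kakinuma
open Filter Topology

variable {n K : ℕ} {Θ : Type*}

theorem mem_multAlg1_of_sobolev {s : ℕ} (hs : n < 2 * s) {f : Θ → Sp n → ℝ} {B : ℝ}
    (h : ∀ θ, SB 2 (s + 1) B (f θ)) : f ∈ multAlg1 Θ n s := by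
  obtain ⟨K, hK, hm⟩ := exists_mult_of_sobolev hs
  refine ⟨K * B, fun θ => ⟨hm _ _ (h θ).pred, fun a => ?_⟩⟩
  obtain ⟨g, h1, h2⟩ := (h θ).2 a
  exact ⟨g, h1, hm _ _ h2⟩

theorem mem_multAlg1_of_top {s : ℕ} {f : Θ → Sp n → ℝ} {B : ℝ}
    (h : ∀ θ, SB ⊤ (s + 1) B (f θ)) : f ∈ multAlg1 Θ n s := by
  refine ⟨2 ^ s * B, fun θ => ⟨.of_top (h θ).pred, fun a => ?_⟩⟩
  obtain ⟨g, h1, h2⟩ := (h θ).2 a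
  exact ⟨g, h1, .of_top h2⟩

theorem wpd_mem_multAlg {s : ℕ} {f : Θ → Sp n → ℝ} (h : f ∈ multAlg1 Θ n s) (a : Fin n) :
    (fun θ => wpd a (f θ)) ∈ multAlg Θ n s := by
  obtain ⟨C, hC⟩ := h
  refine ⟨C, fun θ => ?_⟩
  obtain ⟨g, h1, h2⟩ := (hC θ).2 a
  exact h2.congr h1.wpd_eq.symm

theorem wd_wpd_of_mem {s : ℕ} {f : Θ → Sp n → ℝ} (h : f ∈ multAlg1 Θ n s) (a : Fin n) (θ : Θ) :
    WD a (f θ) (wpd a (f θ)) := by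
  obtain ⟨C, hC⟩ := h
  obtain ⟨g, h1, h2⟩ := (hC θ).2 a
  exact h1.wpd

/-- Physical parameters, interface and bottom subject to the assumptions of the theorem. -/
structure Params (n s : ℕ) (c₀ M₀ : ℝ) where
  (ρ₁ ρ₂ h₁ h₂ δ : ℝ)
  (ζ b : Sp n → ℝ)
  ρ₁_pos : 0 < ρ₁
  ρ₂_pos : 0 < ρ₂
  h₁_pos : 0 < h₁
  h₂_pos : 0 < h₂
  δ_pos : 0 < δ
  ρ_div_h : ρ₁ / h₁ + ρ₂ / h₂ = 1
  h₁δ : h₁ * δ ≤ 1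
  h₂δ : h₂ * δ ≤ 1
  memW_ζ : MemW (s + 1) 2 ζ
  memW_b : MemW (s + 1) ⊤ b
  bound : h₁⁻¹ * wNorm (s + 1) 2 ζ + h₂⁻¹ * wNorm (s + 1) 2 ζ + h₂⁻¹ * wNorm (s + 1) ⊤ b ≤ M₀
  lower : ∀ᵐ x, c₀ ≤ H₁ h₁ ζ x ∧ c₀ ≤ H₂ h₂ ζ b x

namespace Params

variable {s : ℕ} {c₀ M₀ : ℝ} (θ : Params n s c₀ M₀)

/-- Depth of the upper layer. -/
noncomputable def D₁ : Sp n → ℝ := H₁ θ.h₁ θ.ζ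

/-- Depth of the lower layer. -/
noncomputable def D₂ : Sp n → ℝ := H₂ θ.h₂ θ.ζ θ.b

/-- The weight of the upper layer. -/
noncomputable def l₁ : ℝ := (θ.h₁ * θ.δ)⁻¹

/-- The weight of the lower layer. -/
noncomputable def l₂ : ℝ := (θ.h₂ * θ.δ)⁻¹

/-- Together with `s₂` a unit vector (`sq_add_sq`): the entries of the orthogonal matrix that takes
(u, φ) to the scaled traces of the two layers. -/
noncomputable def s₁ : ℝ := √(θ.ρ₁ / θ.h₁)

noncomputable def s₂ : ℝ := √(θ.ρ₂ / θ.h₂)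

theorem one_le_l₁ : 1 ≤ θ.l₁ :=
  (one_le_inv₀ (mul_pos θ.h₁_pos θ.δ_pos)).2 θ.h₁δ

theorem one_le_l₂ : 1 ≤ θ.l₂ :=
  (one_le_inv₀ (mul_pos θ.h₂_pos θ.δ_pos)).2 θ.h₂δ

theorem s₁_sq : θ.s₁ ^ 2 = θ.ρ₁ / θ.h₁ := Real.sq_sqrt (div_pos θ.ρ₁_pos θ.h₁_pos).le

theorem s₂_sq : θ.s₂ ^ 2 = θ.ρ₂ / θ.h₂ := Real.sq_sqrt (div_pos θ.ρ₂_pos θ.h₂_pos).le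

theorem s₁_pos : 0 < θ.s₁ := Real.sqrt_pos.2 (div_pos θ.ρ₁_pos θ.h₁_pos)

theorem s₂_pos : 0 < θ.s₂ := Real.sqrt_pos.2 (div_pos θ.ρ₂_pos θ.h₂_pos)

theorem sq_add_sq : θ.s₁ ^ 2 + θ.s₂ ^ 2 = 1 := by rw [s₁_sq, s₂_sq, θ.ρ_div_h]

theorem abs_s₁_le : |θ.s₁| ≤ 1 := by
  rw [← sq_le_one_iff_abs_le_one]; nlinarith [θ.sq_add_sq, sq_nonneg θ.s₂]

theorem abs_s₂_le : |θ.s₂| ≤ 1 := by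
  rw [← sq_le_one_iff_abs_le_one]; nlinarith [θ.sq_add_sq, sq_nonneg θ.s₁]

theorem bounds : θ.h₁⁻¹ * wNorm (s + 1) 2 θ.ζ ≤ M₀ ∧ θ.h₂⁻¹ * wNorm (s + 1) 2 θ.ζ ≤ M₀ ∧
    θ.h₂⁻¹ * wNorm (s + 1) ⊤ θ.b ≤ M₀ := by
  have h1 := inv_pos.2 θ.h₁_pos
  have h2 := inv_pos.2 θ.h₂_pos
  have a1 := mul_nonneg h1.le (wNorm_nonneg (s + 1) 2 θ.ζ)
  have a2 := mul_nonneg h2.le (wNorm_nonneg (s + 1) 2 θ.ζ)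
  have a3 := mul_nonneg h2.le (wNorm_nonneg (s + 1) ⊤ θ.b)
  have := θ.bound
  exact ⟨by linarith, by linarith, by linarith⟩

theorem bottom_mem : (fun (θ : Params n s c₀ M₀) x => θ.h₂⁻¹ * θ.b x) ∈ multAlg1 _ n s :=
  mem_multAlg1_of_top (B := M₀) fun θ => (θ.memW_b.sb.const_mul θ.h₂⁻¹).mono (by
    rw [abs_of_pos (inv_pos.2 θ.h₂_pos)]; exact θ.bounds.2.2)

theorem D₁_mem (hs : n < 2 * s) : (fun θ : Params n s c₀ M₀ => θ.D₁) ∈ multAlg1 _ n s := by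
  refine mem_sub _ (mem_const _ 1) (mem_multAlg1_of_sobolev (B := M₀) hs fun θ => ?_)
  exact (θ.memW_ζ.sb.const_mul θ.h₁⁻¹).mono (by
    rw [abs_of_pos (inv_pos.2 θ.h₁_pos)]; exact θ.bounds.1)

theorem D₂_mem (hs : n < 2 * s) : (fun θ : Params n s c₀ M₀ => θ.D₂) ∈ multAlg1 _ n s := by
  refine mem_sub _ (mem_add _ (mem_const _ 1) (mem_multAlg1_of_sobolev (B := M₀) hs fun θ => ?_))
    bottom_mem
  exact (θ.memW_ζ.sb.const_mul θ.h₂⁻¹).mono (by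
    rw [abs_of_pos (inv_pos.2 θ.h₂_pos)]; exact θ.bounds.2.1)

/-- The slope of the bottom of the upper layer, which is flat. -/
noncomputable def β₁ (a : Fin n) (x : Sp n) : ℝ := θ.h₁⁻¹ * wpd a 0 x

/-- The slope of the bottom of the lower layer. -/
noncomputable def β₂ (a : Fin n) (x : Sp n) : ℝ := θ.h₂⁻¹ * wpd a θ.b x

/-- The derivative `wpd` of the zero function is a chosen representative and vanishes only almost
everywhere. -/
theorem β₁_mem (a : Fin n) : (fun θ : Params n s c₀ M₀ => θ.β₁ a) ∈ multAlg _ n s := by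
  refine ⟨0, fun θ => (Mult.zero s).congr ?_⟩
  filter_upwards [(WD.const (n := n) a 0).wpd_eq] with x hx
  have : wpd a (0 : Sp n → ℝ) x = 0 := hx
  simp [β₁, this]

theorem β₂_mem (a : Fin n) : (fun θ : Params n s c₀ M₀ => θ.β₂ a) ∈ multAlg _ n s := by
  obtain ⟨C, hC⟩ := wpd_mem_multAlg (bottom_mem (n := n) (s := s) (c₀ := c₀) (M₀ := M₀)) a
  refine ⟨C, fun θ => (hC θ).congr ?_⟩
  obtain ⟨g, h1, h2⟩ := θ.memW_b.sb.2 a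
  exact (h1.wpd.const_mul θ.h₂⁻¹).wpd_eq

variable {N Ns : ℕ}

/-- The weights of the unknowns. -/
noncomputable def lam (N Ns : ℕ) : Unit ⊕ (Fin N ⊕ Fin Ns) → ℝ :=
  Sum.elim (fun _ => 0) (Sum.elim (fun _ => θ.l₁) (fun _ => θ.l₂))

theorem lam_cases (i : Unit ⊕ (Fin N ⊕ Fin Ns)) : θ.lam N Ns i = 0 ∨ 1 ≤ θ.lam N Ns i := by
  rcases i with _ | i | i
  · exact .inl rfl
  · exact .inr θ.one_le_l₁
  · exact .inr θ.one_le_l₂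

/-- The indices of the unknowns of the upper layer. -/
def e₁ (N Ns : ℕ) (j : Fin N) : Unit ⊕ (Fin N ⊕ Fin Ns) := .inr (.inl j)

/-- The indices of the unknowns of the lower layer. -/
def e₂ (N Ns : ℕ) (j : Fin Ns) : Unit ⊕ (Fin N ⊕ Fin Ns) := .inr (.inr j)

/-- The weighted matrix of the two layers, for given slopes. -/
noncomputable def mat (p : Fin (Ns + 1) → ℕ) (G₁ B₁ G₂ B₂ : Fin n → Sp n → ℝ)
    (q r : (Unit ⊕ (Fin N ⊕ Fin Ns)) × Fin n ⊕ (Unit ⊕ (Fin N ⊕ Fin Ns))) (x : Sp n) : ℝ :=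
  (jetWeight n (θ.lam N Ns) q)⁻¹ * (jetWeight n (θ.lam N Ns) r)⁻¹
      * layerMat (evenExp N) (.inl ()) (e₁ N Ns) θ.s₂ (θ.l₁ ^ 2) θ.D₁ G₁ B₁ q r x
    + (jetWeight n (θ.lam N Ns) q)⁻¹ * (jetWeight n (θ.lam N Ns) r)⁻¹
      * layerMat p (.inl ()) (e₂ N Ns) θ.s₁ (θ.l₂ ^ 2) θ.D₂ G₂ B₂ q r x

/-- The lower order part. -/
noncomputable def low (p : Fin (Ns + 1) → ℕ)
    (q r : (Unit ⊕ (Fin N ⊕ Fin Ns)) × Fin n ⊕ (Unit ⊕ (Fin N ⊕ Fin Ns))) (x : Sp n) : ℝ :=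
  layerLow (evenExp N) (.inl ()) (e₁ N Ns) θ.s₂ θ.D₁ (fun a => wpd a θ.D₁) θ.β₁ q r x
    + layerLow p (.inl ()) (e₂ N Ns) θ.s₁ θ.D₂ (fun a => wpd a θ.D₂) θ.β₂ q r x

/-- The slopes only change the lower order part, and `fullMat` gives that part the same inverse
weights that `mat` contains. -/
theorem fullMat_eq (p : Fin (Ns + 1) → ℕ) :
    fullMat (θ.lam N Ns) (θ.mat p 0 0 0 0) (θ.low p)
      = θ.mat p (fun a => wpd a θ.D₁) θ.β₁ (fun a => wpd a θ.D₂) θ.β₂ := by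
  funext q r x
  simp only [fullMat, mat, low]
  rw [layerMat_eq_add_low _ _ _ _ _ _ (fun a => wpd a θ.D₁) θ.β₁,
    layerMat_eq_add_low _ _ _ _ _ _ (fun a => wpd a θ.D₂) θ.β₂]
  ring

theorem mat_mem (hs : n < 2 * s) (p : Fin (Ns + 1) → ℕ)
    (q r : (Unit ⊕ (Fin N ⊕ Fin Ns)) × Fin n ⊕ (Unit ⊕ (Fin N ⊕ Fin Ns))) :
    (fun θ : Params n s c₀ M₀ => θ.mat p 0 0 0 0 q r) ∈ multAlg1 _ n s :=
  mem_add _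
    (mem_layerMat_principal (l := fun θ => θ.l₁) (lam := fun θ => θ.lam N Ns) abs_s₂_le (D₁_mem hs)
      (fun θ => θ.lam_cases) (fun _ _ => rfl) one_le_l₁ q r)
    (mem_layerMat_principal (l := fun θ => θ.l₂) (lam := fun θ => θ.lam N Ns) abs_s₁_le (D₂_mem hs)
      (fun θ => θ.lam_cases) (fun _ _ => rfl) one_le_l₂ q r)

theorem low_mem (hs : n < 2 * s) (p : Fin (Ns + 1) → ℕ)
    (q r : (Unit ⊕ (Fin N ⊕ Fin Ns)) × Fin n ⊕ (Unit ⊕ (Fin N ⊕ Fin Ns))) :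
    (fun θ : Params n s c₀ M₀ => θ.low p q r) ∈ multAlg _ n s :=
  mem_add _
    (mem_layerLow abs_s₂_le (D₁_mem hs) (wpd_mem_multAlg (D₁_mem hs)) β₁_mem q r)
    (mem_layerLow abs_s₁_le (D₂_mem hs) (wpd_mem_multAlg (D₂_mem hs)) β₂_mem q r)

theorem low_inl_inl (p : Fin (Ns + 1) → ℕ) (q r : (Unit ⊕ (Fin N ⊕ Fin Ns)) × Fin n) :
    θ.low p (.inl q) (.inl r) = 0 := by
  funext x
  simp only [low, layerLow_inl_inl]
  simp

/-- The form of both layers. -/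
theorem sum_mat (p : Fin (Ns + 1) → ℕ) (G₁ B₁ G₂ B₂ : Fin n → Sp n → ℝ)
    (z z' : (Unit ⊕ (Fin N ⊕ Fin Ns)) × Fin n ⊕ (Unit ⊕ (Fin N ⊕ Fin Ns)) → ℝ) (x : Sp n) :
    ∑ q, ∑ r, θ.mat p G₁ B₁ G₂ B₂ q r x * z r * z' q
      = layerForm (evenExp N) (θ.D₁ x) (θ.l₁ ^ 2) (fun a => B₁ a x)
          (layerMap (evenExp N) (.inl ()) (e₁ N Ns) θ.s₂ (θ.D₁ x) (fun a => G₁ a x)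
            fun r => (jetWeight n (θ.lam N Ns) r)⁻¹ * z r)
          (layerMap (evenExp N) (.inl ()) (e₁ N Ns) θ.s₂ (θ.D₁ x) (fun a => G₁ a x)
            fun r => (jetWeight n (θ.lam N Ns) r)⁻¹ * z' r)
        + layerForm p (θ.D₂ x) (θ.l₂ ^ 2) (fun a => B₂ a x)
          (layerMap p (.inl ()) (e₂ N Ns) θ.s₁ (θ.D₂ x) (fun a => G₂ a x)
            fun r => (jetWeight n (θ.lam N Ns) r)⁻¹ * z r)
          (layerMap p (.inl ()) (e₂ N Ns) θ.s₁ (θ.D₂ x) (fun a => G₂ a x)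
            fun r => (jetWeight n (θ.lam N Ns) r)⁻¹ * z' r) := by
  simp only [mat, add_mul, Finset.sum_add_distrib, sum_layerMat]

/-- Uniform coercivity. -/
theorem exists_coercive (n s : ℕ) {p : Fin (Ns + 1) → ℕ} (hp0 : p 0 = 0) (hp : StrictMono p)
    (hc₀ : 0 < c₀) {M : ℝ} (hM : 0 ≤ M) : ∃ c : ℝ, 0 < c ∧
    ∀ (θ : Params n s c₀ M₀) (G₁ B₁ G₂ B₂ : Fin n → Sp n → ℝ), (∀ᵐ x, |θ.D₁ x| ≤ M) →
      (∀ᵐ x, |θ.D₂ x| ≤ M) → (∀ a, ∀ᵐ x, |G₁ a x| ≤ M) → (∀ a, ∀ᵐ x, |B₁ a x| ≤ M) →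
      (∀ a, ∀ᵐ x, |G₂ a x| ≤ M) → (∀ a, ∀ᵐ x, |B₂ a x| ≤ M) →
      Coercive (θ.lam N Ns) c (θ.mat (N := N) p G₁ B₁ G₂ B₂) := by
  have hev : StrictMono (evenExp N) := fun i j h => by
    have : (i : ℕ) < j := h
    simp only [evenExp]; omega
  obtain ⟨g₁, hg₁, b₁⟩ := exists_layerMap_bound (Unit ⊕ (Fin N ⊕ Fin Ns)) n (p := evenExp N) rfl
    hev hc₀ hM
  obtain ⟨g₂, hg₂, b₂⟩ := exists_layerMap_bound (Unit ⊕ (Fin N ⊕ Fin Ns)) n hp0 hp hc₀ hM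
  refine ⟨min g₁ g₂, lt_min hg₁ hg₂, fun θ G₁ B₁ G₂ B₂ a1 a2 a3 a4 a5 a6 => ?_⟩
  filter_upwards [a1, a2, ae_all_iff.2 a3, ae_all_iff.2 a4, ae_all_iff.2 a5, ae_all_iff.2 a6,
    θ.lower] with x x1 x2 x3 x4 x5 x6 xl z hz
  rw [sum_mat]
  have hl1 := θ.one_le_l₁
  have hl2 := θ.one_le_l₂
  have c1 := b₁ (.inl ()) (e₁ N Ns) θ.s₂ (θ.D₁ x) (θ.l₁ ^ 2) (fun a => B₁ a x) (fun a => G₁ a x)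
    (fun r => (jetWeight n (θ.lam N Ns) r)⁻¹ * z r) xl.1 x1 x3 x4 (one_le_pow₀ hl1)
  have c2 := b₂ (.inl ()) (e₂ N Ns) θ.s₁ (θ.D₂ x) (θ.l₂ ^ 2) (fun a => B₂ a x) (fun a => G₂ a x)
    (fun r => (jetWeight n (θ.lam N Ns) r)⁻¹ * z r) xl.2 x2 x5 x6 (one_le_pow₀ hl2)
  refine le_trans ?_ (add_le_add c1 c2)
  -- The coefficient μ = l² of the coercivity bound exactly compensates the inverse weights, so the
  -- weighted entries are controlled with a constant independent of δ.
  have m1 : θ.l₁ ^ 2 * ∑ j, ((jetWeight n (θ.lam N Ns) (.inr (e₁ N Ns j)))⁻¹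
      * z (.inr (e₁ N Ns j))) ^ 2 = ∑ j, z (.inr (e₁ N Ns j)) ^ 2 := by
    rw [Finset.mul_sum]
    refine Finset.sum_congr rfl fun j _ => ?_
    have : θ.l₁ ≠ 0 := (zero_lt_one.trans_le hl1).ne'
    simp only [jetWeight, Sum.elim_inr, lam, e₁, Sum.elim_inl]
    field_simp
  have m2 : θ.l₂ ^ 2 * ∑ j, ((jetWeight n (θ.lam N Ns) (.inr (e₂ N Ns j)))⁻¹
      * z (.inr (e₂ N Ns j))) ^ 2 = ∑ j, z (.inr (e₂ N Ns j)) ^ 2 := by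
    rw [Finset.mul_sum]
    refine Finset.sum_congr rfl fun j _ => ?_
    have : θ.l₂ ≠ 0 := (zero_lt_one.trans_le hl2).ne'
    simp only [jetWeight, Sum.elim_inr, lam, e₂]
    field_simp
  rw [m1, m2]
  simp only [jetWeight, Sum.elim_inl, inv_one, one_mul]
  have hz0 : z (.inr (.inl ())) = 0 := hz _ rfl
  have hz2 : ∑ q, z q ^ 2 = (∑ a, z (.inl (.inl (), a)) ^ 2)
      + ((∑ j, ∑ a, z (.inl (e₁ N Ns j, a)) ^ 2) + ∑ j, z (.inr (e₁ N Ns j)) ^ 2)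
      + ((∑ j, ∑ a, z (.inl (e₂ N Ns j, a)) ^ 2) + ∑ j, z (.inr (e₂ N Ns j)) ^ 2) := by
    rw [Fintype.sum_sum_type, Fintype.sum_prod_type, Fintype.sum_sum_type, Fintype.sum_sum_type,
      Fintype.sum_sum_type, Fintype.sum_sum_type]
    simp [hz0, e₁, e₂]
    ring
  -- The upper layer controls s₂∇u and the lower one s₁∇u. Each may degenerate with the parameters,
  -- but s₁² + s₂² = 1.
  have hu : ∑ a, z (.inl (.inl (), a)) ^ 2 = (∑ a, (θ.s₂ * z (.inl (.inl (), a))) ^ 2)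
      + ∑ a, (θ.s₁ * z (.inl (.inl (), a))) ^ 2 := by
    rw [← Finset.sum_add_distrib]
    refine Finset.sum_congr rfl fun a _ => ?_
    linear_combination -(z (.inl (.inl (), a)) ^ 2) * θ.sq_add_sq
  rw [hz2, hu]
  have n1 : 0 ≤ (∑ a, (θ.s₂ * z (.inl (.inl (), a))) ^ 2)
      + (∑ j, ∑ a, z (.inl (e₁ N Ns j, a)) ^ 2) + ∑ j, z (.inr (e₁ N Ns j)) ^ 2 := by positivity
  have n2 : 0 ≤ (∑ a, (θ.s₁ * z (.inl (.inl (), a))) ^ 2)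
      + (∑ j, ∑ a, z (.inl (e₂ N Ns j, a)) ^ 2) + ∑ j, z (.inr (e₂ N Ns j)) ^ 2 := by positivity
  have k1 := mul_le_mul_of_nonneg_right (min_le_left g₁ g₂) n1
  have k2 := mul_le_mul_of_nonneg_right (min_le_right g₁ g₂) n2
  refine le_trans (le_of_eq ?_) (add_le_add k1 k2)
  ring

end Params

end Kakinuma

/-! ### Variations of the unknowns reproduce the operators of the model -/

namespace Kakinuma
open Filter Topology

variable {n K : ℕ}

/-- A single parameter and s = 0 turn `multAlg` into an algebra of bounded functions, so that
polynomial expressions in H and β are bounded by the closure lemmas above. -/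
theorem mem_multAlg_unit {f : Sp n → ℝ} (hf : MemLp f ⊤ volume) :
    (fun _ : Unit => f) ∈ multAlg Unit n 0 :=
  ⟨_, fun _ => Mult.of_top (s := 0) (LB.self hf)⟩

theorem memLp_top_of_mem {f : Sp n → ℝ} (hf : (fun _ : Unit => f) ∈ multAlg Unit n 0) :
    MemLp f ⊤ volume := by
  obtain ⟨C, hC⟩ := hf
  exact (hC ()).lb.1

/-- `pairForm` does not see components of vanishing exponent. -/
theorem pairForm_congr {p : Fin K → ℕ} (H μ : ℝ) (β : Fin n → ℝ) {i j : Fin K}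
    {v w v' w' : (Fin n → ℝ) × ℝ} (h1 : v.1 = w.1) (h2 : p j ≠ 0 → v.2 = w.2) (h1' : v'.1 = w'.1)
    (h2' : p i ≠ 0 → v'.2 = w'.2) : pairForm p H μ β i j v v' = pairForm p H μ β i j w w' := by
  unfold pairForm
  rw [h1, h1']
  by_cases hj : p j = 0
  · by_cases hi : p i = 0
    · simp [hi, hj]
    · simp [hj, h2' hi]
  · by_cases hi : p i = 0
    · simp [hi, h2 hj]
    · rw [h2 hj, h2' hi]

theorem layerForm_congr {p : Fin K → ℕ} (H μ : ℝ) (β : Fin n → ℝ)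
    {v w v' w' : Fin K → (Fin n → ℝ) × ℝ} (h1 : ∀ i, (v i).1 = (w i).1)
    (h2 : ∀ i, p i ≠ 0 → (v i).2 = (w i).2) (h1' : ∀ i, (v' i).1 = (w' i).1)
    (h2' : ∀ i, p i ≠ 0 → (v' i).2 = (w' i).2) :
    layerForm p H μ β v v' = layerForm p H μ β w w' := by
  simp only [layerForm_apply]
  exact Finset.sum_congr rfl fun i _ => Finset.sum_congr rfl fun j _ =>
    pairForm_congr H μ β (h1 j) (h2 j) (h1' i) (h2' i)

section

variable {p : Fin K → ℕ} {H b : Sp n → ℝ} {h δ : ℝ}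

/-- A component of exponent zero enters through its gradient only. It need not be square integrable
and is replaced by zero in the proof. -/
theorem integrable_pairForm (hH : MemLp H ⊤ volume) {β : Fin n → Sp n → ℝ}
    (hβ : ∀ a, MemLp (β a) ⊤ volume) (μ : ℝ) {i j : Fin K}
    {φ χ : Sp n → ℝ} {g G : Fin n → Sp n → ℝ} (hg : ∀ a, MemLp (g a) 2 volume)
    (hφ : p j ≠ 0 → MemLp φ 2 volume) (hG : ∀ a, MemLp (G a) 2 volume) (hχ : MemLp χ 2 volume) :
    Integrable (fun x => pairForm p (H x) μ (fun a => β a x) i j (fun a => g a x, φ x)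
      (fun a => G a x, χ x)) := by
  set φ' : Sp n → ℝ := if p j = 0 then 0 else φ with hφ'
  have hφ2 : MemLp φ' 2 volume := by
    by_cases hj : p j = 0
    · simp only [hφ', hj, if_true]; exact MemLp.zero
    · simp only [hφ', hj, if_false]; exact hφ hj
  have e : ∀ x, pairForm p (H x) μ (fun a => β a x) i j (fun a => g a x, φ x)
      (fun a => G a x, χ x) = pairForm p (H x) μ (fun a => β a x) i j (fun a => g a x, φ' x)
      (fun a => G a x, χ x) := fun x =>
    pairForm_congr _ _ _ rfl (fun hj => by simp [hφ', hj]) rfl (fun _ => rfl)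
  refine (integrable_congr (ae_of_all _ e)).2 ?_
  simp only [pairForm]
  set A := multAlg Unit n 0
  have c := mem_const A
  have hHA := mem_multAlg_unit hH
  have hβA : ∀ a, (fun (_ : Unit) x => β a x) ∈ A := fun a => mem_multAlg_unit (hβ a)
  have m2 : ∀ {f u : Sp n → ℝ}, (fun _ : Unit => f) ∈ A → MemLp u 2 volume →
      MemLp (fun x => f x * u x) 2 volume := fun hf hu =>
    hu.mul (p := ⊤) (q := 2) (r := 2) (memLp_top_of_mem hf)
  refine Integrable.add (Integrable.sub (integrable_finsetSum _ fun a _ => ?_) ?_) ?_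
  · refine integrable_mul_two (MemLp.sub (m2 (mem_mul A (c _) (mem_pow A hHA _)) (hg a)) ?_) (hG a)
    have hf : (fun (_ : Unit) x => (p j : ℝ) / ((p i : ℝ) + p j) * H x ^ (p i + p j) * β a x) ∈ A :=
      mem_mul A (mem_mul A (c _) (mem_pow A hHA _)) (hβA a)
    have := m2 hf hφ2
    convert this using 2
    ring
  · exact integrable_mul_two (m2 (mem_mul A (c _) (mem_pow A hHA _))
      (memLp_finsetSum _ fun a _ => m2 (hβA a) (hg a))) hχ
  · exact integrable_mul_two (m2 (mem_mul A (mem_mul A (c _) (mem_pow A hHA _))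
      (mem_add A (c _) (mem_sum A _ fun a => mem_pow A (hβA a) 2))) hφ2) hχ

theorem Lpair_eq {i j : Fin K} {φ χ : Sp n → ℝ} {g G : Fin n → Sp n → ℝ}
    (hg : ∀ a, WD a φ (g a)) (hG : ∀ a, WD a χ (G a)) :
    Lpair p H b h δ i j φ χ = ∫ x, pairForm p (H x) ((h * δ) ^ 2)⁻¹ (fun a => h⁻¹ * wpd a b x) i j
      (fun a => g a x, φ x) (fun a => G a x, χ x) := by
  unfold Lpair
  refine integral_congr_ae ?_
  filter_upwards [ae_all_iff.2 fun a => (hg a).wpd_eq, ae_all_iff.2 fun a => (hG a).wpd_eq]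
    with x h1 h2
  simp only [h1, h2, pairForm, mul_pow, Finset.mul_sum, inv_pow]

end

section

variable {p : Fin (K + 1) → ℕ} {H b : Sp n → ℝ} {h δ : ℝ} {φ : Fin (K + 1) → Sp n → ℝ}
  {g : Fin (K + 1) → Fin n → Sp n → ℝ}

/-- Weak derivatives of powers of bounded functions. -/
theorem WD.pow {a : Fin n} {f f' : Sp n → ℝ} (hf : WD a f f') (h1 : MemLp f ⊤ volume)
    (h2 : MemLp f' ⊤ volume) (k : ℕ) :
    WD a (fun x => f x ^ k) (fun x => k * f x ^ (k - 1) * f' x) := by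
  set A := multAlg Unit n 0
  have c := mem_const A
  have m1 := mem_multAlg_unit h1
  have m2 := mem_multAlg_unit h2
  induction k with
  | zero => simpa using WD.const a 1
  | succ k ih =>
    have := ih.mul hf (.of_memLp_top (memLp_top_of_mem (mem_pow A m1 k)))
      (.of_memLp_top (memLp_top_of_mem (mem_mul A (mem_mul A (c _) (mem_pow A m1 _)) m2)))
      (.of_memLp_top h1) (.of_memLp_top h2)
    have e1 : (fun x => f x ^ (k + 1)) = fun x => f x ^ k * f x := by ext x; ring
    have e2 : (fun x => ((k + 1 : ℕ) : ℝ) * f x ^ (k + 1 - 1) * f' x)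
        = fun x => k * f x ^ (k - 1) * f' x * f x + f x ^ k * f' x := by
      ext x
      rcases k with _ | k
      · simp
      · simp only [Nat.add_sub_cancel]; push_cast; ring
    rw [e1, e2]
    exact this

/-- Gradients and values of a tuple of functions. -/
def fieldJet (φ : Fin (K + 1) → Sp n → ℝ) (g : Fin (K + 1) → Fin n → Sp n → ℝ) (x : Sp n)
    (i : Fin (K + 1)) : (Fin n → ℝ) × ℝ := (fun a => g i a x, φ i x)

/-- Gradients and values of a tuple whose only nonzero component is the test function `ψ`. -/
noncomputable def testJet {ι : Type*} [DecidableEq ι] (k : ι) (ψ : Sp n → ℝ) (x : Sp n) :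
    ι × Fin n ⊕ ι → ℝ
  | .inl q => if q.1 = k then pd q.2 ψ x else 0
  | .inr i => if i = k then ψ x else 0

/-- Since p₀ = 0 the form does not see the value of the first component, so y is free; it will be ψ
or H^k ψ, as the operators demand. -/
theorem layerForm_single_zero (hp0 : p 0 = 0) (H μ : ℝ) (β : Fin n → ℝ)
    (v v' : Fin (K + 1) → (Fin n → ℝ) × ℝ) (w : Fin n → ℝ) (y σ : ℝ) (h0 : ∀ a, (v' 0).1 a = σ * w a)
    (hs : ∀ j : Fin K, v' j.succ = 0) :
    layerForm p H μ β v v' = σ * ∑ j, pairForm p H μ β 0 j (v j) (w, y) := by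
  rw [layerForm_apply, Fin.sum_univ_succ, Finset.mul_sum]
  have h1 : ∀ i : Fin K, ∑ j, pairForm p H μ β i.succ j (v j) (v' i.succ) = 0 := fun i =>
    Finset.sum_eq_zero fun j _ => by rw [hs, ← pairFormL_apply, map_zero]
  rw [Finset.sum_eq_zero fun i _ => h1 i, add_zero]
  refine Finset.sum_congr rfl fun j _ => ?_
  rw [← pairFormL_apply (v' := (w, y)), ← smul_eq_mul, ← map_smul]
  exact pairForm_congr _ _ _ rfl (fun _ => rfl) (funext fun a => by simp [h0])
    (fun hi => absurd hp0 hi)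

variable {ι : Type*} [DecidableEq ι] {u : ι} {e : Fin K → ι} {σ : ℝ} {H' : Fin n → Sp n → ℝ}
  {β : Fin n → Sp n → ℝ}

/-- A variation of u by ψ moves only the first component of the layer, by σψ. -/
theorem integral_layerForm_zero (hp0 : p 0 = 0) (hH : MemLp H ⊤ volume)
    (hb : ∀ a, MemLp (fun x => h⁻¹ * wpd a b x) ⊤ volume) (hwd : ∀ i a, WD a (φ i) (g i a))
    (hg : ∀ i a, MemLp (g i a) 2 volume)
    (hφ : ∀ i : Fin K, MemLp (φ i.succ) 2 volume) (hue : ∀ j, e j ≠ u) {ψ : Sp n → ℝ}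
    (hψ : IsTest ψ) :
    Integrable (fun x => layerForm p (H x) ((h * δ) ^ 2)⁻¹ (fun a => h⁻¹ * wpd a b x)
      (fieldJet φ g x) (layerMap p u e σ (H x) (fun a => H' a x) (testJet u ψ x))) ∧
    ∫ x, layerForm p (H x) ((h * δ) ^ 2)⁻¹ (fun a => h⁻¹ * wpd a b x) (fieldJet φ g x)
      (layerMap p u e σ (H x) (fun a => H' a x) (testJet u ψ x)) = σ * calL0 p H b h δ φ ψ := by
  have hφ' : ∀ j, p j ≠ 0 → MemLp (φ j) 2 volume := fun j => by
    refine Fin.cases (fun h => absurd hp0 h) (fun j _ => hφ j) j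
  have e1 : ∀ x, layerForm p (H x) ((h * δ) ^ 2)⁻¹ (fun a => h⁻¹ * wpd a b x) (fieldJet φ g x)
      (layerMap p u e σ (H x) (fun a => H' a x) (testJet u ψ x))
      = σ * ∑ j, pairForm p (H x) ((h * δ) ^ 2)⁻¹ (fun a => h⁻¹ * wpd a b x) 0 j
        (fun a => g j a x, φ j x) (fun a => pd a ψ x, ψ x) := fun x => by
    refine layerForm_single_zero hp0 _ _ _ _ _ _ _ _ (fun a => ?_) fun j => ?_
    · simp [layerMap_zero, testJet, hue]
    · ext <;> simp [layerMap_succ, testJet, hue]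
  have hi : ∀ j, Integrable (fun x => pairForm p (H x) ((h * δ) ^ 2)⁻¹ (fun a => h⁻¹ * wpd a b x) 0 j
      (fun a => g j a x, φ j x) (fun a => pd a ψ x, ψ x)) := fun j =>
    integrable_pairForm hH hb _ (hg j) (hφ' j) (fun a => (hψ.pd a).memLp 2) (hψ.memLp 2)
  simp only [e1]
  refine ⟨(integrable_finsetSum _ fun j _ => hi j).const_mul σ, ?_⟩
  rw [integral_const_mul, integral_finsetSum _ fun j _ => hi j, calL0]
  congr 1
  refine Finset.sum_congr rfl fun j _ => ?_
  rw [Lpair_eq (hwd j) (fun a => WD.of_contDiff (hψ.1.of_le (by norm_cast)) a)]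

/-- A variation of vᵢ by ψ with u fixed leaves the trace unchanged: component i moves by ψ and the
first component by −H^{pᵢ}ψ. This is the origin of the combination L_{ij}φⱼ − H^{pᵢ}L_{0j}φⱼ. -/
theorem integral_layerForm_succ (hp0 : p 0 = 0) (hH : MemLp H ⊤ volume)
    (hH' : ∀ a, MemLp (H' a) ⊤ volume) (hHH' : ∀ a, WD a H (H' a))
    (hb : ∀ a, MemLp (fun x => h⁻¹ * wpd a b x) ⊤ volume) (hwd : ∀ i a, WD a (φ i) (g i a))
    (hg : ∀ i a, MemLp (g i a) 2 volume)
    (hφ : ∀ i : Fin K, MemLp (φ i.succ) 2 volume) (hue : ∀ j, e j ≠ u)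
    (he : Function.Injective e) (i : Fin K) {ψ : Sp n → ℝ} (hψ : IsTest ψ) :
    Integrable (fun x => layerForm p (H x) ((h * δ) ^ 2)⁻¹ (fun a => h⁻¹ * wpd a b x)
      (fieldJet φ g x) (layerMap p u e σ (H x) (fun a => H' a x) (testJet (e i) ψ x))) ∧
    ∫ x, layerForm p (H x) ((h * δ) ^ 2)⁻¹ (fun a => h⁻¹ * wpd a b x) (fieldJet φ g x)
      (layerMap p u e σ (H x) (fun a => H' a x) (testJet (e i) ψ x))
      = calL p H b h δ i.succ φ ψ := by
  have hφ' : ∀ j, p j ≠ 0 → MemLp (φ j) 2 volume := fun j => by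
    refine Fin.cases (fun h => absurd hp0 h) (fun j _ => hφ j) j
  set k := p i.succ
  set A := multAlg Unit n 0
  have c := mem_const A
  have m1 := mem_multAlg_unit hH
  have m2 := fun a => mem_multAlg_unit (hH' a)
  have hHk : MemLp (fun x => H x ^ k) ⊤ volume := memLp_top_of_mem (mem_pow A m1 k)
  have hHk' : ∀ a, MemLp (fun x => k * H x ^ (k - 1) * H' a x) ⊤ volume := fun a =>
    memLp_top_of_mem (mem_mul A (mem_mul A (c _) (mem_pow A m1 _)) (m2 a))
  set G : Fin n → Sp n → ℝ := fun a x => k * H x ^ (k - 1) * H' a x * ψ x + H x ^ k * pd a ψ x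
  have hψW : ∀ a, WD a ψ (pd a ψ) := fun a => WD.of_contDiff (hψ.1.of_le (by norm_cast)) a
  have hG : ∀ a, WD a (fun x => H x ^ k * ψ x) (G a) := fun a =>
    ((hHH' a).pow hH (hH' a) k).mul (hψW a) (.of_memLp_top hHk) (.of_memLp_top (hHk' a))
      (.of_memLp_two (hψ.memLp 2)) (.of_memLp_two ((hψ.pd a).memLp 2))
  have hχ2 : MemLp (fun x => H x ^ k * ψ x) 2 volume :=
    (hψ.memLp 2).mul (p := ⊤) (q := 2) (r := 2) hHk
  have hG2 : ∀ a, MemLp (G a) 2 volume := fun a =>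
    ((hψ.memLp 2).mul (p := ⊤) (q := 2) (r := 2) (hHk' a)).add
      (((hψ.pd a).memLp 2).mul (p := ⊤) (q := 2) (r := 2) hHk)
  have e1 : ∀ x, layerForm p (H x) ((h * δ) ^ 2)⁻¹ (fun a => h⁻¹ * wpd a b x) (fieldJet φ g x)
      (layerMap p u e σ (H x) (fun a => H' a x) (testJet (e i) ψ x))
      = ∑ j, (pairForm p (H x) ((h * δ) ^ 2)⁻¹ (fun a => h⁻¹ * wpd a b x) i.succ j
          (fun a => g j a x, φ j x) (fun a => pd a ψ x, ψ x)
        - pairForm p (H x) ((h * δ) ^ 2)⁻¹ (fun a => h⁻¹ * wpd a b x) 0 j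
          (fun a => g j a x, φ j x) (fun a => G a x, H x ^ k * ψ x)) := fun x => by
    set v' := layerMap p u e σ (H x) (fun a => H' a x) (testJet (e i) ψ x) with hv'
    have h0 : ∀ a, (v' 0).1 a = -1 * G a x := fun a => by
      rw [hv', layerMap_zero]
      simp only [testJet, he.eq_iff, Ne.symm (hue i), if_false, mul_zero, zero_sub]
      rw [Finset.sum_eq_single i]
      · simp only [if_true, G]; ring
      · intro j _ hj; simp [hj]
      · simp
    have hs : ∀ j : Fin K, v' j.succ = if j = i then (fun a => pd a ψ x, ψ x) else 0 := fun j => by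
      rw [hv', layerMap_succ]
      by_cases hj : j = i
      · subst hj; simp [testJet]
      · simp only [testJet, he.eq_iff, hj, if_false]; rfl
    set v0 : Fin (K + 1) → (Fin n → ℝ) × ℝ := Fin.cons (v' 0) 0
    set v1 : Fin (K + 1) → (Fin n → ℝ) × ℝ := Fin.cons 0 (fun j => v' j.succ)
    have hv : v' = v0 + v1 := by
      funext j
      refine Fin.cases ?_ (fun j => ?_) j <;> simp [v0, v1]
    rw [hv, map_add, layerForm_single_zero hp0 _ _ _ _ v0 (fun a => G a x) (H x ^ k * ψ x) (-1) h0
      (fun j => by simp [v0])]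
    have hv1 : ∀ j : Fin K, v1 j.succ = if j = i then (fun a => pd a ψ x, ψ x) else 0 := hs
    have z1 : layerForm p (H x) ((h * δ) ^ 2)⁻¹ (fun a => h⁻¹ * wpd a b x) (fieldJet φ g x) v1
        = ∑ j, pairForm p (H x) ((h * δ) ^ 2)⁻¹ (fun a => h⁻¹ * wpd a b x) i.succ j
          (fieldJet φ g x j) (fun a => pd a ψ x, ψ x) := by
      rw [layerForm_apply, Finset.sum_eq_single i.succ]
      · rw [hv1, if_pos rfl]
      · intro j _ hj
        refine Finset.sum_eq_zero fun l _ => ?_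
        have : v1 j = 0 := by
          revert hj
          refine Fin.cases (fun _ => rfl) (fun j hj => ?_) j
          rw [hv1, if_neg fun h => hj (by rw [h])]
        rw [← pairFormL_apply, this, map_zero]
      · simp
    rw [z1, Finset.sum_sub_distrib]
    simp only [fieldJet]
    ring
  have i1 : ∀ j, Integrable (fun x => pairForm p (H x) ((h * δ) ^ 2)⁻¹ (fun a => h⁻¹ * wpd a b x)
      i.succ j (fun a => g j a x, φ j x) (fun a => pd a ψ x, ψ x)) := fun j =>
    integrable_pairForm hH hb _ (hg j) (hφ' j) (fun a => (hψ.pd a).memLp 2) (hψ.memLp 2)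
  have i2 : ∀ j, Integrable (fun x => pairForm p (H x) ((h * δ) ^ 2)⁻¹ (fun a => h⁻¹ * wpd a b x)
      0 j (fun a => g j a x, φ j x) (fun a => G a x, H x ^ k * ψ x)) := fun j =>
    integrable_pairForm hH hb _ (hg j) (hφ' j) hG2 hχ2
  have i3 : ∀ j, Integrable (fun x => pairForm p (H x) ((h * δ) ^ 2)⁻¹ (fun a => h⁻¹ * wpd a b x)
      i.succ j (fun a => g j a x, φ j x) (fun a => pd a ψ x, ψ x)
      - pairForm p (H x) ((h * δ) ^ 2)⁻¹ (fun a => h⁻¹ * wpd a b x)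
      0 j (fun a => g j a x, φ j x) (fun a => G a x, H x ^ k * ψ x)) := fun j => (i1 j).sub (i2 j)
  simp only [e1]
  refine ⟨integrable_finsetSum _ fun j _ => i3 j, ?_⟩
  rw [integral_finsetSum _ fun j _ => i3 j, calL]
  refine Finset.sum_congr rfl fun j _ => ?_
  rw [Lpair_eq (hwd j) hψW, Lpair_eq (hwd j) hG]
  exact integral_sub (i1 j) (i2 j)

end

end Kakinuma

/-! ### The system for the unknowns -/

namespace Kakinuma
open Filter Topology

variable {n K : ℕ} {Θ : Type*} {ι : Type*}

theorem memLp_of_mem_multAlg {s : ℕ} {f : Θ → Sp n → ℝ} (h : f ∈ multAlg Θ n s) (θ : Θ) :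
    MemLp (f θ) ⊤ volume := by
  obtain ⟨C, hC⟩ := h
  exact (hC θ).lb.1

theorem layerMap_congr (p : Fin (K + 1) → ℕ) {u : ι} {e : Fin K → ι} (σ H : ℝ) (H' : Fin n → ℝ)
    {z z' : ι × Fin n ⊕ ι → ℝ} (h0 : ∀ a, z (.inl (u, a)) = z' (.inl (u, a)))
    (h1 : ∀ j a, z (.inl (e j, a)) = z' (.inl (e j, a)))
    (h2 : ∀ j, z (.inr (e j)) = z' (.inr (e j))) :
    layerMap p u e σ H H' z = layerMap p u e σ H H' z' := by
  funext i
  refine Fin.cases ?_ (fun j => ?_) i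
  · simp only [layerMap_zero, h0, h1, h2]
  · simp only [layerMap_succ, h1, h2]

/-- A layer whose only nonzero entry is the gradient `τ γ` of the first component. -/
def shift (K : ℕ) (τ : ℝ) : (Fin n → ℝ) →ₗ[ℝ] (Fin (K + 1) → (Fin n → ℝ) × ℝ) :=
  (LinearMap.single ℝ (fun _ : Fin (K + 1) => (Fin n → ℝ) × ℝ) 0).comp
    ((LinearMap.inl ℝ (Fin n → ℝ) ℝ).comp (τ • LinearMap.id))

theorem shift_zero (K : ℕ) (τ : ℝ) (γ : Fin n → ℝ) : shift K τ γ 0 = (τ • γ, 0) := by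
  simp [shift]

theorem shift_succ {K : ℕ} (τ : ℝ) (γ : Fin n → ℝ) (j : Fin K) : shift K τ γ j.succ = 0 := by
  simp [shift]

/-- The tuple `κ φ` is given by the unknowns `U` and the gradient `γ`. -/
def LayerRel (p : Fin (K + 1) → ℕ) (u : ι) (e : Fin K → ι) (σ : ℝ) (H : Sp n → ℝ)
    (H' : Fin n → Sp n → ℝ) (κ τ : ℝ) (U : ι → Sp n → ℝ) (D : ι → Fin n → Sp n → ℝ)
    (γ : Fin n → Sp n → ℝ) (φ : Fin (K + 1) → Sp n → ℝ) (g : Fin (K + 1) → Fin n → Sp n → ℝ) : Prop :=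
  ∀ᵐ x, (∀ a, κ * g 0 a x = (layerMap p u e σ (H x) (fun a => H' a x)
        (fun q => jet (fun _ => 1) U D q x) 0).1 a + τ * γ a x) ∧
    (∀ j a, κ * g j.succ a x = D (e j) a x) ∧ ∀ j : Fin K, κ * φ j.succ x = U (e j) x

/-- `LayerRel` says nothing about the value of the first component, and because of p₀ = 0 the form
does not ask for it; the rest is linearity. -/
theorem LayerRel.form {p : Fin (K + 1) → ℕ} {u : ι} {e : Fin K → ι} {σ : ℝ} {H : Sp n → ℝ}
    {H' : Fin n → Sp n → ℝ} {κ τ : ℝ} {U : ι → Sp n → ℝ} {D : ι → Fin n → Sp n → ℝ}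
    {γ : Fin n → Sp n → ℝ} {φ : Fin (K + 1) → Sp n → ℝ} {g : Fin (K + 1) → Fin n → Sp n → ℝ}
    (h : LayerRel p u e σ H H' κ τ U D γ φ g) (hp0 : p 0 = 0) : ∀ᵐ x, ∀ μ β w,
      κ * layerForm p (H x) μ β (fieldJet φ g x) w
        = layerForm p (H x) μ β (layerMap p u e σ (H x) (fun a => H' a x)
            fun q => jet (fun _ => 1) U D q x) w
          + layerForm p (H x) μ β (shift K τ fun a => γ a x) w := by
  filter_upwards [h] with x hx μ β w
  rw [← smul_eq_mul, ← LinearMap.smul_apply, ← map_smul, ← LinearMap.add_apply, ← map_add]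
  refine layerForm_congr _ _ _ (fun i => ?_) (fun i => ?_) (fun _ => rfl) fun _ _ => rfl
  · refine Fin.cases ?_ (fun j => ?_) i
    · ext a
      simpa [shift_zero, fieldJet] using hx.1 a
    · ext a
      simpa [shift_succ, layerMap_succ, fieldJet, jet] using hx.2.1 j a
  · refine Fin.cases (fun h0 => absurd hp0 h0) (fun j _ => ?_) i
    simpa [shift_succ, layerMap_succ, fieldJet, jet] using hx.2.2 j

namespace Params

variable {s : ℕ} {c₀ M₀ : ℝ} (θ : Params n s c₀ M₀) {N Ns : ℕ}

/-- The variables of the upper layer in terms of the unknowns. -/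
noncomputable def map₁ (N Ns : ℕ) (x : Sp n) :=
  layerMap (evenExp N) (.inl ()) (e₁ N Ns) θ.s₂ (θ.D₁ x) (fun a => wpd a θ.D₁ x)

/-- The variables of the lower layer in terms of the unknowns. -/
noncomputable def map₂ (N : ℕ) (p : Fin (Ns + 1) → ℕ) (x : Sp n) :=
  layerMap p (.inl ()) (e₂ N Ns) θ.s₁ (θ.D₂ x) (fun a => wpd a θ.D₂ x)

/-- The form of the upper layer. -/
noncomputable def form₁ (N : ℕ) (x : Sp n) :=
  layerForm (evenExp N) (θ.D₁ x) (θ.l₁ ^ 2) (fun a => θ.β₁ a x)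

/-- The form of the lower layer. -/
noncomputable def form₂ (p : Fin (Ns + 1) → ℕ) (x : Sp n) :=
  layerForm p (θ.D₂ x) (θ.l₂ ^ 2) (fun a => θ.β₂ a x)

/-- The data of the system for the unknowns. -/
noncomputable def data (p : Fin (Ns + 1) → ℕ) (γ : Fin n → Sp n → ℝ)
    (q : (Unit ⊕ (Fin N ⊕ Fin Ns)) × Fin n ⊕ (Unit ⊕ (Fin N ⊕ Fin Ns))) (x : Sp n) : ℝ :=
  -((jetWeight n (θ.lam N Ns) q)⁻¹
    * (θ.form₁ N x (shift N (-θ.s₁) fun a => γ a x) (θ.map₁ N Ns x (Pi.single q 1))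
      + θ.form₂ p x (shift Ns θ.s₂ fun a => γ a x) (θ.map₂ N p x (Pi.single q 1))))

/-- The matrix of the system for the unknowns. -/
noncomputable def full (N : ℕ) (p : Fin (Ns + 1) → ℕ) :=
  θ.mat (N := N) p (fun a => wpd a θ.D₁) θ.β₁ (fun a => wpd a θ.D₂) θ.β₂

theorem sum_full (p : Fin (Ns + 1) → ℕ)
    (z z' : (Unit ⊕ (Fin N ⊕ Fin Ns)) × Fin n ⊕ (Unit ⊕ (Fin N ⊕ Fin Ns)) → ℝ) (x : Sp n) :
    ∑ q, ∑ r, θ.full N p q r x * z r * z' q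
      = θ.form₁ N x (θ.map₁ N Ns x fun r => (jetWeight n (θ.lam N Ns) r)⁻¹ * z r)
          (θ.map₁ N Ns x fun r => (jetWeight n (θ.lam N Ns) r)⁻¹ * z' r)
        + θ.form₂ p x (θ.map₂ N p x fun r => (jetWeight n (θ.lam N Ns) r)⁻¹ * z r)
          (θ.map₂ N p x fun r => (jetWeight n (θ.lam N Ns) r)⁻¹ * z' r) :=
  θ.sum_mat p _ _ _ _ z z' x

theorem sum_data (p : Fin (Ns + 1) → ℕ) (γ : Fin n → Sp n → ℝ)
    (z' : (Unit ⊕ (Fin N ⊕ Fin Ns)) × Fin n ⊕ (Unit ⊕ (Fin N ⊕ Fin Ns)) → ℝ) (x : Sp n) :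
    ∑ q, θ.data p γ q x * z' q
      = -(θ.form₁ N x (shift N (-θ.s₁) fun a => γ a x)
          (θ.map₁ N Ns x fun r => (jetWeight n (θ.lam N Ns) r)⁻¹ * z' r)
        + θ.form₂ p x (shift Ns θ.s₂ fun a => γ a x)
          (θ.map₂ N p x fun r => (jetWeight n (θ.lam N Ns) r)⁻¹ * z' r)) := by
  have e1 := layerMap_eq_sum (evenExp N) (.inl ()) (e₁ N Ns) θ.s₂ (θ.D₁ x)
    (fun a => wpd a θ.D₁ x) fun r => (jetWeight n (θ.lam N Ns) r)⁻¹ * z' r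
  have e2 := layerMap_eq_sum p (.inl ()) (e₂ N Ns) θ.s₁ (θ.D₂ x)
    (fun a => wpd a θ.D₂ x) fun r => (jetWeight n (θ.lam N Ns) r)⁻¹ * z' r
  unfold map₁ map₂
  rw [e1, e2, map_sum, map_sum, ← Finset.sum_add_distrib, ← Finset.sum_neg_distrib]
  refine Finset.sum_congr rfl fun q _ => ?_
  rw [map_smul, map_smul, smul_eq_mul, smul_eq_mul, data, map₁, map₂]
  ring

/-- The only slot of weight zero is the value of u, which the layer variables never use; in all
other slots the weights cancel. -/
theorem map₁_weight (U : Unit ⊕ (Fin N ⊕ Fin Ns) → Sp n → ℝ)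
    (D : Unit ⊕ (Fin N ⊕ Fin Ns) → Fin n → Sp n → ℝ) (x : Sp n) :
    θ.map₁ N Ns x (fun r => (jetWeight n (θ.lam N Ns) r)⁻¹ * jet (θ.lam N Ns) U D r x)
      = θ.map₁ N Ns x fun r => jet (fun _ => 1) U D r x := by
  refine layerMap_congr _ _ _ _ (fun a => ?_) (fun j a => ?_) fun j => ?_
  · simp [jetWeight, jet]
  · simp [jetWeight, jet]
  · have : θ.l₁ ≠ 0 := (zero_lt_one.trans_le θ.one_le_l₁).ne'
    simp [jetWeight, jet, lam, e₁, this]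

theorem map₂_weight (p : Fin (Ns + 1) → ℕ) (U : Unit ⊕ (Fin N ⊕ Fin Ns) → Sp n → ℝ)
    (D : Unit ⊕ (Fin N ⊕ Fin Ns) → Fin n → Sp n → ℝ) (x : Sp n) :
    θ.map₂ N p x (fun r => (jetWeight n (θ.lam N Ns) r)⁻¹ * jet (θ.lam N Ns) U D r x)
      = θ.map₂ N p x fun r => jet (fun _ => 1) U D r x := by
  refine layerMap_congr _ _ _ _ (fun a => ?_) (fun j a => ?_) fun j => ?_
  · simp [jetWeight, jet]
  · simp [jetWeight, jet]
  · have : θ.l₂ ≠ 0 := (zero_lt_one.trans_le θ.one_le_l₂).ne'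
    simp [jetWeight, jet, lam, e₂, this]

theorem map₁_testJet (k : Unit ⊕ (Fin N ⊕ Fin Ns)) (ψ : Sp n → ℝ) (x : Sp n) :
    θ.map₁ N Ns x (fun r => (jetWeight n (θ.lam N Ns) r)⁻¹
        * (jetWeight n (θ.lam N Ns) r * testJet k ψ x r))
      = θ.map₁ N Ns x (testJet k ψ x) := by
  refine layerMap_congr _ _ _ _ (fun a => ?_) (fun j a => ?_) fun j => ?_
  · simp [jetWeight]
  · simp [jetWeight]
  · have : θ.l₁ ≠ 0 := (zero_lt_one.trans_le θ.one_le_l₁).ne'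
    simp [jetWeight, lam, e₁, this]

theorem map₂_testJet (p : Fin (Ns + 1) → ℕ) (k : Unit ⊕ (Fin N ⊕ Fin Ns)) (ψ : Sp n → ℝ) (x : Sp n) :
    θ.map₂ N p x (fun r => (jetWeight n (θ.lam N Ns) r)⁻¹
        * (jetWeight n (θ.lam N Ns) r * testJet k ψ x r))
      = θ.map₂ N p x (testJet k ψ x) := by
  refine layerMap_congr _ _ _ _ (fun a => ?_) (fun j a => ?_) fun j => ?_
  · simp [jetWeight]
  · simp [jetWeight]
  · have : θ.l₂ ≠ 0 := (zero_lt_one.trans_le θ.one_le_l₂).ne'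
    simp [jetWeight, lam, e₂, this]

theorem map₁_testJet_e₂ (j : Fin Ns) (ψ : Sp n → ℝ) (x : Sp n) :
    θ.map₁ N Ns x (testJet (e₂ N Ns j) ψ x) = 0 := by
  rw [← map_zero (θ.map₁ N Ns x)]
  refine layerMap_congr _ _ _ _ (fun a => ?_) (fun j a => ?_) fun j => ?_ <;>
    simp [testJet, e₁, e₂]

theorem map₂_testJet_e₁ (p : Fin (Ns + 1) → ℕ) (j : Fin N) (ψ : Sp n → ℝ) (x : Sp n) :
    θ.map₂ N p x (testJet (e₁ N Ns j) ψ x) = 0 := by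
  rw [← map_zero (θ.map₂ N p x)]
  refine layerMap_congr _ _ _ _ (fun a => ?_) (fun j a => ?_) fun j => ?_ <;>
    simp [testJet, e₁, e₂]

/-- The factor of the upper layer. -/
noncomputable def κ₁ : ℝ := θ.h₁ * θ.s₁

/-- The factor of the lower layer. -/
noncomputable def κ₂ : ℝ := θ.h₂ * θ.s₂

theorem κ₁_pos : 0 < θ.κ₁ := mul_pos θ.h₁_pos θ.s₁_pos

theorem κ₂_pos : 0 < θ.κ₂ := mul_pos θ.h₂_pos θ.s₂_pos

/-- The velocity potentials `φ₁`, `φ₂` are given by the unknowns `U`. -/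
structure Rel (p : Fin (Ns + 1) → ℕ) (U : Unit ⊕ (Fin N ⊕ Fin Ns) → Sp n → ℝ)
    (D : Unit ⊕ (Fin N ⊕ Fin Ns) → Fin n → Sp n → ℝ) (γ : Fin n → Sp n → ℝ)
    (φ₁ : Fin (N + 1) → Sp n → ℝ) (g₁ : Fin (N + 1) → Fin n → Sp n → ℝ)
    (φ₂ : Fin (Ns + 1) → Sp n → ℝ) (g₂ : Fin (Ns + 1) → Fin n → Sp n → ℝ) : Prop where
  energy : Energy (θ.lam N Ns) U D
  grad : ∀ a, MemLp (γ a) 2 volume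
  wd₁ : ∀ i a, WD a (φ₁ i) (g₁ i a)
  wd₂ : ∀ i a, WD a (φ₂ i) (g₂ i a)
  memLp₁ : ∀ i a, MemLp (g₁ i a) 2 volume
  memLp₂ : ∀ i a, MemLp (g₂ i a) 2 volume
  memLp_succ₁ : ∀ i : Fin N, MemLp (φ₁ i.succ) 2 volume
  memLp_succ₂ : ∀ i : Fin Ns, MemLp (φ₂ i.succ) 2 volume
  rel₁ : LayerRel (evenExp N) (.inl ()) (e₁ N Ns) θ.s₂ θ.D₁ (fun a => wpd a θ.D₁) θ.κ₁ (-θ.s₁) U D γ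
    φ₁ g₁
  rel₂ : LayerRel p (.inl ()) (e₂ N Ns) θ.s₁ θ.D₂ (fun a => wpd a θ.D₂) θ.κ₂ θ.s₂ U D γ φ₂ g₂

theorem sum_jetWeight_testJet (k : Unit ⊕ (Fin N ⊕ Fin Ns)) (ψ : Sp n → ℝ) (x : Sp n)
    (G : (Unit ⊕ (Fin N ⊕ Fin Ns)) × Fin n ⊕ (Unit ⊕ (Fin N ⊕ Fin Ns)) → ℝ) :
    ∑ q, G q * (jetWeight n (θ.lam N Ns) q * testJet k ψ x q)
      = (∑ a, G (.inl (k, a)) * pd a ψ x) + θ.lam N Ns k * G (.inr k) * ψ x := by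
  rw [Fintype.sum_sum_type, Fintype.sum_prod_type, Finset.sum_eq_single k, Finset.sum_eq_single k]
  · simp only [jetWeight, Sum.elim_inl, Sum.elim_inr, testJet, if_true, one_mul]
    ring
  · intro i _ hi; simp [testJet, hi]
  · simp
  · intro i _ hi; simp [testJet, hi]
  · simp

/-- By `LayerRel.form`, κφ splits into the layer variables of U, which give the matrix applied to
the jet, and the shift along ∇φ, which is the data with the opposite sign. -/
theorem Rel.pointwise {p : Fin (Ns + 1) → ℕ} (hp0 : p 0 = 0)
    {U : Unit ⊕ (Fin N ⊕ Fin Ns) → Sp n → ℝ}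
    {D : Unit ⊕ (Fin N ⊕ Fin Ns) → Fin n → Sp n → ℝ} {γ : Fin n → Sp n → ℝ}
    {φ₁ : Fin (N + 1) → Sp n → ℝ} {g₁ : Fin (N + 1) → Fin n → Sp n → ℝ}
    {φ₂ : Fin (Ns + 1) → Sp n → ℝ} {g₂ : Fin (Ns + 1) → Fin n → Sp n → ℝ}
    (h : θ.Rel p U D γ φ₁ g₁ φ₂ g₂) (k : Unit ⊕ (Fin N ⊕ Fin Ns)) (ψ : Sp n → ℝ) : ∀ᵐ x,
      (∑ a, (∑ r, θ.full N p (.inl (k, a)) r x * jet (θ.lam N Ns) U D r x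
          - θ.data p γ (.inl (k, a)) x) * pd a ψ x)
        + θ.lam N Ns k * (∑ r, θ.full N p (.inr k) r x * jet (θ.lam N Ns) U D r x
          - θ.data p γ (.inr k) x) * ψ x
      = θ.κ₁ * θ.form₁ N x (fieldJet φ₁ g₁ x) (θ.map₁ N Ns x (testJet k ψ x))
        + θ.κ₂ * θ.form₂ p x (fieldJet φ₂ g₂ x) (θ.map₂ N p x (testJet k ψ x)) := by
  filter_upwards [h.rel₁.form rfl, h.rel₂.form hp0] with x x1 x2
  rw [← θ.sum_jetWeight_testJet k ψ x fun q =>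
    ∑ r, θ.full N p q r x * jet (θ.lam N Ns) U D r x - θ.data p γ q x]
  simp only [sub_mul, Finset.sum_sub_distrib, Finset.sum_mul]
  rw [sum_full, sum_data, map₁_weight, map₂_weight, map₁_testJet, map₂_testJet]
  have y1 := x1 (θ.l₁ ^ 2) (fun a => θ.β₁ a x) (θ.map₁ N Ns x (testJet k ψ x))
  have y2 := x2 (θ.l₂ ^ 2) (fun a => θ.β₂ a x) (θ.map₂ N p x (testJet k ψ x))
  change _ = θ.form₁ N x (θ.map₁ N Ns x _) _ + θ.form₁ N x _ _ at y1
  change _ = θ.form₂ p x (θ.map₂ N p x _) _ + θ.form₂ p x _ _ at y2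
  change _ = θ.κ₁ * layerForm _ _ _ _ _ _ + θ.κ₂ * layerForm _ _ _ _ _ _
  rw [y1, y2]
  ring

end Params

end Kakinuma

/-! ### Bounds for the data, and equivalence with the compatibility conditions -/

namespace Kakinuma
open Filter Topology

variable {n K : ℕ} {Θ : Type*} {ι : Type*}

/-- Applied to the shift along ∇φ, which has no zeroth order entries, this removes the unbounded
coefficient μ; the data are therefore bounded uniformly in δ. -/
theorem layerForm_of_snd_left (p : Fin K → ℕ) (H μ : ℝ) (β : Fin n → ℝ)
    {v : Fin K → (Fin n → ℝ) × ℝ} (hv : ∀ i, (v i).2 = 0) (v' : Fin K → (Fin n → ℝ) × ℝ) :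
    layerForm p H μ β v v' = layerForm p H 0 β v v' := by
  rw [layerForm_eq_add]
  simp [massForm, hv]

theorem shift_snd (K : ℕ) (τ : ℝ) (γ : Fin n → ℝ) (i : Fin (K + 1)) : (shift K τ γ i).2 = 0 := by
  refine Fin.cases ?_ (fun j => ?_) i
  · simp [shift_zero]
  · simp [shift_succ]

theorem mem_shift (A : Subalgebra ℝ (Θ → Sp n → ℝ)) {τ : Θ → ℝ} (hτ : (fun θ _ => τ θ) ∈ A)
    (γ : Fin n → ℝ) (i : Fin (K + 1)) :
    (∀ a, (fun θ _ => (shift K (τ θ) γ i).1 a) ∈ A) ∧ (fun θ _ => (shift K (τ θ) γ i).2) ∈ A := by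
  have c := mem_const A
  refine Fin.cases ?_ (fun j => ?_) i
  · simp only [shift_zero]
    exact ⟨fun a => mem_mul A hτ (c _), c 0⟩
  · simp only [shift_succ]
    exact ⟨fun a => c 0, c 0⟩

theorem mem_layerForm_shift (A : Subalgebra ℝ (Θ → Sp n → ℝ)) {p : Fin (K + 1) → ℕ} {u : ι}
    {e : Fin K → ι} {σ τ μ : Θ → ℝ} {H : Θ → Sp n → ℝ} {H' β : Θ → Fin n → Sp n → ℝ}
    (hσ : (fun θ _ => σ θ) ∈ A) (hτ : (fun θ _ => τ θ) ∈ A) (hH : H ∈ A)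
    (hH' : ∀ a, (fun θ => H' θ a) ∈ A) (hβ : ∀ a, (fun θ => β θ a) ∈ A) (γ : Fin n → ℝ)
    (z : ι × Fin n ⊕ ι → ℝ) :
    (fun θ x => layerForm p (H θ x) (μ θ) (fun a => β θ a x) (shift K (τ θ) γ)
      (layerMap p u e (σ θ) (H θ x) (fun a => H' θ a x) z)) ∈ A := by
  simp only [layerForm_of_snd_left p _ _ _ (shift_snd K _ γ)]
  exact mem_layerForm A (μ := fun θ _ => 0) (β := fun a θ => β θ a) hH hβ (mem_const A 0)
    (fun i => (mem_shift A hτ γ i).1) (fun i => (mem_shift A hτ γ i).2)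
    (fun i => (mem_layerMap A (σ := fun θ _ => σ θ) (H' := fun a θ => H' θ a) hσ hH hH' z i).1)
    (fun i => (mem_layerMap A (σ := fun θ _ => σ θ) (H' := fun a θ => H' θ a) hσ hH hH' z i).2)

theorem map_eq_sum_single {E : Type*} [AddCommGroup E] [Module ℝ E] (L : (Fin n → ℝ) →ₗ[ℝ] E)
    (γ : Fin n → ℝ) : L γ = ∑ a, γ a • L (Pi.single a 1) := by
  conv_lhs => rw [← Finset.univ_sum_single γ]
  rw [map_sum]
  refine Finset.sum_congr rfl fun a _ => ?_
  rw [← map_smul, ← Pi.single_smul, smul_eq_mul, mul_one]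

/-- Finitely many families of multipliers have a common bound. -/
theorem exists_mult_bound {κ : Type*} [Finite κ] {s : ℕ} {f : κ → Θ → Sp n → ℝ}
    (h : ∀ k, f k ∈ multAlg Θ n s) : ∃ C, 0 ≤ C ∧ ∀ k θ, Mult s C (f k θ) := by
  choose C hC using h
  obtain ⟨M, hM⟩ := (Set.finite_range C).bddAbove
  exact ⟨max M 0, le_max_right _ _, fun k θ =>
    (hC k θ).mono ((hM ⟨k, rfl⟩).trans (le_max_left _ _))⟩

theorem exists_mult1_bound {κ : Type*} [Finite κ] {s : ℕ} {f : κ → Θ → Sp n → ℝ}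
    (h : ∀ k, f k ∈ multAlg1 Θ n s) : ∃ C, 0 ≤ C ∧ ∀ k θ, Mult1 s C (f k θ) := by
  choose C hC using h
  obtain ⟨M, hM⟩ := (Set.finite_range C).bddAbove
  exact ⟨max M 0, le_max_right _ _, fun k θ =>
    (hC k θ).mono ((hM ⟨k, rfl⟩).trans (le_max_left _ _))⟩

namespace Params

variable {s : ℕ} {c₀ M₀ : ℝ} {N Ns : ℕ}

/-- The coefficients of the data. -/
noncomputable def coef (θ : Params n s c₀ M₀) (p : Fin (Ns + 1) → ℕ) (a : Fin n)
    (q : (Unit ⊕ (Fin N ⊕ Fin Ns)) × Fin n ⊕ (Unit ⊕ (Fin N ⊕ Fin Ns))) (x : Sp n) : ℝ :=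
  -((jetWeight n (θ.lam N Ns) q)⁻¹
    * (θ.form₁ N x (shift N (-θ.s₁) (Pi.single a 1)) (θ.map₁ N Ns x (Pi.single q 1))
      + θ.form₂ p x (shift Ns θ.s₂ (Pi.single a 1)) (θ.map₂ N p x (Pi.single q 1))))

theorem data_eq (θ : Params n s c₀ M₀) (p : Fin (Ns + 1) → ℕ) (γ : Fin n → Sp n → ℝ)
    (q : (Unit ⊕ (Fin N ⊕ Fin Ns)) × Fin n ⊕ (Unit ⊕ (Fin N ⊕ Fin Ns))) (x : Sp n) :
    θ.data p γ q x = ∑ a, θ.coef p a q x * γ a x := by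
  rw [data, map_eq_sum_single (shift N (-θ.s₁)), map_eq_sum_single (shift Ns θ.s₂)]
  simp only [map_sum, LinearMap.sum_apply, map_smul, LinearMap.smul_apply, smul_eq_mul]
  rw [← Finset.sum_add_distrib, Finset.mul_sum, ← Finset.sum_neg_distrib]
  refine Finset.sum_congr rfl fun a _ => ?_
  rw [coef]; ring

theorem coef_mem (hs : n < 2 * s) (p : Fin (Ns + 1) → ℕ) (a : Fin n)
    (q : (Unit ⊕ (Fin N ⊕ Fin Ns)) × Fin n ⊕ (Unit ⊕ (Fin N ⊕ Fin Ns))) :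
    (fun θ : Params n s c₀ M₀ => θ.coef p a q) ∈ multAlg _ n s := by
  set A := multAlg (Params n s c₀ M₀) n s
  have c : ∀ {f : Params n s c₀ M₀ → ℝ}, (∀ θ, |f θ| ≤ 1) → (fun θ _ => f θ) ∈ A := fun h =>
    multAlg1_le (const_mem_multAlg1 h)
  have hw := c fun θ => abs_jetWeight_inv_le (n := n) (θ.lam_cases (N := N) (Ns := Ns)) q
  have f1 := mem_layerForm_shift A (p := evenExp N) (u := .inl ()) (e := e₁ N Ns)
    (μ := fun θ => θ.l₁ ^ 2) (c abs_s₂_le)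
    (c (f := fun θ => -θ.s₁) fun θ => by rw [abs_neg]; exact θ.abs_s₁_le) (multAlg1_le (D₁_mem hs))
    (wpd_mem_multAlg (D₁_mem hs)) β₁_mem (Pi.single a 1) (Pi.single q 1)
  have f2 := mem_layerForm_shift A (p := p) (u := .inl ()) (e := e₂ N Ns)
    (μ := fun θ => θ.l₂ ^ 2) (c abs_s₁_le) (c abs_s₂_le) (multAlg1_le (D₂_mem hs))
    (wpd_mem_multAlg (D₂_mem hs)) β₂_mem (Pi.single a 1) (Pi.single q 1)
  exact A.neg_mem (mem_mul A hw (mem_add A f1 f2))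

theorem exists_data_bound (hs : n < 2 * s) (c₀ M₀ : ℝ) (N : ℕ) (p : Fin (Ns + 1) → ℕ) :
    ∃ C, 0 ≤ C ∧ ∀ (θ : Params n s c₀ M₀) (γ : Fin n → Sp n → ℝ) (B : ℝ),
      (∀ a, SB 2 s B (γ a)) → ∀ q, SB 2 s (C * B) (θ.data (N := N) p γ q) := by
  obtain ⟨C, hC0, hC⟩ := exists_mult_bound fun k : Fin n ×
    ((Unit ⊕ (Fin N ⊕ Fin Ns)) × Fin n ⊕ (Unit ⊕ (Fin N ⊕ Fin Ns))) =>
    coef_mem (c₀ := c₀) (M₀ := M₀) hs p k.1 k.2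
  refine ⟨n * C, by positivity, fun θ γ B hγ q => ?_⟩
  have := SB.sum (by norm_num) Finset.univ fun a _ => (hC (a, q) θ).2.2.2 s le_rfl B _ (hγ a)
  have e : (fun x => ∑ a, θ.coef p a q x * γ a x) = θ.data p γ q := by
    ext x; rw [data_eq]
  rw [← e]
  refine this.mono (le_of_eq ?_)
  simp [mul_assoc]

theorem memLp_data (hs : n < 2 * s) (θ : Params n s c₀ M₀) (p : Fin (Ns + 1) → ℕ)
    {γ : Fin n → Sp n → ℝ} (hγ : ∀ a, MemLp (γ a) 2 volume)
    (q : (Unit ⊕ (Fin N ⊕ Fin Ns)) × Fin n ⊕ (Unit ⊕ (Fin N ⊕ Fin Ns))) :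
    MemLp (θ.data p γ q) 2 volume := by
  have e : (fun x => ∑ a, θ.coef p a q x * γ a x) = θ.data p γ q := by
    ext x; rw [data_eq]
  rw [← e]
  exact memLp_finsetSum _ fun a _ =>
    (hγ a).mul (p := ⊤) (q := 2) (r := 2) (memLp_of_mem_multAlg (coef_mem hs p a q) θ)

theorem memLp_full (hs : n < 2 * s) (θ : Params n s c₀ M₀) (p : Fin (Ns + 1) → ℕ)
    (q r : (Unit ⊕ (Fin N ⊕ Fin Ns)) × Fin n ⊕ (Unit ⊕ (Fin N ⊕ Fin Ns))) :
    MemLp (θ.full N p q r) ⊤ volume := by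
  rw [full, ← fullMat_eq]
  exact (memLp_of_mem_multAlg (multAlg1_le (mat_mem hs p q r)) θ).add
    ((memLp_of_mem_multAlg (low_mem hs p q r) θ).const_mul _)

variable {θ : Params n s c₀ M₀} {p : Fin (Ns + 1) → ℕ}
    {U : Unit ⊕ (Fin N ⊕ Fin Ns) → Sp n → ℝ}
    {D : Unit ⊕ (Fin N ⊕ Fin Ns) → Fin n → Sp n → ℝ} {γ : Fin n → Sp n → ℝ}
    {φ₁ : Fin (N + 1) → Sp n → ℝ} {g₁ : Fin (N + 1) → Fin n → Sp n → ℝ}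
    {φ₂ : Fin (Ns + 1) → Sp n → ℝ} {g₂ : Fin (Ns + 1) → Fin n → Sp n → ℝ}

theorem form₁_eq (θ : Params n s c₀ M₀) (N : ℕ) (x : Sp n) :
    θ.form₁ N x = layerForm (evenExp N) (H₁ θ.h₁ θ.ζ x) ((θ.h₁ * θ.δ) ^ 2)⁻¹
      (fun a => θ.h₁⁻¹ * wpd a 0 x) := by
  rw [form₁, l₁, inv_pow]; rfl

theorem form₂_eq (θ : Params n s c₀ M₀) (p : Fin (Ns + 1) → ℕ) (x : Sp n) :
    θ.form₂ p x = layerForm p (H₂ θ.h₂ θ.ζ θ.b x) ((θ.h₂ * θ.δ) ^ 2)⁻¹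
      (fun a => θ.h₂⁻¹ * wpd a θ.b x) := by
  rw [form₂, l₂, inv_pow]; rfl

theorem Rel.weak (hs : n < 2 * s) (hp0 : p 0 = 0) (h : θ.Rel p U D γ φ₁ g₁ φ₂ g₂)
    (k : Unit ⊕ (Fin N ⊕ Fin Ns)) {ψ : Sp n → ℝ} (hψ : IsTest ψ) :
    (∑ a, ∫ x, (∑ r, θ.full N p (.inl (k, a)) r x * jet (θ.lam N Ns) U D r x
          - θ.data p γ (.inl (k, a)) x) * pd a ψ x)
        + ∫ x, (θ.lam N Ns k * (∑ r, θ.full N p (.inr k) r x * jet (θ.lam N Ns) U D r x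
          - θ.data p γ (.inr k) x) - (0 : Unit ⊕ (Fin N ⊕ Fin Ns) → Sp n → ℝ) k x) * ψ x
      = ∫ x, (θ.κ₁ * θ.form₁ N x (fieldJet φ₁ g₁ x) (θ.map₁ N Ns x (testJet k ψ x))
        + θ.κ₂ * θ.form₂ p x (fieldJet φ₂ g₂ x) (θ.map₂ N p x (testJet k ψ x))) := by
  have hG : ∀ q, MemLp (fun x => ∑ r, θ.full N p q r x * jet (θ.lam N Ns) U D r x
      - θ.data p γ q x) 2 volume := fun q =>
    (memLp_sum_mul (θ.memLp_full hs p) h.energy.memLp_jet q).sub (θ.memLp_data hs p h.grad q)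
  have i1 : ∀ a, Integrable (fun x => (∑ r, θ.full N p (.inl (k, a)) r x * jet (θ.lam N Ns) U D r x
          - θ.data p γ (.inl (k, a)) x) * pd a ψ x) := fun a =>
    integrable_mul_two (hG _) ((hψ.pd a).memLp 2)
  have i2 : Integrable (fun x => θ.lam N Ns k * (∑ r, θ.full N p (.inr k) r x
      * jet (θ.lam N Ns) U D r x - θ.data p γ (.inr k) x) * ψ x) :=
    integrable_mul_two ((hG _).const_mul _) (hψ.memLp 2)
  simp only [Pi.zero_apply, sub_zero]
  rw [← integral_finsetSum _ fun a _ => i1 a,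
    ← integral_add (integrable_finsetSum _ fun a _ => i1 a) i2]
  exact integral_congr_ae (h.pointwise θ hp0 k ψ)

/-- As κ₁s₂ = s₁s₂h₁ and κ₂s₁ = s₁s₂h₂, the equation for u is s₁s₂ times the condition that couples
the layers. The equation for another unknown concerns a single layer and is κ times the condition
for 𝓛ᵢ. All these factors are nonzero. -/
theorem Rel.weakSys_iff (hs : n < 2 * s) (hp0 : p 0 = 0) (h : θ.Rel p U D γ φ₁ g₁ φ₂ g₂) :
    WeakSys (θ.lam N Ns) (θ.full N p) U D (θ.data p γ) 0
      ↔ Compatible p θ.h₁ θ.h₂ θ.δ θ.ζ θ.b φ₁ φ₂ := by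
  have hD₁ := memLp_of_mem_multAlg (multAlg1_le (D₁_mem hs)) θ
  have hD₂ := memLp_of_mem_multAlg (multAlg1_le (D₂_mem hs)) θ
  have hD₁' := fun a => memLp_of_mem_multAlg (wpd_mem_multAlg (D₁_mem hs) a) θ
  have hD₂' := fun a => memLp_of_mem_multAlg (wpd_mem_multAlg (D₂_mem hs) a) θ
  have hβ₁ := fun a => memLp_of_mem_multAlg (β₁_mem a) θ
  have hβ₂ := fun a => memLp_of_mem_multAlg (β₂_mem a) θ
  have inj₁ : Function.Injective (e₁ N Ns) := fun i j h => by simpa [e₁] using h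
  have inj₂ : Function.Injective (e₂ N Ns) := fun i j h => by simpa [e₂] using h
  have z₁ := fun {ψ : Sp n → ℝ} (hψ : IsTest ψ) => integral_layerForm_zero (σ := θ.s₂)
    (H' := fun a => wpd a θ.D₁) (p := evenExp N) (u := .inl ()) (e := e₁ N Ns) (h := θ.h₁) (δ := θ.δ)
    (b := 0) rfl hD₁ hβ₁ h.wd₁ h.memLp₁ h.memLp_succ₁ (fun j => by simp [e₁]) hψ
  have z₂ := fun {ψ : Sp n → ℝ} (hψ : IsTest ψ) => integral_layerForm_zero (σ := θ.s₁)
    (H' := fun a => wpd a θ.D₂) (p := p) (u := .inl ()) (e := e₂ N Ns) (h := θ.h₂) (δ := θ.δ)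
    (b := θ.b) hp0 hD₂ hβ₂ h.wd₂ h.memLp₂ h.memLp_succ₂ (fun j => by simp [e₂]) hψ
  have y₁ := fun i {ψ : Sp n → ℝ} (hψ : IsTest ψ) => integral_layerForm_succ (σ := θ.s₂)
    (H' := fun a => wpd a θ.D₁) (p := evenExp N) (u := .inl ()) (e := e₁ N Ns) (h := θ.h₁) (δ := θ.δ)
    (b := 0) rfl hD₁ hD₁' (fun a => wd_wpd_of_mem (D₁_mem hs) a θ) hβ₁ h.wd₁ h.memLp₁ h.memLp_succ₁
    (fun j => by simp [e₁]) inj₁ i hψ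
  have y₂ := fun i {ψ : Sp n → ℝ} (hψ : IsTest ψ) => integral_layerForm_succ (σ := θ.s₁)
    (H' := fun a => wpd a θ.D₂) (p := p) (u := .inl ()) (e := e₂ N Ns) (h := θ.h₂) (δ := θ.δ)
    (b := θ.b) hp0 hD₂ hD₂' (fun a => wd_wpd_of_mem (D₂_mem hs) a θ) hβ₂ h.wd₂ h.memLp₂ h.memLp_succ₂
    (fun j => by simp [e₂]) inj₂ i hψ
  have E0 : ∀ {ψ : Sp n → ℝ}, IsTest ψ →
      ∫ x, (θ.κ₁ * θ.form₁ N x (fieldJet φ₁ g₁ x) (θ.map₁ N Ns x (testJet (.inl ()) ψ x))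
        + θ.κ₂ * θ.form₂ p x (fieldJet φ₂ g₂ x) (θ.map₂ N p x (testJet (.inl ()) ψ x)))
      = θ.s₁ * θ.s₂ * (θ.h₁ * calL0 (evenExp N) (H₁ θ.h₁ θ.ζ) 0 θ.h₁ θ.δ φ₁ ψ
        + θ.h₂ * calL0 p (H₂ θ.h₂ θ.ζ θ.b) θ.b θ.h₂ θ.δ φ₂ ψ) := fun {ψ} hψ => by
    simp only [form₁_eq, form₂_eq]
    refine (integral_add ((z₁ hψ).1.const_mul θ.κ₁) ((z₂ hψ).1.const_mul θ.κ₂)).trans ?_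
    rw [integral_const_mul, integral_const_mul, (z₁ hψ).2, (z₂ hψ).2]
    simp only [κ₁, κ₂, D₁, D₂]; ring
  have E1 : ∀ i {ψ : Sp n → ℝ}, IsTest ψ →
      ∫ x, (θ.κ₁ * θ.form₁ N x (fieldJet φ₁ g₁ x) (θ.map₁ N Ns x (testJet (e₁ N Ns i) ψ x))
        + θ.κ₂ * θ.form₂ p x (fieldJet φ₂ g₂ x) (θ.map₂ N p x (testJet (e₁ N Ns i) ψ x)))
      = θ.κ₁ * calL (evenExp N) (H₁ θ.h₁ θ.ζ) 0 θ.h₁ θ.δ i.succ φ₁ ψ := fun i {ψ} hψ => by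
    simp only [map₂_testJet_e₁, map_zero, mul_zero, add_zero, form₁_eq]
    rw [integral_const_mul]
    exact congrArg (θ.κ₁ * ·) (y₁ i hψ).2
  have E2 : ∀ i {ψ : Sp n → ℝ}, IsTest ψ →
      ∫ x, (θ.κ₁ * θ.form₁ N x (fieldJet φ₁ g₁ x) (θ.map₁ N Ns x (testJet (e₂ N Ns i) ψ x))
        + θ.κ₂ * θ.form₂ p x (fieldJet φ₂ g₂ x) (θ.map₂ N p x (testJet (e₂ N Ns i) ψ x)))
      = θ.κ₂ * calL p (H₂ θ.h₂ θ.ζ θ.b) θ.b θ.h₂ θ.δ i.succ φ₂ ψ := fun i {ψ} hψ => by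
    simp only [map₁_testJet_e₂, map_zero, mul_zero, zero_add, form₂_eq]
    rw [integral_const_mul]
    exact congrArg (θ.κ₂ * ·) (y₂ i hψ).2
  have hss : θ.s₁ * θ.s₂ ≠ 0 := (mul_pos θ.s₁_pos θ.s₂_pos).ne'
  constructor
  · intro hW ψ hψ
    refine ⟨fun i => ?_, fun i => ?_, ?_⟩
    · have := hW (e₁ N Ns i) ψ hψ
      rw [h.weak hs hp0 _ hψ, E1 i hψ] at this
      exact (mul_eq_zero.1 this).resolve_left θ.κ₁_pos.ne'
    · have := hW (e₂ N Ns i) ψ hψ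
      rw [h.weak hs hp0 _ hψ, E2 i hψ] at this
      exact (mul_eq_zero.1 this).resolve_left θ.κ₂_pos.ne'
    · have := hW (.inl ()) ψ hψ
      rw [h.weak hs hp0 _ hψ, E0 hψ] at this
      exact (mul_eq_zero.1 this).resolve_left hss
  · intro hC k ψ hψ
    rw [h.weak hs hp0 _ hψ]
    obtain ⟨h1, h2, h3⟩ := hC ψ hψ
    rcases k with ⟨⟩ | i | i
    · rw [E0 hψ, h3, mul_zero]
    · exact (E1 i hψ).trans (by rw [h1 i, mul_zero])
    · exact (E2 i hψ).trans (by rw [h2 i, mul_zero])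

end Params

end Kakinuma

/-! ### Reconstruction of the potentials from the unknowns -/

namespace Kakinuma
open Filter Topology

variable {n K : ℕ} {ι : Type*}

/-- A function with vanishing weak gradient is constant. -/
theorem exists_ae_eq_const {W : Sp n → ℝ} (h : ∀ a, WD a W (fun _ => 0))
    (hW : LocallyIntegrable W volume) : ∃ c : ℝ, ∀ᵐ x, W x = c := by
  have hc : ∀ k x y, moll k W x = moll k W y := fun k => by
    have hd : Differentiable ℝ (moll k W) := (contDiff_moll k hW).differentiable (by simp)
    refine is_const_of_fderiv_eq_zero (𝕜 := ℝ) hd fun x => ?_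
    ext z
    rw [fderiv_eq_sum_pd]
    refine Finset.sum_eq_zero fun a _ => ?_
    rw [pd_moll k (h a)]
    simp [moll]
  have ht := tendsto_moll hW
  obtain ⟨x₀, hx₀⟩ := ht.exists
  refine ⟨W x₀, ?_⟩
  filter_upwards [ht] with x hx
  refine tendsto_nhds_unique hx ?_
  simpa only [hc _ x x₀] using hx₀

theorem memLp_sum_pow_mul {H H' : Sp n → ℝ} (h1 : MemLp H ⊤ volume) (h2 : MemLp H' ⊤ volume)
    (r : Fin K → ℕ) {f f' : Fin K → Sp n → ℝ} (hf : ∀ j, MemLp (f j) 2 volume)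
    (hf' : ∀ j, MemLp (f' j) 2 volume) :
    MemLp (fun x => ∑ j, (H x ^ r j * f' j x + r j * H x ^ (r j - 1) * H' x * f j x)) 2 volume := by
  set A := multAlg Unit n 0
  have c := mem_const A
  have m1 := mem_multAlg_unit h1
  have m2 := mem_multAlg_unit h2
  exact memLp_finsetSum _ fun j _ =>
    ((hf' j).mul (p := ⊤) (q := 2) (r := 2) (memLp_top_of_mem (mem_pow A m1 _))).add
      ((hf j).mul (p := ⊤) (q := 2) (r := 2)
        (memLp_top_of_mem (mem_mul A (mem_mul A (c _) (mem_pow A m1 _)) m2)))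

theorem WD.sum_pow_mul {a : Fin n} {H H' : Sp n → ℝ} (hH : WD a H H') (h1 : MemLp H ⊤ volume)
    (h2 : MemLp H' ⊤ volume) (r : Fin K → ℕ) {f f' : Fin K → Sp n → ℝ}
    (hw : ∀ j, WD a (f j) (f' j)) (hf : ∀ j, MemLp (f j) 2 volume)
    (hf' : ∀ j, MemLp (f' j) 2 volume) :
    WD a (fun x => ∑ j, H x ^ r j * f j x)
      (fun x => ∑ j, (H x ^ r j * f' j x + r j * H x ^ (r j - 1) * H' x * f j x)) := by
  set A := multAlg Unit n 0
  have c := mem_const A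
  have m1 := mem_multAlg_unit h1
  have m2 := mem_multAlg_unit h2
  refine WD.sum Finset.univ fun j _ => ?_
  have := (hH.pow h1 h2 (r j)).mul (hw j) (.of_memLp_top (memLp_top_of_mem (mem_pow A m1 _)))
    (.of_memLp_top (memLp_top_of_mem (mem_mul A (mem_mul A (c _) (mem_pow A m1 _)) m2)))
    (.of_memLp_two (hf j)) (.of_memLp_two (hf' j))
  exact this.congr EventuallyEq.rfl (ae_of_all _ fun x => add_comm _ _)

/-- The tuple given by the unknowns `U` and the function `φ`. -/
noncomputable def layerField (p : Fin (K + 1) → ℕ) (u : ι) (e : Fin K → ι) (σ : ℝ) (H : Sp n → ℝ)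
    (κ τ : ℝ) (U : ι → Sp n → ℝ) (φ : Sp n → ℝ) : Fin (K + 1) → Sp n → ℝ :=
  Fin.cons (fun x => κ⁻¹ * (σ * U u x - ∑ j, H x ^ p j.succ * U (e j) x + τ * φ x))
    fun j x => κ⁻¹ * U (e j) x

/-- The gradients of `layerField`. -/
noncomputable def layerGrad (p : Fin (K + 1) → ℕ) (u : ι) (e : Fin K → ι) (σ : ℝ) (H : Sp n → ℝ)
    (H' : Fin n → Sp n → ℝ) (κ τ : ℝ) (U : ι → Sp n → ℝ) (D : ι → Fin n → Sp n → ℝ)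
    (γ : Fin n → Sp n → ℝ) : Fin (K + 1) → Fin n → Sp n → ℝ :=
  Fin.cons (fun a x => κ⁻¹ * ((layerMap p u e σ (H x) (fun a => H' a x)
      (fun q => jet (fun _ => 1) U D q x) 0).1 a + τ * γ a x))
    fun j a x => κ⁻¹ * D (e j) a x

section

variable {p : Fin (K + 1) → ℕ} {u : ι} {e : Fin K → ι} {σ κ τ : ℝ} {H : Sp n → ℝ}
  {H' : Fin n → Sp n → ℝ} {U : ι → Sp n → ℝ} {D : ι → Fin n → Sp n → ℝ} {φ : Sp n → ℝ}
  {γ : Fin n → Sp n → ℝ}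

theorem wd_layerField (hH : ∀ a, WD a H (H' a)) (h1 : MemLp H ⊤ volume)
    (h2 : ∀ a, MemLp (H' a) ⊤ volume) (hU : ∀ i a, WD a (U i) (D i a))
    (hU2 : ∀ j, MemLp (U (e j)) 2 volume) (hD : ∀ j a, MemLp (D (e j) a) 2 volume)
    (hφ : ∀ a, WD a φ (γ a)) (i : Fin (K + 1)) (a : Fin n) :
    WD a (layerField p u e σ H κ τ U φ i) (layerGrad p u e σ H H' κ τ U D γ i a) := by
  refine Fin.cases ?_ (fun j => ?_) i
  · have := (((hU u a).const_mul σ).sub ((hH a).sum_pow_mul h1 (h2 a) (fun j => p j.succ)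
      (fun j => hU (e j) a) hU2 (fun j => hD j a))).add ((hφ a).const_mul τ)
    refine (this.const_mul κ⁻¹).congr EventuallyEq.rfl (ae_of_all _ fun x => ?_)
    simp [layerGrad, layerMap_zero, jet]
  · exact (hU (e j) a).const_mul κ⁻¹

theorem layerRel_layerField (hκ : κ ≠ 0) : LayerRel p u e σ H H' κ τ U D γ
    (layerField p u e σ H κ τ U φ) (layerGrad p u e σ H H' κ τ U D γ) :=
  ae_of_all _ fun _ => ⟨fun _ => mul_inv_cancel_left₀ hκ _, fun _ _ => mul_inv_cancel_left₀ hκ _,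
    fun _ => mul_inv_cancel_left₀ hκ _⟩

/-- The first component contains the other contributions to the trace with a minus sign, so they
cancel. -/
theorem sum_layerField (hp0 : p 0 = 0) (x : Sp n) :
    ∑ i, H x ^ p i * layerField p u e σ H κ τ U φ i x = κ⁻¹ * (σ * U u x + τ * φ x) := by
  rw [Fin.sum_univ_succ, hp0]
  simp only [layerField, Fin.cons_zero, Fin.cons_succ, pow_zero, one_mul]
  have : ∑ j : Fin K, H x ^ p j.succ * (κ⁻¹ * U (e j) x)
      = κ⁻¹ * ∑ j : Fin K, H x ^ p j.succ * U (e j) x := by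
    rw [Finset.mul_sum]
    exact Finset.sum_congr rfl fun j _ => by ring
  rw [this]; ring

end

section

variable {h δ κ E : ℝ} {k : ℕ} {φ : Fin (K + 1) → Sp n → ℝ} {g : Fin (K + 1) → Fin n → Sp n → ℝ}

theorem SB.of_const_mul {p : ℝ≥0∞} {c : ℝ} (hc : c ≠ 0) {f : Sp n → ℝ}
    (hf : SB p k E (fun x => c * f x)) : SB p k (|c⁻¹| * E) f :=
  (hf.const_mul c⁻¹).congr (ae_of_all _ fun _ => inv_mul_cancel_left₀ hc _)

theorem inClass_of_sb (hl : h * δ ≠ 0) (hκ : κ ≠ 0) (hw : ∀ i a, WD a (φ i) (g i a))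
    (hg : ∀ i a, SB 2 k E (fun x => κ * g i a x))
    (hφ : ∀ j : Fin K, SB 2 k E (fun x => (h * δ)⁻¹ * (κ * φ j.succ x))) : InClass k φ := by
  have hg' := fun i a => (hg i a).of_const_mul hκ
  have hφ' := fun j => ((hφ j).of_const_mul (inv_ne_zero hl)).of_const_mul hκ
  refine ⟨fun a => ⟨g 0 a, hasWeakDeriv_one.2 (hw 0 a), (hg' 0 a).memW (by norm_num)⟩, fun j => ?_⟩
  exact (SB.succ ((hφ' j).lb.mono (le_max_left _ _)) (fun a => hw j.succ a)
    fun a => (hg' j.succ a).mono (le_max_right _ _)).memW (by norm_num)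

/-- The factor counts the (K + 1)n gradient entries and the K functions, each of which has norm at
most `numDeriv n k * E` after multiplication by κ and by its weight. -/
theorem layerNormSq_le (hl : 0 < h * δ) (hκ : 0 < κ) (hw : ∀ i a, WD a (φ i) (g i a))
    (hg : ∀ i a, SB 2 k E (fun x => κ * g i a x))
    (hφ : ∀ j : Fin K, SB 2 k E (fun x => (h * δ)⁻¹ * (κ * φ j.succ x))) :
    κ ^ 2 * layerNormSq k h δ φ ≤ ((K + 1) * n + K) * (numDeriv n k * E) ^ 2 := by
  have t1 : ∀ i a, κ ^ 2 * wNorm k 2 (wpd a (φ i)) ^ 2 ≤ (numDeriv n k * E) ^ 2 := fun i a => by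
    have := (((hg i a).of_const_mul hκ.ne').congr (hw i a).wpd_eq.symm).wNorm_le (by norm_num)
    rw [← mul_pow]
    refine pow_le_pow_left₀ (mul_nonneg hκ.le (wNorm_nonneg _ _ _)) ?_ 2
    rw [abs_of_pos (inv_pos.2 hκ)] at this
    calc κ * wNorm k 2 (wpd a (φ i)) ≤ κ * (numDeriv n k * (κ⁻¹ * E)) := by gcongr
      _ = _ := by field_simp
  have t2 : ∀ j : Fin K, κ ^ 2 * (((h * δ) ^ 2)⁻¹ * wNorm k 2 (φ j.succ) ^ 2)
      ≤ (numDeriv n k * E) ^ 2 := fun j => by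
    have := (((hφ j).of_const_mul (inv_pos.2 hl).ne').of_const_mul hκ.ne').wNorm_le (by norm_num)
    rw [inv_inv, abs_of_pos (inv_pos.2 hκ), abs_of_pos hl] at this
    have e1 : κ ^ 2 * (((h * δ) ^ 2)⁻¹ * wNorm k 2 (φ j.succ) ^ 2)
        = (κ * (h * δ)⁻¹ * wNorm k 2 (φ j.succ)) ^ 2 := by
      rw [← inv_pow]; ring
    rw [e1]
    have hi := inv_pos.2 hl
    refine pow_le_pow_left₀ (mul_nonneg (mul_nonneg hκ.le hi.le) (wNorm_nonneg _ _ _)) ?_ 2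
    calc κ * (h * δ)⁻¹ * wNorm k 2 (φ j.succ)
        ≤ κ * (h * δ)⁻¹ * (numDeriv n k * (κ⁻¹ * (h * δ * E))) := by gcongr
      _ = κ * κ⁻¹ * ((h * δ)⁻¹ * (h * δ)) * (numDeriv n k * E) := by ring
      _ = _ := by rw [mul_inv_cancel₀ hκ.ne', inv_mul_cancel₀ hl.ne']; ring
  have e : κ ^ 2 * layerNormSq k h δ φ = (∑ i, ∑ a, κ ^ 2 * wNorm k 2 (wpd a (φ i)) ^ 2)
      + ∑ j : Fin K, κ ^ 2 * (((h * δ) ^ 2)⁻¹ * wNorm k 2 (φ j.succ) ^ 2) := by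
    simp only [layerNormSq, gradNormSq, mul_add, Finset.mul_sum]
  rw [e]
  refine (add_le_add (Finset.sum_le_sum fun i _ => Finset.sum_le_sum fun a _ => t1 i a)
    (Finset.sum_le_sum fun j _ => t2 j)).trans (le_of_eq ?_)
  simp
  ring

end

section

variable {p : Fin (K + 1) → ℕ} {H : Sp n → ℝ} {H' : Fin n → Sp n → ℝ}
  {χ : Fin (K + 1) → Sp n → ℝ} {g : Fin (K + 1) → Fin n → Sp n → ℝ}

/-- The gradient of `∑ᵢ H^{pᵢ} χᵢ`. -/
noncomputable def traceGrad (p : Fin (K + 1) → ℕ) (H : Sp n → ℝ) (H' : Fin n → Sp n → ℝ)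
    (χ : Fin (K + 1) → Sp n → ℝ) (g : Fin (K + 1) → Fin n → Sp n → ℝ) (a : Fin n) (x : Sp n) : ℝ :=
  g 0 a x + ∑ j : Fin K, (H x ^ p j.succ * g j.succ a x
    + p j.succ * H x ^ (p j.succ - 1) * H' a x * χ j.succ x)

theorem wd_trace (hp0 : p 0 = 0) (hH : ∀ a, WD a H (H' a)) (h1 : MemLp H ⊤ volume)
    (h2 : ∀ a, MemLp (H' a) ⊤ volume) (hw : ∀ i a, WD a (χ i) (g i a))
    (hg : ∀ i a, MemLp (g i a) 2 volume) (hχ : ∀ j : Fin K, MemLp (χ j.succ) 2 volume) (a : Fin n) :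
    WD a (fun x => ∑ i, H x ^ p i * χ i x) (traceGrad p H H' χ g a) := by
  have := (hw 0 a).add ((hH a).sum_pow_mul h1 (h2 a) (fun j => p j.succ)
      (fun j => hw j.succ a) hχ (fun j => hg j.succ a))
  refine this.congr (ae_of_all _ fun x => ?_) EventuallyEq.rfl
  simp [Fin.sum_univ_succ, hp0]

theorem memLp_traceGrad (h1 : MemLp H ⊤ volume)
    (h2 : ∀ a, MemLp (H' a) ⊤ volume)
    (hg : ∀ i a, MemLp (g i a) 2 volume) (hχ : ∀ j : Fin K, MemLp (χ j.succ) 2 volume) (a : Fin n) :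
    MemLp (traceGrad p H H' χ g a) 2 volume :=
  (hg 0 a).add (memLp_sum_pow_mul h1 (h2 a) (fun j => p j.succ) hχ fun j => hg j.succ a)

/-- Solving the gradient of the trace for the gradient of the first component gives the first entry
of `layerMap`. -/
theorem layerRel_of_trace {u : ι} {e : Fin K → ι} {σ κ τ : ℝ} {U : ι → Sp n → ℝ}
    {D : ι → Fin n → Sp n → ℝ} {γ : Fin n → Sp n → ℝ} (hU : ∀ j x, U (e j) x = κ * χ j.succ x)
    (hD : ∀ j a x, D (e j) a x = κ * g j.succ a x)
    (h : ∀ a, ∀ᵐ x, κ * traceGrad p H H' χ g a x = σ * D u a x + τ * γ a x) :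
    LayerRel p u e σ H H' κ τ U D γ χ g := by
  filter_upwards [ae_all_iff.2 h] with x hx
  refine ⟨fun a => ?_, fun j a => (hD j a x).symm, fun j => (hU j x).symm⟩
  have := hx a
  simp only [traceGrad, mul_add, Finset.mul_sum, layerMap_zero, jet, hU, hD, one_mul,
    Finset.sum_add_distrib] at this ⊢
  have e1 : ∀ j : Fin K, κ * (H x ^ p j.succ * g j.succ a x) = H x ^ p j.succ * (κ * g j.succ a x) :=
    fun j => by ring
  have e2 : ∀ j : Fin K, κ * (p j.succ * H x ^ (p j.succ - 1) * H' a x * χ j.succ x)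
      = p j.succ * H x ^ (p j.succ - 1) * H' a x * (κ * χ j.succ x) := fun j => by ring
  simp only [e1, e2] at this
  linarith

end

theorem DivEq.sub {Φ Φ' : Fin n → Sp n → ℝ} {Ψ Ψ' : Sp n → ℝ} (h : DivEq Φ Ψ) (h' : DivEq Φ' Ψ')
    (hΦ : ∀ a, MemLp (Φ a) 2 volume) (hΦ' : ∀ a, MemLp (Φ' a) 2 volume) (hΨ : MemLp Ψ 2 volume)
    (hΨ' : MemLp Ψ' 2 volume) :
    DivEq (fun a x => Φ a x - Φ' a x) (fun x => Ψ x - Ψ' x) := fun ψ hψ => by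
  have e1 : ∀ a, ∫ x, (Φ a x - Φ' a x) * pd a ψ x
      = (∫ x, Φ a x * pd a ψ x) - ∫ x, Φ' a x * pd a ψ x := fun a => by
    rw [← integral_sub (integrable_mul_two (hΦ a) ((hψ.pd a).memLp 2))
      (integrable_mul_two (hΦ' a) ((hψ.pd a).memLp 2))]
    simp only [sub_mul]
  have e2 : ∫ x, (Ψ x - Ψ' x) * ψ x = (∫ x, Ψ x * ψ x) - ∫ x, Ψ' x * ψ x := by
    rw [← integral_sub (integrable_mul_two hΨ (hψ.memLp 2)) (integrable_mul_two hΨ' (hψ.memLp 2))]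
    simp only [sub_mul]
  simp only [e1, e2, Finset.sum_sub_distrib]
  linarith [h ψ hψ, h' ψ hψ]

/-- Solutions of a coercive system with the same data have the same jets. -/
theorem WeakSys.unique [Fintype ι] {lam : ι → ℝ} {Q : ι × Fin n ⊕ ι → ι × Fin n ⊕ ι → Sp n → ℝ}
    {U V : ι → Sp n → ℝ} {D E : ι → Fin n → Sp n → ℝ} {F : ι × Fin n ⊕ ι → Sp n → ℝ} {c : ℝ}
    (hQ : ∀ q r, MemLp (Q q r) ⊤ volume) (hc0 : 0 < c) (hc : Coercive lam c Q)
    (hF : ∀ q, MemLp (F q) 2 volume) (hU : Energy lam U D) (hV : Energy lam V E)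
    (h : WeakSys lam Q U D F 0) (h' : WeakSys lam Q V E F 0) (q : ι × Fin n ⊕ ι) :
    jet lam U D q =ᵐ[volume] jet lam V E q := by
  have hd := hU.add (hV.smul (-1))
  have hj : ∀ q, jet lam (U + (-1 : ℝ) • V) (D + (-1 : ℝ) • E) q
      = fun x => jet lam U D q x - jet lam V E q x := fun q => by
    rw [jet_add, jet_smul]
    ext x
    simp [sub_eq_add_neg]
  have hG := fun q => (memLp_sum_mul hQ hU.memLp_jet q).sub (hF q)
  have hG' := fun q => (memLp_sum_mul hQ hV.memLp_jet q).sub (hF q)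
  -- The data cancel in the difference, so the energy estimate with bound 0 annihilates its jet.
  have hw : WeakSys lam Q (U + (-1 : ℝ) • V) (D + (-1 : ℝ) • E) 0 0 := fun i => by
    have := (h i).sub (h' i) (fun a => hG _) (fun a => hG' _)
      (((hG (.inr i)).const_mul (lam i)).sub MemLp.zero)
      (((hG' (.inr i)).const_mul (lam i)).sub MemLp.zero)
    convert this using 1
    · ext a x
      simp only [hj, mul_sub, Finset.sum_sub_distrib, Pi.zero_apply]
      ring
    · ext x
      simp only [hj, mul_sub, Finset.sum_sub_distrib, Pi.zero_apply]
      ring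
  have hz : LB 2 0 (0 : Sp n → ℝ) := ⟨MemLp.zero, le_rfl, by simp⟩
  have h0 := (hw.energy hQ hc0 hc hd le_rfl (fun _ => hz) q).2.2
  rw [mul_zero, ENNReal.ofReal_zero, nonpos_iff_eq_zero, eLpNorm_eq_zero_iff
    (hd.memLp_jet q).1 (by norm_num), hj] at h0
  filter_upwards [h0] with x hx
  exact sub_eq_zero.1 hx

end Kakinuma

/-! ### Uniform bounds for the unknowns and the layer variables -/

namespace Kakinuma
open Filter Topology

variable {n : ℕ}

namespace Params

variable {s : ℕ} {c₀ M₀ : ℝ} {N Ns : ℕ}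

theorem exists_ae_bound {f : Params n s c₀ M₀ → Sp n → ℝ} (h : f ∈ multAlg _ n s) :
    ∃ C, 0 ≤ C ∧ ∀ θ, ∀ᵐ x, |f θ x| ≤ C := by
  obtain ⟨C, h0, hC⟩ := exists_mult_bound fun _ : Unit => h
  exact ⟨C, h0, fun θ => (hC () θ).2.2.1⟩

theorem exists_ae_bound_fin {f : Fin n → Params n s c₀ M₀ → Sp n → ℝ}
    (h : ∀ a, f a ∈ multAlg _ n s) : ∃ C, 0 ≤ C ∧ ∀ θ a, ∀ᵐ x, |f a θ x| ≤ C := by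
  obtain ⟨C, h0, hC⟩ := exists_mult_bound h
  exact ⟨C, h0, fun θ a => (hC a θ).2.2.1⟩

/-- The full matrix serves existence, uniqueness and the energy estimate, the principal one the
regularity argument. A single bound for the depths and all slopes, zero slopes included, gives a
common constant. -/
theorem exists_coercive_both (hs : n < 2 * s) (M₀ : ℝ) (N : ℕ) {p : Fin (Ns + 1) → ℕ}
    (hp0 : p 0 = 0) (hp : StrictMono p) (hc₀ : 0 < c₀) : ∃ c : ℝ, 0 < c ∧
    ∀ θ : Params n s c₀ M₀, Coercive (θ.lam N Ns) c (θ.mat (N := N) p 0 0 0 0) ∧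
      Coercive (θ.lam N Ns) c (θ.full N p) := by
  obtain ⟨C1, z1, b1⟩ := exists_ae_bound (multAlg1_le (D₁_mem (c₀ := c₀) (M₀ := M₀) hs))
  obtain ⟨C2, z2, b2⟩ := exists_ae_bound (multAlg1_le (D₂_mem (c₀ := c₀) (M₀ := M₀) hs))
  obtain ⟨C3, z3, b3⟩ := exists_ae_bound_fin (wpd_mem_multAlg (D₁_mem (c₀ := c₀) (M₀ := M₀) hs))
  obtain ⟨C4, z4, b4⟩ := exists_ae_bound_fin (wpd_mem_multAlg (D₂_mem (c₀ := c₀) (M₀ := M₀) hs))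
  obtain ⟨C5, z5, b5⟩ := exists_ae_bound_fin (β₁_mem (n := n) (s := s) (c₀ := c₀) (M₀ := M₀))
  obtain ⟨C6, z6, b6⟩ := exists_ae_bound_fin (β₂_mem (n := n) (s := s) (c₀ := c₀) (M₀ := M₀))
  have hM : 0 ≤ C1 + C2 + C3 + C4 + C5 + C6 := by positivity
  obtain ⟨c, hc, h⟩ := exists_coercive (M₀ := M₀) (N := N) n s hp0 hp hc₀ hM
  have hz : ∀ a : Fin n, ∀ᵐ x, |(0 : Fin n → Sp n → ℝ) a x| ≤ C1 + C2 + C3 + C4 + C5 + C6 :=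
    fun a => ae_of_all _ fun x => by simpa using hM
  have up : ∀ {f : Sp n → ℝ} {C : ℝ}, (∀ᵐ x, |f x| ≤ C) → C ≤ C1 + C2 + C3 + C4 + C5 + C6 →
      ∀ᵐ x, |f x| ≤ C1 + C2 + C3 + C4 + C5 + C6 := fun h hC => h.mono fun _ hx => hx.trans hC
  refine ⟨c, hc, fun θ => ⟨h θ 0 0 0 0 (up (b1 θ) (by linarith)) (up (b2 θ) (by linarith)) hz hz hz hz,
    h θ _ _ _ _ (up (b1 θ) (by linarith)) (up (b2 θ) (by linarith))
      (fun a => up (b3 θ a) (by linarith)) (fun a => up (b5 θ a) (by linarith))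
      (fun a => up (b4 θ a) (by linarith)) (fun a => up (b6 θ a) (by linarith))⟩⟩

/-- Uniform bounds for the unknowns. -/
theorem exists_jet_bound (hs : n < 2 * s) (M₀ : ℝ) (N : ℕ) {p : Fin (Ns + 1) → ℕ}
    (hp0 : p 0 = 0) (hp : StrictMono p) (hc₀ : 0 < c₀) : ∃ C : ℝ, 0 ≤ C ∧
    ∀ (θ : Params n s c₀ M₀) (U : Unit ⊕ (Fin N ⊕ Fin Ns) → Sp n → ℝ)
      (D : Unit ⊕ (Fin N ⊕ Fin Ns) → Fin n → Sp n → ℝ) (γ : Fin n → Sp n → ℝ) (B : ℝ),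
      Energy (θ.lam N Ns) U D → WeakSys (θ.lam N Ns) (θ.full N p) U D (θ.data p γ) 0 →
      (∀ a, SB 2 s B (γ a)) → ∀ q, SB 2 s (C * B) (jet (θ.lam N Ns) U D q) := by
  obtain ⟨c, hc, hco⟩ := exists_coercive_both hs M₀ N hp0 hp hc₀
  obtain ⟨Ca, _, ha⟩ := exists_mult1_bound fun k :
    ((Unit ⊕ (Fin N ⊕ Fin Ns)) × Fin n ⊕ (Unit ⊕ (Fin N ⊕ Fin Ns))) ×
      ((Unit ⊕ (Fin N ⊕ Fin Ns)) × Fin n ⊕ (Unit ⊕ (Fin N ⊕ Fin Ns))) =>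
      mat_mem (c₀ := c₀) (M₀ := M₀) hs p k.1 k.2
  obtain ⟨Cb, _, hb⟩ := exists_mult_bound fun k :
    ((Unit ⊕ (Fin N ⊕ Fin Ns)) × Fin n ⊕ (Unit ⊕ (Fin N ⊕ Fin Ns))) ×
      ((Unit ⊕ (Fin N ⊕ Fin Ns)) × Fin n ⊕ (Unit ⊕ (Fin N ⊕ Fin Ns))) =>
      low_mem (c₀ := c₀) (M₀ := M₀) hs p k.1 k.2
  obtain ⟨Cd, hd0, hd⟩ := exists_data_bound hs c₀ M₀ N p
  obtain ⟨C, hC0, hC⟩ := exists_regularity (Unit ⊕ (Fin N ⊕ Fin Ns)) n s (max Ca Cb) c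
    (le_max_of_le_left ‹_›) hc
  refine ⟨C * Cd, mul_nonneg hC0 hd0, fun θ U D γ B hU hW hγ q => ?_⟩
  rw [mul_assoc]
  have hf := θ.fullMat_eq (N := N) p
  refine hC (θ.lam N Ns) (θ.mat p 0 0 0 0) (θ.low p) U D (θ.data p γ) (Cd * B) θ.lam_cases
    (fun q r => (ha (q, r) θ).mono (le_max_left _ _))
    (fun q r => (hb (q, r) θ).mono (le_max_right _ _)) (θ.low_inl_inl p) (hco θ).1 ?_ hU ?_
    (hd θ γ B hγ) q
  · rw [hf]; exact (hco θ).2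
  · rw [hf]; exact hW

/-- The map is expanded in the standard basis: its columns are multipliers, the inverse weights are
at most 1, and the number of columns is fixed. -/
theorem exists_map_bound {L : Params n s c₀ M₀ → Sp n →
      ((Unit ⊕ (Fin N ⊕ Fin Ns)) × Fin n ⊕ (Unit ⊕ (Fin N ⊕ Fin Ns)) → ℝ) →ₗ[ℝ] (Fin n → ℝ)}
    (hL : ∀ q a, (fun θ x => L θ x (Pi.single q 1) a) ∈ multAlg _ n s) : ∃ C, 0 ≤ C ∧
    ∀ (θ : Params n s c₀ M₀) (J : (Unit ⊕ (Fin N ⊕ Fin Ns)) × Fin n ⊕ (Unit ⊕ (Fin N ⊕ Fin Ns)) →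
      Sp n → ℝ) (B : ℝ), (∀ q, SB 2 s B (J q)) → ∀ a, SB 2 s (C * B)
        fun x => L θ x (fun q => (jetWeight n (θ.lam N Ns) q)⁻¹ * J q x) a := by
  obtain ⟨C, hC0, hC⟩ := exists_mult_bound fun k :
    ((Unit ⊕ (Fin N ⊕ Fin Ns)) × Fin n ⊕ (Unit ⊕ (Fin N ⊕ Fin Ns))) × Fin n => hL k.1 k.2
  refine ⟨Fintype.card ((Unit ⊕ (Fin N ⊕ Fin Ns)) × Fin n ⊕ (Unit ⊕ (Fin N ⊕ Fin Ns))) * C,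
    by positivity, fun θ J B hJ a => ?_⟩
  have h1 : ∀ q, SB 2 s B fun x => (jetWeight n (θ.lam N Ns) q)⁻¹ * J q x := fun q =>
    ((hJ q).const_mul _).mono (mul_le_of_le_one_left (hJ q).nonneg
      (abs_jetWeight_inv_le θ.lam_cases q))
  have h2 := SB.sum (by norm_num) Finset.univ fun q _ => (hC (q, a) θ).2.2.2 s le_rfl B _ (h1 q)
  refine (h2.congr (ae_of_all _ fun x => ?_)).mono (le_of_eq ?_)
  · conv_rhs => rw [← Finset.univ_sum_single fun q => (jetWeight n (θ.lam N Ns) q)⁻¹ * J q x]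
    rw [map_sum, Finset.sum_apply]
    refine Finset.sum_congr rfl fun q _ => ?_
    have : (Pi.single q ((jetWeight n (θ.lam N Ns) q)⁻¹ * J q x) :
        (Unit ⊕ (Fin N ⊕ Fin Ns)) × Fin n ⊕ (Unit ⊕ (Fin N ⊕ Fin Ns)) → ℝ)
        = ((jetWeight n (θ.lam N Ns) q)⁻¹ * J q x) • Pi.single q 1 := by
      rw [← Pi.single_smul, smul_eq_mul, mul_one]
    rw [this, map_smul, Pi.smul_apply, smul_eq_mul, mul_comm]
  · rw [Finset.sum_const, Finset.card_univ, nsmul_eq_mul, mul_assoc]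

/-- The gradient of the first component. -/
noncomputable def firstGrad (K : ℕ) : (Fin (K + 1) → (Fin n → ℝ) × ℝ) →ₗ[ℝ] (Fin n → ℝ) :=
  (LinearMap.fst ℝ (Fin n → ℝ) ℝ).comp (LinearMap.proj 0)

theorem exists_map₁_bound (hs : n < 2 * s) (c₀ M₀ : ℝ) (N Ns : ℕ) : ∃ C, 0 ≤ C ∧
    ∀ (θ : Params n s c₀ M₀) (U : Unit ⊕ (Fin N ⊕ Fin Ns) → Sp n → ℝ)
      (D : Unit ⊕ (Fin N ⊕ Fin Ns) → Fin n → Sp n → ℝ) (B : ℝ),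
      (∀ q, SB 2 s B (jet (θ.lam N Ns) U D q)) →
      ∀ a, SB 2 s (C * B) fun x => (θ.map₁ N Ns x (fun q => jet (fun _ => 1) U D q x) 0).1 a := by
  obtain ⟨C, h0, hC⟩ := exists_map_bound (n := n) (s := s) (c₀ := c₀) (M₀ := M₀) (N := N) (Ns := Ns)
    (L := fun θ x => (firstGrad N).comp (θ.map₁ N Ns x)) fun q a => by
      have := (mem_layerMap (multAlg (Params n s c₀ M₀) n s) (p := evenExp N) (u := .inl ())
        (e := e₁ N Ns) (σ := fun θ _ => θ.s₂) (H' := fun a θ => wpd a θ.D₁)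
        (multAlg1_le (const_mem_multAlg1 abs_s₂_le)) (multAlg1_le (D₁_mem hs))
        (wpd_mem_multAlg (D₁_mem hs)) (Pi.single q 1) 0).1 a
      exact this
  refine ⟨C, h0, fun θ U D B hJ a => ?_⟩
  have := hC θ _ B hJ a
  simp only [LinearMap.comp_apply, map₁_weight] at this
  exact this

theorem exists_map₂_bound (hs : n < 2 * s) (c₀ M₀ : ℝ) (N : ℕ) (p : Fin (Ns + 1) → ℕ) : ∃ C, 0 ≤ C ∧
    ∀ (θ : Params n s c₀ M₀) (U : Unit ⊕ (Fin N ⊕ Fin Ns) → Sp n → ℝ)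
      (D : Unit ⊕ (Fin N ⊕ Fin Ns) → Fin n → Sp n → ℝ) (B : ℝ),
      (∀ q, SB 2 s B (jet (θ.lam N Ns) U D q)) →
      ∀ a, SB 2 s (C * B) fun x => (θ.map₂ N p x (fun q => jet (fun _ => 1) U D q x) 0).1 a := by
  obtain ⟨C, h0, hC⟩ := exists_map_bound (n := n) (s := s) (c₀ := c₀) (M₀ := M₀) (N := N) (Ns := Ns)
    (L := fun θ x => (firstGrad Ns).comp (θ.map₂ N p x)) fun q a => by
      have := (mem_layerMap (multAlg (Params n s c₀ M₀) n s) (p := p) (u := .inl ())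
        (e := e₂ N Ns) (σ := fun θ _ => θ.s₁) (H' := fun a θ => wpd a θ.D₂)
        (multAlg1_le (const_mem_multAlg1 abs_s₁_le)) (multAlg1_le (D₂_mem hs))
        (wpd_mem_multAlg (D₂_mem hs)) (Pi.single q 1) 0).1 a
      exact this
  refine ⟨C, h0, fun θ U D B hJ a => ?_⟩
  have := hC θ _ B hJ a
  simp only [LinearMap.comp_apply, map₂_weight] at this
  exact this

end Params

end Kakinuma

/-! ### Potentials with a given canonical variable -/

namespace Kakinuma
open Filter Topology

variable {n K : ℕ}

theorem GradMemH.sb {k : ℕ} {φ : Sp n → ℝ} (h : GradMemH k φ) (a : Fin n) :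
    WD a φ (wpd a φ) ∧ SB 2 k √(gradNormSq k φ) (wpd a φ) := by
  obtain ⟨g, h1, h2⟩ := h a
  have hw := hasWeakDeriv_one.1 h1
  have := ((h2.sb.congr hw.wpd_eq.symm).memW (by norm_num)).sb
  refine ⟨hw.wpd, this.mono (Real.le_sqrt_of_sq_le ?_)⟩
  exact Finset.single_le_sum (f := fun a => wNorm k 2 (wpd a φ) ^ 2) (fun _ _ => sq_nonneg _)
    (Finset.mem_univ a)

theorem InClass.wd {χ : Fin (K + 1) → Sp n → ℝ} (h : InClass 0 χ) (i : Fin (K + 1)) (a : Fin n) :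
    WD a (χ i) (wpd a (χ i)) ∧ MemLp (wpd a (χ i)) 2 volume := by
  refine Fin.cases ?_ (fun j => ?_) i
  · exact ⟨(h.1.sb a).1, (h.1.sb a).2.memLp⟩
  · obtain ⟨g, h1, h2⟩ := (h.2 j).sb.2 a
    exact ⟨h1.wpd, (memLp_congr_ae h1.wpd_eq).2 h2.memLp⟩

theorem InClass.memLp {χ : Fin (K + 1) → Sp n → ℝ} (h : InClass 0 χ) (j : Fin K) :
    MemLp (χ j.succ) 2 volume := (h.2 j).sb.memLp

namespace Params

variable {s : ℕ} {c₀ M₀ : ℝ} {N Ns : ℕ} (θ : Params n s c₀ M₀)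

theorem κ₁_mul : θ.κ₁ * θ.s₁ = θ.ρ₁ := by
  have := θ.h₁_pos.ne'
  rw [κ₁, mul_assoc, ← sq, s₁_sq]; field_simp

theorem κ₂_mul : θ.κ₂ * θ.s₂ = θ.ρ₂ := by
  have := θ.h₂_pos.ne'
  rw [κ₂, mul_assoc, ← sq, s₂_sq]; field_simp

theorem κ₁_sq : θ.κ₁ ^ 2 = θ.ρ₁ * θ.h₁ := by
  rw [← κ₁_mul, κ₁]; ring

theorem κ₂_sq : θ.κ₂ ^ 2 = θ.ρ₂ * θ.h₂ := by
  rw [← κ₂_mul, κ₂]; ring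

/-- The potentials of the upper layer in terms of the unknowns. -/
noncomputable def field₁ (U : Unit ⊕ (Fin N ⊕ Fin Ns) → Sp n → ℝ) (φ : Sp n → ℝ) :
    Fin (N + 1) → Sp n → ℝ :=
  layerField (evenExp N) (.inl ()) (e₁ N Ns) θ.s₂ θ.D₁ θ.κ₁ (-θ.s₁) U φ

/-- The potentials of the lower layer in terms of the unknowns. -/
noncomputable def field₂ (p : Fin (Ns + 1) → ℕ) (U : Unit ⊕ (Fin N ⊕ Fin Ns) → Sp n → ℝ)
    (φ : Sp n → ℝ) : Fin (Ns + 1) → Sp n → ℝ :=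
  layerField p (.inl ()) (e₂ N Ns) θ.s₁ θ.D₂ θ.κ₂ θ.s₂ U φ

noncomputable def grad₁ (U : Unit ⊕ (Fin N ⊕ Fin Ns) → Sp n → ℝ)
    (D : Unit ⊕ (Fin N ⊕ Fin Ns) → Fin n → Sp n → ℝ) (γ : Fin n → Sp n → ℝ) :
    Fin (N + 1) → Fin n → Sp n → ℝ :=
  layerGrad (evenExp N) (.inl ()) (e₁ N Ns) θ.s₂ θ.D₁ (fun a => wpd a θ.D₁) θ.κ₁ (-θ.s₁) U D γ

noncomputable def grad₂ (p : Fin (Ns + 1) → ℕ) (U : Unit ⊕ (Fin N ⊕ Fin Ns) → Sp n → ℝ)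
    (D : Unit ⊕ (Fin N ⊕ Fin Ns) → Fin n → Sp n → ℝ) (γ : Fin n → Sp n → ℝ) :
    Fin (Ns + 1) → Fin n → Sp n → ℝ :=
  layerGrad p (.inl ()) (e₂ N Ns) θ.s₁ θ.D₂ (fun a => wpd a θ.D₂) θ.κ₂ θ.s₂ U D γ

/-- ρ₂T₂ − ρ₁T₁ = s₂(s₁u + s₂φ) − s₁(s₂u − s₁φ) = (s₁² + s₂²)φ. -/
theorem canonical_field {p : Fin (Ns + 1) → ℕ} (hp0 : p 0 = 0)
    (U : Unit ⊕ (Fin N ⊕ Fin Ns) → Sp n → ℝ) (φ : Sp n → ℝ) :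
    Canonical p θ.ρ₁ θ.ρ₂ θ.h₁ θ.h₂ θ.ζ θ.b φ (θ.field₁ U φ) (θ.field₂ p U φ) := by
  refine ae_of_all _ fun x => ?_
  have e1 := sum_layerField (p := evenExp N) (u := .inl ()) (e := e₁ N Ns) (σ := θ.s₂) (κ := θ.κ₁)
    (τ := -θ.s₁) (H := θ.D₁) (U := U) (φ := φ) rfl x
  have e2 := sum_layerField (u := .inl ()) (e := e₂ N Ns) (σ := θ.s₁) (κ := θ.κ₂)
    (τ := θ.s₂) (H := θ.D₂) (U := U) (φ := φ) hp0 x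
  change φ x = θ.ρ₂ * ∑ i, θ.D₂ x ^ p i * layerField p _ _ _ _ _ _ _ _ i x
    - θ.ρ₁ * ∑ i, θ.D₁ x ^ evenExp N i * layerField _ _ _ _ _ _ _ _ _ i x
  rw [e1, e2, ← κ₁_mul, ← κ₂_mul]
  have h1 := θ.κ₁_pos.ne'
  have h2 := θ.κ₂_pos.ne'
  field_simp
  linear_combination -(φ x) * θ.sq_add_sq

section

variable {θ} {p : Fin (Ns + 1) → ℕ} {U : Unit ⊕ (Fin N ⊕ Fin Ns) → Sp n → ℝ}
  {D : Unit ⊕ (Fin N ⊕ Fin Ns) → Fin n → Sp n → ℝ} {φ : Sp n → ℝ} {γ : Fin n → Sp n → ℝ} {B : ℝ}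

theorem memLp_e₁ (hU : Energy (θ.lam N Ns) U D) (j : Fin N) : MemLp (U (e₁ N Ns j)) 2 volume :=
  hU.memLp_self _ (zero_lt_one.trans_le θ.one_le_l₁).ne'

theorem memLp_e₂ (hU : Energy (θ.lam N Ns) U D) (j : Fin Ns) : MemLp (U (e₂ N Ns j)) 2 volume :=
  hU.memLp_self _ (zero_lt_one.trans_le θ.one_le_l₂).ne'

theorem wd_field₁ (hs : n < 2 * s) (hU : Energy (θ.lam N Ns) U D) (hφ : ∀ a, WD a φ (γ a))
    (i : Fin (N + 1)) (a : Fin n) : WD a (θ.field₁ U φ i) (θ.grad₁ U D γ i a) :=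
  wd_layerField (fun a => wd_wpd_of_mem (D₁_mem hs) a θ)
    (memLp_of_mem_multAlg (multAlg1_le (D₁_mem hs)) θ)
    (fun a => memLp_of_mem_multAlg (wpd_mem_multAlg (D₁_mem hs) a) θ) hU.wd (memLp_e₁ hU)
    (fun _ => hU.memLp _) hφ i a

theorem wd_field₂ (hs : n < 2 * s) (hU : Energy (θ.lam N Ns) U D) (hφ : ∀ a, WD a φ (γ a))
    (i : Fin (Ns + 1)) (a : Fin n) : WD a (θ.field₂ p U φ i) (θ.grad₂ p U D γ i a) :=
  wd_layerField (fun a => wd_wpd_of_mem (D₂_mem hs) a θ)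
    (memLp_of_mem_multAlg (multAlg1_le (D₂_mem hs)) θ)
    (fun a => memLp_of_mem_multAlg (wpd_mem_multAlg (D₂_mem hs) a) θ) hU.wd (memLp_e₂ hU)
    (fun _ => hU.memLp _) hφ i a

theorem sb_grad₁ (hJ : ∀ q, SB 2 s B (jet (θ.lam N Ns) U D q)) {C : ℝ}
    (hC : ∀ a, SB 2 s (C * B) fun x => (θ.map₁ N Ns x (fun q => jet (fun _ => 1) U D q x) 0).1 a)
    {B' : ℝ} (hγ : ∀ a, SB 2 s B' (γ a)) (i : Fin (N + 1)) (a : Fin n) :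
    SB 2 s (C * B + B + B') (fun x => θ.κ₁ * θ.grad₁ U D γ i a x) := by
  refine Fin.cases ?_ (fun j => ?_) i
  · have := ((hC a).add (by norm_num) ((hγ a).const_mul (-θ.s₁))).congr
      (g := fun x => θ.κ₁ * θ.grad₁ U D γ 0 a x)
      (ae_of_all _ fun x => (mul_inv_cancel_left₀ θ.κ₁_pos.ne' _).symm)
    have h1 : |(-θ.s₁)| * B' ≤ B' :=
      mul_le_of_le_one_left (hγ a).nonneg (by rw [abs_neg]; exact θ.abs_s₁_le)
    have := (hJ (.inr (.inl ()))).nonneg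
    exact SB.mono ‹_› (by linarith)
  · have := (hJ (.inl (e₁ N Ns j, a))).congr (g := fun x => θ.κ₁ * θ.grad₁ U D γ j.succ a x)
      (ae_of_all _ fun x => (mul_inv_cancel_left₀ θ.κ₁_pos.ne' _).symm)
    exact this.mono (by linarith [(hC a).nonneg, (hγ a).nonneg])

theorem sb_grad₂ (hJ : ∀ q, SB 2 s B (jet (θ.lam N Ns) U D q)) {C : ℝ}
    (hC : ∀ a, SB 2 s (C * B) fun x => (θ.map₂ N p x (fun q => jet (fun _ => 1) U D q x) 0).1 a)
    {B' : ℝ} (hγ : ∀ a, SB 2 s B' (γ a)) (i : Fin (Ns + 1)) (a : Fin n) :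
    SB 2 s (C * B + B + B') (fun x => θ.κ₂ * θ.grad₂ p U D γ i a x) := by
  refine Fin.cases ?_ (fun j => ?_) i
  · have := ((hC a).add (by norm_num) ((hγ a).const_mul θ.s₂)).congr
      (g := fun x => θ.κ₂ * θ.grad₂ p U D γ 0 a x)
      (ae_of_all _ fun x => (mul_inv_cancel_left₀ θ.κ₂_pos.ne' _).symm)
    have h1 : |θ.s₂| * B' ≤ B' := mul_le_of_le_one_left (hγ a).nonneg θ.abs_s₂_le
    have := (hJ (.inr (.inl ()))).nonneg
    exact SB.mono ‹_› (by linarith)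
  · have := (hJ (.inl (e₂ N Ns j, a))).congr (g := fun x => θ.κ₂ * θ.grad₂ p U D γ j.succ a x)
      (ae_of_all _ fun x => (mul_inv_cancel_left₀ θ.κ₂_pos.ne' _).symm)
    exact this.mono (by linarith [(hC a).nonneg, (hγ a).nonneg])

theorem sb_field₁ (hJ : ∀ q, SB 2 s B (jet (θ.lam N Ns) U D q)) (j : Fin N) :
    SB 2 s B (fun x => (θ.h₁ * θ.δ)⁻¹ * (θ.κ₁ * θ.field₁ U φ j.succ x)) :=
  (hJ (.inr (e₁ N Ns j))).congr (ae_of_all _ fun x =>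
    congrArg (θ.l₁ * ·) (mul_inv_cancel_left₀ θ.κ₁_pos.ne' (U (e₁ N Ns j) x)).symm)

theorem sb_field₂ (hJ : ∀ q, SB 2 s B (jet (θ.lam N Ns) U D q)) (j : Fin Ns) :
    SB 2 s B (fun x => (θ.h₂ * θ.δ)⁻¹ * (θ.κ₂ * θ.field₂ p U φ j.succ x)) :=
  (hJ (.inr (e₂ N Ns j))).congr (ae_of_all _ fun x =>
    congrArg (θ.l₂ * ·) (mul_inv_cancel_left₀ θ.κ₂_pos.ne' (U (e₂ N Ns j) x)).symm)

/-- Potentials in the expression of the canonical variable come from unknowns of the energy class. -/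
theorem exists_rel_of_canonical (hn : 1 ≤ n) (hs : n < 2 * s) (hp0 : p 0 = 0)
    (hφ : ∀ a, WD a φ (γ a)) (hγ : ∀ a, MemLp (γ a) 2 volume)
    {χ₁ : Fin (N + 1) → Sp n → ℝ} {χ₂ : Fin (Ns + 1) → Sp n → ℝ} (h₁ : InClass 0 χ₁)
    (h₂ : InClass 0 χ₂) (hc : Canonical p θ.ρ₁ θ.ρ₂ θ.h₁ θ.h₂ θ.ζ θ.b φ χ₁ χ₂) :
    ∃ (V : Unit ⊕ (Fin N ⊕ Fin Ns) → Sp n → ℝ) (E : Unit ⊕ (Fin N ⊕ Fin Ns) → Fin n → Sp n → ℝ),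
      θ.Rel p V E γ χ₁ (fun i a => wpd a (χ₁ i)) χ₂ (fun i a => wpd a (χ₂ i)) ∧
      (∀ᵐ x, χ₁ 0 x = θ.field₁ V φ 0 x) ∧ (∀ᵐ x, χ₂ 0 x = θ.field₂ p V φ 0 x) ∧
      (∀ j x, χ₁ j.succ x = θ.κ₁⁻¹ * V (e₁ N Ns j) x) ∧
      ∀ j x, χ₂ j.succ x = θ.κ₂⁻¹ * V (e₂ N Ns j) x := by
  have k1 := θ.κ₁_pos.ne'
  have k2 := θ.κ₂_pos.ne'
  set T₁ : Sp n → ℝ := fun x => ∑ i, θ.D₁ x ^ evenExp N i * χ₁ i x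
  set T₂ : Sp n → ℝ := fun x => ∑ i, θ.D₂ x ^ p i * χ₂ i x
  set G₁ := traceGrad (evenExp N) θ.D₁ (fun a => wpd a θ.D₁) χ₁ (fun i a => wpd a (χ₁ i))
  set G₂ := traceGrad p θ.D₂ (fun a => wpd a θ.D₂) χ₂ (fun i a => wpd a (χ₂ i))
  have hD₁ := memLp_of_mem_multAlg (multAlg1_le (D₁_mem hs)) θ
  have hD₂ := memLp_of_mem_multAlg (multAlg1_le (D₂_mem hs)) θ
  have hD₁' := fun a => memLp_of_mem_multAlg (wpd_mem_multAlg (D₁_mem hs) a) θ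
  have hD₂' := fun a => memLp_of_mem_multAlg (wpd_mem_multAlg (D₂_mem hs) a) θ
  have w1 : ∀ a, WD a T₁ (G₁ a) := wd_trace rfl (fun a => wd_wpd_of_mem (D₁_mem hs) a θ) hD₁ hD₁'
    (fun i a => (h₁.wd i a).1) (fun i a => (h₁.wd i a).2) h₁.memLp
  have w2 : ∀ a, WD a T₂ (G₂ a) := wd_trace hp0 (fun a => wd_wpd_of_mem (D₂_mem hs) a θ) hD₂ hD₂'
    (fun i a => (h₂.wd i a).1) (fun i a => (h₂.wd i a).2) h₂.memLp
  have m1 : ∀ a, MemLp (G₁ a) 2 volume :=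
    memLp_traceGrad hD₁ hD₁' (fun i a => (h₁.wd i a).2) h₁.memLp
  have m2 : ∀ a, MemLp (G₂ a) 2 volume :=
    memLp_traceGrad hD₂ hD₂' (fun i a => (h₂.wd i a).2) h₂.memLp
  have hγ' : ∀ a, ∀ᵐ x, γ a x = θ.ρ₂ * G₂ a x - θ.ρ₁ * G₁ a x := fun a =>
    (hφ a).ae_eq ((((w2 a).const_mul θ.ρ₂).sub ((w1 a).const_mul θ.ρ₁)).congr
      (hc.mono fun x hx => hx.symm) EventuallyEq.rfl)
  -- The unknown u is recovered from the traces by the transposed orthogonal matrix; its φ-component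
  -- is the canonical relation.
  set V : Unit ⊕ (Fin N ⊕ Fin Ns) → Sp n → ℝ := Sum.elim
    (fun _ x => θ.s₂ * θ.κ₁ * T₁ x + θ.s₁ * θ.κ₂ * T₂ x)
    (Sum.elim (fun j x => θ.κ₁ * χ₁ j.succ x) (fun j x => θ.κ₂ * χ₂ j.succ x)) with hV
  set E : Unit ⊕ (Fin N ⊕ Fin Ns) → Fin n → Sp n → ℝ := Sum.elim
    (fun _ a x => θ.s₂ * θ.κ₁ * G₁ a x + θ.s₁ * θ.κ₂ * G₂ a x)
    (Sum.elim (fun j a x => θ.κ₁ * wpd a (χ₁ j.succ) x) (fun j a x => θ.κ₂ * wpd a (χ₂ j.succ) x))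
  have hwd : ∀ i a, WD a (V i) (E i a) := by
    rintro (_ | j | j) a
    · exact ((w1 a).const_mul _).add ((w2 a).const_mul _)
    · exact (h₁.wd _ a).1.const_mul _
    · exact (h₂.wd _ a).1.const_mul _
  have hE : Energy (θ.lam N Ns) V E := by
    -- Local integrability is contained in the existence of a weak derivative, and n ≥ 1 provides a
    -- direction.
    refine ⟨fun i => (hwd i ⟨0, hn⟩).1, hwd, ?_, ?_⟩
    · rintro (_ | j | j) a
      · exact ((m1 a).const_mul _).add ((m2 a).const_mul _)
      · exact (h₁.wd _ a).2.const_mul _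
      · exact (h₂.wd _ a).2.const_mul _
    · rintro (_ | j | j) hi
      · exact absurd rfl hi
      · exact (h₁.memLp j).const_mul _
      · exact (h₂.memLp j).const_mul _
  refine ⟨V, E, ⟨hE, hγ, fun i a => (h₁.wd i a).1, fun i a => (h₂.wd i a).1,
    fun i a => (h₁.wd i a).2, fun i a => (h₂.wd i a).2, h₁.memLp, h₂.memLp, ?_, ?_⟩, ?_, ?_,
    fun j x => (inv_mul_cancel_left₀ k1 _).symm, fun j x => (inv_mul_cancel_left₀ k2 _).symm⟩
  · refine layerRel_of_trace (fun _ _ => rfl) (fun _ _ _ => rfl) fun a => ?_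
    filter_upwards [hγ' a] with x hx
    rw [hx, ← κ₁_mul, ← κ₂_mul]
    change θ.κ₁ * G₁ a x = θ.s₂ * (θ.s₂ * θ.κ₁ * G₁ a x + θ.s₁ * θ.κ₂ * G₂ a x) + _
    linear_combination -(θ.κ₁ * G₁ a x) * θ.sq_add_sq
  · refine layerRel_of_trace (fun _ _ => rfl) (fun _ _ _ => rfl) fun a => ?_
    filter_upwards [hγ' a] with x hx
    rw [hx, ← κ₁_mul, ← κ₂_mul]
    change θ.κ₂ * G₂ a x = θ.s₁ * (θ.s₂ * θ.κ₁ * G₁ a x + θ.s₁ * θ.κ₂ * G₂ a x) + _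
    linear_combination -(θ.κ₂ * G₂ a x) * θ.sq_add_sq
  · filter_upwards [hc] with x hx
    have hx' : φ x = θ.ρ₂ * T₂ x - θ.ρ₁ * T₁ x := hx
    have hT : T₁ x = χ₁ 0 x + ∑ j : Fin N, θ.D₁ x ^ evenExp N j.succ * χ₁ j.succ x := by
      simp [T₁, Fin.sum_univ_succ, evenExp]
    have hS : ∑ j : Fin N, θ.D₁ x ^ evenExp N j.succ * V (e₁ N Ns j) x
        = θ.κ₁ * ∑ j : Fin N, θ.D₁ x ^ evenExp N j.succ * χ₁ j.succ x := by
      rw [Finset.mul_sum]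
      exact Finset.sum_congr rfl fun j _ => mul_left_comm _ _ _
    change χ₁ 0 x = θ.κ₁⁻¹ * (θ.s₂ * (θ.s₂ * θ.κ₁ * T₁ x + θ.s₁ * θ.κ₂ * T₂ x)
      - ∑ j : Fin N, θ.D₁ x ^ evenExp N j.succ * V (e₁ N Ns j) x + -θ.s₁ * φ x)
    rw [hS, hx', ← κ₁_mul, ← κ₂_mul, eq_inv_mul_iff_mul_eq₀ k1]
    linear_combination -(θ.κ₁ * T₁ x) * θ.sq_add_sq - θ.κ₁ * hT
  · filter_upwards [hc] with x hx
    have hx' : φ x = θ.ρ₂ * T₂ x - θ.ρ₁ * T₁ x := hx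
    have hT : T₂ x = χ₂ 0 x + ∑ j : Fin Ns, θ.D₂ x ^ p j.succ * χ₂ j.succ x := by
      simp [T₂, Fin.sum_univ_succ, hp0]
    have hS : ∑ j : Fin Ns, θ.D₂ x ^ p j.succ * V (e₂ N Ns j) x
        = θ.κ₂ * ∑ j : Fin Ns, θ.D₂ x ^ p j.succ * χ₂ j.succ x := by
      rw [Finset.mul_sum]
      exact Finset.sum_congr rfl fun j _ => mul_left_comm _ _ _
    change χ₂ 0 x = θ.κ₂⁻¹ * (θ.s₁ * (θ.s₂ * θ.κ₁ * T₁ x + θ.s₁ * θ.κ₂ * T₂ x)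
      - ∑ j : Fin Ns, θ.D₂ x ^ p j.succ * V (e₂ N Ns j) x + θ.s₂ * φ x)
    rw [hS, hx', ← κ₁_mul, ← κ₂_mul, eq_inv_mul_iff_mul_eq₀ k2]
    linear_combination -(θ.κ₂ * T₂ x) * θ.sq_add_sq - θ.κ₂ * hT

end

end Params

end Kakinuma

/-! ### Uniqueness up to constants, and the solution -/

namespace Kakinuma
open Filter Topology

variable {n K : ℕ}

namespace Params

variable {s : ℕ} {c₀ M₀ : ℝ} {N Ns : ℕ} {θ : Params n s c₀ M₀}

/-- The data of the theorem determine the unknowns up to a constant in the first one. -/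
theorem eq_add_const (hn : 1 ≤ n) (hs : n < 2 * s) {p : Fin (Ns + 1) → ℕ} {c : ℝ} (hc0 : 0 < c)
    (hc : Coercive (θ.lam N Ns) c (θ.full N p)) {U V : Unit ⊕ (Fin N ⊕ Fin Ns) → Sp n → ℝ}
    {D E : Unit ⊕ (Fin N ⊕ Fin Ns) → Fin n → Sp n → ℝ} {γ : Fin n → Sp n → ℝ}
    (hγ : ∀ a, MemLp (γ a) 2 volume) (hU : Energy (θ.lam N Ns) U D)
    (hV : Energy (θ.lam N Ns) V E)
    (wU : WeakSys (θ.lam N Ns) (θ.full N p) U D (θ.data p γ) 0)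
    (wV : WeakSys (θ.lam N Ns) (θ.full N p) V E (θ.data p γ) 0) :
    ∃ k : ℝ, ∀ᵐ x, V (.inl ()) x = U (.inl ()) x + k ∧ (∀ j, V (e₁ N Ns j) x = U (e₁ N Ns j) x) ∧
      ∀ j, V (e₂ N Ns j) x = U (e₂ N Ns j) x := by
  have h := WeakSys.unique (θ.memLp_full hs p) hc0 hc (θ.memLp_data hs p hγ) hV hU wV wU
  have hw : ∀ a, WD a (fun x => V (.inl ()) x - U (.inl ()) x) fun _ => 0 := fun a =>
    ((hV.wd _ a).sub (hU.wd _ a)).congr EventuallyEq.rfl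
      ((h (.inl (.inl (), a))).mono fun x hx => sub_eq_zero.2 hx)
  obtain ⟨k, hk⟩ := exists_ae_eq_const hw (hw ⟨0, hn⟩).1
  refine ⟨k, ?_⟩
  filter_upwards [hk, ae_all_iff.2 fun j => h (.inr (e₁ N Ns j)),
    ae_all_iff.2 fun j => h (.inr (e₂ N Ns j))] with x x0 x1 x2
  exact ⟨by linarith, fun j => mul_left_cancel₀ (zero_lt_one.trans_le θ.one_le_l₁).ne' (x1 j),
    fun j => mul_left_cancel₀ (zero_lt_one.trans_le θ.one_le_l₂).ne' (x2 j)⟩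

variable {p : Fin (Ns + 1) → ℕ} {U : Unit ⊕ (Fin N ⊕ Fin Ns) → Sp n → ℝ}
  {D : Unit ⊕ (Fin N ⊕ Fin Ns) → Fin n → Sp n → ℝ} {φ : Sp n → ℝ} {γ : Fin n → Sp n → ℝ}

/-- Any competitor comes from unknowns that solve the same coercive system, hence differ from U by a
constant in u only. Conversely such a constant is invisible to all gradients and drops out of the
canonical relation. -/
theorem compatible_canonical_iff (hn : 1 ≤ n) (hs : n < 2 * s) (hp0 : p 0 = 0) {c : ℝ}
    (hc0 : 0 < c) (hc : Coercive (θ.lam N Ns) c (θ.full N p)) (hφ : ∀ a, WD a φ (γ a))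
    (hR : θ.Rel p U D γ (θ.field₁ U φ) (θ.grad₁ U D γ) (θ.field₂ p U φ) (θ.grad₂ p U D γ))
    (hW : WeakSys (θ.lam N Ns) (θ.full N p) U D (θ.data p γ) 0)
    {χ₁ : Fin (N + 1) → Sp n → ℝ} {χ₂ : Fin (Ns + 1) → Sp n → ℝ} (h₁ : InClass 0 χ₁)
    (h₂ : InClass 0 χ₂) :
    (Compatible p θ.h₁ θ.h₂ θ.δ θ.ζ θ.b χ₁ χ₂ ∧
      Canonical p θ.ρ₁ θ.ρ₂ θ.h₁ θ.h₂ θ.ζ θ.b φ χ₁ χ₂) ↔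
    ∃ K : ℝ, ∀ᵐ x, χ₁ 0 x = θ.field₁ U φ 0 x + K * θ.ρ₂ ∧
      χ₂ 0 x = θ.field₂ p U φ 0 x + K * θ.ρ₁ ∧
      (∀ i : Fin N, χ₁ i.succ x = θ.field₁ U φ i.succ x) ∧
      (∀ i : Fin Ns, χ₂ i.succ x = θ.field₂ p U φ i.succ x) := by
  have k1 := θ.κ₁_pos.ne'
  have k2 := θ.κ₂_pos.ne'
  have t1 := θ.s₁_pos.ne'
  have t2 := θ.s₂_pos.ne'
  constructor
  · rintro ⟨hC, hcan⟩
    obtain ⟨V, E, hV, v1, v2, v3, v4⟩ := exists_rel_of_canonical hn hs hp0 hφ hR.grad h₁ h₂ hcan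
    obtain ⟨k, hk⟩ := eq_add_const hn hs hc0 hc hR.grad hR.energy hV.energy hW
      ((hV.weakSys_iff hs hp0).2 hC)
    -- A shift of u by k moves φ_{1,0} by s₂k/κ₁ = ρ₂k/(κ₁κ₂) and φ_{2,0} by s₁k/κ₂ = ρ₁k/(κ₁κ₂),
    -- because κ_ℓ s_ℓ = ρ_ℓ.
    refine ⟨k * (θ.κ₁ * θ.κ₂)⁻¹, ?_⟩
    filter_upwards [hk, v1, v2] with x hx x1 x2
    refine ⟨?_, ?_, fun i => ?_, fun i => ?_⟩
    · rw [x1, ← κ₂_mul]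
      simp only [field₁, layerField, Fin.cons_zero, hx.1, hx.2.1]
      field_simp
      ring
    · rw [x2, ← κ₁_mul]
      simp only [field₂, layerField, Fin.cons_zero, hx.1, hx.2.2]
      field_simp
      ring
    · rw [v3, hx.2.1]; rfl
    · rw [v4, hx.2.2]; rfl
  · rintro ⟨k, hk⟩
    have hcan := θ.canonical_field hp0 U φ
    have hw1 : ∀ i a, WD a (χ₁ i) (θ.grad₁ U D γ i a) := fun i a => by
      refine Fin.cases ?_ (fun j => ?_) i
      · refine ((hR.wd₁ 0 a).add (WD.const a (k * θ.ρ₂))).congr ?_ (ae_of_all _ fun x => add_zero _)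
        exact hk.mono fun x hx => hx.1.symm
      · exact (hR.wd₁ j.succ a).congr (hk.mono fun x hx => (hx.2.2.1 j).symm) EventuallyEq.rfl
    have hw2 : ∀ i a, WD a (χ₂ i) (θ.grad₂ p U D γ i a) := fun i a => by
      refine Fin.cases ?_ (fun j => ?_) i
      · refine ((hR.wd₂ 0 a).add (WD.const a (k * θ.ρ₁))).congr ?_ (ae_of_all _ fun x => add_zero _)
        exact hk.mono fun x hx => hx.2.1.symm
      · exact (hR.wd₂ j.succ a).congr (hk.mono fun x hx => (hx.2.2.2 j).symm) EventuallyEq.rfl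
    refine ⟨?_, ?_⟩
    -- The relation to U involves the first components through their gradients only, so χ belongs to
    -- the same unknowns.
    · have hR' : θ.Rel p U D γ χ₁ (θ.grad₁ U D γ) χ₂ (θ.grad₂ p U D γ) := by
        refine ⟨hR.energy, hR.grad, hw1, hw2, hR.memLp₁, hR.memLp₂, h₁.memLp, h₂.memLp, ?_, ?_⟩
        · filter_upwards [hR.rel₁, hk] with x hx hxk
          exact ⟨hx.1, hx.2.1, fun j => by rw [hxk.2.2.1, hx.2.2]⟩
        · filter_upwards [hR.rel₂, hk] with x hx hxk
          exact ⟨hx.1, hx.2.1, fun j => by rw [hxk.2.2.2, hx.2.2]⟩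
      exact (hR'.weakSys_iff hs hp0).1 hW
    -- The traces change by Kρ₁ and Kρ₂ in the lower and the upper layer, and ρ₂·Kρ₁ − ρ₁·Kρ₂ = 0.
    · filter_upwards [hcan, hk] with x hx hxk
      rw [hx]
      simp only [Fin.sum_univ_succ, hxk.1, hxk.2.1, hxk.2.2.1, hxk.2.2.2, hp0, evenExp, Fin.val_zero,
        mul_zero, pow_zero]
      ring

theorem exists_solution (hn : 1 ≤ n) (hs : n < 2 * s) (M₀ : ℝ) (N : ℕ) (hp0 : p 0 = 0)
    (hp : StrictMono p) (hc₀ : 0 < c₀) : ∃ C : ℝ, 0 < C ∧ ∀ (θ : Params n s c₀ M₀) (φ : Sp n → ℝ),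
    GradMemH s φ → ∃ (φ₁ : Fin (N + 1) → Sp n → ℝ) (φ₂ : Fin (Ns + 1) → Sp n → ℝ),
      InClass s φ₁ ∧ InClass s φ₂ ∧ Compatible p θ.h₁ θ.h₂ θ.δ θ.ζ θ.b φ₁ φ₂ ∧
      Canonical p θ.ρ₁ θ.ρ₂ θ.h₁ θ.h₂ θ.ζ θ.b φ φ₁ φ₂ ∧
      θ.ρ₁ * θ.h₁ * layerNormSq s θ.h₁ θ.δ φ₁ + θ.ρ₂ * θ.h₂ * layerNormSq s θ.h₂ θ.δ φ₂
        ≤ C * gradNormSq s φ ∧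
      ∀ (χ₁ : Fin (N + 1) → Sp n → ℝ) (χ₂ : Fin (Ns + 1) → Sp n → ℝ),
        InClass 0 χ₁ → InClass 0 χ₂ →
        ((Compatible p θ.h₁ θ.h₂ θ.δ θ.ζ θ.b χ₁ χ₂ ∧
            Canonical p θ.ρ₁ θ.ρ₂ θ.h₁ θ.h₂ θ.ζ θ.b φ χ₁ χ₂) ↔
          ∃ K : ℝ, ∀ᵐ x, χ₁ 0 x = φ₁ 0 x + K * θ.ρ₂ ∧ χ₂ 0 x = φ₂ 0 x + K * θ.ρ₁ ∧
            (∀ i : Fin N, χ₁ i.succ x = φ₁ i.succ x) ∧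
            (∀ i : Fin Ns, χ₂ i.succ x = φ₂ i.succ x)) := by
  obtain ⟨c, hc0, hc⟩ := exists_coercive_both hs M₀ N hp0 hp hc₀
  obtain ⟨Cj, hCj, hj⟩ := exists_jet_bound hs M₀ N hp0 hp hc₀
  obtain ⟨Ca, hCa, ha⟩ := exists_map₁_bound hs c₀ M₀ N Ns
  obtain ⟨Cb, hCb, hb⟩ := exists_map₂_bound hs c₀ M₀ N p
  -- The three summands bound, relative to ∇φ, the part of the first gradient that comes from the
  -- unknowns, the jets themselves, and the shift along ∇φ.
  set A := max Ca Cb * Cj + Cj + 1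
  refine ⟨((N + 1) * n + N) * (numDeriv n s * A) ^ 2 + ((Ns + 1) * n + Ns) * (numDeriv n s * A) ^ 2
    + 1, by positivity, fun θ φ hφ => ?_⟩
  set B := √(gradNormSq s φ) with hB
  have hB0 : 0 ≤ B := Real.sqrt_nonneg _
  have hB2 : B ^ 2 = gradNormSq s φ :=
    Real.sq_sqrt (Finset.sum_nonneg fun _ _ => sq_nonneg _)
  set γ : Fin n → Sp n → ℝ := fun a => wpd a φ
  have hwφ : ∀ a, WD a φ (γ a) := fun a => (hφ.sb a).1
  have hγ : ∀ a, SB 2 s B (γ a) := fun a => (hφ.sb a).2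
  have hγ2 : ∀ a, MemLp (γ a) 2 volume := fun a => (hγ a).memLp
  obtain ⟨U, D, hU, hW⟩ := exists_weakSys (θ.memLp_full (N := N) hs p) hc0 (hc θ).2
    (θ.memLp_data (N := N) hs p hγ2)
  have hJ := hj θ U D γ B hU hW hγ
  have hm₁ := fun a => (ha θ U D _ hJ a).mono (mul_le_mul_of_nonneg_right (le_max_left Ca Cb)
    (mul_nonneg hCj hB0))
  have hm₂ := fun a => (hb θ U D _ hJ a).mono (mul_le_mul_of_nonneg_right (le_max_right Ca Cb)
    (mul_nonneg hCj hB0))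
  have hE : max Ca Cb * (Cj * B) + Cj * B + B = A * B := by ring
  have hEJ : Cj * B ≤ A * B := mul_le_mul_of_nonneg_right (by
    have : 0 ≤ max Ca Cb * Cj := mul_nonneg (le_max_of_le_left hCa) hCj
    linarith) hB0
  have g₁ : ∀ i a, SB 2 s (A * B) (fun x => θ.κ₁ * θ.grad₁ U D γ i a x) := fun i a =>
    hE ▸ sb_grad₁ hJ hm₁ hγ i a
  have g₂ : ∀ i a, SB 2 s (A * B) (fun x => θ.κ₂ * θ.grad₂ p U D γ i a x) := fun i a =>
    hE ▸ sb_grad₂ hJ hm₂ hγ i a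
  have f₁ : ∀ j : Fin N, SB 2 s (A * B) (fun x => (θ.h₁ * θ.δ)⁻¹ * (θ.κ₁ * θ.field₁ U φ j.succ x)) :=
    fun j => (sb_field₁ hJ j).mono hEJ
  have f₂ : ∀ j : Fin Ns, SB 2 s (A * B)
      (fun x => (θ.h₂ * θ.δ)⁻¹ * (θ.κ₂ * θ.field₂ p U φ j.succ x)) :=
    fun j => (sb_field₂ hJ j).mono hEJ
  have w₁ := wd_field₁ hs hU hwφ
  have w₂ := wd_field₂ (p := p) hs hU hwφ
  have hl₁ := mul_pos θ.h₁_pos θ.δ_pos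
  have hl₂ := mul_pos θ.h₂_pos θ.δ_pos
  have hR : θ.Rel p U D γ (θ.field₁ U φ) (θ.grad₁ U D γ) (θ.field₂ p U φ) (θ.grad₂ p U D γ) :=
    ⟨hU, hγ2, w₁, w₂, fun i a => ((g₁ i a).of_const_mul θ.κ₁_pos.ne').memLp,
      fun i a => ((g₂ i a).of_const_mul θ.κ₂_pos.ne').memLp,
      fun j => (memLp_e₁ hU j).const_mul _, fun j => (memLp_e₂ hU j).const_mul _,
      layerRel_layerField θ.κ₁_pos.ne', layerRel_layerField θ.κ₂_pos.ne'⟩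
  refine ⟨θ.field₁ U φ, θ.field₂ p U φ, inClass_of_sb hl₁.ne' θ.κ₁_pos.ne' w₁ g₁ f₁,
    inClass_of_sb hl₂.ne' θ.κ₂_pos.ne' w₂ g₂ f₂, (hR.weakSys_iff hs hp0).1 hW,
    θ.canonical_field hp0 U φ, ?_,
    fun χ₁ χ₂ h1 h2 => compatible_canonical_iff hn hs hp0 hc0 (hc θ).2 hwφ hR hW h1 h2⟩
  have n1 := layerNormSq_le hl₁ θ.κ₁_pos w₁ g₁ f₁
  have n2 := layerNormSq_le hl₂ θ.κ₂_pos w₂ g₂ f₂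
  -- The identity κ_ℓ² = ρ_ℓ h_ℓ turns the bounds for the scaled potentials into the weighted
  -- energy.
  rw [κ₁_sq] at n1
  rw [κ₂_sq] at n2
  refine (add_le_add n1 n2).trans ?_
  rw [← hB2]
  nlinarith [sq_nonneg B]

end Params

end Kakinuma

theorem proposition3
    (n N Ns : ℕ) (hn : 1 ≤ n)
    (p : Fin (Ns + 1) → ℕ) (hp0 : p 0 = 0) (hp : StrictMono p)
    (m : ℕ) (hm : (m : ℝ) > (n : ℝ) / 2 + 1)
    (c₀ M₀ : ℝ) (hc₀ : 0 < c₀) (hM₀ : 0 < M₀) :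
    ∃ C : ℝ, 0 < C ∧
      ∀ ρ₁ ρ₂ h₁ h₂ δ : ℝ, 0 < ρ₁ → 0 < ρ₂ → 0 < h₁ → 0 < h₂ → 0 < δ →
        ρ₁ + ρ₂ = 1 → ρ₁ / h₁ + ρ₂ / h₂ = 1 → h₁ * δ ≤ 1 → h₂ * δ ≤ 1 →
      ∀ ζ φ b : Kakinuma.Sp n → ℝ,
        Kakinuma.MemW m 2 ζ → Kakinuma.GradMemH (m - 1) φ → Kakinuma.MemW m ⊤ b →
        h₁⁻¹ * Kakinuma.wNorm m 2 ζ + h₂⁻¹ * Kakinuma.wNorm m 2 ζ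
          + h₂⁻¹ * Kakinuma.wNorm m ⊤ b ≤ M₀ →
        (∀ᵐ x ∂(MeasureTheory.volume : MeasureTheory.Measure (Kakinuma.Sp n)),
          c₀ ≤ Kakinuma.H₁ h₁ ζ x ∧ c₀ ≤ Kakinuma.H₂ h₂ ζ b x) →
      ∃ (φ₁ : Fin (N + 1) → Kakinuma.Sp n → ℝ) (φ₂ : Fin (Ns + 1) → Kakinuma.Sp n → ℝ),
        Kakinuma.InClass (m - 1) φ₁ ∧ Kakinuma.InClass (m - 1) φ₂ ∧
        Kakinuma.Compatible p h₁ h₂ δ ζ b φ₁ φ₂ ∧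
        Kakinuma.Canonical p ρ₁ ρ₂ h₁ h₂ ζ b φ φ₁ φ₂ ∧
        ρ₁ * h₁ * Kakinuma.layerNormSq (m - 1) h₁ δ φ₁
            + ρ₂ * h₂ * Kakinuma.layerNormSq (m - 1) h₂ δ φ₂
          ≤ C * Kakinuma.gradNormSq (m - 1) φ ∧
        -- uniqueness up to an additive constant, even among data of lowest regularity
        ∀ (χ₁ : Fin (N + 1) → Kakinuma.Sp n → ℝ) (χ₂ : Fin (Ns + 1) → Kakinuma.Sp n → ℝ),
          Kakinuma.InClass 0 χ₁ → Kakinuma.InClass 0 χ₂ →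
          ((Kakinuma.Compatible p h₁ h₂ δ ζ b χ₁ χ₂ ∧
              Kakinuma.Canonical p ρ₁ ρ₂ h₁ h₂ ζ b φ χ₁ χ₂) ↔
            ∃ K : ℝ,
              (∀ᵐ x ∂(MeasureTheory.volume : MeasureTheory.Measure (Kakinuma.Sp n)),
                χ₁ 0 x = φ₁ 0 x + K * ρ₂ ∧ χ₂ 0 x = φ₂ 0 x + K * ρ₁ ∧
                (∀ i : Fin N, χ₁ i.succ x = φ₁ i.succ x) ∧
                (∀ i : Fin Ns, χ₂ i.succ x = φ₂ i.succ x))) := by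
  -- As m is positive, m − 1 is a genuine predecessor.
  obtain ⟨s, rfl⟩ : ∃ s, m = s + 1 := ⟨m - 1, by
    have : (0 : ℝ) < m := lt_of_le_of_lt (by positivity) hm
    have := Nat.cast_pos.1 this
    omega⟩
  -- The condition m > n/2 + 1 says that s = m − 1 exceeds n/2, so the first derivatives of ζ are
  -- multipliers.
  have hs : n < 2 * s := by
    have : (n : ℝ) < 2 * s := by push_cast at hm; linarith
    exact_mod_cast this
  obtain ⟨C, hC, h⟩ := Kakinuma.Params.exists_solution (c₀ := c₀) hn hs M₀ N hp0 hp hc₀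
  refine ⟨C, hC, fun ρ₁ ρ₂ h₁ h₂ δ a1 a2 a3 a4 a5 _ a6 a7 a8 ζ φ b z1 z2 z3 z4 z5 => ?_⟩
  exact h ⟨ρ₁, ρ₂, h₁, h₂, δ, ζ, b, a1, a2, a3, a4, a5, a6, a7, a8, z1, z3, z4, z5⟩ φ z2
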